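/- Let $G=(V,E)$ be a finite simple connected graph with $n\ge 2$ vertices and $m$ edges. **Notation.** A *4-Steiner root* of $G$ is a finite tree $T$ with $V\subseteq V(T)$ such that distinct $u,v\in V$ are adjacent in $G$ iff $dist_T(u,v)\le 4$. Nodes in $V$ are *real*, the others are *Steiner* nodes. For a set $X$ of nodes, $T\langle X\rangle$ is the smallest subtree of $T$ containing $X$, and $\mathcal C(\cdot)$ denotes the center of a tree (its nodes of minimum eccentricity). Two trees are *Steiner-equivalent*, $\equiv_G$, if they have the same real nodes and there is an isomorphism between them fixing each real node. A *clique-intersection* is an intersection of a nonempty family of maximal cliques. For a clique-intersection $X$, a vertex $v\in X$ is *$X$-constrained* if either $v\in X'$ for some clique-intersection $X'\subsetneq X$ with $|X'|\ge 2$, or there are clique-intersections $X_1,X_2$ with $X\subsetneq X_1$ and $X\cap X_2=\{v\}\subsetneq X_1\cap X_2$; otherwise $v$ is *$X$-free*. A 4-Steiner root $T$ is *well-structured* if for every nonempty clique-intersection $X$: (i) all $X$-free vertices are leaves of $T\langle X\rangle$ with eccentricity $diam(T\langle X\rangle)$; (ii) there is $c\in\mathcal C(T\langle X\rangle)$ such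 that $dist_T(v,c)=dist_T(v,\mathcal C(T\langle X\rangle))$ for all $X$-free vertices $v$, except maybe one; (iii) all internal nodes on a path between $\mathcal C(T\langle X\rangle)$ and an $X$-free vertex are Steiner nodes of degree two; (iv) if $X$ is a maximal clique with an $X$-free vertex, then $diam(T\langle X\rangle)=4$. A minimal separator $S\subsetneq K$ with $|S|\ge 2$, where $K$ is a maximal clique, gives a *thin branch* $T\langle S\rangle$ of $T\langle K\rangle$ if $T\langle S\rangle\setminus\mathcal C(T\langle K\rangle)$ is a connected component of $T\langle K\rangle\setminus\mathcal C(T\langle K\rangle)$, and no $T\langle S'\rangle$ with $S'\subsetneq K$ a minimal separator other than $S$ intersects both $\mathcal C(T\langle K\rangle)$ and $T\langle S\rangle\setminus\mathcal C(T\langle K\rangle)$. A *bistar* is a tree of diameter three. Let a rooted clique-tree of $G$ be given (a rooted tree on the maximal cliques of $G$ in which, for each vertex $v$, the maximal cliques containing $v$ induce a subtree). For a maximal clique $K_i$, let $S_i$ be the intersection of $K_i$ with its father ($S_i=\emptyset$ for the root), and let $V_i$ be the union of the maximal cliques in the subtree rooted at $K_i$. **Proposition.** There is an algorithm (a fixed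 word-RAM program with words of $O(\log n)$ bits) that, given any such $G$, a rooted clique-tree of $G$ and any maximal clique $K_i$, computes in time $\mathcal O(|K_i|^7\cdot n^3m\log n)$ a family $\mathcal F_i$ of trees with centers (pairs consisting of a tree whose real nodes are in $K_i$ and a subset of its nodes) with the following property. For any well-structured 4-Steiner root $T$ of $G$, there exist a well-structured 4-Steiner root $T'$ of $G$ and a (not necessarily maximal) clique $Y_i\subseteq K_i$ such that $$\bigl(T'\langle Y_i\cup\mathcal C(T'\langle K_i\rangle)\rangle,\ \mathcal C(T'\langle K_i\rangle)\bigr)\in\mathcal F_i$$ up to Steiner equivalence, and: * $S_i\subseteq Y_i$ and $T'\langle S_i\rangle\equiv_G T\langle S_i\rangle$; * $dist_{T'}(r,V_i\setminus S_i)\ge dist_T(r,V_i\setminus S_i)$ for every node $r$ of $T\langle S_i\rangle$ (where $T\langle S_i\rangle$ and $T'\langle S_i\rangle$ are identified by a Steiner equivalence); * for any $v\in K_i\setminus Y_i$ there is a minimal separator $S\subseteq(K_i\setminus Y_i)\cup\mathcal C(T\langle K_i\rangle)$ such that $v\in S$ and $T\langle S\rangle$ is a thin branch of $T\langle K_i\rangle$.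 Moreover, $Y_i=K_i$ if either $diam(T'\langle K_i\rangle)<4$ or there exists a minimal separator $S\subsetneq K_i$ such that $T'\langle S\rangle$ is a bistar. -/

import Mathlib

/-! ## A word RAM with a step count

Programs are fixed (they do not depend on the input), manipulate natural numbers in registers and
in a random-access memory, and every elementary operation and every test costs one step.  No
number larger than the word bound `W` may ever be produced: an assignment whose value would exceed
`W` has no execution. -/

namespace WordRAM

/-- Right-hand sides: a constant, a register, one arithmetic operation on two registers (truncated
subtraction, floor division), or the memory cell whose address is in a register. -/
inductive Expr where
  | const (k : ℕ)
  | reg (x : ℕ)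
  | add (x y : ℕ)
  | sub (x y : ℕ)
  | mul (x y : ℕ)
  | div (x y : ℕ)
  | load (x : ℕ)

/-- Programs: `assign x e` is `x := e`, `store x y` is `mem[x] := y`, and the tests of
`ite x y _ _` and `loop x y _` (a while loop) are `x < y`. -/
inductive Program where
  | skip
  | assign (x : ℕ) (e : Expr)
  | store (x y : ℕ)
  | seq (p q : Program)
  | ite (x y : ℕ) (p q : Program)
  | loop (x y : ℕ) (p : Program)

structure State where
  reg : ℕ → ℕ
  mem : ℕ → ℕ

def Expr.eval (s : State) : Expr → ℕ
  | .const k => k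
  | .reg x => s.reg x
  | .add x y => s.reg x + s.reg y
  | .sub x y => s.reg x - s.reg y
  | .mul x y => s.reg x * s.reg y
  | .div x y => s.reg x / s.reg y
  | .load x => s.mem (s.reg x)

/-- `Exec W p s t s'`: started in state `s`, the program `p` halts after exactly `t` steps in state
`s'`, and all numbers produced on the way are at most `W`. -/
inductive Exec (W : ℕ) : Program → State → ℕ → State → Prop where
  | skip (s : State) : Exec W .skip s 1 s
  | assign (s : State) (x : ℕ) (e : Expr) (h : e.eval s ≤ W) :
      Exec W (.assign x e) s 1 { s with reg := Function.update s.reg x (e.eval s) }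
  | store (s : State) (x y : ℕ) :
      Exec W (.store x y) s 1 { s with mem := Function.update s.mem (s.reg x) (s.reg y) }
  | seq {p q : Program} {s s' s'' : State} {t t' : ℕ}
      (hp : Exec W p s t s') (hq : Exec W q s' t' s'') : Exec W (.seq p q) s (t + t') s''
  | ite_true {x y : ℕ} {p q : Program} {s s' : State} {t : ℕ}
      (h : s.reg x < s.reg y) (hp : Exec W p s t s') : Exec W (.ite x y p q) s (t + 1) s'
  | ite_false {x y : ℕ} {p q : Program} {s s' : State} {t : ℕ}
      (h : ¬ s.reg x < s.reg y) (hq : Exec W q s t s') : Exec W (.ite x y p q) s (t + 1) s'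
  | loop_stop {x y : ℕ} {p : Program} {s : State}
      (h : ¬ s.reg x < s.reg y) : Exec W (.loop x y p) s 1 s
  | loop_step {x y : ℕ} {p : Program} {s s' s'' : State} {t t' : ℕ}
      (h : s.reg x < s.reg y) (hp : Exec W p s t s')
      (hl : Exec W (.loop x y p) s' t' s'') : Exec W (.loop x y p) s (t + t' + 1) s''

/-- All registers are `0`; the input list occupies the memory cells `0, 1, 2, …`, and all further
cells hold `0`. -/
def initial (input : List ℕ) : State where
  reg := fun _ => 0
  mem := fun a => input.getD a 0

/-- The list `output` stands in consecutive memory cells, from the address in register `0` on. -/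
def State.Outputs (s : State) (output : List ℕ) : Prop :=
  ∀ (j : ℕ) (h : j < output.length), s.mem (s.reg 0 + j) = output[j]

end WordRAM

/-! ## Cliques, separators, rooted clique-trees -/

section Graphs

variable {V : Type}

def IsMaxClique (G : SimpleGraph V) (K : Set V) : Prop :=
  Maximal (fun A : Set V => G.IsClique A) K

/-- The intersection of a (nonempty) family of maximal cliques. -/
def IsCliqueIntersection (G : SimpleGraph V) (X : Set V) : Prop :=
  ∃ 𝒦 : Set (Set V), 𝒦.Nonempty ∧ (∀ K ∈ 𝒦, IsMaxClique G K) ∧ X = ⋂₀ 𝒦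

/-- `S` avoids `u` and `v`, and `u`, `v` lie in different components of `G ∖ S`. -/
def IsSeparatorOf (G : SimpleGraph V) (u v : V) (S : Set V) : Prop :=
  ∃ (hu : u ∈ Sᶜ) (hv : v ∈ Sᶜ), ¬ (G.induce Sᶜ).Reachable ⟨u, hu⟩ ⟨v, hv⟩

def IsMinimalSeparator (G : SimpleGraph V) (S : Set V) : Prop :=
  ∃ u v : V, IsSeparatorOf G u v S ∧ ∀ S' : Set V, S' ⊂ S → ¬ IsSeparatorOf G u v S'

/-- `v ∈ X` is `X`-constrained: it is in a smaller clique-intersection with at least two elements,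
or it is sandwiched. -/
def IsConstrained (G : SimpleGraph V) (X : Set V) (v : V) : Prop :=
  (∃ X' : Set V, IsCliqueIntersection G X' ∧ X' ⊂ X ∧ v ∈ X' ∧ 2 ≤ X'.ncard) ∨
  (∃ X₁ X₂ : Set V, IsCliqueIntersection G X₁ ∧ IsCliqueIntersection G X₂ ∧
    X ⊂ X₁ ∧ X ∩ X₂ = {v} ∧ {v} ⊂ X₁ ∩ X₂)

def IsFree (G : SimpleGraph V) (X : Set V) (v : V) : Prop :=
  v ∈ X ∧ ¬ IsConstrained G X v

/-- A rooted clique-tree: a tree on the maximal cliques of `G` (enumerated, without repetition, by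
`Fin q`) such that the maximal cliques containing any given vertex induce a subtree. -/
structure RootedCliqueTree (G : SimpleGraph V) where
  q : ℕ
  clique : Fin q → Set V
  clique_injective : Function.Injective clique
  isMaxClique_iff : ∀ K : Set V, IsMaxClique G K ↔ ∃ i, clique i = K
  tree : SimpleGraph (Fin q)
  isTree : tree.IsTree
  induces_subtree : ∀ v : V, (tree.induce {i | v ∈ clique i}).Connected
  root : Fin q

namespace RootedCliqueTree

variable {G : SimpleGraph V} (R : RootedCliqueTree G)

/-- `Sᵢ`: the intersection of `Kᵢ` with its father, and `∅` if `Kᵢ` is the root. -/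
def sep (i : Fin R.q) : Set V :=
  {v | v ∈ R.clique i ∧
    ∃ j, R.tree.Adj i j ∧ R.tree.dist R.root j < R.tree.dist R.root i ∧ v ∈ R.clique j}

/-- `Kⱼ` is in the subtree rooted at `Kᵢ`: the path from the root to `Kⱼ` goes through `Kᵢ`. -/
def IsDescendant (i j : Fin R.q) : Prop :=
  R.tree.dist R.root i + R.tree.dist i j = R.tree.dist R.root j

/-- `Vᵢ`: the union of the maximal cliques in the subtree rooted at `Kᵢ`. -/
def verts (i : Fin R.q) : Set V :=
  {v | ∃ j, R.IsDescendant i j ∧ v ∈ R.clique j}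

end RootedCliqueTree

end Graphs

/-! ## Subtrees of a tree -/

namespace SubTree

variable {N : Type}

/-- The node set of `T⟨A⟩`, the smallest subtree of the tree `T` that contains the nodes `A`. -/
def hull (T : SimpleGraph N) (A : Set N) : Set N :=
  ⋂₀ {B | A ⊆ B ∧ (T.induce B).Preconnected}

/-- The subtree `T⟨A⟩`. -/
abbrev tree (T : SimpleGraph N) (A : Set N) : SimpleGraph (hull T A) := T.induce (hull T A)

/-- The center of the subtree `T⟨A⟩` (the nodes of minimum eccentricity), as a set of nodes. -/
def center (T : SimpleGraph N) (A : Set N) : Set N :=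
  Subtype.val '' (tree T A).center

/-- The distance from a node to a set of nodes (`⊤` if the set is empty). -/
noncomputable def distTo (T : SimpleGraph N) (x : N) (A : Set N) : ℕ∞ :=
  ⨅ a ∈ A, (T.dist x a : ℕ∞)

end SubTree

/-! ## Steiner roots -/

/-- A finite tree some of whose nodes are the elements of `V` (the real nodes, given by the
embedding `real`); the other nodes are the Steiner nodes. -/
structure SteinerTree (V : Type) where
  Node : Type
  finite : Finite Node
  graph : SimpleGraph Node
  isTree : graph.IsTree
  real : V ↪ Node

namespace SteinerTree

variable {V : Type} (T : SteinerTree V)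

/-- `G` is the subgraph of the `k`-th power of `T` that is induced by the real nodes. -/
def IsRoot (k : ℕ) (G : SimpleGraph V) : Prop :=
  ∀ u v : V, u ≠ v → (G.Adj u v ↔ T.graph.dist (T.real u) (T.real v) ≤ k)

def IsSteinerNode (x : T.Node) : Prop := ∀ v : V, T.real v ≠ x

/-- The node set of `T⟨X⟩` for a set `X` of real nodes. -/
abbrev span (X : Set V) : Set T.Node := SubTree.hull T.graph (T.real '' X)

/-- The tree `T⟨X⟩`. -/
abbrev subtree (X : Set V) : SimpleGraph (T.span X) := SubTree.tree T.graph (T.real '' X)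

/-- The center of `T⟨X⟩`. -/
abbrev center (X : Set V) : Set T.Node := SubTree.center T.graph (T.real '' X)

/-- The real node `v` is a leaf of `T⟨X⟩` whose eccentricity in `T⟨X⟩` is the diameter. -/
def IsExtremalLeaf (X : Set V) (v : V) : Prop :=
  ∃ h : T.real v ∈ T.span X,
    ((T.subtree X).neighborSet ⟨T.real v, h⟩).ncard = 1 ∧
    (T.subtree X).eccent ⟨T.real v, h⟩ = (T.subtree X).ediam

/-- A well-structured `4`-Steiner root of `G`. -/
structure WellStructured (G : SimpleGraph V) : Prop where
  isRoot : T.IsRoot 4 G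
  /-- free vertices are leaves of maximum eccentricity -/
  leaf : ∀ X : Set V, IsCliqueIntersection G X → X.Nonempty →
    ∀ v, IsFree G X v → T.IsExtremalLeaf X v
  /-- some central node is a nearest central node for all free vertices, except maybe one -/
  side : ∀ X : Set V, IsCliqueIntersection G X → X.Nonempty →
    ∃ c ∈ T.center X, {v | IsFree G X v ∧
      (T.graph.dist (T.real v) c : ℕ∞) ≠ SubTree.distTo T.graph (T.real v) (T.center X)}.Subsingleton
  /-- internal nodes on a path between the center and a free vertex are Steiner nodes of degree
  two -/
  path : ∀ X : Set V, IsCliqueIntersection G X → X.Nonempty →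
    ∀ v, IsFree G X v → ∀ c ∈ T.center X, ∀ x : T.Node,
      T.graph.dist (T.real v) x + T.graph.dist x c = T.graph.dist (T.real v) c →
      x ≠ T.real v → x ∉ T.center X →
      T.IsSteinerNode x ∧ (T.graph.neighborSet x).ncard = 2
  /-- a maximal clique with a free vertex spans a subtree of diameter four -/
  diam : ∀ K : Set V, IsMaxClique G K → (∃ v, IsFree G K v) → (T.subtree K).diam = 4

/-- `T⟨S⟩` is a bistar: a subtree of diameter three. -/
def IsBistar (S : Set V) : Prop := (T.subtree S).diam = 3

/-- `T⟨S⟩` is a thin branch of `T⟨K⟩`, where `S ⊂ K` is a minimal separator with at least two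
elements. -/
structure IsThinBranch (G : SimpleGraph V) (K S : Set V) : Prop where
  isMinimalSeparator : IsMinimalSeparator G S
  ssubset : S ⊂ K
  two_le : 2 ≤ S.ncard
  component : ∃ D : (T.graph.induce (T.span K \ T.center K)).ConnectedComponent,
    Subtype.val '' D.supp = T.span S \ T.center K
  unique : ∀ S' : Set V, IsMinimalSeparator G S' → S' ⊂ K → S' ≠ S →
    ¬ ((T.span S' ∩ T.center K).Nonempty ∧
       (T.span S' ∩ (T.span S \ T.center K)).Nonempty)

/-- An isomorphism between subtrees, given by node sets of two trees, is a Steiner equivalence if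
the two subtrees have the same real nodes and it maps each of them to itself. -/
def IsSteinerEquiv {T T' : SteinerTree V} {A : Set T.Node} {B : Set T'.Node}
    (φ : T.graph.induce A ≃g T'.graph.induce B) : Prop :=
  ∀ (a : A) (v : V), T.real v = a ↔ T'.real v = φ a

end SteinerTree

/-! ## Representation of the input and of the output -/

/-- A tree with a distinguished set of nodes ("center"), for graphs with vertex set `Fin n`: nodes
are natural numbers, a node `x < n` is the real node `x`, a node `x ≥ n` is a Steiner node. -/
structure CenteredTree where
  nodes : List ℕ
  edges : List (ℕ × ℕ)
  center : List ℕ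

namespace CenteredTree

variable (F : CenteredTree)

def graph : SimpleGraph {x : ℕ // x ∈ F.nodes} :=
  SimpleGraph.fromRel fun x y => ((x : ℕ), (y : ℕ)) ∈ F.edges

/-- `F` is a tree, its center consists of nodes of the tree, and all its real nodes are in `K`. -/
structure IsValid {n : ℕ} (K : Set (Fin n)) : Prop where
  nodup : F.nodes.Nodup
  edges_mem : ∀ e ∈ F.edges, e.1 ∈ F.nodes ∧ e.2 ∈ F.nodes
  isTree : F.graph.IsTree
  center_subset : F.center ⊆ F.nodes
  real_subset : ∀ v : Fin n, (v : ℕ) ∈ F.nodes → v ∈ K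

/-- `F` is, up to Steiner equivalence, the pair `(B, C)` of a subtree of `T`, given by its node set
`B`, and a set `C` of nodes. -/
def Represents {n : ℕ} (T : SteinerTree (Fin n)) (B C : Set T.Node) : Prop :=
  ∃ φ : F.graph ≃g T.graph.induce B,
    (∀ (a : {x : ℕ // x ∈ F.nodes}) (v : Fin n), (v : ℕ) = a ↔ T.real v = φ a) ∧
    (∀ a : {x : ℕ // x ∈ F.nodes}, (a : ℕ) ∈ F.center ↔ (φ a : T.Node) ∈ C) ∧
    C ⊆ B

/-- The lists of nodes, edges and central nodes, each one preceded by its length. -/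
def code : List ℕ :=
  (F.nodes.length :: F.nodes) ++
  (F.edges.length :: F.edges.flatMap fun e => [e.1, e.2]) ++
  (F.center.length :: F.center)

/-- A family, as the number of its members followed by their codes. -/
def familyCode (ℱ : List CenteredTree) : List ℕ :=
  ℱ.length :: ℱ.flatMap code

end CenteredTree

open Classical in
/-- The `0/1`-matrix of a relation, row by row. -/
noncomputable def matrixCode {a b : ℕ} (r : Fin a → Fin b → Prop) : List ℕ :=
  (List.finRange a).flatMap fun x => (List.finRange b).map fun y => if r x y then 1 else 0

/-- The input: `n`, the number of maximal cliques, the root and the index `i`, followed by the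
adjacency matrix of the graph, the incidence matrix of its maximal cliques, and the adjacency matrix
of the clique-tree. -/
noncomputable def inputCode {n : ℕ} (G : SimpleGraph (Fin n)) (R : RootedCliqueTree G)
    (i : Fin R.q) : List ℕ :=
  [n, R.q, R.root, i] ++ matrixCode G.Adj ++ matrixCode (fun j v => v ∈ R.clique j) ++
    matrixCode R.tree.Adj

section

/-! ## The metric of a tree -/

namespace TreeMetric

/-- A sequence with steps `±1` and without interior local maximum is V-shaped. -/
theorem exists_valley (f : ℕ → ℕ) (n : ℕ)
    (hstep : ∀ i < n, f i = f (i + 1) + 1 ∨ f (i + 1) = f i + 1)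
    (hmax : ∀ i, i + 2 ≤ n → f (i + 1) = f i + 1 → f (i + 2) = f (i + 1) + 1) :
    ∃ m ≤ n, ∀ i ≤ n, f i = f m + (i - m) + (m - i) := by
  induction n with
  | zero => grind
  | succ n ih =>
    obtain ⟨m, hm, h⟩ := ih (fun i hi => hstep i (by omega)) (fun i hi => hmax i (by omega))
    rcases hstep n (by omega) with h1 | h1
    · have hmn : m = n := by
        by_contra hne
        have h2 := hmax (n - 1) (by omega)
        have h3 := h (n - 1) (by omega)
        have h4 := h n le_rfl
        rw [show n - 1 + 1 = n by omega, show n - 1 + 2 = n + 1 by omega] at h2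
        have := h2 (by omega)
        omega
      subst hmn
      refine ⟨m + 1, le_rfl, fun i hi => ?_⟩
      grind
    · refine ⟨m, by omega, fun i hi => ?_⟩
      grind

variable {N : Type} {G : SimpleGraph N}

theorem exists_geodesic (hG : G.IsTree) (x y : N) :
    ∃ s : ℕ → N, s 0 = x ∧ s (G.dist x y) = y ∧ (∀ i < G.dist x y, G.Adj (s i) (s (i + 1))) ∧
      ∀ i j, i ≤ j → j ≤ G.dist x y → G.dist (s i) (s j) = j - i := by
  obtain ⟨p, hp⟩ := (hG.connected x y).exists_walk_length_eq_dist
  have hadj : ∀ i < G.dist x y, G.Adj (p.getVert i) (p.getVert (i + 1)) := fun i hi =>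
    p.adj_getVert_succ (by omega)
  have hle : ∀ i k, i + k ≤ G.dist x y → G.dist (p.getVert i) (p.getVert (i + k)) ≤ k := by
    intro i k
    induction k with
    | zero => simp
    | succ k ih =>
      intro h
      have h1 := hG.connected.dist_triangle (u := p.getVert i) (v := p.getVert (i + k))
        (w := p.getVert (i + (k + 1)))
      have h2 := SimpleGraph.dist_eq_one_iff_adj.2 (hadj (i + k) (by omega))
      grind
  refine ⟨p.getVert, p.getVert_zero, by rw [← hp, p.getVert_length], hadj, fun i j hij hj => ?_⟩
  have h1 := hle 0 i (by omega)
  have h2 := hle i (j - i) (by omega)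
  have h3 := hle j (G.dist x y - j) (by omega)
  have e : p.getVert (G.dist x y) = y := by rw [← hp, p.getVert_length]
  rw [zero_add, p.getVert_zero] at h1
  rw [show i + (j - i) = j by omega] at h2
  rw [show j + (G.dist x y - j) = G.dist x y by omega, e] at h3
  have h4 := hG.connected.dist_triangle (u := x) (v := p.getVert i) (w := y)
  have h5 := hG.connected.dist_triangle (u := p.getVert i) (v := p.getVert j) (w := y)
  omega

theorem eq_of_closer (hG : G.IsTree) {w y₁ y₂ z : N} (h₁ : G.Adj w y₁) (h₂ : G.Adj w y₂)
    (d₁ : G.dist y₁ z + 1 = G.dist w z) (d₂ : G.dist y₂ z + 1 = G.dist w z) : y₁ = y₂ := by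
  obtain ⟨p₁, hp₁⟩ := (hG.connected y₁ z).exists_walk_length_eq_dist
  obtain ⟨p₂, hp₂⟩ := (hG.connected y₂ z).exists_walk_length_eq_dist
  have q₁ : (SimpleGraph.Walk.cons h₁ p₁).IsPath :=
    SimpleGraph.Walk.isPath_of_length_eq_dist _ (by simp; omega)
  have q₂ : (SimpleGraph.Walk.cons h₂ p₂).IsPath :=
    SimpleGraph.Walk.isPath_of_length_eq_dist _ (by simp; omega)
  have h := (hG.isAcyclic.subsingleton_path w z).elim ⟨_, q₁⟩ ⟨_, q₂⟩
  grind

/-- The four-point condition. -/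
theorem four_point (hG : G.IsTree) (x y z w : N) :
    G.dist x y + G.dist z w ≤ G.dist x z + G.dist y w ∨
      G.dist x y + G.dist z w ≤ G.dist x w + G.dist y z := by
  obtain ⟨s, h0, hn, hadj, hs⟩ := exists_geodesic hG x y
  have key : ∀ z, ∃ m ≤ G.dist x y, ∀ i ≤ G.dist x y,
      G.dist z (s i) = G.dist z (s m) + (i - m) + (m - i) := by
    intro z
    refine exists_valley (fun i => G.dist z (s i)) _
      (fun i hi => hG.dist_eq_dist_add_one_of_adj z (hadj i hi)) ?_
    intro i hi hup
    change G.dist z (s (i + 1)) = G.dist z (s i) + 1 at hup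
    rcases hG.dist_eq_dist_add_one_of_adj z (hadj (i + 1) (by omega)) with h | h
    · exfalso
      have e := eq_of_closer hG (hadj i (by omega)).symm (hadj (i + 1) (by omega)) (z := z)
        (by rw [SimpleGraph.dist_comm, SimpleGraph.dist_comm (u := s (i + 1))]; omega)
        (by rw [SimpleGraph.dist_comm, SimpleGraph.dist_comm (u := s (i + 1))]; omega)
      grind
    · exact h
  obtain ⟨m, hm, h1⟩ := key z
  obtain ⟨m', hm', h2⟩ := key w
  have a1 := h1 0 (by omega)
  have a2 := h1 _ le_rfl
  have a3 := h1 m' hm'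
  have b1 := h2 0 (by omega)
  have b2 := h2 _ le_rfl
  rw [h0] at a1 b1
  rw [hn] at a2 b2
  have c := hG.connected.dist_triangle (u := z) (v := s m') (w := w)
  rw [SimpleGraph.dist_comm (u := s m')] at c
  rw [SimpleGraph.dist_comm (u := x) (v := z), SimpleGraph.dist_comm (u := y) (v := w),
    SimpleGraph.dist_comm (u := x) (v := w), SimpleGraph.dist_comm (u := y) (v := z)]
  omega

theorem parity (hG : G.IsTree) (x y z : N) :
    (G.dist x y + G.dist y z + G.dist x z) % 2 = 0 := by
  obtain ⟨s, h0, hn, hadj, hs⟩ := exists_geodesic hG y z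
  have : ∀ i ≤ G.dist y z, (G.dist x y + i + G.dist x (s i)) % 2 = 0 := by
    intro i
    induction i with
    | zero => grind
    | succ i ih =>
      intro hi
      have h1 := ih (by omega)
      have h2 := hG.dist_eq_dist_add_one_of_adj x (hadj i (by omega))
      omega
  grind

theorem exists_between (hG : G.IsTree) (x y : N) {i : ℕ} (hi : i ≤ G.dist x y) :
    ∃ z, G.dist x z = i ∧ G.dist z y + i = G.dist x y := by
  obtain ⟨s, h0, hn, -, hs⟩ := exists_geodesic hG x y
  grind

theorem dist_eq_zero (hG : G.IsTree) {x y : N} : G.dist x y = 0 ↔ x = y :=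
  hG.connected.dist_eq_zero_iff

/-- The graph whose edges are the pairs at distance one. -/
def unitGraph (δ : N → N → ℕ) (hsymm : ∀ x y, δ x y = δ y x) (hzero : ∀ x y, δ x y = 0 ↔ x = y) :
    SimpleGraph N where
  Adj x y := δ x y = 1
  symm := ⟨fun x y h => by grind⟩
  loopless := ⟨fun x h => by grind⟩

section

variable {δ : N → N → ℕ} {hsymm : ∀ x y, δ x y = δ y x} {hzero : ∀ x y, δ x y = 0 ↔ x = y}

theorem unitGraph_step_unique (hsymm : ∀ x y, δ x y = δ y x) (hzero : ∀ x y, δ x y = 0 ↔ x = y)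
    (hfour : ∀ x y z w, δ x y + δ z w ≤ δ x z + δ y w ∨ δ x y + δ z w ≤ δ x w + δ y z)
    {w y₁ y₂ z : N} (h₁ : δ w y₁ = 1) (h₂ : δ w y₂ = 1)
    (d₁ : δ y₁ z + 1 = δ w z) (d₂ : δ y₂ z + 1 = δ w z) : y₁ = y₂ := by
  have h := hfour y₁ y₂ w z
  grind

theorem unitGraph_closer
    (hfour : ∀ x y z w, δ x y + δ z w ≤ δ x z + δ y w ∨ δ x y + δ z w ≤ δ x w + δ y z)
    (hpar : ∀ x y z, (δ x y + δ y z + δ x z) % 2 = 0)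
    {y z : N} (p : (unitGraph δ hsymm hzero).Walk y z) :
    ∀ x, (hxy : (unitGraph δ hsymm hzero).Adj x y) → (p.cons hxy).IsPath →
      δ y z + 1 = δ x z := by
  induction p with
  | nil =>
    intro x hxy _
    have h1 : δ x _ = 1 := hxy
    grind
  | @cons y y₂ z h p ih =>
    intro x hxy hp
    have hp' := hp.of_cons
    have h1 := ih y h hp'
    have hxy' : δ x y = 1 := hxy
    have hy' : δ y y₂ = 1 := h
    by_contra hne
    have h2 := hpar x y z
    have h3 := hfour x z y y
    have h4 := hfour y z x x
    have s1 := hsymm x y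
    have s2 := hsymm x z
    have s3 := hsymm y z
    have z1 := (hzero x x).2 rfl
    have z2 := (hzero y y).2 rfl
    have e : x = y₂ := unitGraph_step_unique hsymm hzero hfour
      (w := y) (z := z) (by omega) hy' (by omega) (by omega)
    subst e
    rw [SimpleGraph.Walk.cons_isPath_iff] at hp
    exact hp.2 (by simp)

theorem unitGraph_isTree [Nonempty N]
    (hfour : ∀ x y z w, δ x y + δ z w ≤ δ x z + δ y w ∨ δ x y + δ z w ≤ δ x w + δ y z)
    (hpar : ∀ x y z, (δ x y + δ y z + δ x z) % 2 = 0)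
    (hstep : ∀ x z, x ≠ z → ∃ y, δ x y = 1 ∧ δ y z + 1 = δ x z) :
    (unitGraph δ hsymm hzero).IsTree ∧ ∀ x y, (unitGraph δ hsymm hzero).dist x y = δ x y := by
  have hwalk : ∀ n x z, δ x z = n → ∃ p : (unitGraph δ hsymm hzero).Walk x z, p.length = n := by
    intro n
    induction n with
    | zero =>
      intro x z h
      obtain rfl := (hzero x z).1 h
      exact ⟨.nil, rfl⟩
    | succ n ih =>
      intro x z h
      obtain ⟨y, h1, h2⟩ := hstep x z (fun e => by grind)
      obtain ⟨p, hp⟩ := ih y z (by omega)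
      exact ⟨p.cons (show (unitGraph δ hsymm hzero).Adj x y from h1), by simp [hp]⟩
  have hconn : (unitGraph δ hsymm hzero).Connected :=
    ⟨fun x z => by obtain ⟨p, -⟩ := hwalk _ x z rfl; exact p.reachable⟩
  refine ⟨⟨hconn, ?_⟩, ?_⟩
  · rw [SimpleGraph.isAcyclic_iff_subsingleton_path]
    refine fun x z => ⟨?_⟩
    rintro ⟨p, hp⟩ ⟨q, hq⟩
    congr
    induction p with
    | nil =>
      cases q with
      | nil => rfl
      | cons h q =>
        exfalso
        rw [SimpleGraph.Walk.cons_isPath_iff] at hq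
        exact hq.2 (by simp)
    | @cons x y z h p ih =>
      cases q with
      | nil =>
        exfalso
        rw [SimpleGraph.Walk.cons_isPath_iff] at hp
        exact hp.2 (by simp)
      | @cons _ y' _ h' q =>
        have e : y = y' := unitGraph_step_unique hsymm hzero hfour h h'
          (unitGraph_closer hfour hpar p x h hp) (unitGraph_closer hfour hpar q x h' hq)
        subst e
        rw [ih hp.of_cons q hq.of_cons]
  · intro x z
    refine le_antisymm ?_ ?_
    · obtain ⟨p, hp⟩ := hwalk _ x z rfl
      exact hp ▸ SimpleGraph.dist_le p
    · obtain ⟨p, hp⟩ := (hconn x z).exists_walk_length_eq_dist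
      rw [← hp]
      clear hp
      induction p with
      | nil => grind
      | @cons x y z h p ih =>
        have h1 : δ x y = 1 := h
        have h2 := hfour x z y y
        have h3 := hsymm y z
        have z2 := (hzero y y).2 rfl
        simp only [SimpleGraph.Walk.length_cons]
        omega

end

end TreeMetric

end

section

/-! ## Hulls and centers in terms of the metric -/

namespace TreeMetric

open SubTree

variable {N : Type} {G : SimpleGraph N}

theorem dist_symm (G : SimpleGraph N) (u v : N) : G.dist u v = G.dist v u := SimpleGraph.dist_comm

theorem dist_tri (hG : G.IsTree) (x y z : N) : G.dist x z ≤ G.dist x y + G.dist y z :=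
  hG.connected.dist_triangle

theorem mem_support_of_between (hG : G.IsTree) {u v x : N} (p : G.Walk u v)
    (h : G.dist u x + G.dist x v = G.dist u v) : x ∈ p.support := by
  induction p with
  | @nil u =>
    rw [SimpleGraph.dist_self] at h
    have := (dist_eq_zero hG (x := u) (y := x)).1 (by omega)
    simp [this]
  | @cons u u' v hadj p ih =>
    by_cases hx : x = u
    · simp [hx]
    have hpos : G.dist u x ≠ 0 := fun e => hx ((dist_eq_zero hG).1 e).symm
    have h1 := dist_symm G u x
    have h2 := dist_symm G u' x
    have h3 := dist_symm G u' v
    have h4 := dist_symm G u v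
    have t1 := dist_tri hG u' x v
    rcases hG.dist_eq_dist_add_one_of_adj x hadj with a | a
    · rcases hG.dist_eq_dist_add_one_of_adj v hadj with b | b
      all_goals grind
    · rcases hG.dist_eq_dist_add_one_of_adj v hadj with b | b
      · exfalso
        obtain ⟨y, y1, y2⟩ := exists_between hG u x (i := 1) (by omega)
        have t2 := dist_tri hG y x v
        have t3 := dist_tri hG u y v
        have e := eq_of_closer hG (w := u) (z := v) hadj (SimpleGraph.dist_eq_one_iff_adj.1 y1)
          (by omega) (by omega)
        grind
      grind

/-- Geodesically closed sets of nodes. -/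
def Convex (G : SimpleGraph N) (B : Set N) : Prop :=
  ∀ u ∈ B, ∀ v ∈ B, ∀ x, G.dist u x + G.dist x v = G.dist u v → x ∈ B

theorem Convex.exists_walk (hG : G.IsTree) {B : Set N} (hB : Convex G B) (n : ℕ) (u v : B)
    (h : G.dist u v = n) : ∃ p : (G.induce B).Walk u v, p.length = n := by
  induction n generalizing u with
  | zero =>
    obtain rfl : u = v := Subtype.ext ((dist_eq_zero hG).1 h)
    exact ⟨.nil, rfl⟩
  | succ n ih =>
    obtain ⟨y, y1, y2⟩ := exists_between hG (u : N) v (i := 1) (by omega)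
    obtain ⟨p, hp⟩ := ih ⟨y, hB u u.2 v v.2 y (by omega)⟩ (by simp; omega)
    exact ⟨.cons (by simpa using SimpleGraph.dist_eq_one_iff_adj.1 y1) p, by simp [hp]⟩

theorem dist_le_induce {B : Set N} {u v : B} (h : (G.induce B).Reachable u v) :
    G.dist u v ≤ (G.induce B).dist u v := by
  obtain ⟨p, hp⟩ := h.exists_walk_length_eq_dist
  have := SimpleGraph.dist_le (p.map (SimpleGraph.Embedding.induce B).toHom)
  rw [SimpleGraph.Walk.length_map, hp] at this
  exact this

theorem Convex.dist_induce (hG : G.IsTree) {B : Set N} (hB : Convex G B) (u v : B) :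
    (G.induce B).dist u v = G.dist u v := by
  obtain ⟨p, hp⟩ := hB.exists_walk hG _ u v rfl
  exact le_antisymm (hp ▸ SimpleGraph.dist_le p) (dist_le_induce p.reachable)

theorem Convex.preconnected (hG : G.IsTree) {B : Set N} (hB : Convex G B) :
    (G.induce B).Preconnected := fun u v => by
  obtain ⟨p, hp⟩ := hB.exists_walk hG _ u v rfl
  exact p.reachable

/-- The four-point condition for all pairings. -/
theorem four_points (hG : G.IsTree) (x y z w : N) :
    (G.dist x y + G.dist z w ≤ G.dist x z + G.dist y w ∨
      G.dist x y + G.dist z w ≤ G.dist x w + G.dist y z) ∧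
    (G.dist x z + G.dist y w ≤ G.dist x y + G.dist z w ∨
      G.dist x z + G.dist y w ≤ G.dist x w + G.dist y z) ∧
    (G.dist x w + G.dist y z ≤ G.dist x y + G.dist z w ∨
      G.dist x w + G.dist y z ≤ G.dist x z + G.dist y w) := by
  have h1 := four_point hG x y z w
  have h2 := four_point hG x z y w
  have h3 := four_point hG x w y z
  have e1 := dist_symm G z y
  have e2 := dist_symm G w z
  have e3 := dist_symm G w y
  grind

theorem between_of_between (hG : G.IsTree) {a b u v x : N}
    (h : G.dist u x + G.dist x v = G.dist u v) (hu : G.dist a u + G.dist u b = G.dist a b) :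
    G.dist a x + G.dist x v = G.dist a v ∨ G.dist b x + G.dist x v = G.dist b v := by
  have f1 := four_points hG a b u x
  have f2 := four_points hG a b u v
  have f3 := four_points hG a b x v
  have f4 := four_points hG a u x v
  have f5 := four_points hG b u x v
  have t1 := dist_tri hG a x v
  have t2 := dist_tri hG b x v
  have c1 := dist_symm G u b
  omega

theorem convex_hullSet (hG : G.IsTree) (A : Set N) :
    Convex G {x | ∃ u ∈ A, ∃ v ∈ A, G.dist u x + G.dist x v = G.dist u v} := by
  rintro u ⟨a, ha, a', ha', hu⟩ v ⟨b, hb, b', hb', hv⟩ x hx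
  have key : ∀ c ∈ A, G.dist c x + G.dist x v = G.dist c v →
      ∃ u ∈ A, ∃ v ∈ A, G.dist u x + G.dist x v = G.dist u v := by
    intro c hc h
    have h' : G.dist v x + G.dist x c = G.dist v c := by
      have c1 := dist_symm G v x
      have c2 := dist_symm G x c
      have c3 := dist_symm G v c
      omega
    rcases between_of_between hG h' hv with h1 | h1
    all_goals grind
  rcases between_of_between hG hx hu with h1 | h1
  all_goals grind

theorem mem_hull_iff (hG : G.IsTree) {A : Set N} {x : N} :
    x ∈ hull G A ↔ ∃ u ∈ A, ∃ v ∈ A, G.dist u x + G.dist x v = G.dist u v := by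
  constructor
  · intro h
    exact Set.mem_sInter.1 h {x | ∃ u ∈ A, ∃ v ∈ A, G.dist u x + G.dist x v = G.dist u v}
      ⟨fun u hu => ⟨u, hu, u, hu, by simp⟩, (convex_hullSet hG A).preconnected hG⟩
  · rintro ⟨u, hu, v, hv, h⟩ B ⟨hAB, hB⟩
    obtain ⟨p⟩ := hB ⟨u, hAB hu⟩ ⟨v, hAB hv⟩
    have := mem_support_of_between hG (p.map (SimpleGraph.Embedding.induce B).toHom) h
    rw [SimpleGraph.Walk.support_map, List.mem_map] at this
    obtain ⟨y, -, rfl⟩ := this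
    exact y.2

theorem convex_hull (hG : G.IsTree) (A : Set N) : Convex G (hull G A) := by
  have : hull G A = {x | ∃ u ∈ A, ∃ v ∈ A, G.dist u x + G.dist x v = G.dist u v} :=
    Set.ext fun x => mem_hull_iff hG
  rw [this]
  exact convex_hullSet hG A

theorem subset_hull (G : SimpleGraph N) (A : Set N) : A ⊆ hull G A :=
  fun _ hx _ hB => hB.1 hx

theorem dist_tree (hG : G.IsTree) {A : Set N} (x y : hull G A) :
    (tree G A).dist x y = G.dist x y := (convex_hull hG A).dist_induce hG x y

theorem edist_tree (hG : G.IsTree) {A : Set N} (x y : hull G A) :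
    (tree G A).edist x y = (G.dist x y : ℕ∞) := by
  rw [← dist_tree hG x y]
  obtain ⟨p⟩ := (convex_hull hG A).preconnected hG x y
  exact (SimpleGraph.Reachable.coe_dist_eq_edist ⟨p⟩).symm

/-- A pair at maximum distance in `A`. -/
structure Diametral (G : SimpleGraph N) (A : Set N) (p q : N) : Prop where
  left : p ∈ A
  right : q ∈ A
  le : ∀ u ∈ A, ∀ v ∈ A, G.dist u v ≤ G.dist p q

section

variable {A : Set N} {p q : N}

theorem Diametral.dist_le (hG : G.IsTree) (h : Diametral G A p q) (x : N) {u : N}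
    (hu : u ∈ hull G A) : G.dist x u ≤ max (G.dist x p) (G.dist x q) := by
  obtain ⟨a, ha, b, hb, hab⟩ := (mem_hull_iff hG).1 hu
  have h1 := h.le a ha p h.left
  have h2 := h.le a ha q h.right
  have h3 := h.le b hb p h.left
  have h4 := h.le b hb q h.right
  have f1 := four_points hG x a p q
  have f2 := four_points hG x b p q
  have f3 := four_points hG x u a b
  have c1 := dist_symm G a u
  omega

theorem Diametral.eccent (hG : G.IsTree) (h : Diametral G A p q) (x : hull G A) :
    (tree G A).eccent x = (max (G.dist x p) (G.dist x q) : ℕ) := by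
  refine le_antisymm ?_ ?_
  · rw [SimpleGraph.eccent_le_iff]
    intro v
    rw [edist_tree hG]
    exact_mod_cast h.dist_le hG x v.2
  · rcases le_total (G.dist x p) (G.dist x q) with h1 | h1
    · rw [max_eq_right h1]
      have := SimpleGraph.edist_le_eccent (G := tree G A) (u := x)
        (v := ⟨q, subset_hull G A h.right⟩)
      rwa [edist_tree hG] at this
    · rw [max_eq_left h1]
      have := SimpleGraph.edist_le_eccent (G := tree G A) (u := x)
        (v := ⟨p, subset_hull G A h.left⟩)
      rwa [edist_tree hG] at this

theorem Diametral.ediam (hG : G.IsTree) (h : Diametral G A p q) :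
    (tree G A).ediam = (G.dist p q : ℕ) := by
  refine le_antisymm ?_ ?_
  · rw [SimpleGraph.ediam_le_iff]
    intro u v
    rw [edist_tree hG]
    have h1 := h.dist_le hG u v.2
    have h2 := h.dist_le hG p u.2
    have h3 := h.dist_le hG q u.2
    have h4 := h.le p h.left p h.left
    have c1 := dist_symm G p u
    have c2 := dist_symm G q u
    have c3 := dist_symm G p q
    have z1 : G.dist p p = 0 := SimpleGraph.dist_self
    have z2 : G.dist q q = 0 := SimpleGraph.dist_self
    exact_mod_cast (by grind)
  · have := SimpleGraph.edist_le_ediam (G := tree G A) (u := ⟨p, subset_hull G A h.left⟩)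
      (v := ⟨q, subset_hull G A h.right⟩)
    rwa [edist_tree hG] at this

theorem Diametral.diam (hG : G.IsTree) (h : Diametral G A p q) :
    (tree G A).diam = G.dist p q := by
  rw [SimpleGraph.diam, h.ediam hG]
  rfl

theorem Diametral.mem_center_iff (hG : G.IsTree) (h : Diametral G A p q) {x : N} :
    x ∈ center G A ↔ 2 * G.dist x p ≤ G.dist p q + 1 ∧ 2 * G.dist x q ≤ G.dist p q + 1 := by
  obtain ⟨m, m1, m2⟩ := exists_between hG p q (i := G.dist p q / 2) (by omega)
  have hm : m ∈ hull G A := (mem_hull_iff hG).2 ⟨p, h.left, q, h.right, by omega⟩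
  have hlow : ∀ y : N, (G.dist p q + 1) / 2 ≤ max (G.dist y p) (G.dist y q) := fun y => by
    have t := dist_tri hG p y q
    have c := dist_symm G p y
    omega
  have hrad : (tree G A).radius = ((G.dist p q + 1) / 2 : ℕ) := by
    refine le_antisymm ?_ ?_
    · refine (SimpleGraph.radius_le_eccent (u := ⟨m, hm⟩)).trans ?_
      rw [h.eccent hG]
      have c := dist_symm G p m
      exact_mod_cast (by grind)
    · have : Nonempty (hull G A) := ⟨⟨m, hm⟩⟩
      obtain ⟨y, hy⟩ := SimpleGraph.exists_eccent_eq_radius (G := tree G A)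
      rw [← hy, h.eccent hG]
      exact_mod_cast hlow y
  constructor
  · rintro ⟨y, hy, rfl⟩
    rw [SimpleGraph.mem_center_iff, hrad, h.eccent hG] at hy
    have : max (G.dist y p) (G.dist y q) = (G.dist p q + 1) / 2 := by exact_mod_cast hy
    omega
  · rintro ⟨h1, h2⟩
    have hx : x ∈ hull G A := by
      refine (mem_hull_iff hG).2 ⟨p, h.left, q, h.right, ?_⟩
      have t := dist_tri hG p x q
      have c := dist_symm G p x
      have par := parity hG p x q
      omega
    refine ⟨⟨x, hx⟩, ?_, rfl⟩
    rw [SimpleGraph.mem_center_iff, hrad, h.eccent hG]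
    have := hlow x
    exact_mod_cast (by grind)

end

end TreeMetric

end

section

/-! ## Well-structured roots in terms of the metric -/

theorem IsMaxClique.isClique {V : Type} {G : SimpleGraph V} {K : Set V} (h : IsMaxClique G K) :
    G.IsClique K := h.prop

theorem IsMaxClique.eq_of_subset {V : Type} {G : SimpleGraph V} {K A : Set V}
    (h : IsMaxClique G K) (hA : G.IsClique A) (hKA : K ⊆ A) : K = A :=
  Maximal.eq_of_subset h hA hKA

theorem IsMaxClique.isCliqueIntersection {V : Type} {G : SimpleGraph V} {K : Set V}
    (h : IsMaxClique G K) : IsCliqueIntersection G K :=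
  ⟨{K}, ⟨K, rfl⟩, by grind, by simp⟩

theorem IsCliqueIntersection.inter {V : Type} {G : SimpleGraph V} {X Y : Set V}
    (hX : IsCliqueIntersection G X) (hY : IsCliqueIntersection G Y) :
    IsCliqueIntersection G (X ∩ Y) := by
  obtain ⟨A, hA, hA', rfl⟩ := hX
  obtain ⟨B, hB, hB', rfl⟩ := hY
  exact ⟨A ∪ B, hA.inl, fun K hK => hK.elim (hA' K) (hB' K), (Set.sInter_union A B).symm⟩

theorem IsCliqueIntersection.isClique {V : Type} {G : SimpleGraph V} {X : Set V}
    (hX : IsCliqueIntersection G X) : G.IsClique X := by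
  obtain ⟨A, ⟨K, hK⟩, hA, rfl⟩ := hX
  exact (hA K hK).isClique.subset (Set.sInter_subset_of_mem hK)

theorem exists_isMaxClique {V : Type} [Finite V] {G : SimpleGraph V} {A : Set V}
    (hA : G.IsClique A) : ∃ K, IsMaxClique G K ∧ A ⊆ K := by
  obtain ⟨K, hK, hmax⟩ := (Set.toFinite {B : Set V | G.IsClique B}).exists_le_maximal hA
  exact ⟨K, hmax, hK⟩

namespace SteinerTree

open SubTree TreeMetric

variable {V : Type} (T : SteinerTree V)

instance : Coe V T.Node := ⟨fun v => T.real v⟩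

/-- The distance between two nodes. -/
noncomputable def D (x y : T.Node) : ℕ := T.graph.dist x y

/-- The distance between two real nodes. -/
noncomputable def d (u v : V) : ℕ := T.D u v

theorem D_comm (x y : T.Node) : T.D x y = T.D y x := SimpleGraph.dist_comm

@[simp] theorem D_self (x : T.Node) : T.D x x = 0 := SimpleGraph.dist_self

theorem D_eq_zero {x y : T.Node} : T.D x y = 0 ↔ x = y := dist_eq_zero T.isTree

theorem D_tri (x y z : T.Node) : T.D x z ≤ T.D x y + T.D y z := T.isTree.connected.dist_triangle

theorem fp (x y z w : T.Node) :
    (T.D x y + T.D z w = T.D x z + T.D y w ∧ T.D x w + T.D y z ≤ T.D x y + T.D z w) ∨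
    (T.D x y + T.D z w = T.D x w + T.D y z ∧ T.D x z + T.D y w ≤ T.D x y + T.D z w) ∨
    (T.D x z + T.D y w = T.D x w + T.D y z ∧ T.D x y + T.D z w ≤ T.D x z + T.D y w) := by
  have := four_points T.isTree x y z w
  unfold D
  omega

theorem par (x y z : T.Node) : (T.D x y + T.D y z + T.D x z) % 2 = 0 := parity T.isTree x y z

theorem D_between (x y : T.Node) {i : ℕ} (hi : i ≤ T.D x y) :
    ∃ z, T.D x z = i ∧ T.D z y + i = T.D x y := exists_between T.isTree x y hi

theorem D_eq_one {x y : T.Node} : T.D x y = 1 ↔ T.graph.Adj x y :=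
  SimpleGraph.dist_eq_one_iff_adj

theorem d_comm (u v : V) : T.d u v = T.d v u := T.D_comm _ _

@[simp] theorem d_self (u : V) : T.d u u = 0 := T.D_self _

theorem d_eq_zero {u v : V} : T.d u v = 0 ↔ u = v := by
  rw [d, D_eq_zero, EmbeddingLike.apply_eq_iff_eq]

/-- The real nodes at distance at most two from a node. -/
def ball (x : T.Node) : Set V := {v | T.D v x ≤ 2}

theorem mem_ball {x : T.Node} {v : V} : v ∈ T.ball x ↔ T.D v x ≤ 2 := Iff.rfl

attribute [grind =] d D_comm D_self D_eq_zero mem_ball Set.mem_sInter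

attribute [grind →] IsMaxClique.isCliqueIntersection IsMaxClique.isClique
  IsCliqueIntersection.isClique

variable {T} {G : SimpleGraph V}

theorem IsRoot.adj_iff (h : T.IsRoot 4 G) {u v : V} (huv : u ≠ v) : G.Adj u v ↔ T.d u v ≤ 4 :=
  h u v huv

theorem IsRoot.isClique_iff (h : T.IsRoot 4 G) {A : Set V} :
    G.IsClique A ↔ ∀ u ∈ A, ∀ v ∈ A, T.d u v ≤ 4 := by
  constructor
  · intro hA u hu v hv
    by_cases huv : u = v
    · grind
    · exact (h.adj_iff huv).1 (hA hu hv huv)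
  · intro hA u hu v hv huv
    exact (h.adj_iff huv).2 (hA u hu v hv)

theorem IsRoot.isClique_ball (h : T.IsRoot 4 G) (x : T.Node) : G.IsClique (T.ball x) := by
  rw [h.isClique_iff]
  intro u hu v hv
  have := T.D_tri u x v
  grind

theorem IsRoot.d_le (h : T.IsRoot 4 G) {K : Set V} (hK : G.IsClique K) {u v : V} (hu : u ∈ K)
    (hv : v ∈ K) : T.d u v ≤ 4 := h.isClique_iff.1 hK u hu v hv

theorem IsRoot.mem_of_forall (h : T.IsRoot 4 G) {K : Set V} (hK : IsMaxClique G K) {v : V}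
    (hv : ∀ u ∈ K, T.d u v ≤ 4) : v ∈ K := by
  have : K = insert v K := hK.eq_of_subset (h.isClique_iff.2 ?_) (Set.subset_insert v K)
  · grind
  · rintro u (rfl | hu) w (rfl | hw)
    · simp
    · grind
    · grind
    · exact h.d_le hK.isClique hu hw

theorem IsRoot.eq_ball (h : T.IsRoot 4 G) {K : Set V} (hK : IsMaxClique G K) {x : T.Node}
    (hx : ∀ u ∈ K, T.D u x ≤ 2) : K = T.ball x :=
  hK.eq_of_subset (h.isClique_ball x) hx

theorem exists_diametral_d [Finite V] (T : SteinerTree V) {X : Set V} (hX : X.Nonempty) :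
    ∃ p ∈ X, ∃ q ∈ X, ∀ u ∈ X, ∀ v ∈ X, T.d u v ≤ T.d p q := by
  obtain ⟨⟨p, q⟩, h, hmax⟩ := (Set.toFinite (X ×ˢ X)).exists_maximalFor
    (fun x : V × V => T.d x.1 x.2) _ (hX.prod hX)
  refine ⟨p, h.1, q, h.2, fun u hu v hv => ?_⟩
  rcases le_total (T.d u v) (T.d p q) with h1 | h1
  · exact h1
  · exact hmax (j := (u, v)) ⟨hu, hv⟩ h1

theorem diametral_image {X : Set V} {p q : V} (hp : p ∈ X) (hq : q ∈ X)
    (h : ∀ u ∈ X, ∀ v ∈ X, T.d u v ≤ T.d p q) :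
    Diametral T.graph (T.real '' X) p q :=
  ⟨⟨p, hp, rfl⟩, ⟨q, hq, rfl⟩, by
    rintro _ ⟨u, hu, rfl⟩ _ ⟨v, hv, rfl⟩
    exact h u hu v hv⟩

theorem IsRoot.exists_center [Finite V] (h : T.IsRoot 4 G) {K : Set V} (hK : IsMaxClique G K)
    (hne : K.Nonempty) : ∃ x, K = T.ball x := by
  obtain ⟨p, hp, q, hq, hpq⟩ := exists_diametral_d T hne
  obtain ⟨m, m1, m2⟩ := T.D_between p q (i := T.d p q / 2)
    (by grind)
  refine ⟨m, h.eq_ball hK fun u hu => ?_⟩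
  have h3 := h.d_le hK.isClique hp hq
  have f := T.fp u m p q
  grind

theorem ball_eq_of_far (h : T.IsRoot 4 G) {K : Set V} (hK : IsMaxClique G K) {u w : V}
    (hu : u ∈ K) (hw : w ∈ K) (huw : T.d u w = 4) {m : T.Node} (h1 : T.D u m = 2)
    (h2 : T.D w m = 2) : K = T.ball m := by
  refine h.eq_ball hK fun z hz => ?_
  have a := h.d_le hK.isClique hz hu
  have b := h.d_le hK.isClique hz hw
  have f := T.fp z m u w
  grind

theorem IsRoot.isMaxClique_of_far (h : T.IsRoot 4 G) {X : Set V} (hX : IsCliqueIntersection G X)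
    {u w : V} (hu : u ∈ X) (hw : w ∈ X) (huw : T.d u w = 4) : IsMaxClique G X := by
  obtain ⟨𝒦, ⟨K, hK⟩, hmax, rfl⟩ := hX
  obtain ⟨m, m1, m2⟩ := T.D_between u w (i := 2) (by grind)
  have m3 : T.D w m = 2 := by grind
  have : ⋂₀ 𝒦 = K := by
    refine Set.Subset.antisymm (Set.sInter_subset_of_mem hK) (Set.subset_sInter fun L hL => ?_)
    rw [ball_eq_of_far h (hmax K hK) (hu K hK) (hw K hK) huw m1 m3,
      ball_eq_of_far h (hmax L hL) (hu L hL) (hw L hL) huw m1 m3]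
  grind

/-- The conditions on well-structured roots, in terms of distances. -/
structure MetricWS (T : SteinerTree V) (G : SimpleGraph V) : Prop where
  root : T.IsRoot 4 G
  leaf : ∀ X : Set V, IsCliqueIntersection G X → ∀ v, IsFree G X v →
    ∃ w ∈ X, w ≠ v ∧ ∀ u ∈ X, ∀ u' ∈ X, T.d u u' ≤ T.d v w
  side : ∀ X : Set V, IsCliqueIntersection G X → ∀ p ∈ X, ∀ q ∈ X, T.d p q = 3 →
    (∀ u ∈ X, ∀ u' ∈ X, T.d u u' ≤ 3) →
    (∀ v v', IsFree G X v → IsFree G X v' → T.d v q < 3 → T.d v' q < 3 → v = v') ∨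
    (∀ v v', IsFree G X v → IsFree G X v' → T.d v p < 3 → T.d v' p < 3 → v = v')
  path : ∀ K : Set V, IsMaxClique G K → ∀ v, IsFree G K v → ∀ c y : T.Node,
    (∀ u ∈ K, T.D u c ≤ 2) → T.D v c = 2 → T.D v y = 1 →
    T.D y c = 1 → T.IsSteinerNode y ∧ ∀ w, T.D y w = 1 → w = T.real v ∨ w = c
  diam : ∀ K : Set V, IsMaxClique G K → ∀ v, IsFree G K v → ∃ p ∈ K, ∃ q ∈ K, T.d p q = 4

theorem ne_distTo_iff {x c : T.Node} {C : Set T.Node} (hc : c ∈ C) :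
    (T.graph.dist x c : ℕ∞) ≠ distTo T.graph x C ↔ ∃ c' ∈ C, T.D x c' < T.D x c := by
  constructor
  · intro h
    by_contra! hno
    refine h (le_antisymm (le_iInf₂ fun a ha => ?_) (iInf₂_le c hc))
    exact_mod_cast hno a ha
  · rintro ⟨c', hc', hlt⟩ h
    have : distTo T.graph x C ≤ (T.graph.dist x c' : ℕ∞) := iInf₂_le c' hc'
    rw [← h] at this
    have : T.graph.dist x c ≤ T.graph.dist x c' := by exact_mod_cast this
    unfold D at hlt
    omega

section

variable {X : Set V} {p q : V}

theorem mem_center_iff_d (hp : p ∈ X) (hq : q ∈ X) (h : ∀ u ∈ X, ∀ v ∈ X, T.d u v ≤ T.d p q)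
    {x : T.Node} : x ∈ T.center X ↔
      2 * T.D x p ≤ T.d p q + 1 ∧ 2 * T.D x q ≤ T.d p q + 1 :=
  (diametral_image hp hq h).mem_center_iff T.isTree

theorem diam_subtree (hp : p ∈ X) (hq : q ∈ X) (h : ∀ u ∈ X, ∀ v ∈ X, T.d u v ≤ T.d p q) :
    (T.subtree X).diam = T.d p q := (diametral_image hp hq h).diam T.isTree

theorem D_le_of_mem_center (hp : p ∈ X) (hq : q ∈ X)
    (h : ∀ u ∈ X, ∀ v ∈ X, T.d u v ≤ T.d p q) {x : T.Node} (hx : x ∈ T.center X) {u : V}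
    (hu : u ∈ X) : 2 * T.D x u ≤ T.d p q + 1 := by
  have h1 := (mem_center_iff_d hp hq h).1 hx
  have h2 := (diametral_image hp hq h).dist_le T.isTree x
    (subset_hull T.graph _ ⟨u, hu, rfl⟩)
  unfold D at *
  omega

theorem isExtremalLeaf_iff (hp : p ∈ X) (hq : q ∈ X)
    (h : ∀ u ∈ X, ∀ v ∈ X, T.d u v ≤ T.d p q) {v : V} (hv : v ∈ X) :
    T.IsExtremalLeaf X v ↔ T.d p q ≠ 0 ∧ max (T.d v p) (T.d v q) = T.d p q := by
  have hdi := diametral_image hp hq h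
  have hmem : T.real v ∈ T.span X := subset_hull T.graph _ ⟨v, hv, rfl⟩
  have hecc : (T.subtree X).eccent ⟨T.real v, hmem⟩ = (T.subtree X).ediam ↔
      max (T.d v p) (T.d v q) = T.d p q := by
    rw [hdi.eccent T.isTree, hdi.ediam T.isTree]
    exact Nat.cast_inj
  constructor
  · rintro ⟨h1, h2, h3⟩
    refine ⟨fun h0 => ?_, hecc.1 h3⟩
    obtain ⟨y, hy⟩ := Set.ncard_eq_one.1 h2
    have hadj : (T.subtree X).Adj ⟨T.real v, h1⟩ y := by
      have : y ∈ (T.subtree X).neighborSet ⟨T.real v, h1⟩ := by rw [hy]; rfl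
      exact this
    have h4 := SimpleGraph.edist_le_ediam (G := T.subtree X) (u := ⟨T.real v, h1⟩) (v := y)
    rw [hdi.ediam T.isTree, edist_tree T.isTree] at h4
    have h5 : T.D v y ≤ T.d p q := by exact_mod_cast h4
    have h6 : T.D v y = 1 := T.D_eq_one.2 (by simpa using hadj)
    omega
  · rintro ⟨h0, hmax⟩
    refine ⟨hmem, ?_, hecc.2 hmax⟩
    obtain ⟨w, hw, hvw⟩ : ∃ w ∈ X, T.d v w = T.d p q := by grind
    obtain ⟨y, y1, y2⟩ := T.D_between v w (i := 1) (by grind)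
    have hyh : y ∈ T.span X := (mem_hull_iff T.isTree).2
      ⟨_, ⟨v, hv, rfl⟩, _, ⟨w, hw, rfl⟩, by unfold D at *; omega⟩
    refine Set.ncard_eq_one.2 ⟨⟨y, hyh⟩, Set.eq_singleton_iff_unique_mem.2 ⟨?_, ?_⟩⟩
    · simpa using T.D_eq_one.1 y1
    · rintro ⟨z, hz⟩ hzadj
      have z1 : T.D v z = 1 := T.D_eq_one.2 (by simpa using hzadj)
      refine Subtype.ext (T.D_eq_zero.1 (?_ : T.D z y = 0))
      have e1 : T.D z w ≤ T.d p q := by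
        have a := (diametral_image hp hq h).dist_le T.isTree w hz
        have b := h w hw p hp
        have c := h w hw q hq
        rw [T.D_comm]
        unfold d D at *
        omega
      have f := T.fp z y v w
      have pz := T.par v z w
      grind

end


end SteinerTree

end

section

namespace SteinerTree

open SubTree TreeMetric

variable {V : Type} {T : SteinerTree V} {G : SimpleGraph V}

theorem WellStructured.metricWS [Finite V] (h : T.WellStructured G) : MetricWS T G where
  root := h.isRoot
  leaf X hX v hv := by
    obtain ⟨p, hp, q, hq, hpq⟩ := exists_diametral_d T ⟨v, hv.1⟩
    obtain ⟨h0, hmax⟩ := (isExtremalLeaf_iff hp hq hpq hv.1).1 (h.leaf X hX ⟨v, hv.1⟩ v hv)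
    grind
  side X hX p hp q hq hpq hle := by
    have hdi : ∀ u ∈ X, ∀ v ∈ X, T.d u v ≤ T.d p q := by grind
    obtain ⟨c, hc, hsub⟩ := h.side X hX ⟨p, hp⟩
    have hc' := (mem_center_iff_d hp hq hdi).1 hc
    have key : ∀ v, IsFree G X v → T.d v p = 3 ∨ T.d v q = 3 := fun v hv => by
      have := ((isExtremalLeaf_iff hp hq hdi hv.1).1 (h.leaf X hX ⟨v, hv.1⟩ v hv)).2
      omega
    have far : ∀ a ∈ X, ∀ b ∈ X, T.d a b = 3 → (∀ u ∈ X, ∀ v ∈ X, T.d u v ≤ T.d a b) →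
        T.D c a = 1 → ∀ v, IsFree G X v → T.d v a = 3 →
        (T.graph.dist v c : ℕ∞) ≠ distTo T.graph v (T.center X) := by
      intro a ha b hb hab hdi' hca v hv hva
      rw [ne_distTo_iff hc]
      obtain ⟨c', c1, c2⟩ := T.D_between b a (i := 1)
        (by grind)
      have hc'' : c' ∈ T.center X := by
        rw [mem_center_iff_d ha hb hdi']
        grind
      refine ⟨c', hc'', ?_⟩
      have h2 := D_le_of_mem_center ha hb hdi' hc'' hv.1
      have f1 := T.fp v c c' a
      have p1 := T.par c c' a
      have p3 := T.par c' v a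
      grind
    have hor : T.D c p = 1 ∨ T.D c q = 1 := by
      have p1 := T.par c p q
      grind
    rcases hor with h1 | h1
    · left
      intro v v' hv hv' hq1 hq2
      refine hsub ⟨hv, far p hp q hq hpq hdi h1 v hv ?_⟩ ⟨hv', far p hp q hq hpq hdi h1 v' hv' ?_⟩
      all_goals grind
    · right
      have hqp := T.d_comm q p
      intro v v' hv hv' hq1 hq2
      refine hsub ⟨hv, far q hq p hp (by omega) (by grind) h1 v hv ?_⟩
        ⟨hv', far q hq p hp (by omega) (by grind) h1 v' hv' ?_⟩
      all_goals grind
  path K hK v hv c y hc hvc hvy hyc := by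
    obtain ⟨p, hp, q, hq, hpq⟩ := exists_diametral_d T ⟨v, hv.1⟩
    have h4 : T.d p q = 4 := by
      rw [← diam_subtree hp hq hpq]
      exact h.diam K hK ⟨v, hv⟩
    have cp := hc p hp
    have cq := hc q hq
    have e1 := T.D_comm p c
    have e2 := T.D_comm q c
    have hcc : c ∈ T.center K := by
      rw [mem_center_iff_d hp hq hpq]
      omega
    have hyc' : y ∉ T.center K := by
      rw [mem_center_iff_d hp hq hpq]
      have t1 := T.D_tri p c q
      have t2 := T.D_tri p y q
      have p1 := T.par y c p
      grind
    obtain ⟨s1, s2⟩ := h.path K hK.isCliqueIntersection ⟨v, hv.1⟩ v hv c hcc y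
      (by unfold D at *; omega) (by grind) hyc'
    refine ⟨s1, fun w hw => ?_⟩
    have hne : T.real v ≠ c := by grind
    have hsub : ({T.real v, c} : Set T.Node) ⊆ T.graph.neighborSet y := by
      rintro z (rfl | rfl)
      · rw [T.D_comm] at hvy
        exact T.D_eq_one.1 hvy
      · exact T.D_eq_one.1 hyc
    have hfin : (T.graph.neighborSet y).Finite := by
      have := T.finite
      exact Set.toFinite _
    have := Set.eq_of_subset_of_ncard_le hsub (by rw [Set.ncard_pair hne, s2]) hfin
    have hw' : w ∈ ({T.real v, c} : Set T.Node) := by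
      rw [this]
      exact T.D_eq_one.1 hw
    grind
  diam K hK v hv := by
    obtain ⟨p, hp, q, hq, hpq⟩ := exists_diametral_d T ⟨v, hv.1⟩
    exact ⟨p, hp, q, hq, by rw [← diam_subtree hp hq hpq]; exact h.diam K hK ⟨v, hv⟩⟩


end SteinerTree

end

section

namespace SteinerTree

open SubTree TreeMetric

variable {V : Type} {T : SteinerTree V} {G : SimpleGraph V}

theorem MetricWS.wellStructured [Finite V] (h : MetricWS T G) : T.WellStructured G where
  isRoot := h.root
  leaf X hX _ v hv := by
    obtain ⟨p, hp, q, hq, hpq⟩ := exists_diametral_d T ⟨v, hv.1⟩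
    obtain ⟨w, hw, hwv, hmax⟩ := h.leaf X hX v hv
    rw [isExtremalLeaf_iff hp hq hpq hv.1]
    have h1 := hmax p hp q hq
    have h2 := (diametral_image hp hq hpq).dist_le T.isTree v
      (subset_hull T.graph _ ⟨w, hw, rfl⟩)
    have h3 := hpq v hv.1 p hp
    have h4 := hpq v hv.1 q hq
    have h5 : T.d v w ≠ 0 := fun e => hwv (T.d_eq_zero.1 e).symm
    unfold d D at *
    omega
  side X hX hne := by
    obtain ⟨p, hp, q, hq, hpq⟩ := exists_diametral_d T hne
    have h4 := h.root.d_le hX.isClique hp hq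
    obtain ⟨m, m1, m2⟩ := T.D_between p q (i := T.d p q / 2)
      (by grind)
    obtain ⟨m', m1', m2'⟩ := T.D_between q p (i := T.d p q / 2)
      (by grind)
    have e1 := T.D_comm p m
    have e2 := T.D_comm q m'
    have e3 := T.D_comm p q
    have hm : m ∈ T.center X := by
      rw [mem_center_iff_d hp hq hpq]
      grind
    have hm' : m' ∈ T.center X := by
      rw [mem_center_iff_d hp hq hpq]
      grind
    have main : ∀ a ∈ X, ∀ b ∈ X, ∀ c ∈ T.center X, (∀ u ∈ X, ∀ v ∈ X, T.d u v ≤ T.d a b) →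
        T.d a b ≤ 4 → T.D c a = T.d a b / 2 → T.D c b + T.d a b / 2 = T.d a b →
        (T.d a b = 3 →
          ∀ v v', IsFree G X v → IsFree G X v' → T.d v b < 3 → T.d v' b < 3 → v = v') →
        {v | IsFree G X v ∧
          (T.graph.dist v c : ℕ∞) ≠
            distTo T.graph v (T.center X)}.Subsingleton := by
      rintro a ha b hb c hc hab hab4 ca cb h3 v ⟨hv, hv2⟩ v' ⟨hv', hv2'⟩
      rw [ne_distTo_iff hc] at hv2 hv2'
      obtain ⟨x, hx, hxlt⟩ := hv2
      obtain ⟨x', hx', hxlt'⟩ := hv2'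
      have aux : ∀ z ∈ T.center X, ∀ w ∈ X, T.D w z < T.D w c →
          (T.d a b = 1 ∧ w = b) ∨ (T.d a b = 3 ∧ T.d w b < 3) := by
        intro z hz w hw hlt
        have z1 := (mem_center_iff_d ha hb hab).1 hz
        have z2 := D_le_of_mem_center ha hb hab hz hw
        have z3 := D_le_of_mem_center ha hb hab hc hw
        have c1 := T.D_comm c w
        have c2 := T.D_comm z w
        have c3 := T.D_comm z a
        have t2 := T.D_tri w z b
        have ez : T.D c z ≠ 0 := fun e => by
          rw [T.D_eq_zero.1 e] at hlt
          grind
        have ew : T.D w b = 0 → w = b := fun e => T.d_eq_zero.1 e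
        have key : 2 * T.D z b + 1 = T.d a b := by
          have f1 := T.fp c z a b
          have p1 := T.par z a b
          grind
        grind
      rcases aux x hx v hv.1 hxlt with ⟨g1, g2⟩ | ⟨g1, g2⟩ <;>
        rcases aux x' hx' v' hv'.1 hxlt' with ⟨g3, g4⟩ | ⟨g3, g4⟩
      · rw [g2, g4]
      · omega
      · omega
      grind
    have hqp : T.d q p = T.d p q := T.d_comm q p
    by_cases h3 : T.d p q = 3
    · rcases h.side X hX p hp q hq h3 (by grind) with hs | hs
      all_goals grind
    grind
  path X hX _ v hv c hc x hvx hxv hxc := by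
    obtain ⟨p, hp, q, hq, hpq⟩ := exists_diametral_d T ⟨v, hv.1⟩
    have h4 := h.root.d_le hX.isClique hp hq
    obtain ⟨w, hw, hwv, hmax⟩ := h.leaf X hX v hv
    have c1 := D_le_of_mem_center hp hq hpq hc hv.1
    have c2 := D_le_of_mem_center hp hq hpq hc hw
    have cp := (mem_center_iff_d hp hq hpq).1 hc
    have hvx' : T.D v x + T.D x c = T.D v c := hvx
    have x1 : T.D v x ≠ 0 := fun e => hxv (T.D_eq_zero.1 e).symm
    have x2 : T.D x c ≠ 0 := fun e => hxc (T.D_eq_zero.1 e ▸ hc)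
    have e1 := T.D_comm v c
    by_cases hd : T.d p q = 4
    · have hK := h.root.isMaxClique_of_far hX hp hq hd
      obtain ⟨s1, s2⟩ := h.path X hK v hv c x (fun u hu => by
        have := D_le_of_mem_center hp hq hpq hc hu
        grind) (by omega) (by omega) (by omega)
      refine ⟨s1, ?_⟩
      have hne : T.real v ≠ c := by grind
      have : T.graph.neighborSet x = {T.real v, c} := by
        ext z
        refine ⟨fun hz => by simpa using s2 z (T.D_eq_one.2 hz), ?_⟩
        rintro (rfl | rfl)
        · refine T.D_eq_one.1 ?_
          grind
        · exact T.D_eq_one.1 (by omega)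
      rw [this, Set.ncard_pair hne]
    · exfalso
      apply hxc
      rw [mem_center_iff_d hp hq hpq]
      have g2 := hpq v hv.1 p hp
      have g3 := hpq v hv.1 q hq
      have c3 : T.d p q = 3 := by omega
      have c4 : T.D v x = 1 ∧ T.D x c = 1 ∧ T.D v c = 2 := by omega
      clear hpq hmax c2
      have main : ∀ u ∈ X, T.D c u ≤ 2 → T.d v u ≤ 3 → T.D x u ≤ 2 := by
        intro u _ h1 h2
        have f1 := T.fp v x c u
        grind
      grind
  diam K hK hv := by
    obtain ⟨v, hv⟩ := hv
    obtain ⟨p, hp, q, hq, h4⟩ := h.diam K hK v hv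
    rw [diam_subtree hp hq fun u hu w hw => by rw [h4]; exact h.root.d_le hK.isClique hu hw, h4]

end SteinerTree

end

section

/-! ## Joining two parts of a tree by a new edge -/

namespace SteinerTree

open SubTree TreeMetric

variable {V : Type}

section

variable (T : SteinerTree V) {A B : Set T.Node} (p q : T.Node)

/-- The metric of the tree that consists of two disjoint copies of subtrees and of an edge between
`p` and `q`. -/
noncomputable def bridgeDist : A ⊕ B → A ⊕ B → ℕ
  | .inl x, .inl y => T.D x y
  | .inr x, .inr y => T.D x y
  | .inl x, .inr y => T.D x p + 1 + T.D q y
  | .inr y, .inl x => T.D x p + 1 + T.D q y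

theorem bridgeDist_comm (x y : A ⊕ B) : T.bridgeDist p q x y = T.bridgeDist p q y x := by
  rcases x with x | x <;> rcases y with y | y <;> simp [bridgeDist, T.D_comm x y]

theorem bridgeDist_eq_zero (x y : A ⊕ B) : T.bridgeDist p q x y = 0 ↔ x = y := by
  rcases x with x | x <;> rcases y with y | y <;>
    simp [bridgeDist, T.D_eq_zero, Subtype.ext_iff]

theorem bridgeDist_four (x y z w : A ⊕ B) :
    T.bridgeDist p q x y + T.bridgeDist p q z w ≤
        T.bridgeDist p q x z + T.bridgeDist p q y w ∨
      T.bridgeDist p q x y + T.bridgeDist p q z w ≤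
        T.bridgeDist p q x w + T.bridgeDist p q y z := by
  rcases x with x | x <;> rcases y with y | y <;> rcases z with z | z <;> rcases w with w | w <;>
    simp only [bridgeDist]
  · have := T.fp x y z w; omega
  · have := T.fp x y z p; omega
  · have := T.fp x y p w
    grind
  · have := T.D_tri x p y
    have := T.D_tri z q w
    grind
  · have := T.fp x p z w
    grind
  · omega
  · omega
  · have := T.fp q y z w
    grind
  · have := T.fp p y z w
    grind
  · omega
  · omega
  · have := T.fp x q z w
    grind
  · have := T.D_tri x q y
    have := T.D_tri z p w
    grind
  · have := T.fp x y q w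
    grind
  · have := T.fp x y z q
    grind
  · have := T.fp x y z w; omega

theorem bridgeDist_parity (x y z : A ⊕ B) :
    (T.bridgeDist p q x y + T.bridgeDist p q y z + T.bridgeDist p q x z) % 2 = 0 := by
  rcases x with x | x <;> rcases y with y | y <;> rcases z with z | z <;> simp only [bridgeDist]
  · exact T.par x y z
  · have := T.par x y p; omega
  · have := T.par x p z
    grind
  · have := T.par q y z; omega
  · have := T.par p y z
    grind
  · have := T.par x q z
    grind
  · have := T.par x y q
    grind
  · exact T.par x y z

theorem bridgeDist_step (hA : Convex T.graph A) (hB : Convex T.graph B) (hp : p ∈ A) (hq : q ∈ B)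
    (x z : A ⊕ B) (hxz : x ≠ z) :
    ∃ y, T.bridgeDist p q x y = 1 ∧ T.bridgeDist p q y z + 1 = T.bridgeDist p q x z := by
  have inner : ∀ (C : Set T.Node), Convex T.graph C → ∀ x ∈ C, ∀ z ∈ C, x ≠ z →
      ∃ y ∈ C, T.D x y = 1 ∧ T.D y z + 1 = T.D x z := by
    intro C hC x hx z hz hne
    obtain ⟨y, h1, h2⟩ := T.D_between x z (i := 1)
      (Nat.one_le_iff_ne_zero.2 fun e => hne (T.D_eq_zero.1 e))
    exact ⟨y, hC x hx z hz y (by unfold D at *; omega), h1, h2⟩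
  rcases x with ⟨x, hx⟩ | ⟨x, hx⟩ <;> rcases z with ⟨z, hz⟩ | ⟨z, hz⟩
  · obtain ⟨y, hy, h1, h2⟩ := inner A hA x hx z hz (by grind)
    exact ⟨.inl ⟨y, hy⟩, h1, h2⟩
  · by_cases h : x = p
    · subst h
      exact ⟨.inr ⟨q, hq⟩, by simp [bridgeDist], by simp [bridgeDist]; omega⟩
    · obtain ⟨y, hy, h1, h2⟩ := inner A hA x hx p hp h
      exact ⟨.inl ⟨y, hy⟩, h1, by simp only [bridgeDist]; omega⟩
  · by_cases h : x = q
    · subst h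
      exact ⟨.inl ⟨p, hp⟩, by simp [bridgeDist], by simp [bridgeDist, T.D_comm z p]⟩
    · obtain ⟨y, hy, h1, h2⟩ := inner B hB x hx q hq h
      refine ⟨.inr ⟨y, hy⟩, h1, ?_⟩
      simp only [bridgeDist]
      grind
  · obtain ⟨y, hy, h1, h2⟩ := inner B hB x hx z hz (by grind)
    exact ⟨.inr ⟨y, hy⟩, h1, h2⟩

variable {T p q}

/-- The subtrees `A` and `B` cover the tree and contain `p` and `q`, respectively. -/
structure IsBridge (T : SteinerTree V) (A B : Set T.Node) (p q : T.Node) : Prop where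
  convex_left : Convex T.graph A
  convex_right : Convex T.graph B
  left_mem : p ∈ A
  right_mem : q ∈ B
  cover : ∀ x, x ∈ A ∨ x ∈ B

namespace IsBridge

variable (b : IsBridge T A B p q)

open Classical in
include b in
/-- The disjoint union of the subtrees `A` and `B`, joined by an edge between `p` and `q`. -/
noncomputable def tree : SteinerTree V where
  Node := A ⊕ B
  finite := by
    have := T.finite
    infer_instance
  graph := unitGraph (T.bridgeDist p q) (T.bridgeDist_comm p q) (T.bridgeDist_eq_zero p q)
  isTree := by
    have : Nonempty (A ⊕ B) := ⟨.inl ⟨p, b.left_mem⟩⟩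
    exact (unitGraph_isTree (T.bridgeDist_four p q) (T.bridgeDist_parity p q)
      (T.bridgeDist_step p q b.1 b.2 b.3 b.4)).1
  real := ⟨fun v => if h : T.real v ∈ A then .inl ⟨T.real v, h⟩
      else .inr ⟨T.real v, (b.cover _).resolve_left h⟩, by
    intro u v huv
    grind⟩

/-- The copy of a node of the first subtree. -/
def inl {x : T.Node} (hx : x ∈ A) : b.tree.Node := (Sum.inl ⟨x, hx⟩ : A ⊕ B)

/-- The copy of a node of the second subtree. -/
def inr {x : T.Node} (hx : x ∈ B) : b.tree.Node := (Sum.inr ⟨x, hx⟩ : A ⊕ B)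

theorem D_eq (x y : A ⊕ B) : b.tree.D x y = T.bridgeDist p q x y := by
  have : Nonempty (A ⊕ B) := ⟨.inl ⟨p, b.left_mem⟩⟩
  exact (unitGraph_isTree (hsymm := T.bridgeDist_comm p q) (hzero := T.bridgeDist_eq_zero p q)
    (T.bridgeDist_four p q) (T.bridgeDist_parity p q) (T.bridgeDist_step p q b.1 b.2 b.3 b.4)).2 x y

theorem real_inl {v : V} (h : T.real v ∈ A) : b.tree.real v = b.inl h := dif_pos h

theorem real_inr {v : V} (h : T.real v ∉ A) :
    b.tree.real v = b.inr ((b.cover _).resolve_left h) := dif_neg h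

variable {u v : V} {x : T.Node}

theorem D_inl (h : T.real v ∈ A) (hx : x ∈ A) :
    b.tree.D v (b.inl hx) = T.D v x := by
  rw [b.real_inl h]; exact b.D_eq _ _

theorem D_inr' (h : T.real v ∈ A) (hx : x ∈ B) :
    b.tree.D v (b.inr hx) = T.D v p + 1 + T.D q x := by
  rw [b.real_inl h]; exact b.D_eq _ _

theorem D_inl' (h : T.real v ∉ A) (hx : x ∈ A) :
    b.tree.D v (b.inl hx) = T.D x p + 1 + T.D q v := by
  rw [b.real_inr h]; exact b.D_eq _ _

theorem D_inr (h : T.real v ∉ A) (hx : x ∈ B) :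
    b.tree.D v (b.inr hx) = T.D v x := by
  rw [b.real_inr h]; exact b.D_eq _ _

theorem d_mem_mem (hu : T.real u ∈ A) (hv : T.real v ∈ A) : b.tree.d u v = T.d u v := by
  rw [d, b.real_inl hv, b.D_inl hu, d]

theorem d_not_mem_not_mem (hu : T.real u ∉ A) (hv : T.real v ∉ A) : b.tree.d u v = T.d u v := by
  rw [d, b.real_inr hv, b.D_inr hu, d]

theorem d_mem_not_mem (hu : T.real u ∈ A) (hv : T.real v ∉ A) :
    b.tree.d u v = T.D u p + 1 + T.D q v := by
  rw [d, b.real_inr hv, b.D_inr' hu]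

theorem isSteinerNode_inl (hx : x ∈ A) (h : T.IsSteinerNode x) :
    b.tree.IsSteinerNode (b.inl hx) := fun v hv => by
  by_cases hvA : T.real v ∈ A
  · rw [b.real_inl hvA] at hv
    exact h v (congrArg Subtype.val (Sum.inl.inj hv))
  · rw [b.real_inr hvA] at hv
    exact nomatch hv

theorem isSteinerNode_inr (hx : x ∈ B) (h : T.IsSteinerNode x) :
    b.tree.IsSteinerNode (b.inr hx) := fun v hv => by
  by_cases hvA : T.real v ∈ A
  · rw [b.real_inl hvA] at hv
    exact nomatch hv
  · rw [b.real_inr hvA] at hv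
    exact h v (congrArg Subtype.val (Sum.inr.inj hv))

end IsBridge

end

/-! ## Isometric spans -/

section

variable {T T' : SteinerTree V}

theorem D_of_between {s₁ s₂ x : T.Node} (h : T.D s₁ x + T.D x s₂ = T.D s₁ s₂) (w : T.Node) :
    T.D x w = max (T.D s₁ w - T.D s₁ x) (T.D s₂ w - T.D x s₂) ∧
      T.D s₁ x ≤ max (T.D s₁ w) (T.D s₂ w + T.D s₁ x - T.D x s₂) ∧
      T.D s₁ w ≤ T.D x w + T.D s₁ x ∧ T.D s₂ w ≤ T.D x w + T.D x s₂ := by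
  have f := T.fp s₁ s₂ x w
  have t1 := T.D_tri s₁ x w
  grind

theorem mem_span_iff {X : Set V} {x : T.Node} : x ∈ T.span X ↔ ∃ u ∈ X, ∃ v ∈ X,
    T.D u x + T.D x v = T.D u v := by
  rw [span, mem_hull_iff T.isTree]
  constructor
  · rintro ⟨_, ⟨u, hu, rfl⟩, _, ⟨v, hv, rfl⟩, h⟩
    exact ⟨u, hu, v, hv, h⟩
  · rintro ⟨u, hu, v, hv, h⟩
    exact ⟨_, ⟨u, hu, rfl⟩, _, ⟨v, hv, rfl⟩, h⟩

theorem IsRoot.real_mem_span {G : SimpleGraph V} (h : T.IsRoot 4 G) {X : Set V}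
    (hX : X = ∅ ∨ IsCliqueIntersection G X) {v : V} : T.real v ∈ T.span X ↔ v ∈ X := by
  refine ⟨fun hv => ?_, fun hv => subset_hull _ _ ⟨v, hv, rfl⟩⟩
  obtain ⟨a, ha, b, hb, hab⟩ := mem_span_iff.1 hv
  rcases hX with rfl | ⟨𝒦, -, hmax, rfl⟩
  · grind
  · intro K hK
    refine h.mem_of_forall (hmax K hK) fun u hu => ?_
    have h1 := h.d_le (hmax K hK).isClique (ha K hK) hu
    have h2 := h.d_le (hmax K hK).isClique (hb K hK) hu
    have h3 := D_of_between hab u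
    grind

theorem exists_same_profile {S : Set V} (hd : ∀ s ∈ S, ∀ s' ∈ S, T'.d s s' = T.d s s')
    {x : T.Node} (hx : x ∈ T.span S) :
    ∃ x' ∈ T'.span S, ∀ s ∈ S, T'.D (T'.real s) x' = T.D s x := by
  obtain ⟨a, ha, b, hb, hab⟩ := mem_span_iff.1 hx
  have h1 := hd a ha b hb
  obtain ⟨x', h2, h3⟩ := T'.D_between (T'.real a) (T'.real b) (i := T.D a x)
    (by grind)
  refine ⟨x', mem_span_iff.2 ⟨a, ha, b, hb, by omega⟩, fun s hs => ?_⟩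
  have g1 := D_of_between hab s
  have g2 := D_of_between (T := T') (s₁ := T'.real a) (s₂ := T'.real b) (x := x') (by omega)
    (T'.real s)
  grind

theorem eq_of_same_profile {S : Set V} {x y : T.Node} (hx : x ∈ T.span S)
    (h : ∀ s ∈ S, T.D s y = T.D s x) : y = x := by
  obtain ⟨a, ha, b, hb, hab⟩ := mem_span_iff.1 hx
  have g := D_of_between hab y
  have h1 := h a ha
  have h2 := h b hb
  have c := T.D_comm x b
  refine (T.D_eq_zero.1 ?_).symm
  omega

theorem D_eq_of_same_profile {S : Set V} {x y : T.Node} {x' y' : T'.Node}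
    (hd : ∀ s ∈ S, ∀ s' ∈ S, T'.d s s' = T.d s s') (hx : x ∈ T.span S)
    (hx' : ∀ s ∈ S, T'.D (T'.real s) x' = T.D s x)
    (hy' : ∀ s ∈ S, T'.D (T'.real s) y' = T.D s y) : T'.D x' y' = T.D x y := by
  obtain ⟨a, ha, b, hb, hab⟩ := mem_span_iff.1 hx
  have g := D_of_between hab y
  have h1 := hx' a ha
  have h2 := hx' b hb
  have h3 := hd a ha b hb
  have h4 := hy' a ha
  have h5 := hy' b hb
  have c := T.D_comm x b
  have c' := T'.D_comm x' (T'.real b)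
  have g' := D_of_between (T := T') (s₁ := T'.real a) (s₂ := T'.real b) (x := x')
    (by grind) y'
  omega

theorem exists_steinerEquiv {G : SimpleGraph V} (hT : T.IsRoot 4 G) (hT' : T'.IsRoot 4 G)
    {S W : Set V} (hS : S = ∅ ∨ IsCliqueIntersection G S)
    (hd : ∀ s ∈ S, ∀ s' ∈ S, T'.d s s' = T.d s s')
    (hW : ∀ w ∈ W, ∃ w' ∈ W, ∀ s ∈ S, T.d s w' ≤ T'.d s w) :
    ∃ φ : T.subtree S ≃g T'.subtree S, IsSteinerEquiv φ ∧
      ∀ r : T.span S, distTo T.graph r (T.real '' W) ≤ distTo T'.graph (φ r) (T'.real '' W) := by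
  have hd' : ∀ s ∈ S, ∀ s' ∈ S, T.d s s' = T'.d s s' := fun s hs s' hs' => (hd s hs s' hs').symm
  choose f hf1 hf2 using fun x : T.span S => exists_same_profile hd x.2
  choose g hg1 hg2 using fun x : T'.span S => exists_same_profile hd' x.2
  let e : T.span S ≃ T'.span S :=
    { toFun := fun x => ⟨f x, hf1 x⟩
      invFun := fun x => ⟨g x, hg1 x⟩
      left_inv := fun x => Subtype.ext (eq_of_same_profile x.2 fun s hs => by grind)
      right_inv := fun x => Subtype.ext (eq_of_same_profile x.2 fun s hs => by grind) }
  refine ⟨⟨e, ?_⟩, ?_, ?_⟩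
  · intro x y
    have := D_eq_of_same_profile hd x.2 (hf2 x) (hf2 y)
    simp only [SimpleGraph.comap_adj, Function.Embedding.subtype_apply]
    rw [← T.D_eq_one, ← T'.D_eq_one]
    grind
  · intro x v
    change T.real v = x ↔ T'.real v = f x
    constructor
    · intro h
      have hv : v ∈ S := (hT.real_mem_span hS).1 (h ▸ x.2)
      refine (eq_of_same_profile (hf1 x) fun s hs => ?_)
      grind
    · intro h
      have hv : v ∈ S := (hT'.real_mem_span hS).1 (h ▸ hf1 x)
      refine (eq_of_same_profile x.2 fun s hs => ?_)
      grind
  · intro r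
    refine le_iInf₂ ?_
    rintro _ ⟨w, hw, rfl⟩
    obtain ⟨w', hw', h⟩ := hW w hw
    refine (iInf₂_le (T.real w') ⟨w', hw', rfl⟩).trans ?_
    obtain ⟨a, ha, b, hb, hab⟩ := mem_span_iff.1 r.2
    have k1 := hf2 r a ha
    have k2 := hf2 r b hb
    have k3 := hd a ha b hb
    have c := T.D_comm r b
    have c' := T'.D_comm (f r) (T'.real b)
    have g1 := D_of_between hab w'
    have g2 := D_of_between (T := T') (s₁ := T'.real a) (s₂ := T'.real b) (x := f r)
      (by grind) (T'.real w)
    have h1 := h a ha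
    have h2 := h b hb
    have : T.D r w' ≤ T'.D (f r) (T'.real w) := by grind
    exact_mod_cast this

end

end SteinerTree

end

section

/-! ## Clique-trees -/

open TreeMetric

theorem TreeMetric.mem_of_between_of_connected {N : Type} {G : SimpleGraph N} (hG : G.IsTree)
    {B : Set N} (hB : (G.induce B).Preconnected) {a b x : N} (ha : a ∈ B) (hb : b ∈ B)
    (h : G.dist a x + G.dist x b = G.dist a b) : x ∈ B := by
  obtain ⟨p⟩ := hB ⟨a, ha⟩ ⟨b, hb⟩
  have := mem_support_of_between hG (p.map (SimpleGraph.Embedding.induce B).toHom) h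
  rw [SimpleGraph.Walk.support_map, List.mem_map] at this
  obtain ⟨y, -, rfl⟩ := this
  exact y.2

namespace RootedCliqueTree

variable {V : Type} {G : SimpleGraph V} (R : RootedCliqueTree G)

theorem isMaxClique (i : Fin R.q) : IsMaxClique G (R.clique i) :=
  (R.isMaxClique_iff _).2 ⟨i, rfl⟩

theorem exists_clique {K : Set V} (hK : IsMaxClique G K) : ∃ i, R.clique i = K :=
  (R.isMaxClique_iff K).1 hK

theorem not_subset {i j : Fin R.q} (hij : i ≠ j) : ¬ R.clique i ⊆ R.clique j := fun h =>
  hij (R.clique_injective ((R.isMaxClique i).eq_of_subset (R.isMaxClique j).isClique h))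

theorem mem_of_between {v : V} {a b x : Fin R.q} (ha : v ∈ R.clique a) (hb : v ∈ R.clique b)
    (h : R.tree.dist a x + R.tree.dist x b = R.tree.dist a b) : v ∈ R.clique x :=
  TreeMetric.mem_of_between_of_connected R.isTree
    (B := {i | v ∈ R.clique i}) (R.induces_subtree v).preconnected ha hb h

theorem sep_eq (i : Fin R.q) : R.sep i = ∅ ∨ ∃ j, j ≠ i ∧ R.sep i = R.clique i ∩ R.clique j := by
  by_cases h : ∃ j, R.tree.Adj i j ∧ R.tree.dist R.root j < R.tree.dist R.root i
  · obtain ⟨j, hij, hlt⟩ := h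
    refine Or.inr ⟨j, hij.ne', Set.ext fun v => ⟨?_, fun hv => ⟨hv.1, j, hij, hlt, hv.2⟩⟩⟩
    rintro ⟨hv, j', hij', hlt', hv'⟩
    have e : j' = j := by
      have h1 := R.isTree.dist_eq_dist_add_one_of_adj R.root hij
      have h2 := R.isTree.dist_eq_dist_add_one_of_adj R.root hij'
      refine eq_of_closer R.isTree hij' hij (z := R.root) ?_ ?_
      · rw [SimpleGraph.dist_comm, SimpleGraph.dist_comm (u := i)]; omega
      · rw [SimpleGraph.dist_comm, SimpleGraph.dist_comm (u := i)]; omega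
    grind
  · left
    ext v
    simp only [Set.mem_empty_iff_false, iff_false]
    rintro ⟨-, j, h1, h2, -⟩
    grind

theorem sep_subset (i : Fin R.q) : R.sep i ⊆ R.clique i := fun _ h => h.1

theorem clique_subset_verts (i : Fin R.q) : R.clique i ⊆ R.verts i := fun v hv =>
  ⟨i, by simp [IsDescendant], hv⟩

theorem sep_isCliqueIntersection (i : Fin R.q) :
    R.sep i = ∅ ∨ IsCliqueIntersection G (R.sep i) := by
  rcases R.sep_eq i with h | ⟨j, -, h⟩
  · grind
  · right
    rw [h]
    exact (R.isMaxClique i).isCliqueIntersection.inter (R.isMaxClique j).isCliqueIntersection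

theorem clique_nonempty [Nonempty V] (i : Fin R.q) : (R.clique i).Nonempty := by
  rw [Set.nonempty_iff_ne_empty]
  intro he
  obtain ⟨v⟩ := ‹Nonempty V›
  have := (R.isMaxClique i).eq_of_subset (A := {v}) (by simp) (by grind)
  rw [he] at this
  exact Set.singleton_ne_empty v this.symm

theorem exists_mem_not_mem_sep [Nonempty V] (i : Fin R.q) : ∃ v ∈ R.clique i, v ∉ R.sep i := by
  rcases R.sep_eq i with h | ⟨j, hj, h⟩
  · obtain ⟨v, hv⟩ := R.clique_nonempty i
    grind
  · obtain ⟨v, hv, hv'⟩ := Set.not_subset.1 (R.not_subset hj.symm)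
    grind

theorem dist_root_of_not_mem_sep {v : V} {i j : Fin R.q} (hi : v ∈ R.clique i)
    (hs : v ∉ R.sep i) (hj : v ∈ R.clique j) :
    R.tree.dist R.root j = R.tree.dist R.root i + R.tree.dist i j := by
  by_cases hij : i = j
  · grind
  have hpos : R.tree.dist i j ≠ 0 := fun e => hij ((dist_eq_zero R.isTree).1 e)
  obtain ⟨k, k1, k2⟩ := exists_between R.isTree i j (i := 1) (by omega)
  have hadj := SimpleGraph.dist_eq_one_iff_adj.1 k1
  have hk : v ∈ R.clique k := R.mem_of_between hi hj (by omega)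
  have h1 : ¬ R.tree.dist R.root k < R.tree.dist R.root i := fun h => hs ⟨hi, k, hadj, h, hk⟩
  have h2 := R.isTree.dist_eq_dist_add_one_of_adj R.root hadj
  have f := four_points R.isTree R.root i k j
  omega

/-- There are at most as many maximal cliques as vertices. -/
theorem q_le [Fintype V] [Nonempty V] : R.q ≤ Fintype.card V := by
  choose f hf hf' using R.exists_mem_not_mem_sep
  have hinj : Function.Injective f := fun i j hij => by
    have h1 := R.dist_root_of_not_mem_sep (hf i) (hf' i) (hij ▸ hf j)
    have h2 := R.dist_root_of_not_mem_sep (hf j) (hf' j) (hij ▸ hf i)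
    have c := dist_symm R.tree i j
    exact (dist_eq_zero R.isTree).1 (by omega)
  simpa using Fintype.card_le_of_injective f hinj

/-! ### Minimal separators -/

variable {R}

theorem side_or {t t' : Fin R.q} (h : R.tree.Adj t t') (a : Fin R.q) :
    R.tree.dist a t' = R.tree.dist a t + 1 ∨ R.tree.dist a t = R.tree.dist a t' + 1 := by
  have := R.isTree.dist_eq_dist_add_one_of_adj a h
  omega

/-- `t` and `t'` are between cliques on different sides of the edge `tt'`. -/
theorem mem_edge {t t' a b : Fin R.q} (h : R.tree.Adj t t')
    (ha : R.tree.dist a t' = R.tree.dist a t + 1) (hb : R.tree.dist b t = R.tree.dist b t' + 1)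
    {v : V} (hva : v ∈ R.clique a) (hvb : v ∈ R.clique b) :
    v ∈ R.clique t ∩ R.clique t' := by
  have h1 := SimpleGraph.dist_eq_one_iff_adj.2 h
  have f := four_points R.isTree a b t t'
  have c1 := dist_symm R.tree b t
  have c2 := dist_symm R.tree b t'
  have t1 := dist_tri R.isTree a t b
  exact ⟨R.mem_of_between hva hvb (by omega), R.mem_of_between hva hvb (by omega)⟩

theorem exists_common_clique [Finite V] (R : RootedCliqueTree G) {u v : V} (h : G.Adj u v) :
    ∃ a, u ∈ R.clique a ∧ v ∈ R.clique a := by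
  obtain ⟨K, hK, hsub⟩ := exists_isMaxClique (SimpleGraph.isClique_pair.2 fun _ => h)
  obtain ⟨a, rfl⟩ := R.exists_clique hK
  grind

theorem isSeparatorOf_edge [Finite V] {t t' a b : Fin R.q} (h : R.tree.Adj t t')
    (ha : R.tree.dist a t' = R.tree.dist a t + 1) (hb : R.tree.dist b t = R.tree.dist b t' + 1)
    {u v : V} (hua : u ∈ R.clique a) (hvb : v ∈ R.clique b)
    (hu : u ∉ R.clique t ∩ R.clique t') (hv : v ∉ R.clique t ∩ R.clique t') :
    IsSeparatorOf G u v (R.clique t ∩ R.clique t') := by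
  refine ⟨hu, hv, ?_⟩
  rintro ⟨p⟩
  have key : ∀ (x y : ↑(R.clique t ∩ R.clique t')ᶜ)
      (_ : (G.induce (R.clique t ∩ R.clique t')ᶜ).Walk x y),
      (∃ a, R.tree.dist a t' = R.tree.dist a t + 1 ∧ (x : V) ∈ R.clique a) →
      ∃ a, R.tree.dist a t' = R.tree.dist a t + 1 ∧ (y : V) ∈ R.clique a := by
    intro x y p
    induction p with
    | nil => exact id
    | @cons x y z hxy p ih =>
      rintro ⟨a, ha, hxa⟩
      obtain ⟨j, hxj, hyj⟩ := R.exists_common_clique (show G.Adj x y by simpa using hxy)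
      refine ih ⟨j, ?_, hyj⟩
      rcases side_or h j with h1 | h1
      · exact h1
      · exact absurd (mem_edge h ha h1 hxa hxj) x.2
  obtain ⟨j, hj, hvj⟩ := key _ _ p ⟨a, ha, hua⟩
  exact hv (mem_edge h hj hb hvj hvb)

theorem isMinimalSeparator_edge [Finite V] {t t' : Fin R.q} (h : R.tree.Adj t t') :
    IsMinimalSeparator G (R.clique t ∩ R.clique t') := by
  obtain ⟨u, hu, hu'⟩ := Set.not_subset.1 (R.not_subset h.ne)
  obtain ⟨v, hv, hv'⟩ := Set.not_subset.1 (R.not_subset h.ne')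
  have h1 := SimpleGraph.dist_eq_one_iff_adj.2 h
  have h2 := dist_symm R.tree t t'
  refine ⟨u, v, isSeparatorOf_edge h (a := t) (b := t') ?_ ?_ hu hv (fun h => hu' h.2)
    (fun h => hv' h.1), ?_⟩
  · grind
  · grind
  · rintro S' hS' ⟨hu1, hv1, hsep⟩
    obtain ⟨s, hs, hs'⟩ := Set.exists_of_ssubset hS'
    have hus : G.Adj u s := (R.isMaxClique t).isClique hu hs.1 (by grind)
    have hsv : G.Adj s v := (R.isMaxClique t').isClique hs.2 hv (by grind)
    refine hsep (SimpleGraph.Reachable.trans (v := ⟨s, hs'⟩) ?_ ?_)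
    · exact SimpleGraph.Adj.reachable (by simpa using hus)
    · exact SimpleGraph.Adj.reachable (by simpa using hsv)

theorem exists_edge_of_isMinimalSeparator [Finite V] (R : RootedCliqueTree G) {S : Set V}
    (hS : IsMinimalSeparator G S) :
    ∃ t t', R.tree.Adj t t' ∧ S = R.clique t ∩ R.clique t' := by
  obtain ⟨u, v, ⟨hu, hv, hsep⟩, hmin⟩ := hS
  obtain ⟨⟨a, ha⟩⟩ := (R.induces_subtree u).nonempty
  obtain ⟨⟨b, hb⟩⟩ := (R.induces_subtree v).nonempty
  obtain ⟨s, h0, hn, hadj, hs⟩ := exists_geodesic R.isTree a b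
  have : ∃ i < R.tree.dist a b, R.clique (s i) ∩ R.clique (s (i + 1)) ⊆ S := by
    by_contra! hno
    apply hsep
    have key : ∀ i ≤ R.tree.dist a b, ∀ w (hw : w ∈ Sᶜ), w ∈ R.clique (s i) →
        (G.induce Sᶜ).Reachable ⟨u, hu⟩ ⟨w, hw⟩ := by
      have step : ∀ i, ∀ w (hw : w ∈ Sᶜ), w ∈ R.clique (s i) → ∀ w' (hw' : w' ∈ Sᶜ),
          w' ∈ R.clique (s i) → (G.induce Sᶜ).Reachable ⟨w, hw⟩ ⟨w', hw'⟩ := by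
        intro i w hw hwi w' hw' hwi'
        by_cases e : w = w'
        · subst e; exact .rfl
        · have := (R.isMaxClique (s i)).isClique hwi hwi' e
          exact SimpleGraph.Adj.reachable (by simpa using this)
      intro i
      induction i with
      | zero =>
        grind
      | succ i ih =>
        intro hi w hw hwi
        obtain ⟨z, hz, hzS⟩ := Set.not_subset.1 (hno i (by omega))
        exact (ih (by omega) z hzS hz.1).trans (step (i + 1) z hzS hz.2 w hw hwi)
    grind
  obtain ⟨i, hi, hsub⟩ := this
  have e1 := hs 0 i (by omega) (by omega)
  have e2 := hs 0 (i + 1) (by omega) (by omega)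
  have e3 := hs i _ (by omega) le_rfl
  have e4 := hs (i + 1) _ (by omega) le_rfl
  rw [h0] at e1 e2
  rw [hn, SimpleGraph.dist_comm] at e3 e4
  refine ⟨s i, s (i + 1), hadj i hi, ?_⟩
  have h3 := isSeparatorOf_edge (hadj i hi) (a := a) (b := b) (by omega) (by omega) ha hb
    (fun h => hu (hsub h)) (fun h => hv (hsub h))
  grind

theorem eq_inter_of_isMinimalSeparator [Finite V] (R : RootedCliqueTree G) {S : Set V}
    (hS : IsMinimalSeparator G S) {i : Fin R.q} (hi : S ⊆ R.clique i) :
    ∃ j, j ≠ i ∧ S = R.clique i ∩ R.clique j := by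
  obtain ⟨t, t', h, rfl⟩ := R.exists_edge_of_isMinimalSeparator hS
  rcases side_or h i with h1 | h1
  · refine ⟨t', ?_, Set.Subset.antisymm (fun v hv => ⟨hi hv, hv.2⟩) fun v hv => ?_⟩
    · grind
    · refine mem_edge h h1 (b := t') ?_ hv.1 hv.2
      rw [SimpleGraph.dist_self, SimpleGraph.dist_comm, SimpleGraph.dist_eq_one_iff_adj.2 h]
  · refine ⟨t, ?_, Set.Subset.antisymm (fun v hv => ⟨hi hv, hv.1⟩) fun v hv => ?_⟩
    · grind
    · refine mem_edge h (a := t) ?_ h1 hv.2 hv.1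
      rw [SimpleGraph.dist_self, SimpleGraph.dist_eq_one_iff_adj.2 h]

theorem isMinimalSeparator_of_maximal [Finite V] (R : RootedCliqueTree G) {i j : Fin R.q}
    (hij : j ≠ i) (hmax : ∀ l, l ≠ i → R.clique i ∩ R.clique j ⊆ R.clique i ∩ R.clique l →
      R.clique i ∩ R.clique l ⊆ R.clique i ∩ R.clique j) :
    IsMinimalSeparator G (R.clique i ∩ R.clique j) := by
  have hpos : R.tree.dist i j ≠ 0 := fun e => hij ((dist_eq_zero R.isTree).1 e).symm
  obtain ⟨k, k1, k2⟩ := exists_between R.isTree i j (i := 1) (by omega)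
  have hadj := SimpleGraph.dist_eq_one_iff_adj.1 k1
  have hsub : R.clique i ∩ R.clique j ⊆ R.clique i ∩ R.clique k := fun v hv =>
    ⟨hv.1, R.mem_of_between hv.1 hv.2 (by omega)⟩
  have e := Set.Subset.antisymm hsub (hmax k hadj.ne' hsub)
  rw [e]
  exact isMinimalSeparator_edge hadj

end RootedCliqueTree

end

section

/-! ## Intersections of two maximal cliques of a root -/

namespace SteinerTree

variable {V : Type} {T : SteinerTree V} {G : SimpleGraph V}

/-- The four types of intersections of the maximal clique `K`, with center `c`, and another maximal
clique `Q`, with center `t`. -/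
theorem inter_types {K Q : Set V} {c t : T.Node} (hK : K = T.ball c) (hQ : Q = T.ball t)
    (hct : c ≠ t) : ∃ p, T.D c p = 1 ∧
      ((t = p ∧ ∀ u ∈ K, u ∈ Q ↔ T.D u c ≤ 1 ∨ T.D u p ≤ 1) ∨
      (T.D c t = 2 ∧ T.D p t = 1 ∧ ∀ u ∈ K, u ∈ Q ↔ T.D u p ≤ 1) ∨
      (T.D c t = 3 ∧ ∃ x, T.D p x = 1 ∧ T.D c x = 2 ∧ T.D x t = 1 ∧
        ∀ u ∈ K, u ∈ Q ↔ T.real u = p ∨ T.real u = x) ∨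
      (∃ x, T.D p x = 1 ∧ T.D c x = 2 ∧ 2 ≤ T.D x t ∧ ∀ u ∈ K, u ∈ Q → T.real u = x)) := by
  subst hK hQ
  have h0 : T.D c t ≠ 0 := fun e => hct (T.D_eq_zero.1 e)
  obtain ⟨p, p1, p2⟩ := T.D_between c t (i := 1) (by omega)
  refine ⟨p, p1, ?_⟩
  have cu : ∀ u, u ∈ T.ball c → T.D u c ≤ 2 := fun u h => h
  have tu : ∀ u, u ∈ T.ball t ↔ T.D u t ≤ 2 := fun u => Iff.rfl
  by_cases h1 : T.D c t = 1
  · left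
    have e : p = t := T.D_eq_zero.1 (by omega)
    subst e
    refine ⟨rfl, fun u hu => ?_⟩
    have f := T.par u c p
    have t1 := T.D_tri u c p
    grind
  by_cases h2 : T.D c t = 2
  · right; left
    refine ⟨h2, by omega, fun u hu => ?_⟩
    have f := T.fp u p c t
    grind
  obtain ⟨x, x1, x2⟩ := T.D_between c t (i := 2) (by omega)
  have px : T.D p x = 1 := by
    have f := T.fp p x c t
    grind
  by_cases h3 : T.D c t = 3
  · right; right; left
    refine ⟨h3, x, px, x1, by omega, fun u hu => ?_⟩
    have h := cu u hu
    rw [tu]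
    constructor
    · intro hut
      have pr := T.par u c t
      have f1 := T.fp u p c t
      have f2 := T.fp u x c t
      have c1 := T.D_comm c p
      rcases (by omega : T.D u c = 1 ∨ T.D u c = 2) with h | h
      · exact Or.inl (T.D_eq_zero.1 (by grind))
      · exact Or.inr (T.D_eq_zero.1 (by grind))
    grind
  · right; right; right
    refine ⟨x, px, x1, by omega, fun u hu hut => ?_⟩
    have h := cu u hu
    rw [tu] at hut
    have f2 := T.fp u x c t
    have c2 := T.D_comm c x
    exact T.D_eq_zero.1 (by omega)

/-- The neighbour of `c` on the way to a node. -/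
theorem exists_mid {x c : T.Node} (h : T.D x c = 2) : ∃ y, T.D x y = 1 ∧ T.D y c = 1 := by
  obtain ⟨y, h1, h2⟩ := T.D_between x c (i := 1) (by omega)
  grind

theorem mid_unique {x c y z : T.Node} (h : T.D x c = 2) (hy : T.D x y = 1) (hyc : T.D y c = 1)
    (hz : T.D x z = 1) (hzc : T.D z c = 1) : y = z := by
  have f := T.fp y z x c
  have c1 := T.D_comm x y
  have c2 := T.D_comm x z
  exact T.D_eq_zero.1 (by omega)

end SteinerTree

end

section

namespace SteinerTree

open SubTree TreeMetric

variable {V : Type} {T : SteinerTree V} {G : SimpleGraph V}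

/-- The Steiner node `y` has exactly the neighbours `v` and `t`. -/
def IsPath (T : SteinerTree V) (v : V) (y t : T.Node) : Prop :=
  T.D v y = 1 ∧ T.D y t = 1 ∧ T.IsSteinerNode y ∧
    ∀ w, T.D y w = 1 → w = T.real v ∨ w = t

/-- The paths of length two from `v` to a center of `K` have middle nodes of degree two. -/
def PathAt (T : SteinerTree V) (K : Set V) (v : V) : Prop :=
  ∀ c z : T.Node, (∀ u ∈ K, T.D u c ≤ 2) → T.D v z = 1 → T.D z c = 1 →
    T.IsSteinerNode z ∧ ∀ w, T.D z w = 1 → w = T.real v ∨ w = c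

/-- The condition `MetricWS.leaf` at `X`. -/
def LeafAt (T : SteinerTree V) (G : SimpleGraph V) (X : Set V) : Prop :=
  ∀ v, IsFree G X v → ∃ w ∈ X, w ≠ v ∧ ∀ u ∈ X, ∀ u' ∈ X, T.d u u' ≤ T.d v w

/-- The condition `MetricWS.side` at `X`. -/
def SideAt (T : SteinerTree V) (G : SimpleGraph V) (X : Set V) : Prop :=
  ∀ p ∈ X, ∀ q ∈ X, T.d p q = 3 → (∀ u ∈ X, ∀ u' ∈ X, T.d u u' ≤ 3) →
    (∀ v v', IsFree G X v → IsFree G X v' → T.d v q < 3 → T.d v' q < 3 → v = v') ∨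
    (∀ v v', IsFree G X v → IsFree G X v' → T.d v p < 3 → T.d v' p < 3 → v = v')

theorem center_unique {p q : V} (hpq : T.d p q = 4) {s t : T.Node} (hp : T.D p s ≤ 2)
    (hq : T.D q s ≤ 2) (hp' : T.D p t ≤ 2) (hq' : T.D q t ≤ 2) :
    s = t := by
  have f := T.fp s t p q
  exact T.D_eq_zero.1 (by grind)

theorem pathAt_of_isPath {K : Set V} {v p q : V} (hp : p ∈ K) (hq : q ∈ K) (hpq : T.d p q = 4)
    {t y : T.Node} (ht : ∀ u ∈ K, T.D u t ≤ 2) (hvt : T.D v t = 2)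
    (h : T.IsPath v y t) : T.PathAt K v := by
  intro c z hc hvz hzc
  obtain rfl := center_unique hpq (ht p hp) (ht q hq) (hc p hp) (hc q hq)
  obtain rfl := mid_unique hvt h.1 h.2.1 hvz hzc
  exact h.2.2

namespace IsBridge

variable {A B : Set T.Node} {p q : T.Node} (b : IsBridge T A B p q) {M : Set V} {r s v : V}
  (hr : r ∈ M) (hs : s ∈ M) (hrs : b.tree.d r s = 4) {t y : T.Node}
  (hvt : T.D v t = 2) (h : T.IsPath v y t)
include hr hs hrs hvt h

theorem pathAt_inl (ht : t ∈ A) (hy : y ∈ A) (hyp : y ≠ p) (hv : T.real v ∈ A)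
    (hD : ∀ u ∈ M, b.tree.D u (b.inl ht) ≤ 2) : b.tree.PathAt M v := by
  obtain ⟨hvy, hyt, hS, hnb⟩ := h
  refine pathAt_of_isPath hr hs hrs hD ((b.D_inl hv ht).trans hvt) (y := b.inl hy)
    ⟨(b.D_inl hv hy).trans hvy, (b.D_eq _ _).trans hyt, b.isSteinerNode_inl hy hS, ?_⟩
  rintro (⟨w, hw⟩ | ⟨w, hw⟩) hyw
  · rcases hnb w ((b.D_eq _ _).symm.trans hyw) with rfl | rfl
    · exact Or.inl (b.real_inl hv).symm
    · exact Or.inr rfl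
  · have : T.D y p + 1 + T.D q w = 1 := (b.D_eq _ _).symm.trans hyw
    exact absurd (T.D_eq_zero.1 (by omega)) hyp

theorem pathAt_inr (ht : t ∈ B) (hy : y ∈ B) (hyq : y ≠ q) (hv : T.real v ∉ A)
    (hD : ∀ u ∈ M, b.tree.D u (b.inr ht) ≤ 2) : b.tree.PathAt M v := by
  obtain ⟨hvy, hyt, hS, hnb⟩ := h
  refine pathAt_of_isPath hr hs hrs hD ((b.D_inr hv ht).trans hvt) (y := b.inr hy)
    ⟨(b.D_inr hv hy).trans hvy, (b.D_eq _ _).trans hyt, b.isSteinerNode_inr hy hS, ?_⟩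
  rintro (⟨w, hw⟩ | ⟨w, hw⟩) hyw
  · have : T.D w p + 1 + T.D q y = 1 := (b.D_eq _ _).symm.trans hyw
    exact absurd (T.D_eq_zero.1 (by omega)).symm hyq
  · rcases hnb w ((b.D_eq _ _).symm.trans hyw) with rfl | rfl
    · exact Or.inl (b.real_inr hv).symm
    · exact Or.inr rfl

end IsBridge

/-- The center of a maximal clique and the middle node of the path to a free vertex. -/
theorem MetricWS.exists_path (h : MetricWS T G) [Finite V] {K : Set V} (hK : IsMaxClique G K)
    {v : V} (hv : IsFree G K v) {t : T.Node} (ht : ∀ u ∈ K, T.D u t ≤ 2) :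
    T.D v t = 2 ∧ ∃ y, T.IsPath v y t := by
  obtain ⟨p, hp, q, hq, hpq⟩ := h.diam K hK v hv
  obtain ⟨w, hw, -, hmax⟩ := h.leaf K hK.isCliqueIntersection v hv
  have h1 := hmax p hp q hq
  have h2 := ht v hv.1
  have h3 := ht w hw
  have h4 := T.D_tri v t w
  have c := T.D_comm t w
  have h5 : T.D v t = 2 := by grind
  obtain ⟨y, y1, y2⟩ := exists_mid h5
  obtain ⟨s1, s2⟩ := h.path K hK v hv t y ht h5 y1 y2
  exact ⟨h5, y, y1, y2, s1, s2⟩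

section

variable (h : MetricWS T G) {T' : SteinerTree V} {K : Set V}
include h

theorem MetricWS.leafAt_congr (hK : IsCliqueIntersection G K)
    (hd : ∀ u ∈ K, ∀ v ∈ K, T'.d u v = T.d u v) : T'.LeafAt G K := fun v hv => by
  obtain ⟨w, hw, hwv, hmax⟩ := h.leaf K hK v hv
  exact ⟨w, hw, hwv, fun u hu u' hu' => by rw [hd u hu u' hu', hd v hv.1 w hw]; grind⟩

theorem MetricWS.sideAt_congr (hK : IsCliqueIntersection G K)
    (hd : ∀ u ∈ K, ∀ v ∈ K, T'.d u v = T.d u v) : T'.SideAt G K := fun p hp q hq hpq hle => by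
  refine (h.side K hK p hp q hq (by grind) (by grind)).imp ?_ ?_ <;> intro h1 v v' hv hv' h3 h4
  · exact h1 v v' hv hv' (hd v hv.1 q hq ▸ h3) (hd v' hv'.1 q hq ▸ h4)
  · exact h1 v v' hv hv' (hd v hv.1 p hp ▸ h3) (hd v' hv'.1 p hp ▸ h4)

variable (hK : IsMaxClique G K) (hle : ∀ u ∈ K, ∀ v ∈ K, T.d u v ≤ T'.d u v)
include hK hle

theorem MetricWS.leafAt_of_le (hroot : T'.IsRoot 4 G) : T'.LeafAt G K := fun v hv => by
  obtain ⟨p, hp, q, hq, hpq⟩ := h.diam K hK v hv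
  obtain ⟨w, hw, hwv, hmax⟩ := h.leaf K hK.isCliqueIntersection v hv
  refine ⟨w, hw, hwv, fun u hu u' hu' => ?_⟩
  have h1 := hroot.d_le hK.isClique hu hu'
  have h2 := hmax p hp q hq
  have h3 := hle v hv.1 w hw
  omega

theorem MetricWS.sideAt_of_le : T'.SideAt G K := fun p _ q _ _ hle' => Or.inl fun v v' hv => by
  obtain ⟨s, hs, t, ht, hst⟩ := h.diam K hK v hv
  grind

end

theorem eq_of_far (h : T.IsRoot 4 G) {K L : Set V} (hK : IsMaxClique G K) (hL : IsMaxClique G L)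
    {u w : V} (hu : u ∈ K) (hw : w ∈ K) (hu' : u ∈ L) (hw' : w ∈ L) (huw : T.d u w = 4) :
    K = L := by
  obtain ⟨m, m1, m2⟩ := T.D_between u w (i := 2) (by grind)
  have m3 : T.D w m = 2 := by grind
  rw [ball_eq_of_far h hK hu hw huw m1 m3, ball_eq_of_far h hL hu' hw' huw m1 m3]

theorem not_isFree_of_mem {X Y : Set V} [Finite V] (hY : IsCliqueIntersection G Y) (hYX : Y ⊂ X)
    {u v : V} (hu : u ∈ Y) (hv : v ∈ Y) (huv : u ≠ v) : ¬ IsFree G X v := fun h =>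
  h.2 (Or.inl ⟨Y, hY, hYX, hv, by
    rw [← Set.ncard_pair huv]
    exact Set.ncard_le_ncard (by grind) (Set.toFinite Y)⟩)

end SteinerTree

end

section

set_option linter.unusedSectionVars false

/-! ## Separating a central real node from its branch -/

namespace SteinerTree

open SubTree TreeMetric

variable {V : Type} {T : SteinerTree V} {G : SimpleGraph V}

/-- `K` and `K'` are the maximal cliques with centers `c` and `a`, and no other maximal clique
that contains `a` contains a node of `K'` outside `Z`. -/
structure SplitData (T : SteinerTree V) (G : SimpleGraph V) (K K' Z : Set V) (c : T.Node)
    (a z x : V) : Prop where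
  ws : MetricWS T G
  hK : IsMaxClique G K
  hK' : IsMaxClique G K'
  ne : K ≠ K'
  ball : K = T.ball c
  ball' : K' = T.ball a
  hZ : IsCliqueIntersection G Z
  memZ : ∀ v, v ∈ Z ↔ T.D v c ≤ 1
  ac : T.D a c = 1
  zc : T.D z c = 1
  az : a ≠ z
  xa : T.d x a = 1
  xc : T.D x c = 2
  only : ∀ Q, IsMaxClique G Q → Q ≠ K → Q ≠ K' → a ∈ Q → ∀ v ∈ Q, v ∈ K' → v ∈ Z

/-- The nodes that are moved. -/
def splitSet (T : SteinerTree V) (c : T.Node) (a : V) : Set T.Node :=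
  {y | y ≠ T.real a ∧ ∃ r : V, T.d r a ≤ 2 ∧ T.d r a ≠ 0 ∧ T.D r c = T.d r a + 1 ∧
    T.D y r < T.D y a + T.d r a}

namespace SplitData

variable {K K' Z : Set V} {c : T.Node} {a z x : V} (h : SplitData T G K K' Z c a z x)
include h

theorem below {y : T.Node} (hy : y ∈ splitSet T c a) : T.D y c = T.D y a + 1 := by
  obtain ⟨-, r, -, -, h3, h4⟩ := hy
  have f := T.fp y r a c
  have p1 := T.par y r a
  have h5 := h.ac
  grind

theorem sep {y w : T.Node} (hy : y ∈ splitSet T c a) (hw : w ∉ splitSet T c a) :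
    T.D w y = T.D w a + T.D a y := by
  by_cases hwa : w = T.real a
  · grind
  obtain ⟨-, r, h1, h2, h3, h4⟩ := hy
  have h5 : ¬ T.D w r < T.D w a + T.d r a := fun hlt =>
    hw ⟨hwa, r, h1, h2, h3, hlt⟩
  have f := T.fp w y r a
  have t1 := T.D_tri w a y
  grind

theorem pos {y : T.Node} (hy : y ∈ splitSet T c a) : T.D a y ≠ 0 := fun e =>
  hy.1 (T.D_eq_zero.1 e).symm

theorem convex_compl : Convex T.graph (splitSet T c a)ᶜ := by
  intro u hu w hw y hy hyS
  have h1 := h.sep hyS hu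
  have h2 := h.sep hyS hw
  have h3 := h.pos hyS
  have t := T.D_tri u a w
  have c1 := T.D_comm w y
  have c2 := T.D_comm w a
  have hy' : T.D u y + T.D y w = T.D u w := hy
  omega

theorem convex_insert : Convex T.graph (insert (T.real a) (splitSet T c a)) := by
  intro u hu w hw y hy
  by_contra hy'
  rw [Set.mem_insert_iff, not_or] at hy'
  have hya : T.D y (T.real a) ≠ 0 := fun e => hy'.1 (T.D_eq_zero.1 e)
  have hu' : T.D y u = T.D y (T.real a) + T.D (T.real a) u := by
    rcases hu with rfl | hu
    · simp
    · exact h.sep hu hy'.2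
  have hw' : T.D y w = T.D y (T.real a) + T.D (T.real a) w := by
    rcases hw with rfl | hw
    · simp
    · exact h.sep hw hy'.2
  have t := T.D_tri u (T.real a) w
  have c1 := T.D_comm u y
  have c2 := T.D_comm u (T.real a)
  have hy2 : T.D u y + T.D y w = T.D u w := hy
  omega

theorem c_mem : c ∈ (splitSet T c a)ᶜ := fun hc => by
  have := h.below hc
  grind

theorem cover (y : T.Node) :
    y ∈ (splitSet T c a)ᶜ ∨ y ∈ insert (T.real a) (splitSet T c a) := by grind

theorem isBridge :
    IsBridge T (splitSet T c a)ᶜ (insert (T.real a) (splitSet T c a)) c (T.real a) :=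
  ⟨h.convex_compl, h.convex_insert, h.c_mem, Set.mem_insert _ _, h.cover⟩

/-- The tree in which some of the branches at `a` hang at a new neighbour of `c`. -/
noncomputable abbrev split : SteinerTree V := h.isBridge.tree

theorem a_not_mem : T.real a ∉ splitSet T c a := fun ha => ha.1 rfl

theorem not_below_three (r : V) (h1 : T.D r c = T.d r a + 1) [Finite V] :
    T.d r a ≠ 3 := by
  intro h3
  obtain ⟨y, y1, y2⟩ := T.D_between a r (i := 1)
    (by grind)
  obtain ⟨Q, hQ, hsub⟩ := exists_isMaxClique (h.ws.root.isClique_ball y)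
  have hra := T.d_comm r a
  have hr : r ∈ Q := hsub (by grind)
  have ha : a ∈ Q := hsub (by grind)
  have hx : x ∈ Q := hsub (by
    change T.D x y ≤ 2
    have := T.D_tri x a y
    have := h.xa
    grind)
  have hxZ := h.only Q hQ ?_ ?_ ha x hx (by
    rw [h.ball']
    change T.D _ _ ≤ 2
    have := h.xa
    grind)
  · have := (h.memZ x).1 hxZ
    have := h.xc
    omega
  · rintro rfl
    rw [h.ball] at hr
    grind
  · rintro rfl
    rw [h.ball'] at hr
    grind

theorem not_mem_four [Finite V] (r : V) (hr : T.real r ∈ splitSet T c a) : T.d r a ≠ 4 := by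
  intro h4
  have hbelow := h.below hr
  obtain ⟨-, s, s1, s2, s3, s4⟩ := hr
  obtain ⟨y, y1, y2⟩ := T.D_between a r (i := 2)
    (by grind)
  obtain ⟨Q, hQ, hsub⟩ := exists_isMaxClique (h.ws.root.isClique_ball y)
  have hra := T.d_comm r a
  have hr : r ∈ Q := hsub (by grind)
  have ha : a ∈ Q := hsub (by grind)
  have hs : s ∈ Q := hsub (by
    change T.D s y ≤ 2
    have f := T.fp s y a r
    have p1 := T.par s a r
    grind)
  have hsZ := h.only Q hQ ?_ ?_ ha s hs (by rw [h.ball']; exact s1)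
  · have := (h.memZ s).1 hsZ
    omega
  · rintro rfl
    rw [h.ball] at hr
    grind
  · rintro rfl
    rw [h.ball'] at hr
    grind

theorem mem_of_near {r : V} (h1 : T.D r c = T.d r a + 1) (h2 : T.d r a ≤ 2)
    (hra : r ≠ a) : T.real r ∈ splitSet T c a := by
  have h0 : T.d r a ≠ 0 := fun e => hra (T.d_eq_zero.1 e)
  refine ⟨fun e => hra (T.real.injective e), r, h2, h0, h1, ?_⟩
  grind

theorem d_cross [Finite V] {u v : V} (hu : T.real u ∉ splitSet T c a)
    (hv : T.real v ∈ splitSet T c a) :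
    h.split.d u v = T.D u c + 1 + T.d v a ∧ T.d u v = T.d u a + T.d v a ∧
    ((T.D u c + 1 = T.d u a ∧ h.split.d u v = T.d u v) ∨
     (u = a ∧ T.d v a ≤ 2 ∧ h.split.d u v = T.d u v + 2) ∨
     (T.D u c = T.d u a + 1 ∧ 5 ≤ T.d u v ∧ h.split.d u v = T.d u v + 2)) := by
  have h1 : h.split.d u v = T.D u c + 1 + T.D a v :=
    h.isBridge.d_mem_not_mem hu (not_not.2 hv)
  have h2 : T.d u v = T.d u a + T.d a v := h.sep hv hu
  have h3 := T.d_comm a v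
  rw [← d, h3] at h1
  rw [h3] at h2
  refine ⟨h1, h2, ?_⟩
  have h4 := T.par u a c
  have t1 := T.D_tri u a c
  have t2 := T.D_tri u c a
  have h5 := h.ac
  have c1 := T.D_comm c a
  have hv0 := h.pos hv
  have hor : T.D u c + 1 = T.d u a ∨ T.D u c = T.d u a + 1 := by grind
  rcases hor with h6 | h6
  · grind
  · right
    by_cases hua : u = a
    · have h7 := h.not_below_three v (h.below hv)
      have h8 := h.not_mem_four v hv
      grind
    · right
      have h7 := h.not_below_three u h6
      have h8 : ¬ T.d u a ≤ 2 := fun h9 => hu (h.mem_of_near h6 h9 hua)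
      grind

/-- The only pairs whose distance matters and changes consist of `a` and a node near `a`. -/
theorem split_d [Finite V] (u v : V) :
    h.split.d u v = T.d u v ∨ (5 ≤ T.d u v ∧ h.split.d u v = T.d u v + 2) ∨
    (h.split.d u v = T.d u v + 2 ∧ T.d u v ≤ 2 ∧
      ((u = a ∧ T.real v ∈ splitSet T c a) ∨ (v = a ∧ T.real u ∈ splitSet T c a))) := by
  by_cases hu : T.real u ∈ splitSet T c a <;> by_cases hv : T.real v ∈ splitSet T c a
  · left
    exact h.isBridge.d_not_mem_not_mem (not_not.2 hu) (not_not.2 hv)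
  · obtain ⟨h1, h2, h3⟩ := h.d_cross hv hu
    grind
  · obtain ⟨h1, h2, h3⟩ := h.d_cross hu hv
    grind
  · left
    exact h.isBridge.d_mem_mem hu hv

theorem d_le_split [Finite V] (u v : V) : T.d u v ≤ h.split.d u v := by
  rcases h.split_d u v with h1 | h1 | h1 <;> omega

theorem split_isRoot [Finite V] : h.split.IsRoot 4 G := by
  intro u v huv
  rw [h.ws.root.adj_iff huv]
  change _ ↔ h.split.d u v ≤ 4
  rcases h.split_d u v with h1 | h1 | h1 <;> omega

theorem mem_K' {v : V} (hv : T.d v a ≤ 2) : v ∈ K' := by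
  rw [h.ball']
  exact hv

theorem eq_of_mem {X : Set V} (hX : IsCliqueIntersection G X) {v : V} (ha : a ∈ X) (hv : v ∈ X)
    (hvS : T.real v ∈ splitSet T c a) (hva : T.d v a ≤ 2) :
    X = K ∨ X = K' ∨ X = K ∩ K' := by
  obtain ⟨𝒦, ⟨L, hL⟩, hmax, rfl⟩ := hX
  have hvZ : v ∉ Z := fun hvZ => by
    have h1 := (h.memZ v).1 hvZ
    have h2 := h.below hvS
    have h3 := h.pos hvS
    grind
  have key : ∀ M ∈ 𝒦, M = K ∨ M = K' := fun M hM => by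
    by_contra! hno
    exact hvZ (h.only M (hmax M hM) hno.1 hno.2 (ha M hM) v (hv M hM) (h.mem_K' hva))
  grind

theorem unchanged_or [Finite V] {X : Set V} (hX : IsCliqueIntersection G X) :
    (∀ u ∈ X, ∀ v ∈ X, h.split.d u v = T.d u v) ∨ X = K ∨ X = K' ∨ X = K ∩ K' := by
  by_cases hno : X = K ∨ X = K' ∨ X = K ∩ K'
  · grind
  · left
    intro u hu v hv
    have h4 := h.ws.root.d_le hX.isClique hu hv
    rcases h.split_d u v with h1 | h1 | ⟨h1, h2, ⟨rfl, h3⟩ | ⟨rfl, h3⟩⟩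
    · exact h1
    · omega
    · exact absurd (h.eq_of_mem hX hu hv h3 (by grind)) hno
    · exact absurd (h.eq_of_mem hX hv hu h3 h2) hno

theorem Z_subset : Z ⊆ K ∩ K' := fun v hv => by
  have h1 := (h.memZ v).1 hv
  refine ⟨?_, h.mem_K' ?_⟩
  · rw [h.ball]
    grind
  · have := T.D_tri v c a
    have := h.ac
    grind

theorem a_mem_Z : a ∈ Z := (h.memZ a).2 h.ac.le

theorem z_mem_Z : z ∈ Z := (h.memZ z).2 h.zc.le

theorem x_mem : x ∈ K ∩ K' := by
  refine ⟨?_, h.mem_K' (by have := h.xa; omega)⟩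
  rw [h.ball]
  exact h.xc.le

theorem Z_ssubset : Z ⊂ K ∩ K' := by
  refine ⟨h.Z_subset, fun hsub => ?_⟩
  have h1 := (h.memZ x).1 (hsub h.x_mem)
  have h2 := h.xc
  omega

theorem not_isFree_Z [Finite V] {X : Set V} (hX : X = K ∨ X = K' ∨ X = K ∩ K') {v : V}
    (hv : v ∈ Z) : ¬ IsFree G X v := by
  have hsub : Z ⊂ X := by
    refine h.Z_ssubset.trans_subset ?_
    grind
  by_cases hva : v = a
  · subst hva
    exact not_isFree_of_mem h.hZ hsub h.z_mem_Z hv h.az.symm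
  · exact not_isFree_of_mem h.hZ hsub h.a_mem_Z hv (Ne.symm hva)

/-- In the intersection of the two cliques, the moved nodes are the ones outside `Z`. -/
theorem mem_inter_cases {v : V} (hv : v ∈ K ∩ K') :
    (v ∈ Z ∧ T.real v ∉ splitSet T c a) ∨
      (T.d v a = 1 ∧ T.D v c = 2 ∧ T.real v ∈ splitSet T c a) := by
  obtain ⟨h1, h2⟩ := hv
  rw [h.ball] at h1
  rw [h.ball'] at h2
  have h1' : T.D v c ≤ 2 := h1
  have h2' : T.d v a ≤ 2 := h2
  by_cases h3 : T.D v c ≤ 1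
  · refine Or.inl ⟨(h.memZ v).2 h3, fun hvS => ?_⟩
    have h4 := h.below hvS
    have h5 := h.pos hvS
    grind
  · right
    have p1 := T.par v c a
    have h4 := h.ac
    have c1 := T.D_comm c a
    have hva : v ≠ a := by grind
    have h0 : T.d v a ≠ 0 := fun e => hva (T.d_eq_zero.1 e)
    have h5 : T.d v a = 1 ∧ T.D v c = 2 := by grind
    exact ⟨h5.1, h5.2, h.mem_of_near (by omega) h2' hva⟩

theorem split_d_inter_le [Finite V] {u v : V} (hu : u ∈ K ∩ K') (hv : v ∈ K ∩ K') :
    h.split.d u v ≤ 3 := by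
  have hle : T.d u v ≤ 3 := by
    have h4 := h.ws.root.d_le h.hK.isClique hu.1 hv.1
    by_contra hlt
    exact h.ne (eq_of_far h.ws.root h.hK h.hK' hu.1 hv.1 hu.2 hv.2 (by omega))
  have hin : ∀ w ∈ K ∩ K', T.real w ∈ splitSet T c a → T.d w a = 1 := fun w hw hwS => by
    rcases h.mem_inter_cases hw with h1 | h1
    all_goals grind
  rcases h.split_d u v with h1 | h1 | ⟨h1, h2, ⟨rfl, h3⟩ | ⟨rfl, h3⟩⟩
  · omega
  · omega
  all_goals grind

theorem split_leaf [Finite V] {X : Set V} (hX : IsCliqueIntersection G X) :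
    h.split.LeafAt G X := by
  rcases h.unchanged_or hX with h1 | rfl | rfl | rfl
  · exact h.ws.leafAt_congr hX h1
  · exact h.ws.leafAt_of_le h.hK (fun u _ v _ => h.d_le_split u v) h.split_isRoot
  · exact h.ws.leafAt_of_le h.hK' (fun u _ v _ => h.d_le_split u v) h.split_isRoot
  · intro v hv
    obtain ⟨w, hw, hwv, hmax⟩ := h.ws.leaf _ hX v hv
    refine ⟨w, hw, hwv, fun u hu u' hu' => ?_⟩
    have h1 := h.split_d_inter_le hu hu'
    have h2 := hmax z (h.Z_subset h.z_mem_Z) x h.x_mem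
    have h3 := h.d_le_split v w
    have h4 : T.d z x = 3 := by
      have hz : T.real z ∉ splitSet T c a := fun hz => by
        have e := h.below hz
        have e0 := h.pos hz
        have e1 := T.D_comm z a
        have e2 := h.zc
        omega
      have hx : T.real x ∈ splitSet T c a :=
        h.mem_of_near (by have := h.xa; have := h.xc; omega) (by have := h.xa; omega)
          (by rintro rfl; have := h.xa; grind)
      have e := (h.d_cross hz hx).2.1
      have h9 : T.d z a ≠ 0 := fun e => h.az (T.d_eq_zero.1 e).symm
      have p1 := T.par z c a
      have t1 := T.D_tri z c a
      have c1 := T.D_comm c a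
      have h5 := h.zc
      have h6 := h.ac
      have h7 := h.xa
      grind
    omega

theorem split_side [Finite V] {X : Set V} (hX : IsCliqueIntersection G X) :
    h.split.SideAt G X := by
  rcases h.unchanged_or hX with h1 | rfl | rfl | rfl
  · exact h.ws.sideAt_congr hX h1
  · exact h.ws.sideAt_of_le h.hK fun u _ v _ => h.d_le_split u v
  · exact h.ws.sideAt_of_le h.hK' fun u _ v _ => h.d_le_split u v
  · intro p hp q hq hpq _
    have key : ∀ s t : V, s ∈ Z → T.real s ∉ splitSet T c a → T.real t ∈ splitSet T c a →
        T.d t a = 1 → h.split.d s t = 3 → ∀ v v', IsFree G (K ∩ K') v → IsFree G (K ∩ K') v' →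
          h.split.d v s < 3 → h.split.d v' s < 3 → v = v' := by
      intro s t hs hsS htS hta hst v v' hv _ hlt
      rcases h.mem_inter_cases hv.1 with h2 | ⟨h2, -, h3⟩
      · exact absurd hv (h.not_isFree_Z (Or.inr (Or.inr rfl)) h2.1)
      · have e1 := (h.d_cross hsS htS).1
        have e2 := (h.d_cross hsS h3).1
        grind
    have hZZ : ∀ s t, s ∈ Z → t ∈ Z → T.real s ∉ splitSet T c a → T.real t ∉ splitSet T c a →
        h.split.d s t ≤ 2 := by
      intro s t hs ht hsS htS
      rw [h.isBridge.d_mem_mem hsS htS]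
      have h1 := (h.memZ s).1 hs
      have h2 := (h.memZ t).1 ht
      have t1 := T.D_tri s c t
      grind
    have hSS : ∀ s t, T.d s a = 1 → T.d t a = 1 → T.real s ∈ splitSet T c a →
        T.real t ∈ splitSet T c a → h.split.d s t ≤ 2 := by
      intro s t hs ht hsS htS
      rw [h.isBridge.d_not_mem_not_mem (not_not.2 hsS) (not_not.2 htS)]
      have t1 := T.D_tri s a t
      grind
    rcases h.mem_inter_cases hp with ⟨hp1, hp2⟩ | ⟨hp1, -, hp2⟩ <;>
      rcases h.mem_inter_cases hq with ⟨hq1, hq2⟩ | ⟨hq1, -, hq2⟩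
    · grind
    · grind
    all_goals grind

/-- The copy of the center of `K`. -/
def newCenter : h.split.Node := h.isBridge.inl h.c_mem

theorem split_D_newCenter (u : V) :
    h.split.D u h.newCenter = T.D u c := by
  by_cases hu : T.real u ∈ splitSet T c a
  · have h1 := h.isBridge.D_inl' (not_not.2 hu) h.c_mem
    have h2 := h.below hu
    have c1 := T.D_comm u a
    rw [T.D_self] at h1
    refine h1.trans ?_
    omega
  · exact h.isBridge.D_inl hu h.c_mem

theorem D_c_cases (x : T.Node) :
    T.D x c + 1 = T.D x a ∨ T.D x c = T.D x a + 1 := by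
  have h4 := T.par x a c
  have t1 := T.D_tri x a c
  have t2 := T.D_tri x c a
  have h5 := h.ac
  grind

/-- A clique with center `t` below `a` has a node further below. -/
theorem exists_beyond {p q : V} (hpq : T.d p q = 4) {t : T.Node} (hpt : T.D p t ≤ 2)
    (hqt : T.D q t ≤ 2) (ht : T.D t c = T.D t a + 1)
    (hta : T.D t a ≠ 0) :
    ∃ r, (r = p ∨ r = q) ∧ T.D r a = T.D t a + 2 ∧
      T.D r c = T.D r a + 1 := by
  have f₁ := T.fp p q t a
  have t0 := T.D_tri p t q
  have t1 := T.D_tri p t a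
  have t2 := T.D_tri q t a
  have c1 := T.D_comm t q
  have key : ∀ r : V, T.D r t = 2 → T.D r a = T.D t a + 2 →
      T.D r c = T.D r a + 1 := by
    intro r h1 h2
    have f := T.fp r a t c
    have c2 := T.D_comm t a
    have h3 := h.D_c_cases r
    have c3 := T.D_comm t r
    have h4 := h.ac
    grind
  grind

theorem split_path [Finite V] {Q : Set V} (hQ : IsMaxClique G Q) {v : V} (hv : IsFree G Q v) :
    h.split.PathAt Q v := by
  obtain ⟨p, hp, q, hq, hpq⟩ := h.ws.diam Q hQ v hv
  obtain ⟨t, htQ⟩ := h.ws.root.exists_center hQ ⟨p, hp⟩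
  have hmem : ∀ u ∈ Q, T.D u t ≤ 2 := fun u hu => by grind
  obtain ⟨hvt, y, hP⟩ := h.ws.exists_path hQ hv hmem
  obtain ⟨hvy, hyt, hS, hnb⟩ := id hP
  have hpq' : h.split.d p q = 4 := le_antisymm (h.split_isRoot.d_le hQ.isClique hp hq)
    (hpq ▸ h.d_le_split p q)
  have hya : y ≠ T.real a := fun e => hS a e.symm
  have uniq : ∀ s, Q = T.ball s → s = t := fun s hs =>
    center_unique hpq (by grind) (by grind) (hmem p hp) (hmem q hq)
  by_cases hQK : Q = K
  · obtain rfl := uniq c (hQK.trans h.ball)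
    have hyS : y ∉ splitSet T c a := fun hyS => by
      have := h.below hyS
      exact hya (T.D_eq_zero.1 (by omega))
    have hvS : T.real v ∉ splitSet T c a := fun hvS => by
      have h1 := h.below hvS
      exact hya (mid_unique hvt hvy hyt (by omega) h.ac)
    refine h.isBridge.pathAt_inl hp hq hpq' hvt hP h.c_mem hyS ?_ hvS ?_
    · grind
    · intro u hu
      exact (h.split_D_newCenter u).trans_le (hmem u hu)
  by_cases hQK' : Q = K'
  · obtain rfl := uniq a (hQK'.trans h.ball')
    have hvZ : v ∉ Z := fun hvZ => h.not_isFree_Z (Or.inr (Or.inl rfl)) hvZ (hQK' ▸ hv)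
    have hyc : y ≠ c := by
      rintro rfl
      rcases hnb z (by rw [T.D_comm]; exact h.zc) with e | e
      · exact hvZ (T.real.injective e ▸ h.z_mem_Z)
      · exact h.az (T.real.injective e).symm
    have hfar : ∀ u ∈ Q, T.real u ∉ splitSet T c a → T.D u c + 1 ≤ 2 := by
      intro u hu huS
      have h1 := hmem u hu
      rcases h.D_c_cases u with h2 | h2
      · omega
      · by_cases hua : u = a
        · grind
        · exact absurd (h.mem_of_near h2 h1 hua) huS
    have hvS : T.real v ∈ splitSet T c a := by
      by_contra hvS
      have h1 := hfar v hv.1 hvS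
      refine hyc (mid_unique hvt hvy hyt ?_ (by rw [T.D_comm]; exact h.ac))
      have := h.D_c_cases v
      omega
    have hyS : y ∈ splitSet T c a := by
      by_contra hyS
      have h1 := h.sep hvS hyS
      grind
    refine h.isBridge.pathAt_inr hp hq hpq' hvt hP (Set.mem_insert _ _) (Or.inr hyS) hya (not_not.2 hvS) ?_
    intro u hu
    by_cases huS : T.real u ∈ splitSet T c a
    · exact (h.isBridge.D_inr (not_not.2 huS) (Set.mem_insert _ _)).trans_le (hmem u hu)
    · refine (h.isBridge.D_inr' huS (Set.mem_insert _ _)).trans_le ?_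
      grind
  have hta : t ≠ T.real a := by
    rintro rfl
    exact hQK' (htQ.trans h.ball'.symm)
  have hta0 : T.D t a ≠ 0 := fun e => hta (T.D_eq_zero.1 e)
  by_cases htS : t ∈ splitSet T c a
  · have hbelow := h.below htS
    have hmain : ∀ u ∈ Q, T.real u ∉ splitSet T c a →
        T.D u c + 1 = T.D u a := by
      intro u hu huS
      rcases h.D_c_cases u with h2 | h2
      · exact h2
      exfalso
      have h1 := h.sep htS huS
      have h3 := hmem u hu
      have c1 := T.D_comm t a
      have hua : u = a := by
        by_contra hua
        exact huS (h.mem_of_near h2 (by grind) hua)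
      obtain ⟨r, hr, hra, hrc⟩ := h.exists_beyond hpq (hmem p hp) (hmem q hq) hbelow hta0
      have hrQ : r ∈ Q := by grind
      have hrS : T.real r ∈ splitSet T c a := by
        by_contra hrS
        have := h.sep htS hrS
        grind
      have h5 := h.not_below_three r hrc
      have h6 := h.not_mem_four r hrS
      grind
    have hvS : T.real v ∈ splitSet T c a := by
      by_contra hvS
      have h1 := hmain v hv.1 hvS
      have h2 := h.sep htS hvS
      have c1 := T.D_comm t a
      exact hya (mid_unique hvt hvy hyt (by omega) (by omega))
    have hyS : y ∈ splitSet T c a :=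
      (h.convex_insert _ (Or.inr hvS) _ (Or.inr htS) y (by
        change T.D _ _ + T.D _ _ = T.D _ _
        omega)).resolve_left hya
    refine h.isBridge.pathAt_inr hp hq hpq' hvt hP (Or.inr htS) (Or.inr hyS) hya (not_not.2 hvS) ?_
    intro u hu
    by_cases huS : T.real u ∈ splitSet T c a
    · exact (h.isBridge.D_inr (not_not.2 huS) (Or.inr htS)).trans_le (hmem u hu)
    · refine (h.isBridge.D_inr' huS (Or.inr htS)).trans_le ?_
      have h1 := hmain u hu huS
      have h2 := h.sep htS huS
      grind
  · have hmain : ∀ u ∈ Q, T.real u ∈ splitSet T c a → T.D t c + 1 = T.D t a := by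
      intro u hu huS
      rcases h.D_c_cases t with h2 | h2
      · exact h2
      exfalso
      have h1 := h.sep huS htS
      have h3 := hmem u hu
      have h4 := h.pos huS
      have c1 := T.D_comm u t
      obtain ⟨r, hr, hra, hrc⟩ := h.exists_beyond hpq (hmem p hp) (hmem q hq) h2 hta0
      have h5 := h.not_below_three r hrc
      grind
    have hvS : T.real v ∉ splitSet T c a := fun hvS => by
      have h1 := h.sep hvS htS
      have h2 := h.pos hvS
      have c1 := T.D_comm v t
      have c2 := T.D_comm v a
      have c3 := T.D_comm t a
      exact hya (mid_unique hvt hvy hyt (by omega) (by omega))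
    have hyS : y ∉ splitSet T c a := h.convex_compl _ hvS _ htS y (by
        change T.D _ _ + T.D _ _ = T.D _ _
        omega)
    have hyc : y ≠ c := by
      rintro rfl
      have hva : v = a := by
        rcases hnb a (by rw [T.D_comm]; exact h.ac) with e | e
        all_goals grind
      have htz : t = T.real z := by
        rcases hnb z (by rw [T.D_comm]; exact h.zc) with e | e
        · exact absurd ((T.real.injective e).trans hva).symm h.az
        grind
      have hZQ : Z ⊂ Q := by
        refine ⟨fun u hu => ?_, fun hsub => ?_⟩
        · rw [htQ]
          change T.D _ _ ≤ 2
          have h1 := (h.memZ u).1 hu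
          have h2 := T.D_tri u y t
          omega
        · have h1 := (h.memZ p).1 (hsub hp)
          have h2 := (h.memZ q).1 (hsub hq)
          have h3 := T.D_tri p y q
          grind
      exact not_isFree_of_mem h.hZ hZQ h.z_mem_Z (hva ▸ h.a_mem_Z) (hva ▸ h.az.symm) hv
    refine h.isBridge.pathAt_inl hp hq hpq' hvt hP htS hyS hyc hvS ?_
    intro u hu
    by_cases huS : T.real u ∈ splitSet T c a
    · refine (h.isBridge.D_inl' (not_not.2 huS) htS).trans_le ?_
      have h1 := hmain u hu huS
      have h2 := h.sep huS htS
      grind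
    · exact (h.isBridge.D_inl huS htS).trans_le (hmem u hu)

theorem split_metricWS [Finite V] : MetricWS h.split G where
  root := h.split_isRoot
  leaf _ hX := h.split_leaf hX
  side _ hX := h.split_side hX
  path Q hQ v hv c' y' hc' _ := h.split_path hQ hv c' y' hc'
  diam Q hQ v hv := by
    obtain ⟨p, hp, q, hq, hpq⟩ := h.ws.diam Q hQ v hv
    exact ⟨p, hp, q, hq, le_antisymm (h.split_isRoot.d_le hQ.isClique hp hq)
      (hpq ▸ h.d_le_split p q)⟩

theorem split_ball : K = h.split.ball h.newCenter := by
  ext u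
  rw [Set.ext_iff.1 h.ball u]
  change T.D _ _ ≤ 2 ↔ h.split.D _ _ ≤ 2
  rw [h.split_D_newCenter]

theorem split_d_lt [Finite V] : T.d a x < h.split.d a x := by
  have hx : T.real x ∈ splitSet T c a :=
    h.mem_of_near (by have := h.xa; have := h.xc; omega) (by have := h.xa; omega)
      (by rintro rfl; have := h.xa; grind)
  have h1 := (h.d_cross (h.a_not_mem) hx)
  grind

theorem split_d_eq [Finite V] {S : Set V} (hS : S ⊆ K) (hSc : IsCliqueIntersection G S)
    (hno : a ∈ S → ∀ v ∈ S, T.D v c = 2 → T.d v a ≠ 1) :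
    ∀ u ∈ S, ∀ v ∈ S, h.split.d u v = T.d u v := by
  have key : ∀ v ∈ S, a ∈ S → T.real v ∉ splitSet T c a := fun v hv ha hvS => by
    have h1 := h.below hvS
    have h2 := h.pos hvS
    have h3 : T.D v c ≤ 2 := by
      have := hS hv
      rw [h.ball] at this
      exact this
    grind
  intro u hu v hv
  rcases h.split_d u v with h1 | h1 | ⟨h1, h2, ⟨rfl, h3⟩ | ⟨rfl, h3⟩⟩
  · exact h1
  · have := h.ws.root.d_le hSc.isClique hu hv
    omega
  all_goals grind

end SplitData

end SteinerTree

end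

section

set_option linter.unusedSectionVars false

/-! ## Moving a branch that hangs below a single central real node -/

namespace SteinerTree

open SubTree TreeMetric

variable {V : Type} {T : SteinerTree V} {G : SimpleGraph V}

/-- `K` and `Q` are the maximal cliques with centers `c` and `y₀`; the path from `c` to `y₀` is
`c, a, x, y₀`, the only real node at distance at most one from `c` is `a`, and a maximal clique
other than `K` contains at most one child of `a`. -/
structure SwapData (T : SteinerTree V) (G : SimpleGraph V) (K Q : Set V) (c y₀ : T.Node)
    (a x x₂ : V) : Prop where
  ws : MetricWS T G
  hK : IsMaxClique G K
  hQ : IsMaxClique G Q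
  ne : K ≠ Q
  ball : K = T.ball c
  ballQ : Q = T.ball y₀
  far : ∃ p ∈ K, ∃ q ∈ K, T.d p q = 4
  only : ∀ v : V, T.D v c ≤ 1 → v = a
  ac : T.D a c = 1
  xa : T.d x a = 1
  xc : T.D x c = 2
  x₂a : T.d x₂ a = 1
  x₂c : T.D x₂ c = 2
  x₂x : x₂ ≠ x
  xy : T.D x y₀ = 1
  ay : T.D a y₀ = 2
  uniq : ∀ M, IsMaxClique G M → M ≠ K → a ∈ M → x ∈ M → M = Q
  few : ∀ M, IsMaxClique G M → M ≠ K → ∀ u ∈ M, ∀ v ∈ M, T.d u a = 1 → T.d v a = 1 →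
    T.D u c = 2 → T.D v c = 2 → u = v

/-- The component of `a` of the tree without the edge between `a` and `x`. -/
def edgeSide (T : SteinerTree V) (a x : V) : Set T.Node :=
  {y | T.D y a < T.D y x}

theorem convex_edgeSide {a x : V} (h : T.d x a = 1) : Convex T.graph (edgeSide T a x) := by
  intro u hu w hw y hy
  have hy' : T.D u y + T.D y w = T.D u w := hy
  have hu' : T.D u a < T.D u x := hu
  have hw' : T.D w a < T.D w x := hw
  change T.D y a < T.D y x
  by_contra hlt
  have h0 : T.D x a = 1 := h
  have p1 := T.par y x a
  have f1 := T.fp y u x a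
  have f2 := T.fp y w x a
  have t := T.D_tri u a w
  grind

namespace SwapData

variable {K Q : Set V} {c y₀ : T.Node} {a x x₂ : V} (h : SwapData T G K Q c y₀ a x x₂)
include h

theorem ax : T.d a x = 1 := by rw [T.d_comm]; exact h.xa

theorem mem_iff_not {y : T.Node} : y ∈ edgeSide T x a ↔ y ∉ edgeSide T a x := by
  change T.D y x < T.D y a ↔ ¬ T.D y a < T.D y x
  have p1 := T.par y x a
  have := h.xa
  grind

theorem cross {u w : T.Node} (hu : u ∈ edgeSide T a x) (hw : w ∉ edgeSide T a x) :
    T.D u w = T.D u a + 1 + T.D x w ∧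
      T.D u x = T.D u a + 1 ∧ T.D w a = T.D w x + 1 := by
  have hu' : T.D u a < T.D u x := hu
  have hw' : T.D w x < T.D w a := h.mem_iff_not.2 hw
  have f := T.fp u w a x
  have t1 := T.D_tri u a x
  have t2 := T.D_tri w x a
  have h1 := h.xa
  grind

theorem c_mem : c ∈ edgeSide T a x := by
  change T.D _ _ < T.D _ _
  have h1 := h.ac
  have h2 := h.xc
  grind

theorem y₀_mem : y₀ ∈ edgeSide T x a := by
  change T.D _ _ < T.D _ _
  have h1 := h.xy
  have h2 := h.ay
  grind

theorem a_mem : T.real a ∈ edgeSide T a x := by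
  change T.D _ _ < T.D _ _
  have := h.ax
  grind

theorem x_not_mem : T.real x ∉ edgeSide T a x := by
  rw [← h.mem_iff_not]
  change T.D _ _ < T.D _ _
  have := h.xa
  grind

theorem cover (y : T.Node) : y ∈ edgeSide T a x ∨ y ∈ edgeSide T x a := by
  rw [h.mem_iff_not]
  exact em _

theorem isBridge : IsBridge T (edgeSide T a x) (edgeSide T x a) c y₀ :=
  ⟨convex_edgeSide h.xa, convex_edgeSide h.ax, h.c_mem, h.y₀_mem, h.cover⟩

/-- The tree in which the edge between `a` and `x` is replaced by one between `c` and `y₀`. -/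
noncomputable abbrev swap : SteinerTree V := h.isBridge.tree

theorem D_c_cases (y : T.Node) :
    T.D y c + 1 = T.D y a ∨ T.D y c = T.D y a + 1 := by
  have h4 := T.par y a c
  have t1 := T.D_tri y a c
  have t2 := T.D_tri y c a
  have h5 := h.ac
  grind

theorem D_y₀_cases (y : T.Node) :
    T.D y y₀ + 1 = T.D y x ∨ T.D y y₀ = T.D y x + 1 := by
  have h4 := T.par y x y₀
  have t1 := T.D_tri y x y₀
  have t2 := T.D_tri y y₀ x
  have h5 := h.xy
  grind

theorem D_c {w : T.Node} (hw : w ∉ edgeSide T a x) : T.D w c = T.D w x + 2 := by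
  have h1 := (h.cross h.c_mem hw).1
  have h2 := h.ac
  grind

theorem D_y₀ {u : T.Node} (hu : u ∈ edgeSide T a x) : T.D u y₀ = T.D u a + 2 := by
  have h1 := (h.cross hu (h.mem_iff_not.1 h.y₀_mem)).1
  have h2 := h.xy
  omega

/-- No maximal clique other than `K` contains both `x` and `x₂`. -/
theorem not_both [Finite V] {m : T.Node} (h1 : T.D x m ≤ 2)
    (h2 : T.D x₂ m ≤ 2) {u : V} (hu : T.D u m ≤ 2) :
    T.D u c ≤ 2 := by
  obtain ⟨M, hM, hsub⟩ := exists_isMaxClique (h.ws.root.isClique_ball m)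
  by_cases hMK : M = K
  · have : u ∈ K := hMK ▸ hsub hu
    rw [h.ball] at this
    exact this
  · exact absurd (h.few M hM hMK x₂ (hsub h2) x (hsub h1) h.x₂a h.xa h.x₂c h.xc) h.x₂x

theorem D_x₂ {m : T.Node} : T.D x₂ m ≤ T.D a m + 1 := by
  have := T.D_tri x₂ a m
  have h1 := h.x₂a
  grind

theorem three_le [Finite V] {w : V} (hw : T.real w ∉ edgeSide T a x) (hwx : w ≠ x) :
    3 ≤ T.D w x := by
  by_contra hlt
  have h0 : T.D w x ≠ 0 := fun e => hwx (T.d_eq_zero.1 e)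
  have h1 := h.not_both (m := T.real x) (u := w) (by grind)
    (by have := h.D_x₂ (m := T.real x); have := h.ax; grind) (by omega)
  have h2 := h.D_c hw
  omega

theorem three_eq [Finite V] {w : V} (hw : T.real w ∉ edgeSide T a x)
    (h3 : T.D w x = 3) : T.D w y₀ = 2 := by
  obtain ⟨m, m1, m2⟩ := T.D_between a w (i := 2) (by
    have h1 := (h.cross h.a_mem hw).1
    grind)
  have h1 := (h.cross h.a_mem hw).1
  have c1 := T.D_comm w x
  have c2 := T.D_comm w m
  have h2 := h.D_c hw
  rw [T.D_self] at h1
  obtain ⟨M, hM, hsub⟩ := exists_isMaxClique (h.ws.root.isClique_ball m)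
  have hwM : w ∈ M := hsub (by grind)
  have haM : a ∈ M := hsub (by grind)
  have hxM : x ∈ M := hsub (by
    change T.D _ _ ≤ 2
    have f := T.fp x m a w
    have c3 := T.D_comm m a
    have h5 := h.xa
    grind)
  have hMK : M ≠ K := by
    rintro rfl
    rw [h.ball] at hwM
    grind
  have e := h.uniq M hM hMK haM hxM
  rw [e, h.ballQ] at hwM
  have : T.D w y₀ ≤ 2 := hwM
  have := h.D_y₀_cases w
  omega

/-- There are no real nodes below `a` at distance two or three from `a`. -/
theorem below_a [Finite V] {u : V} (hu : T.real u ∈ edgeSide T a x)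
    (huc : T.D u c = T.D u a + 1) :
    u = a ∨ T.D u a = 1 ∨ 4 ≤ T.D u a := by
  by_contra! hno
  have h0 : T.D u a ≠ 0 := fun e => hno.1 (T.d_eq_zero.1 e)
  obtain ⟨m, m1, m2⟩ := T.D_between a u (i := 1) (by grind)
  have c1 := T.D_comm a u
  have c2 := T.D_comm m u
  have t := T.D_tri x a m
  have h1 := h.xa
  unfold d at h1
  have h2 := h.not_both (m := m) (u := u) (by omega)
    (by have := h.D_x₂ (m := m); omega) (by omega)
  omega

theorem swap_d_cross {u w : V} (hu : T.real u ∈ edgeSide T a x) (hw : T.real w ∉ edgeSide T a x) :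
    h.swap.d u w = T.D u c + 1 + T.D w y₀ := by
  have h1 : h.swap.d u w = T.D u c + 1 + T.D y₀ w :=
    h.isBridge.d_mem_not_mem hu hw
  grind

theorem swap_d_mem {u w : V} (hu : T.real u ∈ edgeSide T a x) (hw : T.real w ∈ edgeSide T a x) :
    h.swap.d u w = T.d u w :=
  h.isBridge.d_mem_mem hu hw

theorem swap_d_not_mem {u w : V} (hu : T.real u ∉ edgeSide T a x)
    (hw : T.real w ∉ edgeSide T a x) : h.swap.d u w = T.d u w :=
  h.isBridge.d_not_mem_not_mem hu hw

theorem cross_cases [Finite V] {u w : V} (hu : T.real u ∈ edgeSide T a x)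
    (hw : T.real w ∉ edgeSide T a x) :
    h.swap.d u w = T.d u w ∨ (5 ≤ T.d u w ∧ 5 ≤ h.swap.d u w) ∨
      (w = x ∧ T.D u c = T.D u a + 1 ∧
        T.D u a ≤ 1 ∧ h.swap.d u w = T.d u w + 2) := by
  have h1 := h.swap_d_cross hu hw
  have h2 : T.d u w = _ := (h.cross hu hw).1
  have h3 := h.D_c_cases u
  have h4 := h.D_y₀_cases w
  have c1 := T.D_comm x w
  by_cases hwx : w = x
  · have h5 : T.D w x = 0 := by grind
    rcases h3 with h3 | h3
    · grind
    · have h6 := h.below_a hu h3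
      grind
  · have h5 := h.three_le hw hwx
    have h6 : T.D w x = 3 → T.D w y₀ = 2 := h.three_eq hw
    have h7 : T.D u c + 1 = T.D u a → 2 ≤ T.D u c := by
      intro h8
      by_contra hlt
      have h9 := h.only u (by omega)
      grind
    omega

theorem eq_pair [Finite V] {v : V} (hvK : v ∈ K) (hvQ : v ∈ Q) : v = a ∨ v = x := by
  rw [h.ball] at hvK
  rw [h.ballQ] at hvQ
  have h1 : T.D v c ≤ 2 := hvK
  have h2 : T.D v y₀ ≤ 2 := hvQ
  by_cases hv : T.real v ∈ edgeSide T a x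
  · left
    have h3 := h.D_y₀ hv
    exact T.d_eq_zero.1 (by grind)
  · right
    have h3 := h.D_c hv
    exact T.d_eq_zero.1 (by grind)

theorem a_mem_K : a ∈ K := by rw [h.ball]; change T.D _ _ ≤ 2; have := h.ac; omega
theorem x_mem_K : x ∈ K := by rw [h.ball]; exact h.xc.le
theorem a_mem_Q : a ∈ Q := by rw [h.ballQ]; exact h.ay.le
theorem x_mem_Q : x ∈ Q := by rw [h.ballQ]; change T.D _ _ ≤ 2; have := h.xy; omega

theorem inter_eq [Finite V] : K ∩ Q = {a, x} := by
  refine Set.Subset.antisymm (fun v hv => h.eq_pair hv.1 hv.2) ?_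
  rintro v (rfl | rfl)
  · exact ⟨h.a_mem_K, h.a_mem_Q⟩
  · exact ⟨h.x_mem_K, h.x_mem_Q⟩

theorem eq_x_of_mem {w : V} (hw : w ∈ K) (hwA : T.real w ∉ edgeSide T a x) : w = x := by
  rw [h.ball] at hw
  have h1 : T.D w c ≤ 2 := hw
  have h3 := h.D_c hwA
  exact T.d_eq_zero.1 (by grind)

theorem eq_a_of_mem {w : V} (hw : w ∈ Q) (hwA : T.real w ∈ edgeSide T a x) : w = a := by
  rw [h.ballQ] at hw
  have h1 : T.D w y₀ ≤ 2 := hw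
  have h3 := h.D_y₀ hwA
  exact T.d_eq_zero.1 (by grind)

theorem eq_of_mem [Finite V] {X : Set V} (hX : IsCliqueIntersection G X) {u : V} (hx : x ∈ X)
    (hu : u ∈ X) (huA : T.real u ∈ edgeSide T a x)
    (huc : T.D u c = T.D u a + 1)
    (hua : T.D u a ≤ 1) : X = K ∨ X = Q ∨ X = {a, x} := by
  obtain ⟨𝒦, ⟨L, hL⟩, hmax, rfl⟩ := hX
  have key : ∀ M ∈ 𝒦, M = K ∨ M = Q := fun M hM => by
    by_contra! hno
    by_cases hua' : u = a
    · exact hno.2 (h.uniq M (hmax M hM) hno.1 (hua' ▸ hu M hM) (hx M hM))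
    · have h0 : T.D u a ≠ 0 := fun e => hua' (T.d_eq_zero.1 e)
      have := h.few M (hmax M hM) hno.1 u (hu M hM) x (hx M hM) (by grind) h.xa
        (by omega) h.xc
      exact h.x_not_mem (this ▸ huA)
  rw [← h.inter_eq]
  grind

theorem swap_d [Finite V] (u v : V) : h.swap.d u v = T.d u v ∨
    (5 ≤ T.d u v ∧ 5 ≤ h.swap.d u v) ∨
    (h.swap.d u v = T.d u v + 2 ∧ T.d u v ≤ 2 ∧
      ∀ X, IsCliqueIntersection G X → u ∈ X → v ∈ X → X = K ∨ X = Q ∨ X = {a, x}) := by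
  by_cases hu : T.real u ∈ edgeSide T a x <;> by_cases hv : T.real v ∈ edgeSide T a x
  · exact Or.inl (h.swap_d_mem hu hv)
  · rcases h.cross_cases hu hv with h1 | h1 | ⟨rfl, h2, h3, h4⟩
    · grind
    · grind
    · refine Or.inr (Or.inr ⟨h4, ?_, fun X hX huX hvX => h.eq_of_mem hX hvX huX hu h2 h3⟩)
      have h5 := (h.cross hu hv).1
      grind
  · rw [h.swap.d_comm, T.d_comm u]
    rcases h.cross_cases hv hu with h1 | h1 | ⟨rfl, h2, h3, h4⟩
    · grind
    · grind
    · refine Or.inr (Or.inr ⟨h4, ?_, fun X hX huX hvX => h.eq_of_mem hX huX hvX hv h2 h3⟩)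
      have h5 := (h.cross hv hu).1
      grind
  · exact Or.inl (h.swap_d_not_mem hu hv)

theorem d_le_swap [Finite V] {u v : V} (huv : T.d u v ≤ 4) : T.d u v ≤ h.swap.d u v := by
  rcases h.swap_d u v with h1 | h1 | h1 <;> omega

theorem swap_isRoot [Finite V] : h.swap.IsRoot 4 G := by
  intro u v huv
  rw [h.ws.root.adj_iff huv]
  change _ ↔ h.swap.d u v ≤ 4
  rcases h.swap_d u v with h1 | h1 | h1 <;> omega

theorem d_le_swap_of_mem [Finite V] {X : Set V} (hX : G.IsClique X) (u) (hu : u ∈ X) (v)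
    (hv : v ∈ X) : T.d u v ≤ h.swap.d u v :=
  h.d_le_swap (h.ws.root.d_le hX hu hv)

theorem unchanged_or [Finite V] {X : Set V} (hX : IsCliqueIntersection G X) :
    (∀ u ∈ X, ∀ v ∈ X, h.swap.d u v = T.d u v) ∨ X = K ∨ X = Q ∨ X = {a, x} := by
  by_cases hno : X = K ∨ X = Q ∨ X = {a, x}
  · grind
  · left
    intro u hu v hv
    have h4 := h.ws.root.d_le hX.isClique hu hv
    rcases h.swap_d u v with h1 | h1 | ⟨h1, h2, h3⟩
    · exact h1
    · omega
    grind

theorem swap_d_ax : h.swap.d a x = 3 := by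
  have h1 := h.swap_d_cross h.a_mem h.x_not_mem
  have h2 := h.ac
  have h3 := h.xy
  omega

theorem swap_leaf [Finite V] {X : Set V} (hX : IsCliqueIntersection G X) :
    h.swap.LeafAt G X := by
  rcases h.unchanged_or hX with h1 | rfl | rfl | rfl
  · exact h.ws.leafAt_congr hX h1
  · exact h.ws.leafAt_of_le h.hK (h.d_le_swap_of_mem h.hK.isClique) h.swap_isRoot
  · exact h.ws.leafAt_of_le h.hQ (h.d_le_swap_of_mem h.hQ.isClique) h.swap_isRoot
  · intro v hv
    have hax : a ≠ x := fun e => by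
      have := h.ax
      grind
    have h3 := h.swap_d_ax
    have h4 := h.swap.d_comm a x
    have hle : ∀ u ∈ ({a, x} : Set V), ∀ u' ∈ ({a, x} : Set V), h.swap.d u u' ≤ 3 := by grind
    rcases hv.1 with e | e <;> rw [e]
    all_goals grind

theorem swap_side [Finite V] {X : Set V} (hX : IsCliqueIntersection G X) :
    h.swap.SideAt G X := by
  rcases h.unchanged_or hX with h1 | rfl | rfl | rfl
  · exact h.ws.sideAt_congr hX h1
  · exact h.ws.sideAt_of_le h.hK (h.d_le_swap_of_mem h.hK.isClique)
  · exact h.ws.sideAt_of_le h.hQ (h.d_le_swap_of_mem h.hQ.isClique)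
  · intro p hp q hq hpq _
    have := h.swap_d_ax
    left
    have key : ∀ v ∈ ({a, x} : Set V), h.swap.d v q < 3 → v = q := by grind
    intro v v' hv hv' h3 h4
    rw [key v hv.1 h3, key v' hv'.1 h4]

/-- The copy of the center of `K`. -/
def newCenter : h.swap.Node := h.isBridge.inl h.c_mem

theorem swap_D_newCenter {u : V} (hu : u ∈ K) :
    h.swap.D u h.newCenter = T.D u c := by
  by_cases huA : T.real u ∈ edgeSide T a x
  · exact h.isBridge.D_inl huA h.c_mem
  · have h1 := h.isBridge.D_inl' huA h.c_mem
    obtain rfl := h.eq_x_of_mem hu huA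
    have h2 := h.xc
    have h3 := h.xy
    have c1 := T.D_comm y₀ u
    rw [T.D_self] at h1
    refine h1.trans ?_
    omega

theorem swap_path [Finite V] {M : Set V} (hM : IsMaxClique G M) {v : V} (hv : IsFree G M v) :
    h.swap.PathAt M v := by
  obtain ⟨p, hp, q, hq, hpq⟩ := h.ws.diam M hM v hv
  obtain ⟨t, htM⟩ := h.ws.root.exists_center hM ⟨p, hp⟩
  have hmem : ∀ u, u ∈ M ↔ T.D u t ≤ 2 := fun u => by grind
  obtain ⟨hvt, y, hP⟩ := h.ws.exists_path hM hv fun u hu => (hmem u).1 hu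
  obtain ⟨hvy, hyt, hS, hnb⟩ := id hP
  have hpq' : h.swap.d p q = 4 := le_antisymm (h.swap_isRoot.d_le hM.isClique hp hq)
    (hpq ▸ h.d_le_swap hpq.le)
  have uniq : ∀ s, M = T.ball s → s = t := fun s hs =>
    center_unique hpq (by grind) (by grind) ((hmem p).1 hp) ((hmem q).1 hq)
  by_cases hMK : M = K
  · obtain rfl := uniq c (hMK.trans h.ball)
    have hvA : T.real v ∈ edgeSide T a x := by
      by_contra hvA
      obtain rfl := h.eq_x_of_mem (hMK ▸ hv.1) hvA
      exact hS a (mid_unique hvt h.xa h.ac hvy hyt)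
    have hyA : y ∈ edgeSide T a x := by
      by_contra hyA
      have := h.D_c hyA
      omega
    refine h.isBridge.pathAt_inl hp hq hpq' hvt hP h.c_mem hyA ?_ hvA ?_
    · grind
    · intro u hu
      exact (h.swap_D_newCenter (hMK ▸ hu)).trans_le ((hmem u).1 hu)
  by_cases hMQ : M = Q
  · obtain rfl := uniq y₀ (hMQ.trans h.ballQ)
    have hvA : T.real v ∉ edgeSide T a x := by
      intro hvA
      obtain rfl := h.eq_a_of_mem (hMQ ▸ hv.1) hvA
      exact hS x (mid_unique hvt h.ax h.xy hvy hyt)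
    have hyA : y ∉ edgeSide T a x := by
      intro hyA
      have := h.D_y₀ hyA
      omega
    refine h.isBridge.pathAt_inr hp hq hpq' hvt hP h.y₀_mem (h.mem_iff_not.2 hyA) ?_ hvA ?_
    · grind
    · intro u hu
      by_cases huA : T.real u ∈ edgeSide T a x
      · obtain rfl := h.eq_a_of_mem (hMQ ▸ hu) huA
        refine (h.isBridge.D_inr' huA h.y₀_mem).trans_le ?_
        have := h.ac
        grind
      · exact (h.isBridge.D_inr huA h.y₀_mem).trans_le ((hmem u).1 hu)
  by_cases htA : t ∈ edgeSide T a x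
  · have hsub : ∀ u ∈ M, T.real u ∈ edgeSide T a x := by
      intro u hu
      by_contra huA
      have h1 := (h.cross htA huA).1
      have h2 := (hmem u).1 hu
      have c1 := T.D_comm t u
      have c2 := T.D_comm x u
      have c3 := T.D_comm t a
      have hux : u = x := by
        by_contra hux
        have := h.three_le huA hux
        omega
      have hx₂ : x₂ ∈ M := by
        rw [hmem]
        have := h.D_x₂ (m := t)
        omega
      exact h.x₂x (h.few M hM hMK x₂ hx₂ x (hux ▸ hu) h.x₂a h.xa h.x₂c h.xc)
    have hyA : y ∈ edgeSide T a x := convex_edgeSide h.xa _ (hsub v hv.1) _ htA y (by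
        change T.D _ _ + T.D _ _ = T.D _ _
        omega)
    have hyc : y ≠ c := by
      rintro rfl
      rcases hnb a (by rw [T.D_comm]; exact h.ac) with e | e
      · obtain rfl := T.real.injective e
        obtain ⟨r, hr, hrt, hra⟩ : ∃ r ∈ K, T.D r t ≤ 2 ∧ a ≠ r := by
          obtain ⟨p', hp', q', hq', hpq'⟩ := h.far
          have key : ∀ r ∈ K, T.D r y = 2 → T.D r a ≠ 1 →
              ∃ r ∈ K, T.D r t ≤ 2 ∧ a ≠ r := by
            intro r hr h2 h3
            obtain ⟨m, m1, m2⟩ := exists_mid h2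
            grind
          have hp2 : T.D p' y ≤ 2 := by rw [h.ball] at hp'; exact hp'
          have hq2 : T.D q' y ≤ 2 := by rw [h.ball] at hq'; exact hq'
          have t1 := T.D_tri p' y q'
          have t2 := T.D_tri p' a q'
          grind
        refine not_isFree_of_mem (h.hK.isCliqueIntersection.inter hM.isCliqueIntersection)
          ⟨Set.inter_subset_right, fun hsub => hMK ?_⟩ (u := r) ⟨hr, (hmem r).2 hrt⟩
          ⟨h.a_mem_K, hv.1⟩ hra.symm hv
        exact hM.eq_of_subset h.hK.isClique fun w hw => (hsub hw).1
      · have : x ∈ M := by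
          rw [hmem, ← e]
          have := h.xa
          grind
        exact h.x_not_mem (hsub x this)
    refine h.isBridge.pathAt_inl hp hq hpq' hvt hP htA hyA hyc (hsub v hv.1) ?_
    intro u hu
    exact (h.isBridge.D_inl (hsub u hu) htA).trans_le ((hmem u).1 hu)
  · have hsub : ∀ u ∈ M, T.real u ∉ edgeSide T a x := by
      intro u hu huA
      have h1 := (h.cross huA htA).1
      have h2 := (hmem u).1 hu
      have h3 := (h.cross h.a_mem htA).1
      rw [T.D_self] at h3
      refine hMQ (h.uniq M hM hMK ((hmem a).2 (by omega)) ((hmem x).2 (by omega)))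
    have hyA : y ∉ edgeSide T a x := h.mem_iff_not.1 (convex_edgeSide h.ax _
      (h.mem_iff_not.2 (hsub v hv.1)) _ (h.mem_iff_not.2 htA) y (by
        change T.D _ _ + T.D _ _ = T.D _ _
        omega))
    have hyc : y ≠ y₀ := by
      rintro rfl
      rcases hnb x (by rw [T.D_comm]; exact h.xy) with e | e
      · obtain rfl := T.real.injective e
        obtain ⟨r, hrQ, hrK⟩ : ∃ r ∈ Q, r ∉ K := by
          by_contra! hno
          exact h.ne (h.hQ.eq_of_subset h.hK.isClique hno).symm
        have hrx : r ≠ x := by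
          rintro rfl
          exact hrK h.x_mem_K
        have hrA : T.real r ∉ edgeSide T a x := fun hrA =>
          hrK (h.eq_a_of_mem hrQ hrA ▸ h.a_mem_K)
        have h1 := h.three_le hrA hrx
        have h2 : T.D r y ≤ 2 := by rw [h.ballQ] at hrQ; exact hrQ
        have h3 := h.D_y₀_cases r
        obtain ⟨m, m1, m2⟩ := exists_mid (by omega : T.D r y = 2)
        have hrM : r ∈ M := by grind
        refine not_isFree_of_mem (h.hQ.isCliqueIntersection.inter hM.isCliqueIntersection)
          ⟨Set.inter_subset_right, fun hsub => hMQ ?_⟩ (u := r) ⟨hrQ, hrM⟩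
          ⟨h.x_mem_Q, hv.1⟩ hrx hv
        exact hM.eq_of_subset h.hQ.isClique fun w hw => (hsub hw).1
      · have : a ∈ M := by
          rw [hmem, ← e]
          have := h.ax
          grind
        exact hsub a this h.a_mem
    refine h.isBridge.pathAt_inr hp hq hpq' hvt hP (h.mem_iff_not.2 htA) (h.mem_iff_not.2 hyA) hyc (hsub v hv.1) ?_
    intro u hu
    exact (h.isBridge.D_inr (hsub u hu) (h.mem_iff_not.2 htA)).trans_le ((hmem u).1 hu)

theorem swap_metricWS [Finite V] : MetricWS h.swap G where
  root := h.swap_isRoot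
  leaf _ hX := h.swap_leaf hX
  side _ hX := h.swap_side hX
  path M hM v hv c' y' hc' _ := h.swap_path hM hv c' y' hc'
  diam M hM v hv := by
    obtain ⟨p, hp, q, hq, hpq⟩ := h.ws.diam M hM v hv
    exact ⟨p, hp, q, hq, le_antisymm (h.swap_isRoot.d_le hM.isClique hp hq)
      (hpq ▸ h.d_le_swap hpq.le)⟩

theorem swap_ball [Finite V] : K = h.swap.ball h.newCenter :=
  h.swap_isRoot.eq_ball h.hK fun u hu => by
    rw [h.swap_D_newCenter hu]
    rw [h.ball] at hu
    exact hu

section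

variable {S M : Set V} (hM : IsMaxClique G M) (hMK : M ≠ K) (hS : S = K ∩ M)
  (hno : ¬ (a ∈ S ∧ x ∈ S))
include hM hMK hS hno

theorem eq_x_of_x_mem [Finite V] (hx : x ∈ S) {s : V} (hs : s ∈ S) : s = x := by
  subst hS
  by_contra hsx
  have hsA : T.real s ∈ edgeSide T a x := by
    by_contra hsA
    exact hsx (h.eq_x_of_mem hs.1 hsA)
  have hsc : T.D s c ≤ 2 := by
    have := hs.1
    rw [h.ball] at this
    exact this
  have hsa : s ≠ a := by grind
  have h1 : 2 ≤ T.D s c := by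
    by_contra hlt
    exact hsa (h.only s (by omega))
  rcases h.D_c_cases s with h2 | h2
  · have h3 := (h.cross hsA h.x_not_mem).1
    rw [T.D_self] at h3
    exact hMK (eq_of_far h.ws.root hM h.hK hs.2 hx.2 hs.1 hx.1 (by grind))
  · exact hsx (h.few M hM hMK s hs.2 x hx.2 (by grind) h.xa (by omega) h.xc)

theorem swap_d_eq [Finite V] : ∀ u ∈ S, ∀ v ∈ S, h.swap.d u v = T.d u v := by
  intro u hu v hv
  by_cases hx : x ∈ S
  · rw [h.eq_x_of_x_mem hM hMK hS hno hx hu, h.eq_x_of_x_mem hM hMK hS hno hx hv, T.d_self,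
      h.swap.d_self]
  · have key : ∀ s ∈ S, T.real s ∈ edgeSide T a x := by
      intro s hs
      by_contra hsA
      have e := h.eq_x_of_mem (hS ▸ hs).1 hsA
      grind
    exact h.swap_d_mem (key u hu) (key v hv)

theorem exists_le_swap [Finite V] {W : Set V} (hxW : x ∉ S → x ∈ W) {w : V} (hw : w ∈ W) :
    ∃ w' ∈ W, ∀ s ∈ S, T.d s w' ≤ h.swap.d s w := by
  by_cases hle : ∀ s ∈ S, T.d s w ≤ h.swap.d s w
  · grind
  push Not at hle
  obtain ⟨s, hs, hlt⟩ := hle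
  have hsK : s ∈ K := by grind
  have hsA : T.real s ∈ edgeSide T a x := by
    by_contra hsA
    by_cases hwA : T.real w ∈ edgeSide T a x
    · rw [h.swap.d_comm, T.d_comm, h.swap_d_cross hwA hsA] at hlt
      have h1 : T.d w s = _ := (h.cross hwA hsA).1
      have h2 := h.D_c_cases w
      have h3 := h.xy
      rw [h.eq_x_of_mem hsK hsA] at h1 hlt
      grind
    · rw [h.swap_d_not_mem hsA hwA] at hlt
      omega
  have hwA : T.real w ∉ edgeSide T a x := fun hwA => by
    rw [h.swap_d_mem hsA hwA] at hlt
    omega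
  by_cases hx : x ∈ S
  · exact absurd (h.eq_x_of_x_mem hM hMK hS hno hx hs ▸ hsA) h.x_not_mem
  refine ⟨x, hxW hx, fun u hu => ?_⟩
  have huK : u ∈ K := by grind
  have huA : T.real u ∈ edgeSide T a x := by
    by_contra huA
    exact hx (h.eq_x_of_mem huK huA ▸ hu)
  rw [h.swap_d_cross huA hwA]
  have h1 : T.d u x = _ := (h.cross huA h.x_not_mem).1
  have h2 := h.D_c_cases u
  have h3 : T.D w y₀ ≠ 0 := fun e => by
    have h4 := h.swap_d_cross hsA hwA
    have h5 : T.d s w = _ := (h.cross hsA hwA).1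
    have h6 := T.D_eq_zero.1 e
    have h7 := h.xy
    rw [h6] at h5
    have h8 := h.three_le hwA (fun e => by grind)
    grind
  grind

end

end SwapData

end SteinerTree

end

section

/-! ## Trees given by a parent function -/

namespace CenteredTree

variable (F : CenteredTree) (r : ℕ) (p : ℕ → ℕ)

/-- `F` is given by the function that maps every node to its parent, and the root `r` to itself;
the depth is at most two. -/
structure IsRooted : Prop where
  nodup : F.nodes.Nodup
  edges_eq : F.edges = F.nodes.map fun x => (x, p x)
  root_mem : r ∈ F.nodes
  root_eq : p r = r
  parent_mem : ∀ x ∈ F.nodes, p x ∈ F.nodes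
  depth : ∀ x ∈ F.nodes, p (p x) = r
  center_subset : F.center ⊆ F.nodes

variable {F r p} (h : F.IsRooted r p)
include h

theorem IsRooted.adj_iff {x y : {x : ℕ // x ∈ F.nodes}} :
    F.graph.Adj x y ↔ x ≠ y ∧ (p x = y ∨ p y = x) := by
  rw [graph, SimpleGraph.fromRel_adj, h.edges_eq]
  grind

theorem IsRooted.isTree : F.graph.IsTree := by
  have hstep : ∀ x : {x : ℕ // x ∈ F.nodes}, F.graph.Reachable x ⟨p x, h.parent_mem x x.2⟩ := by
    intro x
    by_cases e : x = ⟨p x, h.parent_mem x x.2⟩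
    · rw [← e]
    · exact (h.adj_iff.2 ⟨e, Or.inl rfl⟩).reachable
  have hroot : ∀ x : {x : ℕ // x ∈ F.nodes}, F.graph.Reachable x ⟨r, h.root_mem⟩ := by
    intro x
    have h1 := (hstep x).trans (hstep ⟨p x, h.parent_mem x x.2⟩)
    have h2 : (⟨p (p x), h.parent_mem _ (h.parent_mem x x.2)⟩ : {x : ℕ // x ∈ F.nodes}) =
      ⟨r, h.root_mem⟩ := Subtype.ext (h.depth x x.2)
    grind
  have hconn : F.graph.Connected := by
    rw [SimpleGraph.connected_iff]
    exact ⟨fun x y => (hroot x).trans (hroot y).symm, ⟨⟨r, h.root_mem⟩⟩⟩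
  rw [SimpleGraph.isTree_iff_connected_and_card]
  refine ⟨hconn, le_antisymm ?_ hconn.card_vert_le_card_edgeSet_add_one⟩
  have hsub : F.graph.edgeSet ⊆
      (fun x : {x : ℕ // x ∈ F.nodes} => s(x, ⟨p x, h.parent_mem x x.2⟩)) ''
        {⟨r, h.root_mem⟩}ᶜ := by
    intro e he
    induction e with
    | _ x y =>
      obtain ⟨h1, h2⟩ := h.adj_iff.1 ((SimpleGraph.mem_edgeSet _).1 he)
      rcases h2 with h2 | h2
      · refine ⟨x, fun hx => h1 ?_, ?_⟩
        · subst hx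
          exact Subtype.ext (by rw [← h2]; exact h.root_eq.symm)
        grind
      · refine ⟨y, fun hy => h1 ?_, ?_⟩
        · subst hy
          exact Subtype.ext (by rw [← h2]; exact h.root_eq)
        grind
  have h1 : Nat.card F.graph.edgeSet ≤ ({⟨r, h.root_mem⟩}ᶜ : Set {x : ℕ // x ∈ F.nodes}).ncard := by
    exact (Set.ncard_le_ncard hsub (Set.toFinite _)).trans (Set.ncard_image_le (Set.toFinite _))
  have h2 := Set.ncard_add_ncard_compl ({⟨r, h.root_mem⟩} : Set {x : ℕ // x ∈ F.nodes})
  rw [Set.ncard_singleton] at h2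
  omega

theorem IsRooted.isValid {n : ℕ} {K : Set (Fin n)}
    (hK : ∀ v : Fin n, (v : ℕ) ∈ F.nodes → v ∈ K) : F.IsValid K where
  nodup := h.nodup
  edges_mem e he := by
    rw [h.edges_eq] at he
    obtain ⟨x, hx, rfl⟩ := List.mem_map.1 he
    exact ⟨hx, h.parent_mem x hx⟩
  isTree := h.isTree
  center_subset := h.center_subset
  real_subset := hK

theorem IsRooted.represents {n : ℕ} {T : SteinerTree (Fin n)} {B C : Set T.Node} (ν : ℕ → T.Node)
    (hinj : ∀ x ∈ F.nodes, ∀ y ∈ F.nodes, ν x = ν y → x = y)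
    (himage : ∀ z, z ∈ B ↔ ∃ x ∈ F.nodes, ν x = z)
    (hparent : ∀ x ∈ F.nodes, x ≠ r →
      T.D (ν x) (ν (p x)) = 1 ∧ T.D (ν x) (ν r) = T.D (ν (p x)) (ν r) + 1)
    (hreal : ∀ x ∈ F.nodes, ∀ v : Fin n, (v : ℕ) = x ↔ T.real v = ν x)
    (hcenter : ∀ x ∈ F.nodes, x ∈ F.center ↔ ν x ∈ C) (hCB : C ⊆ B) : F.Represents T B C := by
  have hadj : ∀ x ∈ F.nodes, ∀ y ∈ F.nodes, T.D (ν x) (ν y) = 1 →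
      T.D (ν x) (ν r) = T.D (ν y) (ν r) + 1 → p x = y := by
    intro x hx y hy h1 h2
    have hxr : x ≠ r := by grind
    refine hinj _ (h.parent_mem x hx) y hy (T.D_eq_zero.1 ?_)
    have f := T.fp (ν (p x)) (ν y) (ν x) (ν r)
    grind
  have himage' : ∀ x : {x : ℕ // x ∈ F.nodes}, ν x ∈ B := fun x => (himage _).2 ⟨x, x.2, rfl⟩
  refine ⟨⟨Equiv.ofBijective (fun x => (⟨ν x, himage' x⟩ : B)) ⟨?_, ?_⟩, ?_⟩, ?_, ?_, hCB⟩
  · intro x y hxy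
    grind
  · rintro ⟨z, hz⟩
    obtain ⟨x, hx, rfl⟩ := (himage z).1 hz
    exact ⟨⟨x, hx⟩, rfl⟩
  · intro x y
    rw [h.adj_iff]
    change T.graph.Adj (ν x) (ν y) ↔ _
    rw [← T.D_eq_one]
    constructor
    · intro h1
      refine ⟨?_, ?_⟩
      · grind
      · have p1 := T.par (ν x) (ν y) (ν r)
        have t1 := T.D_tri (ν x) (ν y) (ν r)
        have t2 := T.D_tri (ν y) (ν x) (ν r)
        grind
    · rintro ⟨h1, h2⟩
      have key : ∀ x y : {x : ℕ // x ∈ F.nodes}, x ≠ y → p x = y → T.D (ν x) (ν y) = 1 := by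
        intro x y hxy e
        rw [← e]
        refine (hparent x x.2 fun hr => hxy (Subtype.ext ?_)).1
        rw [← e, hr, h.root_eq]
      grind
  · exact fun a v => hreal a a.2 v
  · exact fun a => hcenter a a.2

end CenteredTree

/-! ## The members of the family -/

/-- The data that determine one member of the family: the central node, the parent of the nodes
on a distinguished branch, a node on this branch, an exceptional node (numbers `≥ n` stand for
Steiner or missing nodes), two maximal cliques, and two switches. -/
structure Guess (q : ℕ) where
  c : ℕ
  a₀ : ℕ
  x₀ : ℕ
  e : ℕ
  j : Fin q
  l : Fin q
  mode : ℕ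
  g : Prop

namespace Guess

variable {n q : ℕ} (Cl : Fin q → Set (Fin n)) (i : Fin q) (τ : Guess q)

/-- Some maximal clique other than `Cl i` contains `u` and `v`. -/
def Share (u v : Fin n) : Prop := ∃ m, m ≠ i ∧ u ∈ Cl m ∧ v ∈ Cl m

def Rel (u v : Fin n) : Prop := u = v ∨ τ.g ∨ Share Cl i u v

/-- Two maximal cliques meet outside `Cl i`. -/
def MeetOut (l m : Fin q) : Prop := ∃ w, w ∈ Cl l ∧ w ∈ Cl m ∧ w ∉ Cl i

/-- The vertex is on a branch that need not be represented. -/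
def Dropped (v : Fin n) : Prop :=
  ∃ m, m ≠ i ∧ v ∈ Cl m ∧ (∃ u ∈ Cl i, u ∈ Cl m ∧ u ≠ v) ∧
    ∀ l, l ≠ i → (∃ u ∈ Cl i, u ∈ Cl l ∧ u ∈ Cl m ∧ (u : ℕ) ≠ τ.c) →
      ∀ u ∈ Cl i, u ∈ Cl l → (u : ℕ) ≠ τ.c → u ∈ Cl m

/-- The ways to recognize the neighbours of the central node. -/
def NearByMode (v : Fin n) : Prop :=
  (τ.mode = 0 ∧ v ∈ Cl τ.j ∧ v ∈ Cl τ.l) ∨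
  (τ.mode = 1 ∧ v ∈ Cl τ.j ∧ v ∉ Cl τ.l) ∨
  (τ.mode = 2 ∧ v ∈ Cl τ.j ∧ (v : ℕ) ≠ τ.e ∧ ¬ ∃ m, v ∈ Cl m ∧
    (∀ u ∈ Cl i, u ∈ Cl τ.j → u ∈ Cl m → u = v ∨ (u : ℕ) = τ.a₀) ∧
    (MeetOut Cl i m τ.j ∨ ∃ u ∈ Cl i, u ∈ Cl τ.j ∧ u ∈ Cl m ∧ u ≠ v)) ∨
  (τ.mode = 3 ∧ v ∈ Cl τ.j ∧ ((v : ℕ) = τ.e ∨ ∃ m, v ∈ Cl m ∧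
    (∀ u ∈ Cl i, u ∈ Cl τ.j → u ∈ Cl m → u = v ∨ (u : ℕ) = τ.c) ∧
    ∃ u ∈ Cl i, u ∈ Cl m ∧ u ≠ v)) ∨
  (τ.mode = 4 ∧ ¬ Dropped Cl i τ v ∧ ∃ l, l ≠ i ∧ v ∈ Cl l ∧ (∃ u ∈ Cl i, u ∈ Cl l ∧ u ≠ v) ∧
    ∃ m, m ≠ i ∧ v ∈ Cl m ∧ ∃ w ∈ Cl i, w ∈ Cl m ∧ w ∉ Cl l)

def Near (v : Fin n) : Prop := (v : ℕ) = τ.a₀ ∨ NearByMode Cl i τ v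

def OnBranch (v : Fin n) : Prop := ∃ x : Fin n, (x : ℕ) = τ.x₀ ∧ Rel Cl i τ v x

def Kept (v : Fin n) : Prop :=
  τ.mode ≠ 4 ∨ (v : ℕ) = τ.a₀ ∨ ¬ Dropped Cl i τ v ∨ OnBranch Cl i τ v

/-- There is evidence that `v` is a child of `a`. -/
def Evidence (v a : Fin n) : Prop :=
  (τ.mode ≠ 0 ∧ Share Cl i v a) ∨
  (τ.mode = 0 ∧ ∃ m, m ≠ i ∧ v ∈ Cl m ∧ a ∈ Cl m ∧
    ((∃ u ∈ Cl i, ((u : ℕ) = τ.c ∨ Near Cl i τ u) ∧ u ∉ Cl m) ∨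
    ∃ l, l ≠ i ∧ l ≠ m ∧ a ∈ Cl l ∧ (MeetOut Cl i l m ∨
      ∃ u ∈ Cl i, (u : ℕ) ≠ τ.c ∧ ¬ Near Cl i τ u ∧ u ∈ Cl l ∧ u ∈ Cl m)))

/-- `a` can be the parent of `v`. -/
def Candidate (v a : Fin n) : Prop :=
  a ∈ Cl i ∧ (a : ℕ) ≠ τ.c ∧ Near Cl i τ a ∧ Kept Cl i τ a ∧ Evidence Cl i τ v a

/-- `v` and `u` are children of the same Steiner node, if `v` is the child of a Steiner node. -/
def Sibling (v u : Fin n) : Prop :=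
  u ∈ Cl i ∧ (u : ℕ) ≠ τ.c ∧ ¬ Near Cl i τ u ∧ Rel Cl i τ v u

open Classical in
/-- The parent of a real node; the number `n + 1 + u` stands for the Steiner node whose first
child is `u`. -/
noncomputable def parent (v : Fin n) : ℕ :=
  if (v : ℕ) = τ.c ∨ Near Cl i τ v then τ.c
  else if τ.mode ≠ 4 ∧ OnBranch Cl i τ v then
    if τ.a₀ < n then τ.a₀ else n + 1 + sInf (Fin.val '' {u | Sibling Cl i τ v u})
  else if ∃ a, Candidate Cl i τ v a then sInf (Fin.val '' {a | Candidate Cl i τ v a})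
  else n + 1 + sInf (Fin.val '' {u | Sibling Cl i τ v u})

/-- The node `n + 1 + u` is present. -/
def Used (u : Fin n) : Prop :=
  ∃ v ∈ Cl i, (v : ℕ) ≠ τ.c ∧ Kept Cl i τ v ∧ parent Cl i τ v = n + 1 + u

open Classical in
/-- The elements of a set, in increasing order. -/
noncomputable def listOf (A : Set (Fin n)) : List (Fin n) :=
  (List.finRange n).filter fun v => v ∈ A

@[simp] theorem mem_listOf {A : Set (Fin n)} {v : Fin n} : v ∈ listOf A ↔ v ∈ A := by
  simp [listOf]

theorem nodup_listOf (A : Set (Fin n)) : (listOf A).Nodup := (List.nodup_finRange n).filter _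

noncomputable def nodes : List ℕ :=
  τ.c :: ((listOf {v | v ∈ Cl i ∧ (v : ℕ) ≠ τ.c ∧ Kept Cl i τ v}).map Fin.val ++
    (listOf {u | u ∈ Cl i ∧ Used Cl i τ u}).map fun u : Fin n => n + 1 + (u : ℕ))

open Classical in
noncomputable def parentId (x : ℕ) : ℕ :=
  if h : x < n then parent Cl i τ ⟨x, h⟩ else τ.c

open Classical in
/-- The second central node. -/
noncomputable def second : ℕ :=
  if τ.g then
    if τ.a₀ < n then τ.a₀ else if h : τ.x₀ < n then parent Cl i τ ⟨τ.x₀, h⟩ else τ.c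
  else τ.c

noncomputable def tree : CenteredTree where
  nodes := nodes Cl i τ
  edges := (nodes Cl i τ).map fun x => (x, parentId Cl i τ x)
  center := [τ.c, second Cl i τ]

/-- The numbers in a guess are elements of `Cl i` or equal to `n`. -/
structure Admissible : Prop where
  c : τ.c = n ∨ ∃ v ∈ Cl i, (v : ℕ) = τ.c
  a₀ : τ.a₀ = n ∨ ∃ v ∈ Cl i, (v : ℕ) = τ.a₀
  x₀ : τ.x₀ = n ∨ ∃ v ∈ Cl i, (v : ℕ) = τ.x₀
  e : τ.e = n ∨ ∃ v ∈ Cl i, (v : ℕ) = τ.e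

variable {Cl i τ}

theorem mem_nodes {x : ℕ} : x ∈ nodes Cl i τ ↔ x = τ.c ∨
    (∃ v : Fin n, v ∈ Cl i ∧ (v : ℕ) ≠ τ.c ∧ Kept Cl i τ v ∧ (v : ℕ) = x) ∨
    ∃ u : Fin n, u ∈ Cl i ∧ Used Cl i τ u ∧ n + 1 + u = x := by
  simp only [nodes, List.mem_cons, List.mem_append, List.mem_map, mem_listOf, Set.mem_ofPred_eq,
    and_assoc]

theorem Admissible.c_le (h : Admissible Cl i τ) : τ.c ≤ n := by
  rcases h.c with e | ⟨v, -, e⟩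
  · exact e.le
  grind

theorem nodup_nodes (h : Admissible Cl i τ) : (nodes Cl i τ).Nodup := by
  have := h.c_le
  rw [nodes, List.nodup_cons]
  refine ⟨?_, List.Nodup.append ?_ ?_ ?_⟩
  · simp only [List.mem_append, List.mem_map, mem_listOf, not_or]
    grind
  · exact (nodup_listOf _).map Fin.val_injective
  · exact (nodup_listOf _).map fun a b hab => Fin.ext (by grind)
  · intro x hx hy
    grind

theorem rel_self (v : Fin n) : Rel Cl i τ v v := Or.inl rfl

theorem exists_sInf_candidate {v a : Fin n} (h : Candidate Cl i τ v a) :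
    ∃ a, Candidate Cl i τ v a ∧ (a : ℕ) = sInf (Fin.val '' {a | Candidate Cl i τ v a}) :=
  Nat.sInf_mem (s := Fin.val '' {a | Candidate Cl i τ v a}) ⟨a, a, h, rfl⟩

theorem exists_sInf_sibling {v u : Fin n} (h : Sibling Cl i τ v u) :
    ∃ a, Sibling Cl i τ v a ∧ (a : ℕ) = sInf (Fin.val '' {a | Sibling Cl i τ v a}) :=
  Nat.sInf_mem (s := Fin.val '' {a | Sibling Cl i τ v a}) ⟨u, u, h, rfl⟩

theorem parentId_of_ge {x : ℕ} (h : n ≤ x) : parentId Cl i τ x = τ.c := by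
  rw [parentId, dif_neg (by omega)]

theorem parentId_val (v : Fin n) : parentId Cl i τ v = parent Cl i τ v := by
  rw [parentId, dif_pos v.2]

theorem parent_of_near {v : Fin n} (h : (v : ℕ) = τ.c ∨ Near Cl i τ v) :
    parent Cl i τ v = τ.c := by
  rw [parent, if_pos h]

theorem parentId_c (h : Admissible Cl i τ) : parentId Cl i τ τ.c = τ.c := by
  rcases h.c with e | ⟨v, -, e⟩
  · rw [parentId_of_ge e.ge]
  · rw [← e, parentId_val, parent_of_near (Or.inl e), e]

/-- The possible parents of a node. -/
theorem parent_cases {v : Fin n} (hv : v ∈ Cl i) :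
    ((v : ℕ) = τ.c ∨ Near Cl i τ v) ∧ parent Cl i τ v = τ.c ∨
    (¬ ((v : ℕ) = τ.c ∨ Near Cl i τ v) ∧
      ((parent Cl i τ v = τ.a₀ ∧ τ.a₀ < n ∧ τ.mode ≠ 4 ∧ OnBranch Cl i τ v) ∨
      (∃ a, Candidate Cl i τ v a ∧ parent Cl i τ v = a ∧ ¬ (τ.mode ≠ 4 ∧ OnBranch Cl i τ v)) ∨
      ∃ u, Sibling Cl i τ v u ∧
        parent Cl i τ v = n + 1 + sInf (Fin.val '' {a | Sibling Cl i τ v a}) ∧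
        parent Cl i τ v = n + 1 + u ∧
        (τ.mode ≠ 4 ∧ OnBranch Cl i τ v → n ≤ τ.a₀) ∧
        (¬ (τ.mode ≠ 4 ∧ OnBranch Cl i τ v) → ∀ a, ¬ Candidate Cl i τ v a))) := by
  by_cases h1 : (v : ℕ) = τ.c ∨ Near Cl i τ v
  · exact Or.inl ⟨h1, parent_of_near h1⟩
  · refine Or.inr ⟨h1, ?_⟩
    obtain ⟨u, hu, e⟩ := exists_sInf_sibling (u := v)
      (⟨hv, fun e => h1 (Or.inl e), fun e => h1 (Or.inr e), rel_self v⟩ : Sibling Cl i τ v v)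
    by_cases h2 : τ.mode ≠ 4 ∧ OnBranch Cl i τ v
    · by_cases h3 : τ.a₀ < n
      · left
        refine ⟨?_, h3, h2⟩
        rw [parent, if_neg h1, if_pos h2, if_pos h3]
      · refine Or.inr (Or.inr ⟨u, hu, ?_, ?_, fun _ => by omega, fun h => absurd h2 h⟩)
        · rw [parent, if_neg h1, if_pos h2, if_neg h3]
        · rw [parent, if_neg h1, if_pos h2, if_neg h3, e]
    · by_cases h3 : ∃ a, Candidate Cl i τ v a
      · obtain ⟨a, ha⟩ := h3
        obtain ⟨b, hb, e⟩ := exists_sInf_candidate ha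
        refine Or.inr (Or.inl ⟨b, hb, ?_, h2⟩)
        rw [parent, if_neg h1, if_neg h2, if_pos ⟨a, ha⟩, e]
      · refine Or.inr (Or.inr ⟨u, hu, ?_, ?_, fun h => absurd h h2, fun _ a ha => h3 ⟨a, ha⟩⟩)
        · rw [parent, if_neg h1, if_neg h2, if_neg h3]
        · rw [parent, if_neg h1, if_neg h2, if_neg h3, e]

theorem mem_nodes_of_kept {v : Fin n} (hv : v ∈ Cl i) (hk : Kept Cl i τ v) :
    (v : ℕ) ∈ nodes Cl i τ := by
  by_cases e : (v : ℕ) = τ.c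
  · exact mem_nodes.2 (Or.inl e)
  · exact mem_nodes.2 (Or.inr (Or.inl ⟨v, hv, e, hk, rfl⟩))

theorem Admissible.a₀_mem (h : Admissible Cl i τ) (hlt : τ.a₀ < n) :
    ∃ v ∈ Cl i, (v : ℕ) = τ.a₀ ∧ Near Cl i τ v ∧ Kept Cl i τ v := by
  rcases h.a₀ with e | ⟨v, hv, e⟩
  · omega
  · exact ⟨v, hv, e, Or.inl e, Or.inr (Or.inl e)⟩

theorem parent_mem (h : Admissible Cl i τ) {v : Fin n} (hv : v ∈ Cl i) (hk : Kept Cl i τ v) :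
    parent Cl i τ v ∈ nodes Cl i τ ∧ parentId Cl i τ (parent Cl i τ v) = τ.c := by
  rcases parent_cases (τ := τ) hv with ⟨-, e⟩ | ⟨h1, ⟨e, h2, -⟩ | ⟨a, ha, e, -⟩ | ⟨u, hu, -, e, -⟩⟩
  · rw [e]
    exact ⟨mem_nodes.2 (Or.inl rfl), parentId_c h⟩
  · obtain ⟨w, hw, hwa, hwn, hwk⟩ := h.a₀_mem h2
    rw [e, ← hwa, parentId_val]
    exact ⟨mem_nodes_of_kept hw hwk, parent_of_near (Or.inr hwn)⟩
  · rw [e, parentId_val]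
    exact ⟨mem_nodes_of_kept ha.1 ha.2.2.2.1, parent_of_near (Or.inr ha.2.2.1)⟩
  · refine ⟨mem_nodes.2 (Or.inr (Or.inr ⟨u, hu.1, ⟨v, hv, fun e => h1 (Or.inl e), hk, e⟩, e.symm⟩)),
      ?_⟩
    rw [e, parentId_of_ge (by omega)]

theorem isRooted (h : Admissible Cl i τ) : (tree Cl i τ).IsRooted τ.c (parentId Cl i τ) where
  nodup := nodup_nodes h
  edges_eq := rfl
  root_mem := mem_nodes.2 (Or.inl rfl)
  root_eq := parentId_c h
  parent_mem x hx := by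
    rcases mem_nodes.1 hx with rfl | ⟨v, hv, -, hk, rfl⟩ | ⟨u, -, -, rfl⟩
    · rw [parentId_c h]
      exact hx
    · rw [parentId_val]
      exact (parent_mem h hv hk).1
    · rw [parentId_of_ge (by omega)]
      exact mem_nodes.2 (Or.inl rfl)
  depth x hx := by
    rcases mem_nodes.1 hx with rfl | ⟨v, hv, -, hk, rfl⟩ | ⟨u, -, -, rfl⟩
    · rw [parentId_c h, parentId_c h]
    · rw [parentId_val]
      exact (parent_mem h hv hk).2
    · rw [parentId_of_ge (x := n + 1 + u) (by omega), parentId_c h]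
  center_subset := by
    have hc : τ.c ∈ nodes Cl i τ := mem_nodes.2 (Or.inl rfl)
    have h2 : second Cl i τ ∈ nodes Cl i τ := by
      unfold second
      split_ifs with h1 h2 h3
      · obtain ⟨w, hw, hwa, -, hwk⟩ := h.a₀_mem h2
        rw [← hwa]
        exact mem_nodes_of_kept hw hwk
      · rcases h.x₀ with e | ⟨v, hv, e⟩
        · omega
        · obtain rfl : v = ⟨τ.x₀, h3⟩ := Fin.ext e
          exact (parent_mem h hv (Or.inr (Or.inr (Or.inr ⟨_, e, rel_self _⟩)))).1
      · exact hc
      · exact hc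
    intro x hx
    rcases List.mem_cons.1 hx with rfl | hx
    · exact hc
    · rw [List.mem_singleton.1 hx]
      exact h2

theorem tree_isValid (h : Admissible Cl i τ) : (tree Cl i τ).IsValid (Cl i) := by
  refine (isRooted h).isValid fun v hv => ?_
  rcases mem_nodes.1 hv with e | ⟨w, hw, -, -, e⟩ | ⟨u, -, -, e⟩
  · rcases h.c with e' | ⟨w, hw, e'⟩
    all_goals grind
  all_goals grind

end Guess

end

section

/-! ## When a member of the family describes a subtree -/

namespace Guess

open SteinerTree SubTree TreeMetric

variable {n q : ℕ} {T : SteinerTree (Fin n)} {Cl : Fin q → Set (Fin n)} {i : Fin q} {τ : Guess q}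

/-- The guess describes the subtree of `T` that is spanned by `Y` and the central nodes. -/
structure Describes (T : SteinerTree (Fin n)) (Cl : Fin q → Set (Fin n)) (i : Fin q) (τ : Guess q)
    (c₀ w₂ : T.Node) (Y : Set (Fin n)) : Prop where
  adm : Admissible Cl i τ
  sub : Y ⊆ Cl i
  real_c : ∀ v : Fin n, (v : ℕ) = τ.c ↔ T.real v = c₀
  depth : ∀ v ∈ Cl i, T.D v c₀ ≤ 2
  kept : ∀ v ∈ Cl i, (v : ℕ) ≠ τ.c → (Kept Cl i τ v ↔ v ∈ Y)
  near : ∀ v ∈ Y, (v : ℕ) ≠ τ.c → (Near Cl i τ v ↔ T.D v c₀ ≤ 1)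
  par_real : ∀ v ∈ Y, T.D v c₀ = 2 → ∀ a, T.d v a = 1 → T.D a c₀ = 1 →
    parent Cl i τ v = a ∧ a ∈ Y
  par_steiner : ∀ v ∈ Y, T.D v c₀ = 2 → ∀ y, T.D v y = 1 → T.D y c₀ = 1 →
    T.IsSteinerNode y → ∃ u : Fin n, parent Cl i τ v = n + 1 + u ∧
      T.D u y = 1 ∧ T.D u c₀ = 2
  par_eq : ∀ v ∈ Y, ∀ v' ∈ Y, T.D v c₀ = 2 → T.D v' c₀ = 2 → ∀ y,
    T.D v y = 1 → T.D v' y = 1 → T.D y c₀ = 1 → T.IsSteinerNode y →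
      parent Cl i τ v = parent Cl i τ v'
  second : (second Cl i τ = τ.c ∧ w₂ = c₀) ∨ (T.D w₂ c₀ = 1 ∧ ∃ x ∈ Y,
    (second Cl i τ = x ∧ T.real x = w₂) ∨
      (T.D x c₀ = 2 ∧ T.D x w₂ = 1 ∧ second Cl i τ = parent Cl i τ x))

open Classical in
/-- The nodes of the tree that correspond to the numbers. -/
noncomputable def nodeOf (T : SteinerTree (Fin n)) (c₀ : T.Node) (x : ℕ) : T.Node :=
  if h : x < n then T.real ⟨x, h⟩
  else if h' : ∃ u : Fin n, x = n + 1 + u ∧ T.D u c₀ = 2 then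
    (exists_mid h'.choose_spec.2).choose
  else c₀

theorem nodeOf_val (c₀ : T.Node) (v : Fin n) : nodeOf T c₀ v = T.real v := by
  rw [nodeOf, dif_pos v.2]

theorem nodeOf_n (c₀ : T.Node) : nodeOf T c₀ n = c₀ := by
  rw [nodeOf, dif_neg (by omega), dif_neg]
  grind

theorem nodeOf_mid {c₀ : T.Node} {u : Fin n} (h : T.D u c₀ = 2) {y : T.Node}
    (h1 : T.D u y = 1) (h2 : T.D y c₀ = 1) : nodeOf T c₀ (n + 1 + u) = y := by
  have h' : ∃ u' : Fin n, n + 1 + (u : ℕ) = n + 1 + u' ∧ T.D u' c₀ = 2 := ⟨u, rfl, h⟩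
  rw [nodeOf, dif_neg (by omega), dif_pos h']
  have e : h'.choose = u := Fin.ext (by grind)
  obtain ⟨h3, h4⟩ := (exists_mid h'.choose_spec.2).choose_spec
  refine mid_unique h ?_ h4 h1 h2
  grind

namespace Describes

variable {c₀ w₂ : T.Node} {Y : Set (Fin n)} (h : Describes T Cl i τ c₀ w₂ Y)
include h

theorem nodeOf_c : nodeOf T c₀ τ.c = c₀ := by
  rcases h.adm.c with e | ⟨v, -, e⟩
  · rw [e, nodeOf_n]
  · rw [← e, nodeOf_val, (h.real_c v).1 e]

theorem depth_cases {v : Fin n} (hv : v ∈ Y) (hc : (v : ℕ) ≠ τ.c) :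
    (T.D v c₀ = 1 ∧ parent Cl i τ v = τ.c) ∨ T.D v c₀ = 2 := by
  have h1 := h.depth v (h.sub hv)
  have h0 : T.D v c₀ ≠ 0 := fun e => hc ((h.real_c v).2 (T.D_eq_zero.1 e))
  rcases (by omega : T.D v c₀ = 1 ∨ T.D v c₀ = 2) with h2 | h2
  · exact Or.inl ⟨h2, parent_of_near (Or.inr ((h.near v hv hc).2 h2.le))⟩
  grind

/-- The parent of a node of depth two. -/
theorem nodeOf_parent {v : Fin n} (hv : v ∈ Y) (h2 : T.D v c₀ = 2) {y : T.Node}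
    (hvy : T.D v y = 1) (hyc : T.D y c₀ = 1) : nodeOf T c₀ (parent Cl i τ v) = y := by
  by_cases hS : T.IsSteinerNode y
  · obtain ⟨u, e, h3, h4⟩ := h.par_steiner v hv h2 y hvy hyc hS
    rw [e]
    exact nodeOf_mid h4 h3 hyc
  · obtain ⟨a, rfl⟩ := not_forall_not.1 hS
    rw [(h.par_real v hv h2 a hvy hyc).1, nodeOf_val]

/-- The number of a Steiner node other than the central node. -/
theorem used {u : Fin n} (hu : Used Cl i τ u) : ∃ v ∈ Y, T.D v c₀ = 2 ∧
    parent Cl i τ v = n + 1 + u ∧ ∃ y, T.D v y = 1 ∧ T.D y c₀ = 1 ∧ T.IsSteinerNode y ∧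
      nodeOf T c₀ (n + 1 + u) = y := by
  obtain ⟨v, hv, hc, hk, e⟩ := hu
  have hvY := (h.kept v hv hc).1 hk
  rcases h.depth_cases hvY hc with h1 | h1
  · have := h.adm.c_le
    omega
  obtain ⟨y, y1, y2⟩ := exists_mid h1
  refine ⟨v, hvY, h1, e, y, y1, y2, ?_, e ▸ h.nodeOf_parent hvY h1 y1 y2⟩
  intro a ha
  subst ha
  have := (h.par_real v hvY h1 a y1 y2).1
  omega

theorem mem_nodes_of_mem {v : Fin n} (hv : v ∈ Y) : (v : ℕ) ∈ nodes Cl i τ := by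
  by_cases e : (v : ℕ) = τ.c
  · exact mem_nodes.2 (Or.inl e)
  · exact mem_nodes_of_kept (h.sub hv) ((h.kept v (h.sub hv) e).2 hv)

theorem parent_mem_nodes {v : Fin n} (hv : v ∈ Y) : parent Cl i τ v ∈ nodes Cl i τ := by
  by_cases e : (v : ℕ) = τ.c
  · rw [parent_of_near (Or.inl e)]
    exact mem_nodes.2 (Or.inl rfl)
  · exact (parent_mem h.adm (h.sub hv) ((h.kept v (h.sub hv) e).2 hv)).1

theorem nodeOf_second :
    Guess.second Cl i τ ∈ nodes Cl i τ ∧ nodeOf T c₀ (Guess.second Cl i τ) = w₂ := by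
  rcases h.second with ⟨e, e'⟩ | ⟨h1, x, hx, ⟨e, e'⟩ | ⟨h2, h3, e⟩⟩
  · rw [e, h.nodeOf_c, e']
    exact ⟨mem_nodes.2 (Or.inl rfl), rfl⟩
  · rw [e, nodeOf_val]
    exact ⟨h.mem_nodes_of_mem hx, e'⟩
  · rw [e]
    exact ⟨h.parent_mem_nodes hx, h.nodeOf_parent hx h2 h3 h1⟩

theorem nodeOf_inj : ∀ x ∈ nodes Cl i τ, ∀ y ∈ nodes Cl i τ, nodeOf T c₀ x = nodeOf T c₀ y →
    x = y := by
  have hcv : ∀ v : Fin n, (v : ℕ) ≠ τ.c → T.real v ≠ c₀ := fun v hv e => hv ((h.real_c v).2 e)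
  have hcS : ∀ y : T.Node, T.D y c₀ = 1 → c₀ ≠ y := fun y hy e => by grind
  intro x hx y hy hxy
  rcases mem_nodes.1 hx with rfl | ⟨v, hv, hvc, hk, rfl⟩ | ⟨u, -, hu, rfl⟩ <;>
    rcases mem_nodes.1 hy with rfl | ⟨v', hv', hvc', hk', rfl⟩ | ⟨u', -, hu', rfl⟩
  · rfl
  · rw [h.nodeOf_c, nodeOf_val] at hxy
    grind
  · obtain ⟨-, -, -, -, z, -, h3, -, h4⟩ := h.used hu'
    rw [h.nodeOf_c, h4] at hxy
    grind
  · rw [h.nodeOf_c, nodeOf_val] at hxy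
    grind
  · rw [nodeOf_val, nodeOf_val] at hxy
    grind
  · obtain ⟨-, -, -, -, z, -, -, h3, h4⟩ := h.used hu'
    rw [h4, nodeOf_val] at hxy
    exact absurd hxy (h3 v)
  · obtain ⟨-, -, -, -, z, -, h3, -, h4⟩ := h.used hu
    rw [h.nodeOf_c, h4] at hxy
    grind
  · obtain ⟨-, -, -, -, z, -, -, h3, h4⟩ := h.used hu
    rw [h4, nodeOf_val] at hxy
    exact absurd hxy.symm (h3 v')
  · obtain ⟨v, hv, h2, e, z, h3, h4, h5, h6⟩ := h.used hu
    obtain ⟨v', hv', h2', e', z', h3', h4', h5', h6'⟩ := h.used hu'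
    rw [h6, h6'] at hxy
    subst hxy
    rw [← e, ← e']
    exact h.par_eq v hv v' hv' h2 h2' z h3 h3' h4 h5

theorem nodeOf_image (z : T.Node) : z ∈ hull T.graph (T.real '' Y ∪ {c₀, w₂}) ↔
    ∃ x ∈ nodes Cl i τ, nodeOf T c₀ x = z := by
  rw [mem_hull_iff T.isTree]
  constructor
  · rintro ⟨s, hs, t, ht, hst⟩
    have key : ∀ s ∈ T.real '' Y ∪ {c₀, w₂}, T.D c₀ z + T.D z s = T.D c₀ s →
        ∃ x ∈ nodes Cl i τ, nodeOf T c₀ x = z := by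
      rintro s (⟨v, hv, rfl⟩ | rfl | rfl) hz
      · have hd := h.depth v (h.sub hv)
        have c1 := T.D_comm c₀ v
        have c2 := T.D_comm c₀ z
        have c3 := T.D_comm z v
        by_cases h0 : T.D c₀ z = 0
        · exact ⟨τ.c, mem_nodes.2 (Or.inl rfl), h.nodeOf_c.trans (T.D_eq_zero.1 h0)⟩
        by_cases h1 : T.D z v = 0
        · exact ⟨v, h.mem_nodes_of_mem hv, (nodeOf_val c₀ v).trans (T.D_eq_zero.1 h1).symm⟩
        exact ⟨_, h.parent_mem_nodes hv,
          h.nodeOf_parent hv (by omega) (by omega) (by omega)⟩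
      · rw [T.D_self] at hz
        exact ⟨τ.c, mem_nodes.2 (Or.inl rfl), h.nodeOf_c.trans (T.D_eq_zero.1 (by omega))⟩
      · by_cases h0 : T.D c₀ z = 0
        · exact ⟨τ.c, mem_nodes.2 (Or.inl rfl), h.nodeOf_c.trans (T.D_eq_zero.1 h0)⟩
        refine ⟨_, h.nodeOf_second.1, h.nodeOf_second.2.trans (T.D_eq_zero.1 ?_).symm⟩
        have c1 := T.D_comm c₀ s
        rcases h.second with ⟨-, e⟩ | ⟨h1, -⟩
        · grind
        · omega
    have hst' : T.D s z + T.D z t = T.D s t := hst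
    have f := T.fp c₀ z s t
    have c1 := T.D_comm z s
    have t1 := T.D_tri c₀ z s
    grind
  · have hc : c₀ ∈ T.real '' Y ∪ {c₀, w₂} := Or.inr (Or.inl rfl)
    rintro ⟨x, hx, rfl⟩
    rcases mem_nodes.1 hx with rfl | ⟨v, hv, hvc, hk, rfl⟩ | ⟨u, -, hu, rfl⟩
    · rw [h.nodeOf_c]
      grind
    · rw [nodeOf_val]
      refine ⟨T.real v, Or.inl ⟨v, (h.kept v hv hvc).1 hk, rfl⟩, c₀, hc, ?_⟩
      simp
    · obtain ⟨v, hv, h2, -, y, h3, h4, -, h5⟩ := h.used hu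
      rw [h5]
      refine ⟨T.real v, Or.inl ⟨v, hv, rfl⟩, c₀, hc, ?_⟩
      change T.D _ _ + T.D _ _ = T.D _ _
      omega

theorem represents : (tree Cl i τ).Represents T (hull T.graph (T.real '' Y ∪ {c₀, w₂})) {c₀, w₂} := by
  refine (isRooted h.adm).represents (nodeOf T c₀) h.nodeOf_inj h.nodeOf_image ?_ ?_ ?_
    ((Set.subset_union_right).trans (subset_hull T.graph _))
  · intro x hx hxc
    rw [h.nodeOf_c]
    rcases mem_nodes.1 hx with rfl | ⟨v, hv, hvc, hk, rfl⟩ | ⟨u, -, hu, rfl⟩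
    · grind
    · have hvY := (h.kept v hv hvc).1 hk
      rw [nodeOf_val, parentId_val]
      rcases h.depth_cases hvY hvc with ⟨h1, e⟩ | h1
      · rw [e, h.nodeOf_c, T.D_self, h1]
        grind
      · obtain ⟨y, y1, y2⟩ := exists_mid h1
        rw [h.nodeOf_parent hvY h1 y1 y2]
        grind
    · obtain ⟨v, hv, h2, -, y, h3, h4, -, h5⟩ := h.used hu
      rw [parentId_of_ge (by omega), h.nodeOf_c, h5, T.D_self]
      grind
  · intro x hx w
    rcases mem_nodes.1 hx with rfl | ⟨v, hv, hvc, hk, rfl⟩ | ⟨u, -, hu, rfl⟩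
    · rw [h.nodeOf_c]
      exact h.real_c w
    · rw [nodeOf_val]
      grind
    · obtain ⟨v, hv, h2, -, y, h3, h4, h5, h6⟩ := h.used hu
      rw [h6]
      exact ⟨fun e => by omega, fun e => absurd e (h5 w)⟩
  · intro x hx
    have h2 := h.nodeOf_second
    have hc : τ.c ∈ nodes Cl i τ := mem_nodes.2 (Or.inl rfl)
    change x ∈ [τ.c, Guess.second Cl i τ] ↔ _
    rw [List.mem_cons, List.mem_singleton, Set.mem_insert_iff, Set.mem_singleton_iff]
    refine or_congr ⟨fun e => by rw [e, h.nodeOf_c], fun e => ?_⟩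
      ⟨fun e => by rw [e, h2.2], fun e => ?_⟩
    · exact h.nodeOf_inj x hx _ hc (by rw [e, h.nodeOf_c])
    · exact h.nodeOf_inj x hx _ h2.1 (by rw [e, h2.2])

end Describes

end Guess

end

section

/-! ## Cliques whose subtree has diameter at most three -/

open SubTree TreeMetric

namespace SteinerTree

variable {n : ℕ} {T : SteinerTree (Fin n)}

open Classical in
/-- The number of a node: `n` for a Steiner node. -/
noncomputable def idOf (T : SteinerTree (Fin n)) (x : T.Node) : ℕ :=
  if h : ∃ v, T.real v = x then (h.choose : Fin n) else n

theorem idOf_real (v : Fin n) : T.idOf v = v := by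
  have h : ∃ w, T.real w = T.real v := ⟨v, rfl⟩
  rw [idOf, dif_pos h, T.real.injective h.choose_spec]

theorem idOf_of_isSteinerNode {x : T.Node} (h : T.IsSteinerNode x) : T.idOf x = n := by
  rw [idOf, dif_neg fun ⟨v, hv⟩ => h v hv]

theorem val_eq_idOf {x : T.Node} {v : Fin n} : (v : ℕ) = T.idOf x ↔ T.real v = x := by
  constructor
  · intro h
    by_cases hS : ∃ w, T.real w = x
    · obtain ⟨w, rfl⟩ := hS
      rw [idOf_real] at h
      grind
    · rw [idOf, dif_neg hS] at h
      grind
  · rintro rfl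
    rw [idOf_real]

theorem idOf_admissible {K : Set (Fin n)} {x : T.Node} (h : ∀ v, T.real v = x → v ∈ K) :
    T.idOf x = n ∨ ∃ v ∈ K, (v : ℕ) = T.idOf x := by
  by_cases hS : ∃ w, T.real w = x
  · obtain ⟨w, hw⟩ := hS
    exact Or.inr ⟨w, h w hw, val_eq_idOf.2 hw⟩
  · exact Or.inl (idOf_of_isSteinerNode fun v hv => hS ⟨v, hv⟩)

theorem exists_real_of_idOf_lt {x : T.Node} (h : T.idOf x < n) : ∃ v, T.real v = x := by
  by_contra hS
  rw [idOf, dif_neg hS] at h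
  grind

/-- The distances in a set `S` agree, and `W` is not closer to `S` in `T'`. -/
def Dominated {V : Type} (T T' : SteinerTree V) (S W : Set V) : Prop :=
  (∀ s ∈ S, ∀ s' ∈ S, T'.d s s' = T.d s s') ∧ ∀ w ∈ W, ∃ w' ∈ W, ∀ s ∈ S, T.d s w' ≤ T'.d s w

theorem Dominated.refl {V : Type} (T : SteinerTree V) (S W : Set V) : Dominated T T S W :=
  ⟨fun _ _ _ _ => rfl, fun w hw => ⟨w, hw, fun _ _ => le_rfl⟩⟩

theorem Dominated.trans {V : Type} {T T' T'' : SteinerTree V} {S W : Set V}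
    (h : Dominated T T' S W) (h' : Dominated T' T'' S W) : Dominated T T'' S W := by
  refine ⟨fun s hs s' hs' => (h'.1 s hs s' hs').trans (h.1 s hs s' hs'), fun w hw => ?_⟩
  obtain ⟨w', hw', h1⟩ := h'.2 w hw
  obtain ⟨w'', hw'', h2⟩ := h.2 w' hw'
  grind

end SteinerTree

namespace Guess

open SteinerTree

variable {n q : ℕ} {T : SteinerTree (Fin n)} {Cl : Fin q → Set (Fin n)} {i : Fin q} {τ : Guess q}

theorem Describes.of_parents {c₀ w₂ : T.Node} {Y : Set (Fin n)}
    (adm : Admissible Cl i τ) (sub : Y ⊆ Cl i)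
    (real_c : ∀ v : Fin n, (v : ℕ) = τ.c ↔ T.real v = c₀)
    (depth : ∀ v ∈ Cl i, T.D v c₀ ≤ 2)
    (kept : ∀ v ∈ Cl i, (v : ℕ) ≠ τ.c → (Kept Cl i τ v ↔ v ∈ Y))
    (near : ∀ v ∈ Y, (v : ℕ) ≠ τ.c → (Near Cl i τ v ↔ T.D v c₀ ≤ 1))
    (sib : ∀ v ∈ Y, T.D v c₀ = 2 → ∀ y, T.D v y = 1 → T.D y c₀ = 1 →
      T.IsSteinerNode y → ∀ u, Sibling Cl i τ v u ↔
        u ∈ Cl i ∧ T.D u y = 1 ∧ T.D u c₀ = 2)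
    (branch : ∀ v ∈ Y, T.D v c₀ = 2 → τ.mode ≠ 4 → OnBranch Cl i τ v → ∀ y,
      T.D v y = 1 → T.D y c₀ = 1 → τ.a₀ = T.idOf y ∧ ∀ a, T.real a = y → a ∈ Y)
    (sound : ∀ v ∈ Y, T.D v c₀ = 2 → ¬ (τ.mode ≠ 4 ∧ OnBranch Cl i τ v) →
      ∀ a ∈ Y, T.D a c₀ = 1 → Evidence Cl i τ v a → T.d v a = 1)
    (complete : ∀ v ∈ Y, T.D v c₀ = 2 → ¬ (τ.mode ≠ 4 ∧ OnBranch Cl i τ v) →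
      ∀ a, T.d v a = 1 → T.D a c₀ = 1 → a ∈ Y ∧ Evidence Cl i τ v a)
    (second : (Guess.second Cl i τ = τ.c ∧ w₂ = c₀) ∨ (T.D w₂ c₀ = 1 ∧ ∃ x ∈ Y,
      (Guess.second Cl i τ = x ∧ T.real x = w₂) ∨
        (T.D x c₀ = 2 ∧ T.D x w₂ = 1 ∧
          Guess.second Cl i τ = parent Cl i τ x))) :
    Describes T Cl i τ c₀ w₂ Y := by
  have hne : ∀ v : Fin n, T.D v c₀ ≠ 0 → (v : ℕ) ≠ τ.c := fun v hv e =>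
    hv (T.D_eq_zero.2 ((real_c v).1 e))
  have hcand : ∀ v ∈ Y, T.D v c₀ = 2 → ¬ (τ.mode ≠ 4 ∧ OnBranch Cl i τ v) → ∀ a,
      Candidate Cl i τ v a ↔ T.d v a = 1 ∧ T.D a c₀ = 1 := by
    intro v hv h2 hb a
    constructor
    · rintro ⟨h3, h4, h5, h6, h7⟩
      have haY := (kept a h3 h4).1 h6
      have h8 := (near a haY h4).1 h5
      have h9 : T.D a c₀ ≠ 0 := fun e => h4 ((real_c a).2 (T.D_eq_zero.1 e))
      grind
    · rintro ⟨h3, h4⟩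
      obtain ⟨haY, h5⟩ := complete v hv h2 hb a h3 h4
      have h6 := hne a (by omega)
      exact ⟨sub haY, h6, (near a haY h6).2 h4.le, (kept a (sub haY) h6).2 haY, h5⟩
  have hpar : ∀ v ∈ Y, T.D v c₀ = 2 → ∀ y, T.D v y = 1 → T.D y c₀ = 1 →
      (∃ a, T.real a = y ∧ parent Cl i τ v = a ∧ a ∈ Y) ∨
      (T.IsSteinerNode y ∧ ∃ u, Sibling Cl i τ v u ∧
        parent Cl i τ v = n + 1 + sInf (Fin.val '' {a | Sibling Cl i τ v a}) ∧
        parent Cl i τ v = n + 1 + u) := by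
    intro v hv h2 y h3 h4
    have hvc := hne v (by omega)
    rcases parent_cases (τ := τ) (sub hv) with
      ⟨e | e, -⟩ | ⟨-, ⟨e, h5, h6⟩ | ⟨a, ha, e, hb⟩ | ⟨u, hu, e, e', h5, h6⟩⟩
    · grind
    · grind
    · obtain ⟨e1, e2⟩ := branch v hv h2 h6.1 h6.2 y h3 h4
      obtain ⟨a, ha⟩ := exists_real_of_idOf_lt (e1 ▸ h5)
      refine Or.inl ⟨a, ha, ?_, e2 a ha⟩
      rw [e, e1, val_eq_idOf.2 ha]
    · obtain ⟨h5, h6⟩ := (hcand v hv h2 hb a).1 ha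
      refine Or.inl ⟨a, mid_unique h2 h5 h6 h3 h4, e, (complete v hv h2 hb a h5 h6).1⟩
    · by_cases hb : τ.mode ≠ 4 ∧ OnBranch Cl i τ v
      · have e1 := (branch v hv h2 hb.1 hb.2 y h3 h4).1
        refine Or.inr ⟨fun a ha => ?_, u, hu, e, e'⟩
        have := h5 hb
        rw [e1, ← val_eq_idOf.2 ha] at this
        grind
      · refine Or.inr ⟨fun a ha => h6 hb a ((hcand v hv h2 hb a).2 ⟨?_, ?_⟩), u, hu, e, e'⟩
        all_goals grind
  refine ⟨adm, sub, real_c, depth, kept, near, ?_, ?_, ?_, second⟩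
  · intro v hv h2 a h3 h4
    rcases hpar v hv h2 _ h3 h4 with ⟨b, hb, e, hbY⟩ | ⟨hS, -⟩
    · grind
    · exact absurd rfl (hS a)
  · intro v hv h2 y h3 h4 hS
    rcases hpar v hv h2 y h3 h4 with ⟨b, hb, -⟩ | ⟨-, u, hu, -, e⟩
    · exact absurd hb (hS b)
    grind
  · intro v hv v' hv' h2 h2' y h3 h3' h4 hS
    rcases hpar v hv h2 y h3 h4 with ⟨b, hb, -⟩ | ⟨-, u, hu, e, -⟩
    · exact absurd hb (hS b)
    rcases hpar v' hv' h2' y h3' h4 with ⟨b, hb, -⟩ | ⟨-, u', hu', e', -⟩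
    · exact absurd hb (hS b)
    rw [e, e']
    have : {a | Sibling Cl i τ v a} = {a | Sibling Cl i τ v' a} := Set.ext fun a =>
      (sib v hv h2 y h3 h4 hS a).trans (sib v' hv' h2' y h3' h4 hS a).symm
    rw [this]

end Guess

namespace RootedCliqueTree

open SteinerTree

variable {n : ℕ} {G : SimpleGraph (Fin n)} (R : RootedCliqueTree G) (i : Fin R.q)

/-- What the family has to provide for the root `T`. -/
def Answer (T : SteinerTree (Fin n)) : Prop :=
  ∃ (T' : SteinerTree (Fin n)) (Y : Set (Fin n)) (τ : Guess R.q) (c₀ w₂ : T'.Node),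
    MetricWS T' G ∧ τ.mode ≤ 4 ∧ Guess.Describes T' R.clique i τ c₀ w₂ Y ∧
    T'.center (R.clique i) = {c₀, w₂} ∧
    Dominated T T' (R.sep i) (R.verts i \ R.sep i) ∧ R.sep i ⊆ Y ∧
    (∀ v ∈ R.clique i \ Y, ∃ S : Set (Fin n),
      (∀ w ∈ S, w ∈ R.clique i \ Y ∨ T.real w ∈ T.center (R.clique i)) ∧
      v ∈ S ∧ T.IsThinBranch G (R.clique i) S) ∧
    ((T'.subtree (R.clique i)).diam < 4 ∨
      (∃ S : Set (Fin n), IsMinimalSeparator G S ∧ S ⊂ R.clique i ∧ T'.IsBistar S) →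
      Y = R.clique i)

variable {R i} {T : SteinerTree (Fin n)}

theorem Answer.of_full {T' : SteinerTree (Fin n)} (hws : MetricWS T' G) (τ : Guess R.q)
    {c₀ w₂ : T'.Node} (hmode : τ.mode ≤ 4)
    (hτ : Guess.Describes T' R.clique i τ c₀ w₂ (R.clique i))
    (hc : T'.center (R.clique i) = {c₀, w₂})
    (hdom : Dominated T T' (R.sep i) (R.verts i \ R.sep i)) : R.Answer i T :=
  ⟨T', R.clique i, τ, c₀, w₂, hws, hmode, hτ, hc, hdom, R.sep_subset i,
    fun v hv => absurd hv.1 hv.2, fun _ => rfl⟩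

theorem mem_of_D_le (hroot : T.IsRoot 4 G) {c : T.Node} (hc : ∀ u ∈ R.clique i, T.D u c ≤ 2)
    {v : Fin n} (hv : T.D v c ≤ 2) : v ∈ R.clique i := by
  rw [hroot.eq_ball (R.isMaxClique i) hc]
  exact hv

/-- A vertex that is not free is in another clique together with a further vertex. -/
theorem exists_clique_of_not_isFree (R : RootedCliqueTree G) {i : Fin R.q} {v : Fin n}
    (hv : v ∈ R.clique i) (hfree : ¬ IsFree G (R.clique i) v) :
    ∃ m, m ≠ i ∧ v ∈ R.clique m ∧ ∃ u ∈ R.clique i, u ∈ R.clique m ∧ u ≠ v := by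
  have hcon : IsConstrained G (R.clique i) v := not_not.1 fun h => hfree ⟨hv, h⟩
  rcases hcon with ⟨X, ⟨𝒦, h𝒦, hmax, rfl⟩, hX, hvX, h2⟩ | ⟨X₁, -, h1, -, h2, -⟩
  · obtain ⟨M, hM, hMK⟩ : ∃ M ∈ 𝒦, M ≠ R.clique i := by grind
    obtain ⟨m, rfl⟩ := R.exists_clique (hmax M hM)
    obtain ⟨u, hu, huv⟩ := Set.exists_ne_of_one_lt_ncard (Nat.lt_of_succ_le h2) v
    grind
  · exact absurd ((R.isMaxClique i).eq_of_subset h1.isClique h2.1) h2.ne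

end RootedCliqueTree

end

section

open SubTree TreeMetric

namespace RootedCliqueTree

open SteinerTree Guess

variable {n : ℕ} {G : SimpleGraph (Fin n)} {R : RootedCliqueTree G} {i : Fin R.q}
  {T : SteinerTree (Fin n)}

theorem exists_ne_mem_clique (hG : G.Connected) (hn : 2 ≤ n) (R : RootedCliqueTree G)
    (i : Fin R.q) : ∃ u ∈ R.clique i, ∃ v ∈ R.clique i, u ≠ v := by
  have : Nontrivial (Fin n) := Fin.nontrivial_iff_two_le.2 hn
  obtain ⟨u, hu⟩ := R.clique_nonempty i
  obtain ⟨v, hv⟩ := hG.preconnected.exists_adj_of_nontrivial u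
  by_contra! hno
  have h1 : R.clique i = {u, v} := (R.isMaxClique i).eq_of_subset
    (SimpleGraph.isClique_pair.2 fun _ => hv) fun w hw => Or.inl (hno w hw u hu)
  exact hv.ne (hno u hu v (by grind))

/-- All vertices are central or next to the only central node. -/
theorem answer_of_star (hws : MetricWS T G) {p q : Fin n} (hp : p ∈ R.clique i)
    (hq : q ∈ R.clique i) (hmax : ∀ u ∈ R.clique i, ∀ v ∈ R.clique i, T.d u v ≤ T.d p q)
    (hpq : T.d p q = 2) : R.Answer i T := by
  obtain ⟨m, m1, m2⟩ := T.D_between p q (i := 1) (by grind)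
  have hpq' : T.D p q = 2 := hpq
  have c2 := T.D_comm m p
  have hm : ∀ u ∈ R.clique i, T.D u m ≤ 1 := fun u hu => by
    have h1 := hmax u hu p hp
    have h2 := hmax u hu q hq
    have f := T.fp u m p q
    grind
  refine Answer.of_full hws ⟨T.idOf m, n, n, n, i, i, 0, False⟩ (c₀ := m) (w₂ := m) (by simp)
    (Describes.of_parents ?_ subset_rfl (fun v => val_eq_idOf) (fun v hv => (hm v hv).trans (by simp))
      ?_ ?_ ?_ ?_ ?_ ?_ ?_) ?_ (Dominated.refl _ _ _)
  · refine ⟨idOf_admissible fun v hv => ?_, Or.inl rfl, Or.inl rfl, Or.inl rfl⟩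
    exact mem_of_D_le hws.root (c := m) (fun u hu => (hm u hu).trans (by simp))
      (by grind)
  · exact fun v hv _ => ⟨fun _ => hv, fun _ => Or.inl (by simp)⟩
  · exact fun v hv _ => ⟨fun _ => hm v hv, fun _ => Or.inr (Or.inl ⟨rfl, hv, hv⟩)⟩
  · grind
  · grind
  · grind
  · grind
  · exact Or.inl ⟨by simp [second], rfl⟩
  · rw [Set.pair_eq_singleton]
    ext x
    rw [mem_center_iff_d hp hq hmax, hpq, Set.mem_singleton_iff]
    constructor
    · intro hx
      have f := T.fp x m p q
      exact T.D_eq_zero.1 (by omega)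
    grind

theorem answer_of_edge (hws : MetricWS T G) {p q : Fin n} (hp : p ∈ R.clique i)
    (hq : q ∈ R.clique i) (hmax : ∀ u ∈ R.clique i, ∀ v ∈ R.clique i, T.d u v ≤ T.d p q)
    (hpq : T.d p q = 1) : R.Answer i T := by
  have hpq' : T.D p q = 1 := hpq
  have c2 := T.D_comm q p
  have hm : ∀ u ∈ R.clique i, T.D u p ≤ 1 := fun u hu => by grind
  refine Answer.of_full hws ⟨p, q, n, n, i, i, 0, True⟩ (c₀ := T.real p) (w₂ := T.real q) (by simp)
    (Describes.of_parents ?_ subset_rfl (fun v => ?_) (fun v hv => (hm v hv).trans (by simp))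
      ?_ ?_ ?_ ?_ ?_ ?_ ?_) ?_ (Dominated.refl _ _ _)
  · exact ⟨Or.inr ⟨p, hp, rfl⟩, Or.inr ⟨q, hq, rfl⟩, Or.inl rfl, Or.inl rfl⟩
  · grind
  · exact fun v hv _ => ⟨fun _ => hv, fun _ => Or.inl (by simp)⟩
  · exact fun v hv _ => ⟨fun _ => hm v hv, fun _ => Or.inr (Or.inl ⟨rfl, hv, hv⟩)⟩
  · grind
  · grind
  · grind
  · grind
  · exact Or.inr ⟨by omega, q, hq, Or.inl ⟨by simp [second], rfl⟩⟩
  · ext x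
    rw [mem_center_iff_d hp hq hmax, hpq, Set.mem_insert_iff, Set.mem_singleton_iff]
    have pr := T.par x p q
    have t := T.D_tri p x q
    have c3 := T.D_comm x p
    have t1 := T.D_tri x p q
    have t2 := T.D_tri x q p
    rw [← T.D_eq_zero, ← T.D_eq_zero]
    omega

/-- The center of the subtree spanned by the clique consists of two nodes. -/
structure Bicentral (T : SteinerTree (Fin n)) (R : RootedCliqueTree G) (i : Fin R.q)
    (c₁ c₂ : T.Node) (p q : Fin n) : Prop where
  ws : MetricWS T G
  edge : T.D c₁ c₂ = 1
  hp : p ∈ R.clique i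
  hq : q ∈ R.clique i
  pc₁ : T.D p c₁ = 1
  pc₂ : T.D p c₂ = 2
  qc₁ : T.D q c₁ = 2
  qc₂ : T.D q c₂ = 1
  near : ∀ u ∈ R.clique i, (T.D u c₁ ≤ 1 ∧ T.D u c₂ ≤ 2) ∨
    (T.D u c₂ ≤ 1 ∧ T.D u c₁ = 2)

namespace Bicentral

variable {c₁ c₂ : T.Node} {p q : Fin n} (h : Bicentral T R i c₁ c₂ p q)
include h

theorem symm : Bicentral T R i c₂ c₁ q p where
  ws := h.ws
  edge := by rw [T.D_comm]; exact h.edge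
  hp := h.hq
  hq := h.hp
  pc₁ := h.qc₂
  pc₂ := h.qc₁
  qc₁ := h.pc₂
  qc₂ := h.pc₁
  near u hu := by
    have h1 := h.near u hu
    grind

theorem D_le {u : Fin n} (hu : u ∈ R.clique i) : T.D u c₁ ≤ 2 := by
  have := h.near u hu
  omega

theorem child {u : Fin n} (hu : u ∈ R.clique i) (h2 : T.D u c₁ = 2) :
    T.D u c₂ = 1 := by
  have h1 := h.near u hu
  have h3 := T.par u c₁ c₂
  have h4 := h.edge
  omega

theorem eq_ball : R.clique i = T.ball c₁ :=
  h.ws.root.eq_ball (R.isMaxClique i) fun _ hu => h.D_le hu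

theorem center_eq : T.center (R.clique i) = {c₁, c₂} := by
  have hpq : T.d p q = 3 := by
    have f := T.fp p c₁ c₂ q
    have h1 := h.edge
    have h2 := h.pc₁
    have h3 := h.qc₂
    have h4 := h.pc₂
    have h5 := h.qc₁
    grind
  have hmax : ∀ u ∈ R.clique i, ∀ v ∈ R.clique i, T.d u v ≤ T.d p q := by
    intro u hu v hv
    have h1 := h.near u hu
    have h2 := h.near v hv
    have t1 := T.D_tri u c₁ v
    have t2 := T.D_tri u c₂ v
    grind
  ext x
  rw [mem_center_iff_d h.hp h.hq hmax, hpq, Set.mem_insert_iff, Set.mem_singleton_iff]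
  have h1 := h.edge
  have h2 := h.pc₁
  have h3 := h.qc₂
  have h4 := h.pc₂
  have h5 := h.qc₁
  constructor
  · intro hx
    rw [← T.D_eq_zero, ← T.D_eq_zero]
    have f1 := T.fp x c₁ p q
    have f2 := T.fp x c₂ p q
    have c1 := T.D_comm c₁ p
    have c2 := T.D_comm c₂ p
    have c3 := T.D_comm c₁ q
    have c4 := T.D_comm c₂ q
    have p1 := T.par x p q
    grind
  grind

theorem answer (j : Fin R.q) (mode : ℕ) (hmode : mode < 4)
    (hnear : ∀ v ∈ R.clique i, (v : ℕ) ≠ T.idOf c₁ →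
      (Near R.clique i ⟨T.idOf c₁, T.idOf c₂, q, n, j, j, mode, True⟩ v ↔ T.D v c₁ ≤ 1)) :
    R.Answer i T := by
  have hc₂ : ∀ v, T.real v = c₂ → v ∈ R.clique i := fun v hv => by
    refine mem_of_D_le h.ws.root (c := c₁) (fun u hu => h.D_le hu) ?_
    have := h.edge
    grind
  have hmid : ∀ v ∈ R.clique i, T.D v c₁ = 2 → ∀ y, T.D v y = 1 →
      T.D y c₁ = 1 → y = c₂ := fun v hv h2 y h3 h4 =>
    mid_unique h2 h3 h4 (h.child hv h2) (by rw [T.D_comm]; exact h.edge)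
  have hb : ∀ v, OnBranch R.clique i ⟨T.idOf c₁, T.idOf c₂, q, n, j, j, mode, True⟩ v :=
    fun v => ⟨q, rfl, Or.inr (Or.inl trivial)⟩
  refine Answer.of_full h.ws ⟨T.idOf c₁, T.idOf c₂, q, n, j, j, mode, True⟩ hmode.le
    (Describes.of_parents ?_ subset_rfl (fun v => val_eq_idOf) (fun v hv => h.D_le hv)
      ?_ hnear ?_ ?_ ?_ ?_ ?_) h.center_eq (Dominated.refl _ _ _)
  · refine ⟨idOf_admissible fun v hv => ?_, idOf_admissible hc₂, Or.inr ⟨q, h.hq, rfl⟩, Or.inl rfl⟩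
    exact mem_of_D_le h.ws.root (c := c₁) (fun u hu => h.D_le hu) (by grind)
  · exact fun v hv _ => ⟨fun _ => hv, fun _ => Or.inl hmode.ne⟩
  · intro v hv h2 y h3 h4 hS u
    obtain rfl := hmid v hv h2 y h3 h4
    constructor
    · rintro ⟨h5, h6, h7, -⟩
      have h8 : ¬ T.D u c₁ ≤ 1 := fun h9 => h7 ((hnear u h5 h6).2 h9)
      have h9 := h.D_le h5
      have h10 : T.D u c₁ = 2 := by omega
      exact ⟨h5, h.child h5 h10, h10⟩
    · rintro ⟨h5, h6, h7⟩
      have h8 : (u : ℕ) ≠ T.idOf c₁ := fun e => by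
        rw [val_eq_idOf.1 e, T.D_self] at h7
        omega
      refine ⟨h5, h8, fun h9 => ?_, Or.inr (Or.inl trivial)⟩
      grind
  · grind
  · grind
  · grind
  · right
    refine ⟨by rw [T.D_comm]; exact h.edge, ?_⟩
    by_cases hlt : T.idOf c₂ < n
    · obtain ⟨a, ha⟩ := exists_real_of_idOf_lt hlt
      refine ⟨a, hc₂ a ha, Or.inl ⟨?_, ha⟩⟩
      rw [second, if_pos trivial, if_pos hlt, ← val_eq_idOf.2 ha]
    · refine ⟨q, h.hq, Or.inr ⟨h.qc₁, h.qc₂, ?_⟩⟩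
      rw [second, if_pos trivial, if_neg hlt, dif_pos q.2]

theorem answer_of_eq {j : Fin R.q} (hj : ∀ u ∈ R.clique i, u ∈ R.clique j ↔ T.D u c₁ ≤ 1) :
    R.Answer i T := by
  refine h.answer j 0 (by simp) fun v hv _ => ⟨?_, fun h1 => Or.inr (Or.inl ?_)⟩
  · rintro (e | ⟨-, h1, -⟩ | ⟨e, -⟩ | ⟨e, -⟩ | ⟨e, -⟩ | ⟨e, -⟩)
    · rw [val_eq_idOf.1 e, T.D_comm]
      exact h.edge.le
    · grind
    all_goals simp at e
  grind

theorem pair (_hno : ∀ j, j ≠ i → ¬ ∀ u ∈ R.clique i, u ∈ R.clique j ↔ T.D u c₁ ≤ 1)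
    (hno' : ∀ j, j ≠ i → ¬ ∀ u ∈ R.clique i, u ∈ R.clique j ↔ T.D u c₂ ≤ 1)
    {v w : Fin n} (hv : v ∈ R.clique i) (hvc : T.D v c₁ = 2) {m : Fin R.q} (hm : m ≠ i)
    (hvm : v ∈ R.clique m) (hw : w ∈ R.clique i) (hwm : w ∈ R.clique m) (hwv : w ≠ v) :
    T.real w = c₂ ∧ ∀ u ∈ R.clique i, u ∈ R.clique m → u = v ∨ u = w := by
  obtain ⟨t, ht⟩ := h.ws.root.exists_center (R.isMaxClique m) ⟨v, hvm⟩
  have hvc₂ := h.child hv hvc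
  have hfar : ∀ u ∈ R.clique i, T.D u v = 1 → T.D u c₂ ≤ 1 := by
    intro u hu h1
    rcases h.near u hu with h2 | h2
    · by_contra hlt
      have p1 := T.par u c₁ c₂
      have h3 := h.edge
      have h4 : T.D u c₁ = 1 := by omega
      have h5 := mid_unique hvc (by grind) h4 hvc₂ (by grind)
      grind
    grind
  obtain ⟨p', hp', ⟨rfl, h1⟩ | ⟨-, -, h1⟩ | ⟨-, x, h2, h3, -, h1⟩ | ⟨x, -, -, -, h1⟩⟩ :=
    inter_types h.symm.eq_ball ht (by
      rintro rfl
      exact hm (R.clique_injective (ht.trans h.symm.eq_ball.symm)))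
  · exfalso
    refine hno' m hm fun u hu => (h1 u hu).trans (or_iff_left_of_imp fun h2 => ?_)
    by_contra hlt
    have hu2 := h.symm.D_le hu
    have hu1 := h.symm.child hu (by omega)
    have h5 : T.D u t = 1 := by
      have t1 := T.D_tri u t c₂
      grind
    have h6 := mid_unique (by grind) h5 (by grind) hu1
      h.edge
    exact hm (R.clique_injective (by rw [ht, h6, h.eq_ball]))
  · have h2 := (h1 v hv).1 hvm
    have h3 := (h1 w hw).1 hwm
    have e : T.real v = p' := T.D_eq_zero.1 (by
      have := T.par v c₂ p'
      omega)
    have key : ∀ u ∈ R.clique i, u ∈ R.clique m → u ≠ v → T.real u = c₂ := by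
      intro u hu hum huv
      have h4 := (h1 u hu).1 hum
      rw [← e] at h4
      have h5 : T.D u v ≠ 0 := fun h => huv (T.d_eq_zero.1 h)
      have h6 := hfar u hu (by omega)
      have := T.par u v c₂
      exact T.D_eq_zero.1 (by omega)
    grind
  all_goals grind

theorem answer_of_pairs
    (hno : ∀ j, j ≠ i → ¬ ∀ u ∈ R.clique i, u ∈ R.clique j ↔ T.D u c₁ ≤ 1)
    (hno' : ∀ j, j ≠ i → ¬ ∀ u ∈ R.clique i, u ∈ R.clique j ↔ T.D u c₂ ≤ 1) :
    R.Answer i T := by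
  have hfree : ∀ v, ¬ IsFree G (R.clique i) v := by
    intro v hv
    obtain ⟨s, hs, t, ht, hst⟩ := h.ws.diam _ (R.isMaxClique i) v hv
    have h1 := h.near s hs
    have h2 := h.near t ht
    have t1 := T.D_tri s c₁ t
    have t2 := T.D_tri s c₂ t
    grind
  refine h.answer i 2 (by simp) fun v hv hvc => ⟨?_, fun h1 => ?_⟩
  · rintro (e | ⟨e, -⟩ | ⟨e, -⟩ | ⟨-, -, -, hex⟩ | ⟨e, -⟩ | ⟨e, -⟩)
    · rw [val_eq_idOf.1 e, T.D_comm]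
      exact h.edge.le
    · simp at e
    · simp at e
    · by_contra hlt
      have h2 : T.D v c₁ = 2 := by
        have := h.D_le hv
        omega
      obtain ⟨m, hm, hvm, w, hw, hwm, hwv⟩ := R.exists_clique_of_not_isFree hv (hfree v)
      obtain ⟨h3, h4⟩ := h.pair hno hno' hv h2 hm hvm hw hwm hwv
      refine hex ⟨m, hvm, fun u hu _ hum => ?_, Or.inr ⟨w, hw, hw, hwm, hwv⟩⟩
      rcases h4 u hu hum with rfl | rfl
      · grind
      · exact Or.inr (val_eq_idOf.2 h3)
    · simp at e
    · simp at e
  · by_cases e : T.real v = c₂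
    · exact Or.inl (val_eq_idOf.2 e)
    refine Or.inr (Or.inr (Or.inr (Or.inl ⟨rfl, hv, v.2.ne, ?_⟩)))
    have hvc' : T.real v ≠ c₁ := fun e => hvc (val_eq_idOf.2 e)
    have h0 : T.D v c₁ ≠ 0 := fun e => hvc' (T.D_eq_zero.1 e)
    have h0' : T.D v c₂ ≠ 0 := fun h => e (T.D_eq_zero.1 h)
    have h2 : T.D v c₂ = 2 := by
      have := h.near v hv
      have := T.par v c₁ c₂
      have := h.edge
      omega
    rintro ⟨m, hvm, hsub, ⟨w, -, h3, h4⟩ | ⟨w, hw, -, hwm, hwv⟩⟩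
    · exact h4 h3
    by_cases hm : m = i
    · subst hm
      obtain ⟨m', hm', hvm', w', hw', hwm', hwv'⟩ := R.exists_clique_of_not_isFree hv (hfree v)
      have h5 := (h.symm.pair hno' hno hv h2 hm' hvm' hw' hwm' hwv').1
      rcases hsub w' hw' hw' hw' with e' | e'
      · grind
      · have h6 := val_eq_idOf.1 e'
        grind
    · have h5 := (h.symm.pair hno' hno hv h2 hm hvm hw hwm hwv).1
      rcases hsub w hw hw hwm with e' | e'
      · exact hwv e'
      · have h6 := val_eq_idOf.1 e'
        grind

theorem answer' : R.Answer i T := by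
  by_cases h1 : ∃ j, j ≠ i ∧ ∀ u ∈ R.clique i, u ∈ R.clique j ↔ T.D u c₁ ≤ 1
  · obtain ⟨j, -, hj⟩ := h1
    exact h.answer_of_eq hj
  by_cases h2 : ∃ j, j ≠ i ∧ ∀ u ∈ R.clique i, u ∈ R.clique j ↔ T.D u c₂ ≤ 1
  · obtain ⟨j, -, hj⟩ := h2
    exact h.symm.answer_of_eq hj
  · exact h.answer_of_pairs (fun j hj hj' => h1 ⟨j, hj, hj'⟩) fun j hj hj' => h2 ⟨j, hj, hj'⟩

end Bicentral

theorem answer_of_lt (hG : G.Connected) (hn : 2 ≤ n) (hws : MetricWS T G)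
    (hlt : ∀ u ∈ R.clique i, ∀ v ∈ R.clique i, T.d u v ≠ 4) : R.Answer i T := by
  obtain ⟨p, hp, q, hq, hmax⟩ := exists_diametral_d T (X := R.clique i)
    (by have : Nonempty (Fin n) := ⟨⟨0, by omega⟩⟩; exact R.clique_nonempty i)
  obtain ⟨u, hu, v, hv, huv⟩ := exists_ne_mem_clique hG hn R i
  have h0 : T.d p q ≠ 0 := fun e => by
    have h1 := hmax u hu v hv
    exact huv (T.d_eq_zero.1 (by omega))
  have h4 := hws.root.d_le (R.isMaxClique i).isClique hp hq
  have h4' := hlt p hp q hq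
  rcases (by omega : T.d p q = 1 ∨ T.d p q = 2 ∨ T.d p q = 3) with h1 | h1 | h1
  · exact answer_of_edge hws hp hq hmax h1
  · exact answer_of_star hws hp hq hmax h1
  · have h1' : T.D p q = 3 := h1
    obtain ⟨c₁, h2, h3⟩ := T.D_between p q (i := 1) (by omega)
    obtain ⟨c₂, h5, h6⟩ := T.D_between c₁ q (i := 1) (by omega)
    have t1 := T.D_tri p c₁ c₂
    have t2 := T.D_tri p c₂ q
    have c1 := T.D_comm c₁ q
    have c2 := T.D_comm c₂ q
    refine (⟨hws, h5, hp, hq, h2, by omega, by omega, by omega, fun u hu => ?_⟩ :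
      Bicentral T R i c₁ c₂ p q).answer'
    have h7 := hmax u hu p hp
    have h8 := hmax u hu q hq
    rw [h1] at h7 h8
    have f1 := T.fp u c₁ p q
    have f2 := T.fp u c₂ p q
    have c3 := T.D_comm c₁ p
    have c4 := T.D_comm c₂ p
    have p1 := T.par u c₁ c₂
    grind

end RootedCliqueTree

end

section

/-! ## Cliques whose subtree has diameter four -/

open SubTree TreeMetric

namespace RootedCliqueTree

open SteinerTree Guess

variable {n : ℕ} {G : SimpleGraph (Fin n)} {R : RootedCliqueTree G} {i : Fin R.q}
  {T : SteinerTree (Fin n)} {c : T.Node}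

/-- The center of the subtree spanned by the clique is the node `c`, and its diameter is four. -/
structure Central (T : SteinerTree (Fin n)) (R : RootedCliqueTree G) (i : Fin R.q)
    (c : T.Node) : Prop where
  ws : MetricWS T G
  ball : R.clique i = T.ball c
  far : ∃ p ∈ R.clique i, ∃ q ∈ R.clique i, T.d p q = 4

namespace Central

theorem exists_center (hws : MetricWS T G) {p q : Fin n} (hp : p ∈ R.clique i)
    (hq : q ∈ R.clique i) (hpq : T.d p q = 4) : ∃ c, Central T R i c := by
  obtain ⟨c, hc⟩ := hws.root.exists_center (R.isMaxClique i) ⟨p, hp⟩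
  exact ⟨c, hws, hc, p, hp, q, hq, hpq⟩

variable (h : Central T R i c)
include h

theorem mem_iff {u : Fin n} : u ∈ R.clique i ↔ T.D u c ≤ 2 := Set.ext_iff.1 h.ball u

theorem D_le {u : Fin n} (hu : u ∈ R.clique i) : T.D u c ≤ 2 := h.mem_iff.1 hu

theorem mem_of_real {u : Fin n} (hu : T.real u = c) : u ∈ R.clique i :=
  h.mem_iff.2 (by grind)

theorem d_le_four {u v : Fin n} (hu : u ∈ R.clique i) (hv : v ∈ R.clique i) : T.d u v ≤ 4 :=
  h.ws.root.d_le (R.isMaxClique i).isClique hu hv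

theorem center_eq : T.center (R.clique i) = {c, c} := by
  obtain ⟨p, hp, q, hq, hpq⟩ := h.far
  ext x
  rw [mem_center_iff_d hp hq (fun u hu v hv => hpq ▸ h.d_le_four hu hv), hpq,
    Set.pair_eq_singleton, Set.mem_singleton_iff]
  have h1 := h.D_le hp
  have h2 := h.D_le hq
  have c1 := T.D_comm c p
  have c2 := T.D_comm c q
  constructor
  · intro hx
    have f := T.fp x c p q
    refine T.D_eq_zero.1 ?_
    grind
  grind

theorem diam_eq : (T.subtree (R.clique i)).diam = 4 := by
  obtain ⟨p, hp, q, hq, hpq⟩ := h.far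
  rw [diam_subtree hp hq (fun u hu v hv => hpq ▸ h.d_le_four hu hv), hpq]

/-- The types of the intersections with the other maximal cliques. -/
theorem types {m : Fin R.q} (hm : m ≠ i) : ∃ t, R.clique m = T.ball t ∧ ∃ p, T.D c p = 1 ∧
    ((t = p ∧ ∀ u ∈ R.clique i, u ∈ R.clique m ↔
        T.D u c ≤ 1 ∨ T.D u p ≤ 1) ∨
      (T.D c t = 2 ∧ T.D p t = 1 ∧ ∀ u ∈ R.clique i, u ∈ R.clique m ↔ T.D u p ≤ 1) ∨
      (T.D c t = 3 ∧ ∃ x, T.D p x = 1 ∧ T.D c x = 2 ∧ T.D x t = 1 ∧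
        ∀ u ∈ R.clique i, u ∈ R.clique m ↔ T.real u = p ∨ T.real u = x) ∨
      (∃ x, T.D p x = 1 ∧ T.D c x = 2 ∧ 2 ≤ T.D x t ∧
        ∀ u ∈ R.clique i, u ∈ R.clique m → T.real u = x)) := by
  have : Nonempty (Fin n) := h.far.nonempty
  obtain ⟨t, ht⟩ := h.ws.root.exists_center (R.isMaxClique m) (R.clique_nonempty m)
  refine ⟨t, ht, inter_types h.ball ht ?_⟩
  rintro rfl
  exact hm (R.clique_injective (ht.trans h.ball.symm))

omit h in
theorem D_eq_one_of_le {y p : T.Node} (hp : T.D c p = 1) (hy : T.D y c = 2) (h1 : T.D y p ≤ 1) :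
    T.D y p = 1 := by
  have := T.par y c p
  omega

omit h in
theorem eq_of_le {y p : T.Node} (hp : T.D c p = 1) (hy : T.D y c = 1) (h1 : T.D y p ≤ 1) :
    y = p := by
  have := T.par y c p
  exact T.D_eq_zero.1 (by omega)

/-- A clique that contains a vertex at distance two from the center and another vertex contains the
middle node between the first vertex and the center. -/
theorem mid_cases {m : Fin R.q} (hm : m ≠ i) {v u : Fin n} (hv : T.D v c = 2)
    (hvm : v ∈ R.clique m) (hu : u ∈ R.clique i) (hum : u ∈ R.clique m) (huv : u ≠ v)
    {y : T.Node} (hy : T.D v y = 1) (hyc : T.D y c = 1) :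
    (∀ w ∈ R.clique i, T.D w y ≤ 1 → w ∈ R.clique m) ∨
      (T.real u = y ∧ ∀ w ∈ R.clique i, w ∈ R.clique m ↔ w = u ∨ w = v) := by
  have hvi : v ∈ R.clique i := h.mem_iff.2 hv.le
  obtain ⟨t, -, p, hp, ⟨-, h1⟩ | ⟨-, -, h1⟩ | ⟨-, x, hpx, hx, -, h1⟩ | ⟨x, -, -, -, h1⟩⟩ := h.types hm
  · have h2 := (h1 v hvi).1 hvm
    obtain rfl := mid_unique hv hy hyc (D_eq_one_of_le hp hv (by omega)) (by grind)
    grind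
  · have h2 := (h1 v hvi).1 hvm
    obtain rfl := mid_unique hv hy hyc (D_eq_one_of_le hp hv (by omega)) (by grind)
    grind
  · right
    have h2 : T.real v = x := ((h1 v hvi).1 hvm).resolve_left fun e => by grind
    have h3 : T.real u = p := ((h1 u hu).1 hum).resolve_right fun e =>
      huv (T.real.injective (e.trans h2.symm))
    have h4 : y = p := mid_unique hv hy hyc (by grind)
      (by grind)
    grind
  grind

theorem mid_mem {m : Fin R.q} (hm : m ≠ i) {v u : Fin n} (hv : T.D v c = 2)
    (hvm : v ∈ R.clique m) (hu : u ∈ R.clique i) (hum : u ∈ R.clique m) (huv : u ≠ v)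
    {a : Fin n} (ha : T.d v a = 1) (hac : T.D a c = 1) : a ∈ R.clique m := by
  rcases h.mid_cases hm hv hvm hu hum huv ha hac with h1 | ⟨h1, -⟩
  · exact h1 a (h.mem_iff.2 (by omega)) (by grind)
  grind

/-- Two vertices at distance two from the center that share another clique are in one branch. -/
theorem same_mid {m : Fin R.q} (hm : m ≠ i) {u v : Fin n} (hu : T.D u c = 2)
    (hv : T.D v c = 2) (hum : u ∈ R.clique m) (hvm : v ∈ R.clique m) {y : T.Node}
    (hy : T.D v y = 1) (hyc : T.D y c = 1) : T.D u y = 1 := by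
  by_cases huv : u = v
  · rwa [huv]
  have hui : u ∈ R.clique i := h.mem_iff.2 hu.le
  have hvi : v ∈ R.clique i := h.mem_iff.2 hv.le
  obtain ⟨t, -, p, hp, ⟨-, h1⟩ | ⟨-, -, h1⟩ | ⟨-, x, hpx, hx, -, h1⟩ | ⟨x, -, -, -, h1⟩⟩ := h.types hm
  · have h2 := (h1 v hvi).1 hvm
    have h3 := (h1 u hui).1 hum
    obtain rfl := mid_unique hv hy hyc (D_eq_one_of_le hp hv (by omega)) (by grind)
    exact D_eq_one_of_le hp hu (by omega)
  · have h2 := (h1 v hvi).1 hvm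
    have h3 := (h1 u hui).1 hum
    obtain rfl := mid_unique hv hy hyc (D_eq_one_of_le hp hv (by omega)) (by grind)
    exact D_eq_one_of_le hp hu (by omega)
  all_goals grind

theorem not_isFree {v : Fin n} (hv : T.D v c ≤ 1) : ¬ IsFree G (R.clique i) v := fun hf => by
  have := (h.ws.exists_path (R.isMaxClique i) hf fun u hu => h.D_le hu).1
  omega

theorem exists_clique_of_le {v : Fin n} (hv : T.D v c ≤ 1) :
    ∃ m, m ≠ i ∧ v ∈ R.clique m ∧ ∃ u ∈ R.clique i, u ∈ R.clique m ∧ u ≠ v :=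
  R.exists_clique_of_not_isFree (h.mem_iff.2 (by omega)) (h.not_isFree hv)

theorem exists_clique_of_child {v a : Fin n} (hv : T.D v c = 2) (hva : T.d v a = 1)
    (ha : T.D a c = 1) :
    ∃ m, m ≠ i ∧ v ∈ R.clique m ∧ a ∈ R.clique m := by
  have hvi : v ∈ R.clique i := h.mem_iff.2 hv.le
  have hf : ¬ IsFree G (R.clique i) v := fun hf => by
    obtain ⟨-, y, y1, y2, hS, -⟩ := h.ws.exists_path (R.isMaxClique i) hf fun u hu => h.D_le hu
    exact hS a (mid_unique hv hva ha y1 y2)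
  obtain ⟨m, hm, hvm, u, hu, hum, huv⟩ := R.exists_clique_of_not_isFree hvi hf
  exact ⟨m, hm, hvm, h.mid_mem hm hv hvm hu hum huv hva ha⟩

theorem share_of_siblings {u v : Fin n} (huv : u ≠ v) (hu : T.D u c = 2)
    (hv : T.D v c = 2) {y : T.Node} (huy : T.D u y = 1)
    (hvy : T.D v y = 1) (hyc : T.D y c = 1) (hy : T.IsSteinerNode y) :
    Share R.clique i v u := by
  have hvi : v ∈ R.clique i := h.mem_iff.2 hv.le
  have hui : u ∈ R.clique i := h.mem_iff.2 hu.le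
  have hf : ¬ IsFree G (R.clique i) v := fun hf => by
    obtain ⟨-, z, z1, z2, -, hz⟩ := h.ws.exists_path (R.isMaxClique i) hf fun u hu => h.D_le hu
    obtain rfl := mid_unique hv hvy hyc z1 z2
    grind
  obtain ⟨m, hm, hvm, w, hw, hwm, hwv⟩ := R.exists_clique_of_not_isFree hvi hf
  refine ⟨m, hm, hvm, ?_⟩
  rcases h.mid_cases hm hv hvm hw hwm hwv hvy hyc with h1 | ⟨h1, -⟩
  · grind
  · exact absurd h1 (hy w)

theorem sibling_iff {τ : Guess R.q} (hc : ∀ v : Fin n, (v : ℕ) = τ.c ↔ T.real v = c) (hg : ¬ τ.g)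
    (hnear : ∀ u ∈ R.clique i, T.D u c = 2 → ¬ Near R.clique i τ u)
    {v : Fin n} (hv : T.D v c = 2)
    (hfar : ∀ u ∈ R.clique i, T.D u c = 1 → Near R.clique i τ u ∨ ¬ Share R.clique i v u)
    {y : T.Node} (hvy : T.D v y = 1) (hyc : T.D y c = 1) (hy : T.IsSteinerNode y)
    (u : Fin n) : Sibling R.clique i τ v u ↔
      u ∈ R.clique i ∧ T.D u y = 1 ∧ T.D u c = 2 := by
  constructor
  · rintro ⟨h1, h2, h3, h4⟩
    have h0 : T.D u c ≠ 0 := fun e => h2 ((hc u).2 (T.D_eq_zero.1 e))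
    rcases h4 with rfl | h4 | ⟨m, hm, hvm, hum⟩
    · grind
    · grind
    · have h5 : T.D u c ≠ 1 := fun e =>
        (hfar u h1 e).elim h3 fun h6 => h6 ⟨m, hm, hvm, hum⟩
      have h6 : T.D u c = 2 := by
        have := h.D_le h1
        omega
      exact ⟨h1, h.same_mid hm h6 hv hum hvm hvy hyc, h6⟩
  · rintro ⟨h1, h2, h3⟩
    refine ⟨h1, fun e => ?_, hnear u h1 h3, ?_⟩
    · grind
    · by_cases e : v = u
      · exact Or.inl e
      · exact Or.inr (Or.inr (h.share_of_siblings (Ne.symm e) h3 hv h2 hvy hyc hy))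

end Central

end RootedCliqueTree

end

section

/-! ## Cliques with no crossing branch -/

open SubTree TreeMetric

namespace RootedCliqueTree

open SteinerTree Guess

variable {n : ℕ} {G : SimpleGraph (Fin n)} {R : RootedCliqueTree G} {i : Fin R.q}
  {T : SteinerTree (Fin n)} {c : T.Node}

/-- The other cliques meet the clique in a branch, in the two nodes of a path, or in at most one
vertex. -/
structure NonCross (T : SteinerTree (Fin n)) (R : RootedCliqueTree G) (i : Fin R.q)
    (c : T.Node) : Prop extends Central T R i c where
  cases : ∀ m, m ≠ i → ∃ p, T.D c p = 1 ∧
    ((∀ u ∈ R.clique i, u ∈ R.clique m ↔ T.D u p ≤ 1) ∨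
    (∃ x, T.D p x = 1 ∧ T.D c x = 2 ∧
      ∀ u ∈ R.clique i, u ∈ R.clique m ↔ T.real u = p ∨ T.real u = x) ∨
    ∀ u ∈ R.clique i, u ∈ R.clique m → ∀ u' ∈ R.clique i, u' ∈ R.clique m → u = u')

theorem Central.nonCross (h : Central T R i c)
    (hno : ∀ m, m ≠ i → ∀ t, R.clique m = T.ball t → T.D c t = 1 →
      (∀ u ∈ R.clique i, T.D u c = 1 → T.real u = t) ∨
      ∀ u ∈ R.clique i, u ∈ R.clique m → ∀ u' ∈ R.clique i, u' ∈ R.clique m → u = u') :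
    NonCross T R i c := by
  refine ⟨h, fun m hm => ?_⟩
  obtain ⟨t, ht, p, hp, ⟨rfl, h1⟩ | ⟨-, -, h1⟩ | ⟨-, x, hpx, hx, -, h1⟩ | ⟨x, -, -, -, h1⟩⟩ :=
    h.types hm
  · refine ⟨t, hp, ?_⟩
    rcases hno m hm t ht hp with h2 | h2
    · refine Or.inl fun u hu => (h1 u hu).trans (or_iff_right_of_imp fun h3 => ?_)
      by_cases h4 : T.D u c = 1
      · grind
      · rw [T.D_eq_zero.1 (by omega : T.D u c = 0), hp]
    grind
  · grind
  all_goals grind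

namespace NonCross

variable (h : NonCross T R i c)
include h

/-- A clique with two common vertices meets the clique in (a part of) one branch. -/
theorem le_one {m : Fin R.q} (hm : m ≠ i) {u v : Fin n} (hu : u ∈ R.clique i)
    (hum : u ∈ R.clique m) (hv : v ∈ R.clique i) (hvm : v ∈ R.clique m) (huv : u ≠ v) :
    ∃ p, T.D c p = 1 ∧ (∀ w ∈ R.clique i, w ∈ R.clique m → T.D w p ≤ 1) ∧
      ((∀ w ∈ R.clique i, T.D w p ≤ 1 → w ∈ R.clique m) ∨
        ∃ a x : Fin n, T.real a = p ∧ T.d x a = 1 ∧ T.D x c = 2 ∧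
          ∀ w ∈ R.clique i, w ∈ R.clique m ↔ w = a ∨ w = x) := by
  obtain ⟨p, hp, h1 | ⟨x, hpx, hx, h1⟩ | h1⟩ := h.cases m hm
  · grind
  · refine ⟨p, hp, fun w hw hwm => ?_, Or.inr ?_⟩
    · grind
    · have key : ∀ a x' : Fin n, T.real a = p → T.real x' = x → ∃ a x : Fin n, T.real a = p ∧
          T.d x a = 1 ∧ T.D x c = 2 ∧
          ∀ w ∈ R.clique i, w ∈ R.clique m ↔ w = a ∨ w = x := by
        rintro a x' rfl rfl
        grind
      grind
  grind

omit h in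
theorem eq_of_le_one {y p p' : T.Node} (hp : T.D c p = 1) (hp' : T.D c p' = 1) (hy : y ≠ c)
    (h1 : T.D y p ≤ 1) (h2 : T.D y p' ≤ 1) : p = p' := by
  have h3 : T.D y c ≠ 0 := fun e => hy (T.D_eq_zero.1 e)
  have f := T.fp y c p p'
  have p1 := T.par y c p
  have p2 := T.par y c p'
  exact T.D_eq_zero.1 (by omega)

variable {τ : Guess R.q} (hc : ∀ v : Fin n, (v : ℕ) = τ.c ↔ T.real v = c)
include hc

/-- The vertices of a completely covered branch are dropped. -/
theorem dropped {m : Fin R.q} (hm : m ≠ i) {p : T.Node} (hp : T.D c p = 1)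
    (hle : ∀ w ∈ R.clique i, w ∈ R.clique m → T.D w p ≤ 1)
    (hmem : ∀ w ∈ R.clique i, T.D w p ≤ 1 → w ∈ R.clique m) {u v : Fin n}
    (hvm : v ∈ R.clique m) (hu : u ∈ R.clique i) (hum : u ∈ R.clique m) (huv : u ≠ v) :
    Dropped R.clique i τ v := by
  refine ⟨m, hm, hvm, ⟨u, hu, hum, huv⟩, ?_⟩
  rintro l hl ⟨x, hx, hxl, hxm, hxc⟩ w hw hwl hwc
  by_cases hwx : w = x
  · rwa [hwx]
  obtain ⟨p', hp', h1, -⟩ := h.le_one hl hw hwl hx hxl hwx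
  obtain rfl := eq_of_le_one hp hp' (fun e => hxc ((hc x).2 e)) (hle x hx hxm) (h1 x hx hxl)
  grind

theorem not_nearByMode (hmode : τ.mode = 4) {v : Fin n} (hv : T.D v c = 2) :
    ¬ NearByMode R.clique i τ v := by
  have hvi : v ∈ R.clique i := h.mem_iff.2 hv.le
  have hvc : T.real v ≠ c := fun e => by grind
  rintro (⟨e, -⟩ | ⟨e, -⟩ | ⟨e, -⟩ | ⟨e, -⟩ |
    ⟨-, hd, l, hl, hvl, ⟨u, hu, hul, huv⟩, m, hm, hvm, w, hw, hwm, hwl⟩)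
  iterate 4 omega
  have hwv : w ≠ v := fun e => hwl (e ▸ hvl)
  obtain ⟨p, hp, h1, h2 | ⟨a, x, ha, hxa, hx, h2⟩⟩ := h.le_one hl hu hul hvi hvl huv
  · exact hd (h.dropped hc hl hp h1 h2 hvl hu hul huv)
  · obtain ⟨p', hp', h3, h4 | ⟨a', x', ha', hxa', hx', h4⟩⟩ := h.le_one hm hw hwm hvi hvm hwv
    · exact hd (h.dropped hc hm hp' h3 h4 hvm hw hwm hwv)
    · obtain rfl := eq_of_le_one hp hp' hvc (h1 v hvi hvl) (h3 v hvi hvm)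
      grind

theorem near_of_not_dropped (hmode : τ.mode = 4) {v : Fin n} (hv : T.D v c = 1)
    (hd : ¬ Dropped R.clique i τ v) : NearByMode R.clique i τ v := by
  have hvi : v ∈ R.clique i := h.mem_iff.2 (by omega)
  obtain ⟨l, hl, hvl, u, hu, hul, huv⟩ := h.exists_clique_of_le hv.le
  refine Or.inr (Or.inr (Or.inr (Or.inr ⟨hmode, hd, l, hl, hvl, ⟨u, hu, hul, huv⟩, ?_⟩)))
  obtain ⟨p, hp, h1, h2 | ⟨a, x, ha, hxa, hx, h2⟩⟩ := h.le_one hl hu hul hvi hvl huv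
  · exact absurd (h.dropped hc hl hp h1 h2 hvl hu hul huv) hd
  · have hva : v = a := by grind
    subst hva
    by_contra hno
    refine hd ⟨l, hl, hvl, ⟨u, hu, hul, huv⟩, ?_⟩
    rintro l' hl' ⟨z, hz, hzl', hzl, hzc⟩ w hw hwl' hwc
    by_contra hwl
    refine hno ⟨l', hl', ?_, w, hw, hwl', hwl⟩
    rcases (h2 z hz).1 hzl with rfl | rfl
    · exact hzl'
    · exact h.mid_mem hl' hx hzl' hw hwl' (fun e => hwl (e ▸ hzl)) hxa hv

end NonCross

end RootedCliqueTree

end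

section

open SubTree TreeMetric

namespace RootedCliqueTree

open SteinerTree Guess

variable {n : ℕ} {G : SimpleGraph (Fin n)} {R : RootedCliqueTree G} {i : Fin R.q}
  {T : SteinerTree (Fin n)} {c : T.Node}

namespace NonCross

section

variable (h : NonCross T R i c)
include h

omit h in
theorem span_le {S : Set (Fin n)} {p : T.Node} (hS : ∀ u ∈ S, T.D u p ≤ 1) {y : T.Node}
    (hy : y ∈ T.span S) : T.D y p ≤ 1 := by
  obtain ⟨u, hu, v, hv, huv⟩ := mem_span_iff.1 hy
  have h1 := hS u hu
  have h2 := hS v hv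
  have f := T.fp y p u v
  grind

/-- The tree spanned by a complete branch. -/
theorem span_diff {S : Set (Fin n)} {p : T.Node} (hp : T.D c p = 1) (hSi : S ⊆ R.clique i)
    (hS : ∀ u ∈ S, T.D u p ≤ 1)
    (hS' : ∀ u ∈ R.clique i, T.D u p ≤ 1 → T.real u ≠ c → u ∈ S)
    {u v : Fin n} (hu : u ∈ S) (hv : v ∈ S) (huv : u ≠ v) :
    p ∈ T.span S ∧ ∀ y, y ∈ T.span S \ {c} ↔ y ∈ T.span (R.clique i) ∧ T.D y c = T.D y p + 1 := by
  have hps : p ∈ T.span S := by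
    have h1 := hS u hu
    have h2 := hS v hv
    have h3 : T.D u v ≠ 0 := fun e => huv (T.real.injective (T.D_eq_zero.1 e))
    have pr := T.par u p v
    have c1 := T.D_comm p v
    by_cases e1 : T.D u p = 0
    · exact mem_span_iff.2 ⟨u, hu, v, hv, by rw [T.D_eq_zero.1 e1, T.D_self]; simp⟩
    by_cases e2 : T.D v p = 0
    · exact mem_span_iff.2 ⟨u, hu, v, hv, by rw [T.D_eq_zero.1 e2, T.D_self]; simp⟩
    have t := T.D_tri u p v
    exact mem_span_iff.2 ⟨u, hu, v, hv, by omega⟩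
  refine ⟨hps, fun y => ⟨?_, ?_⟩⟩
  · rintro ⟨hy, hyc⟩
    have h1 := span_le hS hy
    have h0 : T.D y c ≠ 0 := fun e => hyc (T.D_eq_zero.1 e)
    have pr := T.par y c p
    have t := T.D_tri y p c
    have c1 := T.D_comm c p
    obtain ⟨u, hu, v, hv, huv⟩ := mem_span_iff.1 hy
    exact ⟨mem_span_iff.2 ⟨u, hSi hu, v, hSi hv, huv⟩, by omega⟩
  · rintro ⟨hy, hyc⟩
    refine ⟨?_, fun e => ?_⟩
    · have key : ∀ u ∈ R.clique i, T.D u c = T.D u p + 1 → u ∈ S := by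
        intro u hu h1
        have h2 := h.D_le hu
        grind
      have near : ∀ u ∈ R.clique i, ∀ v ∈ R.clique i,
          T.D u y + T.D y v = T.D u v →
          T.D u c = T.D u p + 1 →
          y ∈ T.span S := by
        intro u hu v hv huv h1
        have huS := key u hu h1
        by_cases h2 : T.D v c = T.D v p + 1
        · exact mem_span_iff.2 ⟨u, huS, v, key v hv h2, huv⟩
        · have pr := T.par v c p
          have t1 := T.D_tri v p c
          have t2 := T.D_tri v c p
          have c1 := T.D_comm c p
          have h3 : T.D v p = T.D v c + 1 := by omega
          have f := T.fp y c v p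
          have f2 := T.fp u c v p
          have c2 := T.D_comm c v
          have h4 := h.D_le hu
          have h5 : T.D u y + T.D y p = T.D u p := by grind
          by_cases h6 : T.D y p = 0
          · rwa [T.D_eq_zero.1 h6]
          · have h7 : T.D u y = 0 := by grind
            rw [← T.D_eq_zero.1 h7]
            exact mem_span_iff.2 ⟨u, huS, u, huS, by simp⟩
      obtain ⟨u, hu, v, hv, huv⟩ := mem_span_iff.1 hy
      by_cases h1 : T.D u c = T.D u p + 1
      · grind
      · refine near v hv u hu ?_ ?_
        · grind
        · have f := T.fp u v c p
          have f1 := T.fp y u c p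
          have c1 := T.D_comm y u
          have c2 := T.D_comm v c
          have c3 := T.D_comm v p
          have pr := T.par u c p
          have pr' := T.par v c p
          have t1 := T.D_tri u p c
          have t2 := T.D_tri u c p
          have t3 := T.D_tri v p c
          have t4 := T.D_tri v c p
          have c4 := T.D_comm c p
          have f2 := T.fp y v c p
          omega
    grind

theorem component {S : Set (Fin n)} {p : T.Node} (hp : T.D c p = 1) (hSi : S ⊆ R.clique i)
    (hS : ∀ u ∈ S, T.D u p ≤ 1)
    (hS' : ∀ u ∈ R.clique i, T.D u p ≤ 1 → T.real u ≠ c → u ∈ S)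
    {u v : Fin n} (hu : u ∈ S) (hv : v ∈ S) (huv : u ≠ v) :
    ∃ D : (T.graph.induce (T.span (R.clique i) \ {c})).ConnectedComponent,
      Subtype.val '' D.supp = T.span S \ {c} := by
  obtain ⟨hps, hiff⟩ := h.span_diff hp hSi hS hS' hu hv huv
  have hpc : p ≠ c := fun e => by grind
  have hpi := ((hiff p).1 ⟨hps, hpc⟩).1
  have hsub : ∀ y, y ∈ T.span S \ {c} → y ∈ T.span (R.clique i) \ {c} := fun y hy =>
    ⟨((hiff y).1 hy).1, hy.2⟩
  refine ⟨(T.graph.induce (T.span (R.clique i) \ {c})).connectedComponentMk ⟨p, hpi, hpc⟩, ?_⟩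
  ext y
  constructor
  · rintro ⟨⟨y, hy⟩, hr, rfl⟩
    obtain ⟨w⟩ := SimpleGraph.ConnectedComponent.exact hr
    rw [hiff]
    refine ⟨hy.1, ?_⟩
    have key : ∀ (a b : ↑(T.span (R.clique i) \ {c}))
        (_ : (T.graph.induce (T.span (R.clique i) \ {c})).Walk a b),
        T.D b c = T.D b p + 1 → T.D a c = T.D a p + 1 := by
      intro a b w
      induction w with
      | nil => exact id
      | @cons a b d hab w ih =>
        intro hd
        have h1 := ih hd
        have h2 : T.D a b = 1 := T.D_eq_one.2 hab
        have h3 : T.D a c ≠ 0 := fun e => a.2.2 (T.D_eq_zero.1 e)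
        have h4 : T.D b c ≠ 0 := fun e => b.2.2 (T.D_eq_zero.1 e)
        have f := T.fp a b c p
        have pr := T.par a c p
        grind
    exact key _ _ w (by grind)
  · intro hy
    refine ⟨⟨y, hsub y hy⟩, ?_, rfl⟩
    refine SimpleGraph.ConnectedComponent.sound ?_
    have h1 := span_le hS hy.1
    by_cases h0 : T.D y p = 0
    · obtain rfl := T.D_eq_zero.1 h0
      exact .rfl
    · exact SimpleGraph.Adj.reachable (T.D_eq_one.1 (by omega : T.D y p = 1))

theorem isThinBranch {l : Fin R.q} (hl : l ≠ i)
    (hmax : ∀ m, m ≠ i → R.clique i ∩ R.clique l ⊆ R.clique i ∩ R.clique m →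
      R.clique i ∩ R.clique m ⊆ R.clique i ∩ R.clique l) {p : T.Node} (hp : T.D c p = 1)
    (hS : ∀ u ∈ R.clique i, u ∈ R.clique l → T.D u p ≤ 1)
    (hS' : ∀ u ∈ R.clique i, T.D u p ≤ 1 → T.real u ≠ c → u ∈ R.clique l)
    {u v : Fin n} (hu : u ∈ R.clique i ∩ R.clique l) (hv : v ∈ R.clique i ∩ R.clique l)
    (huv : u ≠ v) : T.IsThinBranch G (R.clique i) (R.clique i ∩ R.clique l) := by
  have hceq : T.center (R.clique i) = {c} := by
    rw [h.center_eq, Set.pair_eq_singleton]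
  refine ⟨R.isMinimalSeparator_of_maximal hl hmax, ?_, ?_, ?_, ?_⟩
  · exact Set.inter_subset_left.ssubset_of_ne fun e => R.not_subset hl.symm (Set.inter_eq_left.1 e)
  · rw [← Set.ncard_pair huv]
    exact Set.ncard_le_ncard (by grind) (Set.toFinite _)
  · rw [hceq]
    exact h.component hp Set.inter_subset_left (fun w hw => hS w hw.1 hw.2)
      (fun w hw hwp hwc => ⟨hw, hS' w hw hwp hwc⟩) hu hv huv
  · rintro S₁ hsep hsub hne ⟨⟨x, hx, hxc⟩, y, hy, hyS, hyc⟩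
    rw [hceq, Set.mem_singleton_iff] at hxc hyc
    subst hxc
    obtain ⟨m, hm, rfl⟩ := R.eq_inter_of_isMinimalSeparator hsep hsub.subset
    have hyp := span_le (fun w hw => hS w hw.1 hw.2) hyS
    obtain ⟨p', hp', h1 | ⟨z, hz, hz', h1⟩ | h1⟩ := h.cases m hm
    · have hyp' := span_le (fun w hw => (h1 w hw.1).1 hw.2) hy
      obtain rfl := eq_of_le_one hp hp' hyc hyp hyp'
      grind
    · obtain ⟨a, ha, b, hb, hab⟩ := mem_span_iff.1 hx
      grind
    · obtain ⟨a, ha, b, hb, hab⟩ := mem_span_iff.1 hx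
      obtain ⟨a', ha', b', hb', hab'⟩ := mem_span_iff.1 hy
      rw [h1 a ha.1 ha.2 b hb.1 hb.2, T.D_self] at hab
      rw [h1 a' ha'.1 ha'.2 b hb.1 hb.2, h1 b' hb'.1 hb'.2 b hb.1 hb.2, T.D_self] at hab'
      have e1 : T.D b y = 0 := by omega
      have e2 : T.D b x = 0 := by omega
      exact hyc ((T.D_eq_zero.1 e1).symm.trans (T.D_eq_zero.1 e2))

omit h in
theorem span_empty : T.span (∅ : Set (Fin n)) = ∅ := by
  ext y
  rw [mem_span_iff]
  simp

theorem not_isBistar {S : Set (Fin n)} (hsep : IsMinimalSeparator G S) (hS : S ⊂ R.clique i) :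
    ¬ T.IsBistar S := by
  intro hb
  obtain ⟨m, hm, rfl⟩ := R.eq_inter_of_isMinimalSeparator hsep hS.subset
  unfold IsBistar at hb
  rcases (R.clique i ∩ R.clique m).eq_empty_or_nonempty with e | hne
  · have : IsEmpty (T.span (R.clique i ∩ R.clique m)) := by
      rw [e, span_empty]
      infer_instance
    have h0 : (T.subtree (R.clique i ∩ R.clique m)).diam = 0 := by
      rw [SimpleGraph.diam, SimpleGraph.ediam_eq_zero_of_subsingleton]
      rfl
    omega
  · obtain ⟨p, hp, q, hq, hmax⟩ := exists_diametral_d T hne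
    rw [diam_subtree hp hq hmax] at hb
    have hpq : p ≠ q := fun e => by grind
    obtain ⟨y, -, h1, -⟩ := h.le_one hm hp.1 hp.2 hq.1 hq.2 hpq
    have h2 := h1 p hp.1 hp.2
    have h3 := h1 q hq.1 hq.2
    have t := T.D_tri p y q
    grind

end

variable (h : NonCross T R i c)
include h

theorem answer_of_guess {τ : Guess R.q} (hadm : Admissible R.clique i τ)
    (hc : ∀ v : Fin n, (v : ℕ) = τ.c ↔ T.real v = c) (hmode : τ.mode = 4) (hg : ¬ τ.g)
    (hsep : ∀ s ∈ R.sep i, T.real s ≠ c → OnBranch R.clique i τ s)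
    (hx₀ : ∀ x : Fin n, (x : ℕ) = τ.x₀ → x ∈ R.clique i ∧ T.real x ≠ c)
    (ha₀ : ∀ v : Fin n, (v : ℕ) = τ.a₀ ↔ T.D v c = 1 ∧
      ∃ x : Fin n, (x : ℕ) = τ.x₀ ∧ (x = v ∨ T.D x c = 2 ∧ T.d x v = 1)) :
    R.Answer i T := by
  have hdist : ∀ {v : Fin n}, v ∈ R.clique i → (v : ℕ) ≠ τ.c →
      T.D v c = 1 ∨ T.D v c = 2 := fun {v} hv hvc => by
    have h0 : T.D v c ≠ 0 := fun e => hvc ((hc v).2 (T.D_eq_zero.1 e))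
    have := h.D_le hv
    omega
  have hne : ∀ {v : Fin n}, T.D v c ≠ 0 → (v : ℕ) ≠ τ.c := fun {v} h0 e => by grind
  have hrel : ∀ u v, Rel R.clique i τ u v ↔ u = v ∨ Share R.clique i u v := fun u v =>
    ⟨fun h1 => h1.elim Or.inl fun h2 => h2.elim (fun h3 => absurd h3 hg) Or.inr,
      fun h1 => h1.elim Or.inl fun h2 => Or.inr (Or.inr h2)⟩
  have hfar : ∀ u ∈ R.clique i, T.D u c = 2 → ¬ Near R.clique i τ u := by
    rintro u hu h2 (e | h3)
    · grind
    · exact h.not_nearByMode hc hmode h2 h3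
  have hmid : ∀ {a x : Fin n}, T.D a c = 1 → x ∈ R.clique i → x ≠ a → T.real x ≠ c →
      Share R.clique i a x → T.D x c = 2 ∧ T.d x a = 1 := by
    rintro a x hac hx hxa hxc ⟨m, hm, ham, hxm⟩
    obtain ⟨p, hp, h1, -⟩ := h.le_one hm (h.mem_iff.2 (by omega)) ham hx hxm (Ne.symm hxa)
    have h2 := Central.eq_of_le hp hac (h1 a (h.mem_iff.2 (by omega)) ham)
    have h3 := h1 x hx hxm
    rw [← h2] at h3
    rcases hdist hx (fun e => hxc ((hc x).1 e)) with h4 | h4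
    · have h5 := Central.eq_of_le hp h4 (by grind)
      grind
    · exact ⟨h4, Central.D_eq_one_of_le (by grind) h4 h3⟩
  have hshare : ∀ {v a : Fin n}, v ∈ R.clique i → T.D v c = 2 → a ∈ R.clique i →
      T.D a c = 1 → Share R.clique i v a → T.d v a = 1 := by
    intro v a hv h2 ha h1 h3
    refine (hmid h1 hv ?_ ?_ (by obtain ⟨m, h4, h5, h6⟩ := h3; exact ⟨m, h4, h6, h5⟩)).2
    all_goals grind
  have hshare' : ∀ {v a : Fin n}, T.D v c = 2 → T.d v a = 1 → T.D a c = 1 →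
      Share R.clique i v a := fun h1 h2 h3 => h.exists_clique_of_child h1 h2 h3
  refine ⟨T, {v | v ∈ R.clique i ∧ ((v : ℕ) = τ.c ∨ Kept R.clique i τ v)}, τ, c, c, h.ws, hmode.le,
    Describes.of_parents hadm (fun v hv => hv.1) hc (fun v hv => h.D_le hv) ?_ ?_ ?_ ?_ ?_ ?_ ?_,
    h.center_eq, Dominated.refl _ _ _, ?_, ?_, ?_⟩
  · grind
  · rintro v ⟨hv, hv'⟩ hvc
    rcases hdist hv hvc with h1 | h1
    · refine ⟨fun _ => h1.le, fun _ => ?_⟩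
      rcases hv'.resolve_left hvc with h2 | h2 | h2 | ⟨x, hx, h2⟩
      · grind
      · exact Or.inl h2
      · exact Or.inr (h.near_of_not_dropped hc hmode h1 h2)
      · refine Or.inl ((ha₀ v).2 ⟨h1, x, hx, ?_⟩)
        grind
    grind
  · rintro v ⟨hv, -⟩ h2 y h3 h4 hS u
    refine h.sibling_iff hc hg hfar h2 (fun u hu h5 => Or.inr fun h6 => ?_) h3 h4 hS u
    exact hS u (mid_unique h2 (hshare hv h2 hu h5 h6) h5 h3 h4)
  · grind
  · rintro v ⟨hv, -⟩ h2 - a ⟨ha, -⟩ h3 (⟨-, h4⟩ | ⟨e, -⟩)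
    · grind
    · omega
  · rintro v ⟨hv, hv'⟩ h2 - a h3 h4
    have hai : a ∈ R.clique i := h.mem_iff.2 (by omega)
    refine ⟨⟨hai, Or.inr ?_⟩, Or.inl ⟨by omega, hshare' h2 h3 h4⟩⟩
    rcases hv'.resolve_left (hne (by omega)) with h5 | h5 | h5 | ⟨x, hx, h5⟩
    · grind
    · grind
    · refine Or.inr (Or.inr (Or.inl fun ⟨m, hm, ham, ⟨u, hu, hum, hua⟩, hall⟩ => h5 ?_))
      obtain ⟨l, hl, hvl, hal⟩ := hshare' h2 h3 h4
      refine ⟨m, hm, hall l hl ⟨a, hai, hal, ham, hne (by omega)⟩ v hv hvl (hne (by omega)),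
        ⟨a, hai, ham, ?_⟩, hall⟩
      grind
    · refine Or.inr (Or.inl ((ha₀ a).2 ⟨h4, x, hx, ?_⟩))
      rcases (hrel v x).1 h5 with rfl | ⟨m, hm, hvm, hxm⟩
      · grind
      · obtain ⟨hxi, hxc⟩ := hx₀ x hx
        rcases hdist hxi (fun e => hxc ((hc x).1 e)) with h6 | h6
        · left
          have h7 := hshare hv h2 hxi h6 ⟨m, hm, hvm, hxm⟩
          exact T.real.injective (mid_unique h2 h7 h6 h3 h4)
        · exact Or.inr ⟨h6, h.same_mid hm h6 h2 hxm hvm h3 h4⟩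
  · exact Or.inl ⟨by rw [second, if_neg hg], rfl⟩
  · intro s hs
    refine ⟨R.sep_subset i hs, ?_⟩
    by_cases e : T.real s = c
    · grind
    · exact Or.inr (Or.inr (Or.inr (Or.inr (hsep s hs e))))
  · rintro v ⟨hv, hvY⟩
    have hvc : (v : ℕ) ≠ τ.c := fun e => hvY ⟨hv, Or.inl e⟩
    have hvk : ¬ Kept R.clique i τ v := fun e => hvY ⟨hv, Or.inr e⟩
    have hd : Dropped R.clique i τ v := by
      by_contra hd
      exact hvk (Or.inr (Or.inr (Or.inl hd)))
    obtain ⟨m, hm, hvm, ⟨u, hu, hum, huv⟩, hall⟩ := hd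
    obtain ⟨A, ⟨l, hl, hsub, rfl⟩, hmax⟩ : ∃ A, Maximal (fun A => ∃ l, l ≠ i ∧
        R.clique i ∩ R.clique m ⊆ A ∧ A = R.clique i ∩ R.clique l) A :=
      (Set.toFinite {A | ∃ l, l ≠ i ∧ R.clique i ∩ R.clique m ⊆ A ∧
        A = R.clique i ∩ R.clique l}).exists_maximal ⟨_, m, hm, subset_rfl, rfl⟩
    have hvl := (hsub ⟨hv, hvm⟩).2
    have hback : ∀ w ∈ R.clique i, w ∈ R.clique l → T.real w ≠ c → w ∈ R.clique m := fun w hw hwl hwc =>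
      hall l hl ⟨v, hv, hvl, hvm, hvc⟩ w hw hwl fun e => hwc ((hc w).1 e)
    refine ⟨R.clique i ∩ R.clique l, fun w hw => ?_, ⟨hv, hvl⟩, ?_⟩
    · by_cases e : T.real w = c
      · right
        rw [e, h.center_eq]
        grind
      · refine Or.inl ⟨hw.1, fun hwY => ?_⟩
        have hwm := hback w hw.1 hw.2 e
        have hon : ∀ x : Fin n, (x : ℕ) = τ.x₀ → ∀ l', l' ≠ i → w ∈ R.clique l' →
            x ∈ R.clique l' → False := by
          intro x hx l' hl' hwl' hxl'
          obtain ⟨hxi, hxc⟩ := hx₀ x hx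
          refine hvk (Or.inr (Or.inr (Or.inr ⟨x, hx, Or.inr (Or.inr ⟨m, hm, hvm, ?_⟩)⟩)))
          grind
        rcases hwY.2.resolve_left fun e' => e ((hc w).1 e') with h1 | h1 | h1 | ⟨x, hx, h1⟩
        · grind
        · obtain ⟨h2, x, hx, rfl | ⟨h3, h4⟩⟩ := (ha₀ w).1 h1
          · grind
          · obtain ⟨l', hl', h5, h6⟩ := hshare' h3 h4 h2
            grind
        · refine h1 ⟨m, hm, hwm, ?_, hall⟩
          grind
        · rcases (hrel w x).1 h1 with rfl | ⟨l', hl', h2, h3⟩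
          all_goals grind
    · obtain ⟨p, hp, h1, h2⟩ := h.le_one hl hu (hsub ⟨hu, hum⟩).2 hv hvl huv
      refine h.isThinBranch hl (fun l' hl' h3 => hmax ⟨l', hl', hsub.trans h3, rfl⟩ h3) hp h1 ?_
        (hsub ⟨hu, hum⟩) ⟨hv, hvl⟩ huv
      intro w hw hwp hwc
      rcases h2 with h2 | ⟨a, x, ha, hxa, hx, h2⟩
      · grind
      · have hac : T.D a c = 1 := by grind
        have hxi : x ∈ R.clique i := h.mem_iff.2 hx.le
        have hai : a ∈ R.clique i := h.mem_iff.2 (by omega)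
        by_cases hwa : w = a
        · grind
        have hw2 : T.D w c = 2 := by
          rcases hdist hw (fun e => hwc ((hc w).1 e)) with h3 | h3
          · exact absurd (T.real.injective ((Central.eq_of_le hp h3 hwp).trans ha.symm)) hwa
          · exact h3
        have hwa1 : T.d w a = 1 := by
          rw [d, ha]
          exact Central.D_eq_one_of_le hp hw2 hwp
        obtain ⟨l', hl', h3, h4⟩ := hshare' hw2 hwa1 hac
        have h5 := hback a hai ((h2 a hai).2 (Or.inl rfl)) fun e => by grind
        have h6 := hall l' hl' ⟨a, hai, h4, h5, hne (by omega)⟩ w hw h3 fun e => hwc ((hc w).1 e)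
        by_contra hwl
        have hm2 := fun z (hz : z ∈ R.clique i ∩ R.clique m) => (hsub hz).2
        grind
  · rintro (h1 | ⟨S, h1, h2, h3⟩)
    · rw [h.diam_eq] at h1
      omega
    · exact absurd h3 (h.not_isBistar h1 h2)

theorem answer : R.Answer i T := by
  have hcadm : T.idOf c = n ∨ ∃ v ∈ R.clique i, (v : ℕ) = T.idOf c :=
    idOf_admissible fun v hv => h.mem_of_real hv
  have hshare : ∀ s ∈ R.sep i, ∀ s' ∈ R.sep i, Share R.clique i s s' := by
    intro s hs s' hs'
    rcases R.sep_eq i with e | ⟨j, hj, e⟩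
    · grind
    · rw [e] at hs hs'
      exact ⟨j, hj, hs.2, hs'.2⟩
  by_cases hS : ∃ x ∈ R.sep i, T.real x ≠ c
  · obtain ⟨x, hx, hxc⟩ := hS
    have hxi := R.sep_subset i hx
    have h0 : T.D x c ≠ 0 := fun e => hxc (T.D_eq_zero.1 e)
    have h1 := h.D_le hxi
    obtain ⟨y, hy, hy'⟩ : ∃ y, T.D y c = 1 ∧
        (T.real x = y ∨ T.D x c = 2 ∧ T.D x y = 1) := by
      by_cases h2 : T.D x c = 1
      · grind
      · obtain ⟨y, h3, h4⟩ := exists_mid (by omega : T.D x c = 2)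
        grind
    refine h.answer_of_guess (τ := ⟨T.idOf c, T.idOf y, x, n, i, i, 4, False⟩)
      ⟨hcadm, idOf_admissible fun v hv => h.mem_iff.2 (by grind), Or.inr ⟨x, hxi, rfl⟩,
        Or.inl rfl⟩ (fun v => val_eq_idOf) rfl id (fun s hs _ => ⟨x, rfl, ?_⟩) ?_ ?_
    · exact Or.inr (Or.inr (hshare s hs x hx))
    · grind
    · intro v
      constructor
      · intro e
        have e' : T.real v = y := val_eq_idOf.1 e
        grind
      · rintro ⟨h2, x', e, h3⟩
        obtain rfl := Fin.ext e
        refine val_eq_idOf.2 ?_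
        rcases h3 with rfl | ⟨h3, h4⟩
        · grind
        · rcases hy' with h5 | ⟨h5, h6⟩
          · grind
          · exact mid_unique h3 h4 h2 h6 hy
  · have hno : ∀ x : Fin n, (x : ℕ) ≠ n := fun x => x.2.ne
    refine h.answer_of_guess (τ := ⟨T.idOf c, n, n, n, i, i, 4, False⟩)
      ⟨hcadm, Or.inl rfl, Or.inl rfl, Or.inl rfl⟩ (fun v => val_eq_idOf) rfl id
      (fun s hs hsc => absurd ⟨s, hs, hsc⟩ hS) (fun x e => absurd e (hno x)) fun v => ?_
    grind

end NonCross

end RootedCliqueTree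

end

section

/-! ## The vertices near the center as an intersection of cliques -/

open SubTree TreeMetric

namespace RootedCliqueTree

open SteinerTree Guess

variable {n : ℕ} {G : SimpleGraph (Fin n)} {R : RootedCliqueTree G} {i : Fin R.q}
  {T : SteinerTree (Fin n)} {c : T.Node} {j l : Fin R.q}

theorem Central.share_cases (h : Central T R i c) {m : Fin R.q} (hm : m ≠ i) {v a : Fin n}
    (hv : T.D v c = 2) (ha : T.D a c = 1) (hvm : v ∈ R.clique m)
    (ham : a ∈ R.clique m) : T.d v a = 1 ∨ ∃ y, R.clique m = T.ball y ∧ T.D y c = 1 ∧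
      T.D v y = 1 ∧
      ∀ u ∈ R.clique i, u ∈ R.clique m ↔ T.D u c ≤ 1 ∨ T.D u y ≤ 1 := by
  have hvi : v ∈ R.clique i := h.mem_iff.2 hv.le
  have hai : a ∈ R.clique i := h.mem_iff.2 (by omega)
  have hav : a ≠ v := by grind
  obtain ⟨t, ht, p, hp, ⟨rfl, h1⟩ | ⟨-, -, h1⟩ | ⟨-, x, hpx, hx, -, h1⟩ | ⟨x, -, -, -, h1⟩⟩ :=
    h.types hm
  · have h2 := (h1 v hvi).1 hvm
    exact Or.inr ⟨t, ht, by grind, Central.D_eq_one_of_le hp hv (by omega), h1⟩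
  · left
    have h2 := Central.D_eq_one_of_le hp hv ((h1 v hvi).1 hvm)
    rwa [← Central.eq_of_le hp ha ((h1 a hai).1 ham)] at h2
  all_goals grind

/-- The vertices next to the center are the common vertices of three maximal cliques. -/
structure NearInter (T : SteinerTree (Fin n)) (R : RootedCliqueTree G) (i : Fin R.q)
    (c : T.Node) (j l : Fin R.q) : Prop extends Central T R i c where
  near : ∀ v ∈ R.clique i, v ∈ R.clique j ∧ v ∈ R.clique l ↔ T.D v c ≤ 1

namespace NearInter

/-- There is no evidence that `v` is a child of `a`. -/
structure Unresolved (T : SteinerTree (Fin n)) (R : RootedCliqueTree G) (i : Fin R.q)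
    (c : T.Node) (v a : Fin n) : Prop where
  hv : T.D v c = 2
  ha : T.D a c = 1
  hva : T.d v a = 1
  near_mem : ∀ m, m ≠ i → v ∈ R.clique m → a ∈ R.clique m → ∀ u : Fin n, T.D u c ≤ 1 →
    u ∈ R.clique m
  inter : ∀ m, m ≠ i → v ∈ R.clique m → a ∈ R.clique m → ∀ k, k ≠ i → k ≠ m → a ∈ R.clique k →
    ∀ u, u ∈ R.clique k → u ∈ R.clique m → T.D u c ≤ 1

variable (h : NearInter T R i c j l)
include h

theorem answer_of_guess {T₀ : SteinerTree (Fin n)}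
    (hdom : Dominated T₀ T (R.sep i) (R.verts i \ R.sep i)) {x a₀ : ℕ}
    (hx : (x = n ∧ a₀ = n) ∨ ∃ w a : Fin n, (w : ℕ) = x ∧ (a : ℕ) = a₀ ∧ T.D w c = 2 ∧
      T.D a c = 1 ∧ T.d w a = 1)
    (hres : ∀ v a, Unresolved T R i c v a →
      ∃ w : Fin n, (w : ℕ) = x ∧ (v = w ∨ Share R.clique i v w)) : R.Answer i T₀ := by
  have hc : ∀ v : Fin n, (v : ℕ) = T.idOf c ↔ T.real v = c := fun v => val_eq_idOf
  have ha₀ : ∀ v : Fin n, (v : ℕ) = a₀ → T.D v c = 1 := fun v e => by grind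
  obtain ⟨τ, rfl⟩ : ∃ τ : Guess R.q, τ = ⟨T.idOf c, a₀, x, n, j, l, 0, False⟩ := ⟨_, rfl⟩
  have hnear : ∀ v ∈ R.clique i, Near R.clique i ⟨T.idOf c, a₀, x, n, j, l, 0, False⟩ v ↔
      T.D v c ≤ 1 := by
    intro v hv
    constructor
    · rintro (e | ⟨-, h1⟩ | ⟨e, -⟩ | ⟨e, -⟩ | ⟨e, -⟩ | ⟨e, -⟩)
      · grind
      · exact (h.near v hv).1 h1
      all_goals simp at e
    · exact fun h1 => Or.inr (Or.inl ⟨rfl, (h.near v hv).2 h1⟩)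
  have hbr : ∀ v, OnBranch R.clique i ⟨T.idOf c, a₀, x, n, j, l, 0, False⟩ v ↔
      ∃ w : Fin n, (w : ℕ) = x ∧ (v = w ∨ Share R.clique i v w) := by
    intro v
    unfold OnBranch Guess.Rel
    simp
  have h0 : ∀ {u : Fin n}, T.D u c = 2 → T.real u ≠ c := fun {u} h2 e => by grind
  refine Answer.of_full h.ws ⟨T.idOf c, a₀, x, n, j, l, 0, False⟩ (c₀ := c) (w₂ := c) (by simp)
    (Describes.of_parents ?_ subset_rfl hc (fun v hv => h.D_le hv) ?_ (fun v hv _ => hnear v hv)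
      ?_ ?_ ?_ ?_ ?_) h.center_eq hdom
  · refine ⟨idOf_admissible fun v hv => h.mem_of_real hv, ?_, ?_, Or.inl rfl⟩
    · rcases hx with ⟨-, h1⟩ | ⟨w, a, -, h2, -, h3, -⟩
      · grind
      · exact Or.inr ⟨a, h.mem_iff.2 (by omega), h2⟩
    · rcases hx with ⟨h1, -⟩ | ⟨w, a, h1, -, h2, -⟩
      · grind
      · exact Or.inr ⟨w, h.mem_iff.2 h2.le, h1⟩
  · exact fun v hv _ => ⟨fun _ => hv, fun _ => Or.inl (by simp)⟩
  · intro v hv h2 y h3 h4 hS u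
    refine h.sibling_iff hc (by simp) (fun u hu h5 h6 => ?_) h2
      (fun u hu h5 => Or.inl ((hnear u hu).2 h5.le)) h3 h4 hS u
    grind
  · intro v hv h2 _ hb y h3 h4
    obtain ⟨w, hw, hvw⟩ := (hbr v).1 hb
    rcases hx with ⟨h1, -⟩ | ⟨w', a, h1, h5, h6, h7, h8⟩
    · grind
    obtain rfl := Fin.ext (hw.trans h1.symm)
    have h9 : T.real a = y := by
      rcases hvw with rfl | ⟨m, hm, hvm, hwm⟩
      · exact mid_unique h2 h8 h7 h3 h4
      · exact mid_unique h6 h8 h7 (h.same_mid hm h6 h2 hwm hvm h3 h4) h4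
    refine ⟨?_, fun b hb => h.mem_iff.2 (by grind)⟩
    change a₀ = _
    rw [← h5, ← h9, idOf_real]
  · rintro v hv h2 - a ha h1 (⟨e, -⟩ | ⟨-, m, hm, hvm, ham, h3⟩)
    · simp at e
    rcases h.share_cases hm h2 h1 hvm ham with h4 | ⟨y, hy, hyc, hvy, hmem⟩
    · exact h4
    by_contra hne
    have hay : T.real a ≠ y := fun e => hne (by grind)
    rcases h3 with ⟨u, hu, h5, h6⟩ | ⟨k, hk, hkm, hak, h5⟩
    · grind
    · have hcon : ∀ r, r ∈ R.clique k → r ∈ R.clique m → T.d a r ≠ 4 := fun r hrk hrm e =>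
        hkm (R.clique_injective (eq_of_far h.ws.root (R.isMaxClique k) (R.isMaxClique m) hak hrk
          ham hrm e))
      have hD : T.D a y ≠ 0 := fun e => hay (T.D_eq_zero.1 e)
      have f := T.fp a y c v
      rcases h5 with ⟨r, hrk, hrm, hri⟩ | ⟨u, hu, huc, hun, huk, hum⟩
      · refine hcon r hrk hrm ?_
        have hrc : ¬ T.D r c ≤ 2 := fun e => hri (h.mem_iff.2 e)
        have hry : T.D r y ≤ 2 := by grind
        have t := T.D_tri r y c
        have f2 := T.fp a y c r
        have c1 := T.D_comm r y
        have c2 := T.D_comm r c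
        have pr := T.par a y c
        grind
      · have hu2 : T.D u c = 2 := by
          have h6 := h.D_le hu
          grind
        have huy := Central.D_eq_one_of_le (by grind) hu2
          (((hmem u hu).1 hum).resolve_left (by omega))
        rcases h.share_cases hk hu2 h1 huk hak with h6 | ⟨y', hy', hyc', huy', -⟩
        · exact hay (mid_unique hu2 h6 h1 huy hyc)
        · exact hkm (R.clique_injective (by rw [hy, hy', mid_unique hu2 huy' hyc' huy hyc]))
  · intro v hv h2 hno a h3 h4
    have hai : a ∈ R.clique i := h.mem_iff.2 (by omega)
    refine ⟨hai, ?_⟩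
    by_contra hev
    refine hno ⟨by simp, (hbr v).2 (hres v a ⟨h2, h4, h3, fun m hm hvm ham u hu => ?_,
      fun m hm hvm ham k hk hkm hak u huk hum => ?_⟩)⟩
    · by_contra hum
      have hui : u ∈ R.clique i := h.mem_iff.2 (by omega)
      exact hev (Or.inr ⟨rfl, m, hm, hvm, ham, Or.inl ⟨u, hui, Or.inr ((hnear u hui).2 hu), hum⟩⟩)
    · by_contra hlt
      refine hev (Or.inr ⟨rfl, m, hm, hvm, ham, Or.inr ⟨k, hk, hkm, hak, ?_⟩⟩)
      by_cases hui : u ∈ R.clique i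
      · grind
      · exact Or.inl ⟨u, huk, hum, hui⟩
  · exact Or.inl ⟨by simp [second], rfl⟩

theorem answer_of_forall {T₀ : SteinerTree (Fin n)}
    (hdom : Dominated T₀ T (R.sep i) (R.verts i \ R.sep i))
    (hno : ∀ v a, ¬ Unresolved T R i c v a) : R.Answer i T₀ :=
  h.answer_of_guess hdom (Or.inl ⟨rfl, rfl⟩) fun v a h1 => absurd h1 (hno v a)

theorem answer_of_special {T₀ : SteinerTree (Fin n)}
    (hdom : Dominated T₀ T (R.sep i) (R.verts i \ R.sep i)) {x a : Fin n}
    (hx : T.D x c = 2) (ha : T.D a c = 1) (hxa : T.d x a = 1)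
    (hres : ∀ v b, Unresolved T R i c v b → v = x ∨ Share R.clique i v x) : R.Answer i T₀ :=
  h.answer_of_guess hdom (Or.inr ⟨x, a, rfl, rfl, hx, ha, hxa⟩) fun v b h1 => ⟨x, rfl, hres v b h1⟩

/-- If there are several vertices at distance one from the center, then the tree provides an answer
or it can be split. -/
theorem exists_split {T₀ : SteinerTree (Fin n)}
    (hdom : Dominated T₀ T (R.sep i) (R.verts i \ R.sep i)) {x a z : Fin n}
    (hu : Unresolved T R i c x a) (hz : T.D z c = 1) (haz : a ≠ z) :
    R.Answer i T₀ ∨ ∃ K' Z a z x, SplitData T G (R.clique i) K' Z c a z x ∧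
      (a ∈ R.sep i → ∀ v ∈ R.sep i, T.D v c = 2 → T.d v a ≠ 1) := by
  have ha := hu.ha
  have key : ∀ v b : Fin n, Unresolved T R i c v b → ∃ m, m ≠ i ∧ R.clique m = T.ball b := by
    intro v b hu
    obtain ⟨z, hz, hbz⟩ : ∃ z : Fin n, T.D z c = 1 ∧ b ≠ z := by grind
    obtain ⟨m, hm, hvm, hbm⟩ := h.exists_clique_of_child hu.hv hu.hva hu.ha
    refine ⟨m, hm, ?_⟩
    rcases h.share_cases hm hu.hv hz hvm (hu.near_mem m hm hvm hbm z hz.le) with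
      h1 | ⟨y, hy, hyc, hvy, -⟩
    · exact absurd (T.real.injective (mid_unique hu.hv hu.hva hu.ha h1 hz)) hbz
    · rw [hy, mid_unique hu.hv hvy hyc hu.hva hu.ha]
  have hball : ∀ {m} {b u : Fin n}, R.clique m = T.ball b → T.d u b ≤ 2 → u ∈ R.clique m :=
    fun {m b u} e hub => by grind
  by_cases hex : ∃ v b, Unresolved T R i c v b ∧
      ¬ (b ∈ R.sep i ∧ ∃ s ∈ R.sep i, T.D s c = 2 ∧ T.d s b = 1)
  · right
    obtain ⟨v, b, hu, hno⟩ := hex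
    obtain ⟨z, hz, hbz⟩ : ∃ z : Fin n, T.D z c = 1 ∧ b ≠ z := by grind
    obtain ⟨m, hm, hmb⟩ := key v b hu
    have hvm := hball hmb (hu.hva.le.trans (by simp))
    have hbm := hball (u := b) hmb (by simp)
    refine ⟨R.clique m, R.clique i ∩ R.clique j ∩ R.clique l, b, z, v,
      ⟨h.ws, R.isMaxClique i, R.isMaxClique m, fun e => hm (R.clique_injective e).symm, h.ball, hmb,
        ?_, fun w => ⟨fun hw => (h.near w hw.1.1).1 ⟨hw.1.2, hw.2⟩, fun hw => ?_⟩, hu.ha, hz,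
        hbz, hu.hva, hu.hv, ?_⟩, fun hb s hs h1 h2 => hno ⟨hb, s, hs, h1, h2⟩⟩
    · exact ((R.isMaxClique i).isCliqueIntersection.inter
        (R.isMaxClique j).isCliqueIntersection).inter (R.isMaxClique l).isCliqueIntersection
    · have hwi : w ∈ R.clique i := h.mem_iff.2 (by omega)
      have := (h.near w hwi).2 hw
      grind
    · intro Q hQ hQi hQm hbQ w hwQ hwm
      obtain ⟨k, rfl⟩ := R.exists_clique hQ
      have hw := hu.inter m hm hvm hbm k (fun e => hQi (by rw [e])) (fun e => hQm (by rw [e]))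
        hbQ w hwQ hwm
      have hwi : w ∈ R.clique i := h.mem_iff.2 (by omega)
      have := (h.near w hwi).2 hw
      grind
  · left
    push Not at hex
    obtain ⟨hasep, s, hs, hsc, hsa⟩ := hex x a hu
    rcases R.sep_eq i with e | ⟨f, hf, e⟩
    · grind
    have hfm : ∀ v b : Fin n, Unresolved T R i c v b → R.clique f = T.ball b := by
      intro v b hu
      obtain ⟨m, hm, hmb⟩ := key v b hu
      by_cases hfm : f = m
      · grind
      obtain ⟨hb, s', hs', hsc', hsb'⟩ := hex v b hu
      rw [e] at hb hs'
      have := hu.inter m hm (hball hmb (hu.hva.le.trans (by simp))) (hball hmb (by simp)) f hf hfm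
        hb.2 s' hs'.2 (hball hmb (by omega))
      omega
    refine h.answer_of_special hdom hu.hv hu.ha hu.hva fun v b hvb => Or.inr ⟨f, hf, ?_, ?_⟩
    · exact hball (hfm v b hvb) (hvb.hva.le.trans (by simp))
    · exact hball (hfm x a hu) (hu.hva.le.trans (by simp))

/-- If there is one vertex at distance one from the center, then the tree provides an answer or a
branch can be moved. -/
theorem exists_swap {T₀ : SteinerTree (Fin n)}
    (hdom : Dominated T₀ T (R.sep i) (R.verts i \ R.sep i)) {x a : Fin n}
    (hu : Unresolved T R i c x a) (hone : ∀ z : Fin n, T.D z c = 1 → z = a) :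
    R.Answer i T₀ ∨ ∃ Q y₀ a x x₂, SwapData T G (R.clique i) Q c y₀ a x x₂ ∧
      ¬ (a ∈ R.sep i ∧ x ∈ R.sep i) := by
  have hun : ∀ {v b}, Unresolved T R i c v b → Unresolved T R i c v a := fun {v b} hu => by
    rw [← hone b hu.ha]
    exact hu
  by_cases hcr : ∃ w, T.real w = c
  · left
    obtain ⟨w, hw⟩ := hcr
    obtain ⟨m, hm, hxm, ham⟩ := h.exists_clique_of_child hu.hv hu.hva hu.ha
    refine h.answer_of_special hdom hu.hv hu.ha hu.hva fun v b hvb => Or.inr ⟨m, hm, ?_, hxm⟩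
    have hwm := hu.near_mem m hm hxm ham w (by grind)
    have hwx : w ≠ x := by
      rintro rfl
      have := hu.hv
      grind
    rcases h.mid_cases hm hu.hv hxm (h.mem_of_real hw) hwm hwx hu.hva hu.ha with h1 | ⟨h1, -⟩
    · exact h1 v (h.mem_iff.2 hvb.hv.le) (hun hvb).hva.le
    · have := hu.ha
      grind
  by_cases htwo : ∃ k, k ≠ i ∧ ∃ u ∈ R.clique k, ∃ v ∈ R.clique k, u ≠ v ∧ T.d u a = 1 ∧
      T.d v a = 1 ∧ T.D u c = 2 ∧ T.D v c = 2
  · left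
    obtain ⟨k, hk, u, huk, v, hvk, huv, hua, hva, huc, hvc⟩ := htwo
    refine h.answer_of_special hdom huc hu.ha hua fun w b hwb => Or.inr ⟨k, hk, ?_, huk⟩
    rcases h.mid_cases hk huc huk (h.mem_iff.2 hvc.le) hvk (Ne.symm huv) hua hu.ha with h1 | ⟨h1, -⟩
    · exact h1 w (h.mem_iff.2 hwb.hv.le) (hun hwb).hva.le
    grind
  have hfew : ∀ k, k ≠ i → ∀ u ∈ R.clique k, ∀ v ∈ R.clique k, T.d u a = 1 → T.d v a = 1 →
      T.D u c = 2 → T.D v c = 2 → u = v := by grind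
  by_cases hex : ∃ v, Unresolved T R i c v a ∧ ¬ (a ∈ R.sep i ∧ v ∈ R.sep i)
  · obtain ⟨v, hv, hno⟩ := hex
    by_cases hx₂ : ∃ w, T.d w a = 1 ∧ T.D w c = 2 ∧ w ≠ v
    · right
      obtain ⟨w, hwa, hwc, hwv⟩ := hx₂
      obtain ⟨m, hm, hvm, ham⟩ := h.exists_clique_of_child hv.hv hv.hva hv.ha
      have hvi : v ∈ R.clique i := h.mem_iff.2 hv.hv.le
      have hai : a ∈ R.clique i := h.mem_iff.2 (by have := hv.ha; omega)
      have hwi : w ∈ R.clique i := h.mem_iff.2 hwc.le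
      have hwm : w ∉ R.clique m := fun hwm => hwv (hfew m hm w hwm v hvm hwa hv.hva hwc hv.hv)
      have hcv := hv.hv
      have hca := hv.ha
      have hava := hv.hva
      have hav : a ≠ v := by grind
      obtain ⟨t, ht, p, hp, ⟨rfl, h1⟩ | ⟨-, -, h1⟩ | ⟨hct, y, hpy, hy, hyt, h1⟩ | ⟨y, -, -, -, h1⟩⟩ :=
        h.types hm
      · exfalso
        have h2 := Central.D_eq_one_of_le hp hcv (((h1 v hvi).1 hvm).resolve_left (by omega))
        have h3 := mid_unique hcv h2 (by grind) hava hca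
        grind
      · exfalso
        have h2 := Central.eq_of_le hp hca ((h1 a hai).1 ham)
        grind
      · have h2 : T.real v = y := ((h1 v hvi).1 hvm).resolve_left fun e => by grind
        have h3 : T.real a = p := ((h1 a hai).1 ham).resolve_right fun e =>
          hav (T.real.injective (e.trans h2.symm))
        subst h2 h3
        refine ⟨R.clique m, t, a, v, w, ⟨h.ws, R.isMaxClique i, R.isMaxClique m,
          fun e => hm (R.clique_injective e).symm, h.ball, ht, h.far, fun z hz => ?_, hca, hava,
          hcv, hwa, hwc, hwv, hyt, ?_, ?_, ?_⟩, hno⟩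
        · refine hone z ?_
          have : T.D z c ≠ 0 := fun e => hcr ⟨z, T.D_eq_zero.1 e⟩
          omega
        · have t1 := T.D_tri a v t
          have t2 := T.D_tri c a t
          omega
        · intro M hM hMi haM hvM
          obtain ⟨k, rfl⟩ := R.exists_clique hM
          by_contra hkm
          have := hv.inter m hm hvm ham k (fun e => hMi (by rw [e])) (fun e => hkm (by rw [e])) haM
            v hvM hvm
          omega
        · intro M hM hMi
          obtain ⟨k, rfl⟩ := R.exists_clique hM
          grind
      grind
    · left
      push Not at hx₂
      exact h.answer_of_special hdom hv.hv hv.ha hv.hva fun w b hwb =>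
        Or.inl (hx₂ w (hun hwb).hva hwb.hv)
  · left
    push Not at hex
    obtain ⟨-, hxs⟩ := hex x hu
    rcases R.sep_eq i with e | ⟨f, hf, e⟩
    · grind
    refine h.answer_of_special hdom hu.hv hu.ha hu.hva fun v b hvb => Or.inl ?_
    have hvs := (hex v (hun hvb)).2
    rw [e] at hvs hxs
    exact hfew f hf v hvs.2 x hxs.2 (hun hvb).hva hu.hva hvb.hv hu.hv

end NearInter

open Classical in
/-- The number of pairs of vertices at distance at most one. -/
noncomputable def closePairs (T : SteinerTree (Fin n)) (K : Set (Fin n)) : ℕ :=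
  {p : Fin n × Fin n | p.1 ∈ K ∧ p.2 ∈ K ∧ T.d p.1 p.2 ≤ 1}.ncard

theorem closePairs_lt {T T' : SteinerTree (Fin n)} {K : Set (Fin n)}
    (hle : ∀ u ∈ K, ∀ v ∈ K, T.d u v ≤ T'.d u v) {a x : Fin n} (ha : a ∈ K) (hx : x ∈ K)
    (h1 : T.d a x ≤ 1) (h2 : 1 < T'.d a x) : closePairs T' K < closePairs T K := by
  refine Set.ncard_lt_ncard ?_ (Set.toFinite _)
  refine ⟨fun p hp => ⟨hp.1, hp.2.1, (hle _ hp.1 _ hp.2.1).trans hp.2.2⟩, fun hsub => ?_⟩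
  have := (hsub (show (a, x) ∈ _ from ⟨ha, hx, h1⟩)).2.2
  grind

theorem NearInter.answer (h : NearInter T R i c j l) {T₀ : SteinerTree (Fin n)}
    (hdom : Dominated T₀ T (R.sep i) (R.verts i \ R.sep i)) : R.Answer i T₀ := by
  induction hk : closePairs T (R.clique i) using Nat.strong_induction_on generalizing T with
  | _ k ih =>
  by_cases hno : ∀ v a, ¬ Unresolved T R i c v a
  · exact h.answer_of_forall hdom hno
  push Not at hno
  obtain ⟨v, b, hu⟩ := hno
  have hfar : ∀ T' : SteinerTree (Fin n), T'.IsRoot 4 G →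
      (∀ u ∈ R.clique i, ∀ v ∈ R.clique i, T.d u v ≤ T'.d u v) →
      ∃ p ∈ R.clique i, ∃ q ∈ R.clique i, T'.d p q = 4 := fun T' hroot hle => by
    obtain ⟨p, hp, q, hq, hpq⟩ := h.far
    exact ⟨p, hp, q, hq, le_antisymm (hroot.d_le (R.isMaxClique i).isClique hp hq)
      (hpq ▸ hle p hp q hq)⟩
  by_cases hz : ∃ z : Fin n, T.D z c = 1 ∧ b ≠ z
  · obtain ⟨z, hz, hbz⟩ := hz
    rcases h.exists_split hdom hu hz hbz with h1 | ⟨K', Z, a, z, x, hs, hsep⟩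
    · exact h1
    have hlt := hs.split_d_lt
    have hxa := hs.xa
    have hax := T.d_comm a x
    have hle : ∀ u ∈ R.clique i, ∀ v ∈ R.clique i, T.d u v ≤ hs.split.d u v := fun u _ v _ =>
      hs.d_le_split u v
    have hai : a ∈ R.clique i := h.mem_iff.2 (by have := hs.ac; omega)
    have hlt' := closePairs_lt hle hai (h.mem_iff.2 hs.xc.le) (by omega) (by omega)
    have hnew : NearInter hs.split R i hs.newCenter j l :=
      ⟨⟨hs.split_metricWS, hs.split_ball, hfar _ hs.split_isRoot hle⟩, fun v hv => by
        rw [h.near v hv, hs.split_D_newCenter]⟩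
    refine ih _ (hk ▸ hlt') hnew
      (hdom.trans ⟨?_, fun w hw => ⟨w, hw, fun s _ => hs.d_le_split s w⟩⟩) rfl
    rcases R.sep_isCliqueIntersection i with e | e
    · grind
    · exact hs.split_d_eq (R.sep_subset i) e hsep
  · push Not at hz
    rcases h.exists_swap hdom hu (fun z h1 => (hz z h1).symm) with h1 | ⟨Q, y₀, a, x, x₂, hs, hsep⟩
    · exact h1
    have hxa := hs.xa
    have hax := T.d_comm a x
    have hxi : x ∈ R.clique i := h.mem_iff.2 hs.xc.le
    have hle : ∀ u ∈ R.clique i, ∀ v ∈ R.clique i, T.d u v ≤ hs.swap.d u v := fun u hu v hv =>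
      hs.d_le_swap (h.d_le_four hu hv)
    have hai : a ∈ R.clique i := h.mem_iff.2 (by have := hs.ac; omega)
    have hlt' := closePairs_lt hle hai hxi (by omega) (by rw [hs.swap_d_ax]; simp)
    have hnew : NearInter hs.swap R i hs.newCenter j l :=
      ⟨⟨hs.swap_metricWS, hs.swap_ball, hfar _ hs.swap_isRoot hle⟩, fun v hv => by
        rw [h.near v hv, hs.swap_D_newCenter hv]⟩
    refine ih _ (hk ▸ hlt') hnew (hdom.trans ?_) rfl
    rcases R.sep_eq i with e | ⟨f, hf, e⟩
    · rw [e]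
      exact ⟨fun s hs => absurd hs (Set.notMem_empty s), fun w hw => ⟨w, hw, fun s hs =>
        absurd hs (Set.notMem_empty s)⟩⟩
    · have hf' : R.clique f ≠ R.clique i := fun e => hf (R.clique_injective e)
      refine ⟨hs.swap_d_eq (R.isMaxClique f) hf' e hsep, fun w hw =>
        hs.exists_le_swap (R.isMaxClique f) hf' e hsep (fun hx => ?_) hw⟩
      exact ⟨R.clique_subset_verts i hxi, hx⟩

end RootedCliqueTree

end

section

/-! ## A clique that meets another clique in a bistar -/

open SubTree TreeMetric

namespace RootedCliqueTree

open SteinerTree Guess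

variable {n : ℕ} {G : SimpleGraph (Fin n)} {R : RootedCliqueTree G} {i : Fin R.q}
  {T : SteinerTree (Fin n)} {c : T.Node} {j : Fin R.q}

/-- The clique `R.clique j` has the center `p`, a neighbour of `c`, and there is no other clique
with such a center. -/
structure Bistar (T : SteinerTree (Fin n)) (R : RootedCliqueTree G) (i : Fin R.q)
    (c : T.Node) (j : Fin R.q) (p : T.Node) (x z : Fin n) : Prop extends Central T R i c where
  hj : j ≠ i
  ballj : R.clique j = T.ball p
  cp : T.D c p = 1
  only : ∀ l, l ≠ i → ∀ t, R.clique l = T.ball t → T.D c t = 1 → l = j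
  xc : T.D x c = 2
  xp : T.D x p = 1
  zc : T.D z c = 1
  zp : T.real z ≠ p

namespace Bistar

variable {p : T.Node} {x z : Fin n} (h : Bistar T R i c j p x z)
include h

theorem pc : T.D p c = 1 := by rw [T.D_comm]; exact h.cp

theorem xi : x ∈ R.clique i := h.mem_iff.2 h.xc.le

theorem zi : z ∈ R.clique i := h.mem_iff.2 (by have := h.zc; omega)

theorem mem_j {u : Fin n} (hu : u ∈ R.clique i) :
    u ∈ R.clique j ↔ T.D u c ≤ 1 ∨ T.D u p ≤ 1 := by
  rw [Set.ext_iff.1 h.ballj u]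
  change T.D _ _ ≤ 2 ↔ _
  have h1 := h.D_le hu
  have pr := T.par u c p
  have h2 := h.cp
  have t := T.D_tri u c p
  omega

theorem mem_j_of_le {u : Fin n} (hu : T.D u c ≤ 1) : u ∈ R.clique j :=
  (h.mem_j (h.mem_iff.2 (by omega))).2 (Or.inl hu)

theorem xj : x ∈ R.clique j := (h.mem_j h.xi).2 (Or.inr h.xp.le)

theorem child {v : Fin n} (hv : T.D v c = 2) (hvj : v ∈ R.clique j) :
    T.D v p = 1 :=
  Central.D_eq_one_of_le h.cp hv (((h.mem_j (h.mem_iff.2 hv.le)).1 hvj).resolve_left (by omega))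

/-- A vertex at distance two from the center and a vertex at distance one that share a clique are
on one branch, or in `R.clique j`. -/
theorem share_cases' {m : Fin R.q} (hm : m ≠ i) (hmj : m ≠ j) {v a : Fin n}
    (hv : T.D v c = 2) (ha : T.D a c = 1) (hvm : v ∈ R.clique m)
    (ham : a ∈ R.clique m) : T.d v a = 1 := by
  rcases h.share_cases hm hv ha hvm ham with h1 | ⟨y, hy, hyc, -⟩
  · exact h1
  · exact absurd (h.only m hm y hy (by grind)) hmj

theorem eq_p {v a : Fin n} (hv : T.D v c = 2) (ha : T.D a c = 1)
    (hva : T.d v a = 1) (hvj : v ∈ R.clique j) : T.real a = p :=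
  mid_unique hv hva ha (h.child hv hvj) h.pc

theorem near_unique {m : Fin R.q} (hm : m ≠ i) (hmj : m ≠ j) {v a : Fin n}
    (hv : T.D v c = 1) (ha : T.D a c = 1) (hvm : v ∈ R.clique m)
    (ham : a ∈ R.clique m) : v = a := by
  have hvi : v ∈ R.clique i := h.mem_iff.2 (by omega)
  have hai : a ∈ R.clique i := h.mem_iff.2 (by omega)
  obtain ⟨t, ht, p, hp, ⟨rfl, h1⟩ | ⟨-, -, h1⟩ | ⟨-, y, hpx, hx, -, h1⟩ | ⟨y, -, -, -, h1⟩⟩ :=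
    h.types hm
  · exact absurd (h.only m hm t ht hp) hmj
  · exact T.real.injective ((Central.eq_of_le hp hv ((h1 v hvi).1 hvm)).trans
      (Central.eq_of_le hp ha ((h1 a hai).1 ham)).symm)
  all_goals grind

/-- A vertex next to the center and a vertex of `R.clique j` outside of the clique are far apart. -/
theorem far_of_not_mem {m : Fin R.q} (hmj : m ≠ j) {v w : Fin n} (hv : T.D v c = 1)
    (hvp : T.real v ≠ p) (hvm : v ∈ R.clique m) (hwm : w ∈ R.clique m) (hwj : w ∈ R.clique j)
    (hwi : w ∉ R.clique i) : False := by
  have h1 : ¬ T.D w c ≤ 2 := fun e => hwi (h.mem_iff.2 e)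
  have h2 : T.D w p ≤ 2 := by
    have : w ∈ T.ball p := h.ballj ▸ hwj
    exact this
  have h3 : T.D v p ≠ 0 := fun e => hvp (T.D_eq_zero.1 e)
  have h4 := h.cp
  have f := T.fp v p c w
  have c1 := T.D_comm w p
  have c2 := T.D_comm w c
  have c3 := T.D_comm c p
  have pr := T.par v c p
  have t := T.D_tri w p c
  have t2 := T.D_tri v c p
  refine hmj (R.clique_injective (eq_of_far h.ws.root (R.isMaxClique m) (R.isMaxClique j) hvm hwm
    (h.mem_j_of_le hv.le) hwj ?_))
  grind

theorem answer_of_near {τ : Guess R.q} (hadm : τ.e = n ∨ ∃ v ∈ R.clique i, (v : ℕ) = τ.e)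
    (hc : τ.c = T.idOf c) (ha₀ : τ.a₀ = T.idOf p) (hx₀ : τ.x₀ = x) (hmode : τ.mode ≤ 4)
    (hmode0 : τ.mode ≠ 0) (hmode4 : τ.mode ≠ 4) (hg : ¬ τ.g)
    (hnear : ∀ v ∈ R.clique i, T.real v ≠ c → T.real v ≠ p →
      (NearByMode R.clique i τ v ↔ T.D v c = 1)) : R.Answer i T := by
  have hc' : ∀ v : Fin n, (v : ℕ) = τ.c ↔ T.real v = c := fun v => by rw [hc, val_eq_idOf]
  have hpi : ∀ v, T.real v = p → v ∈ R.clique i := fun v e => h.mem_iff.2 (by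
    rw [e, h.pc]
    simp)
  have hnear' : ∀ v ∈ R.clique i, (v : ℕ) ≠ τ.c → (Near R.clique i τ v ↔ T.D v c ≤ 1) := by
    intro v hv hvc
    have hvc' : T.real v ≠ c := fun e => hvc ((hc' v).2 e)
    have h0 : T.D v c ≠ 0 := fun e => hvc' (T.D_eq_zero.1 e)
    by_cases hvp : T.real v = p
    · exact ⟨fun _ => by rw [hvp, h.pc], fun _ => Or.inl (by rw [ha₀, val_eq_idOf, hvp])⟩
    · have h1 : (v : ℕ) ≠ τ.a₀ := fun e => hvp (by rwa [ha₀, val_eq_idOf] at e)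
      rw [Near, or_iff_right h1, hnear v hv hvc' hvp]
      omega
  have hne : ∀ v : Fin n, T.D v c ≠ 0 → (v : ℕ) ≠ τ.c := fun v h0 e => by grind
  have hbr : ∀ v : Fin n, T.D v c = 2 → (OnBranch R.clique i τ v ↔ T.D v p = 1) := by
    intro v hv
    constructor
    · rintro ⟨x', e, h1⟩
      obtain rfl := Fin.ext (e.trans hx₀)
      rcases h1 with rfl | h1 | ⟨m, hm, hvm, hxm⟩
      · exact h.xp
      · grind
      · exact h.same_mid hm hv h.xc hvm hxm h.xp h.pc
    · intro h1
      exact ⟨x, hx₀.symm, Or.inr (Or.inr ⟨j, h.hj,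
        (h.mem_j (h.mem_iff.2 hv.le)).2 (Or.inr h1.le), h.xj⟩)⟩
  refine Answer.of_full h.ws τ (c₀ := c) (w₂ := c) hmode
    (Describes.of_parents ⟨?_, ?_, Or.inr ⟨x, h.xi, hx₀.symm⟩, hadm⟩ subset_rfl hc'
      (fun v hv => h.D_le hv) (fun v hv _ => ⟨fun _ => hv, fun _ => Or.inl hmode4⟩) hnear'
      ?_ ?_ ?_ ?_ ?_) h.center_eq (Dominated.refl _ _ _)
  · rw [hc]
    exact idOf_admissible fun v hv => h.mem_of_real hv
  · rw [ha₀]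
    exact idOf_admissible hpi
  · intro v hv h2 y h3 h4 hS u
    refine h.sibling_iff hc' hg (fun u hu h5 h6 => ?_) h2
      (fun u hu h5 => Or.inl ((hnear' u hu (hne u (by omega))).2 h5.le)) h3 h4 hS u
    grind
  · intro v hv h2 _ hb y h3 h4
    obtain rfl := mid_unique h2 h3 h4 ((hbr v h2).1 hb) h.pc
    grind
  · rintro v hv h2 hb a ha h1 (⟨-, m, hm, hvm, ham⟩ | ⟨e, -⟩)
    · rcases h.share_cases hm h2 h1 hvm ham with h3 | ⟨y, hy, hyc, hvy, -⟩
      · exact h3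
      · obtain rfl := h.only m hm y hy (by grind)
        exact absurd ⟨hmode4, (hbr v h2).2 (h.child h2 hvm)⟩ hb
    grind
  · exact fun v hv h2 hb a h3 h4 => ⟨h.mem_iff.2 (by omega),
      Or.inl ⟨hmode0, h.exists_clique_of_child h2 h3 h4⟩⟩
  · exact Or.inl ⟨by rw [second, if_neg hg], rfl⟩

/-- A third clique contains all children of `p`. -/
theorem answer_of_subset {m : Fin R.q} (hm : m ≠ i) (hmj : m ≠ j)
    (hsub : ∀ v : Fin n, T.D v c = 2 → v ∈ R.clique j → v ∈ R.clique m) : R.Answer i T := by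
  refine h.answer_of_near (τ := ⟨T.idOf c, T.idOf p, x, n, j, m, 1, False⟩) (Or.inl rfl) rfl rfl rfl
    (by simp) (by simp) (by simp) id fun v hv hvc hvp => ?_
  have h0 : T.D v c ≠ 0 := fun e => hvc (T.D_eq_zero.1 e)
  have h1 := h.D_le hv
  constructor
  · rintro (⟨e, -⟩ | ⟨-, h2, h3⟩ | ⟨e, -⟩ | ⟨e, -⟩ | ⟨e, -⟩)
    · simp at e
    · grind
    all_goals simp at e
  · refine fun h2 => Or.inr (Or.inl ⟨rfl, h.mem_j_of_le h2.le, fun h3 => hvp ?_⟩)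
    exact h.eq_p h.xc h2 (h.share_cases' hm hmj h.xc h2 (hsub x h.xc h.xj) h3) h.xj

theorem constrained {v : Fin n} (hv : IsConstrained G (R.clique i ∩ R.clique j) v) :
    ∃ m, m ≠ i ∧ m ≠ j ∧ v ∈ R.clique m ∧
      ((∃ u ∈ R.clique i, u ∈ R.clique j ∧ u ∈ R.clique m ∧ u ≠ v) ∨
      (∃ w ∈ R.clique i, w ∉ R.clique j ∧ w ∈ R.clique m ∧ w ≠ v) ∨
      ∃ w ∈ R.clique j, w ∉ R.clique i ∧ w ∈ R.clique m) := by
  rcases hv with ⟨X, ⟨𝒦, -, hmax, rfl⟩, hX, hvX, h2⟩ |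
    ⟨X₁, X₂, ⟨𝒦₁, ⟨L, hL⟩, hmax₁, rfl⟩, ⟨𝒦₂, -, hmax₂, rfl⟩, hX, hv, hlt⟩
  · obtain ⟨M, hM, hno⟩ : ∃ M ∈ 𝒦, ¬ R.clique i ∩ R.clique j ⊆ M := by
      by_contra! hno
      exact hX.2 (Set.subset_sInter hno)
    obtain ⟨m, rfl⟩ := R.exists_clique (hmax M hM)
    obtain ⟨u, hu, huv⟩ := Set.exists_ne_of_one_lt_ncard (Nat.lt_of_succ_le h2) v
    grind
  · have hor : ∀ M ∈ 𝒦₁, M = R.clique i ∨ M = R.clique j := by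
      intro M hM
      obtain ⟨m, rfl⟩ := R.exists_clique (hmax₁ M hM)
      by_contra hne
      push Not at hne
      have hsub : R.clique i ∩ R.clique j ⊆ R.clique m := fun u hu => hX.1 hu _ hM
      exact h.zp (h.eq_p h.xc h.zc (h.share_cases' (fun e => hne.1 (by rw [e]))
        (fun e => hne.2 (by rw [e])) h.xc h.zc (hsub ⟨h.xi, h.xj⟩)
        (hsub ⟨h.zi, h.mem_j_of_le h.zc.le⟩)) h.xj)
    have hvX : v ∈ R.clique i ∩ R.clique j ∩ ⋂₀ 𝒦₂ := by rw [hv]; rfl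
    obtain ⟨M, hM, hno⟩ : ∃ M ∈ 𝒦₂, ¬ R.clique i ∩ R.clique j ⊆ M := by
      by_contra! hno
      rw [Set.inter_eq_left.2 (Set.subset_sInter hno)] at hv
      have h1 : x ∈ R.clique i ∩ R.clique j := ⟨h.xi, h.xj⟩
      have h2 : z ∈ R.clique i ∩ R.clique j := ⟨h.zi, h.mem_j_of_le h.zc.le⟩
      rw [hv, Set.mem_singleton_iff] at h1 h2
      have h3 := h.xc
      have h4 := h.zc
      grind
    obtain ⟨m, rfl⟩ := R.exists_clique (hmax₂ M hM)
    grind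

variable (hno : ∀ m, m ≠ i → m ≠ j → ¬ ∀ v : Fin n, T.D v c = 2 → v ∈ R.clique j → v ∈ R.clique m)
include hno

theorem eq_of_mem {m : Fin R.q} (hm : m ≠ i) (hmj : m ≠ j) {v u : Fin n}
    (hv : T.D v c = 2) (hvj : v ∈ R.clique j) (hvm : v ∈ R.clique m)
    (hu : u ∈ R.clique i) (hum : u ∈ R.clique m) : u = v ∨ T.real u = p := by
  by_cases huv : u = v
  · grind
  rcases h.mid_cases hm hv hvm hu hum huv (h.child hv hvj) h.pc with h1 | ⟨h1, -⟩
  · exact absurd (fun w hw hwj => h1 w (h.mem_iff.2 hw.le) (h.child hw hwj).le) (hno m hm hmj)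
  grind

/-- At most one child of `p` is free in the bistar. -/
theorem answer_of_children (hside : ∀ v v', IsFree G (R.clique i ∩ R.clique j) v →
    IsFree G (R.clique i ∩ R.clique j) v' → T.D v c = 2 → T.D v' c = 2 → v = v') :
    R.Answer i T := by
  obtain ⟨e, hadm, he, he'⟩ : ∃ e : ℕ, (e = n ∨ ∃ v ∈ R.clique i, (v : ℕ) = e) ∧
      (∀ v : Fin n, (v : ℕ) = e → T.D v c = 2) ∧
      ∀ v, IsFree G (R.clique i ∩ R.clique j) v → T.D v c = 2 → (v : ℕ) = e := by
    by_cases hex : ∃ v, IsFree G (R.clique i ∩ R.clique j) v ∧ T.D v c = 2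
    · obtain ⟨v, hv, hvc⟩ := hex
      exact ⟨v, Or.inr ⟨v, hv.1.1, rfl⟩, fun w hw => by grind, fun w hw hwc => by grind⟩
    · exact ⟨n, Or.inl rfl, fun v hv => absurd hv v.2.ne, fun v hv hvc => absurd ⟨v, hv, hvc⟩ hex⟩
  refine h.answer_of_near (τ := ⟨T.idOf c, T.idOf p, x, e, j, j, 2, False⟩) hadm rfl rfl rfl
    (by simp) (by simp) (by simp) id fun v hv hvc hvp => ?_
  have h0 : T.D v c ≠ 0 := fun e => hvc (T.D_eq_zero.1 e)
  have h1 := h.D_le hv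
  constructor
  · rintro (⟨e, -⟩ | ⟨e, -⟩ | ⟨-, h2, h3, h4⟩ | ⟨e, -⟩ | ⟨e, -⟩)
    iterate 2 simp at e
    · by_contra hne
      have hv2 : T.D v c = 2 := by omega
      have hcon : IsConstrained G (R.clique i ∩ R.clique j) v := by
        by_contra hf
        exact h3 (he' v ⟨⟨hv, h2⟩, hf⟩ hv2)
      obtain ⟨m, hm, hmj, hvm, h5⟩ := h.constrained hcon
      refine h4 ⟨m, hvm, fun u hu huj hum => (h.eq_of_mem hno hm hmj hv2 h2 hvm hu hum).imp_right
        fun e => val_eq_idOf.2 e, ?_⟩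
      rcases h5 with ⟨u, hu, huj, hum, huv⟩ | ⟨w, hw, hwj, hwm, hwv⟩ | ⟨w, hw, hwi, hwm⟩
      · grind
      · rcases h.eq_of_mem hno hm hmj hv2 h2 hvm hw hwm with e | e
        · grind
        · exact absurd (h.mem_j_of_le (by rw [e, h.pc])) hwj
      · exact Or.inl ⟨w, hwm, hw, hwi⟩
    all_goals simp at e
  · intro h2
    refine Or.inr (Or.inr (Or.inl ⟨rfl, h.mem_j_of_le h2.le, fun h3 => ?_, ?_⟩))
    · grind
    · rintro ⟨m, hvm, h3, h4⟩
      have hxm : x ∉ R.clique m := fun hxm => by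
        have h5 := h.xc
        rcases h3 x h.xi h.xj hxm with e | e
        · grind
        · rw [val_eq_idOf.1 e, h.pc] at h5
          omega
      have hm : m ≠ i := fun e => hxm (e ▸ h.xi)
      have hmj : m ≠ j := fun e => hxm (e ▸ h.xj)
      rcases h4 with ⟨w, hwm, hwj, hwi⟩ | ⟨u, hu, huj, hum, huv⟩
      · exact h.far_of_not_mem hmj h2 hvp hvm hwm hwj hwi
      · have hup : T.real u = p := val_eq_idOf.1 ((h3 u hu huj hum).resolve_left huv)
        exact huv (h.near_unique hm hmj (by rw [hup, h.pc]) h2 hum hvm)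

/-- At most one vertex next to `c` is free in the bistar. -/
theorem answer_of_near_side (hside : ∀ v v', IsFree G (R.clique i ∩ R.clique j) v →
    IsFree G (R.clique i ∩ R.clique j) v' → T.D v c = 1 → T.D v' c = 1 → v = v') :
    R.Answer i T := by
  obtain ⟨e, hadm, he, he'⟩ : ∃ e : ℕ, (e = n ∨ ∃ v ∈ R.clique i, (v : ℕ) = e) ∧
      (∀ v : Fin n, (v : ℕ) = e → T.D v c = 1) ∧
      ∀ v, IsFree G (R.clique i ∩ R.clique j) v → T.D v c = 1 → (v : ℕ) = e := by
    by_cases hex : ∃ v, IsFree G (R.clique i ∩ R.clique j) v ∧ T.D v c = 1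
    · obtain ⟨v, hv, hvc⟩ := hex
      exact ⟨v, Or.inr ⟨v, hv.1.1, rfl⟩, fun w hw => by grind, fun w hw hwc => by grind⟩
    · exact ⟨n, Or.inl rfl, fun v hv => absurd hv v.2.ne, fun v hv hvc => absurd ⟨v, hv, hvc⟩ hex⟩
  refine h.answer_of_near (τ := ⟨T.idOf c, T.idOf p, x, e, j, j, 3, False⟩) hadm rfl rfl rfl
    (by simp) (by simp) (by simp) id fun v hv hvc hvp => ?_
  have h0 : T.D v c ≠ 0 := fun e => hvc (T.D_eq_zero.1 e)
  have h1 := h.D_le hv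
  constructor
  · rintro (⟨e, -⟩ | ⟨e, -⟩ | ⟨e, -⟩ | ⟨-, h2, h3⟩ | ⟨e, -⟩)
    iterate 3 simp at e
    · rcases h3 with h3 | ⟨m, hvm, h3, u, hu, hum, huv⟩
      · grind
      by_contra hne
      have hv2 : T.D v c = 2 := by omega
      have hzm : z ∉ R.clique m := fun hzm => by
        have h5 := h.zc
        rcases h3 z h.zi (h.mem_j_of_le h5.le) hzm with e | e
        · grind
        · rw [val_eq_idOf.1 e, T.D_self] at h5
          omega
      have hm : m ≠ i := fun e => hzm (e ▸ h.zi)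
      have hmj : m ≠ j := fun e => hzm (e ▸ h.mem_j_of_le h.zc.le)
      have hup := (h.eq_of_mem hno hm hmj hv2 h2 hvm hu hum).resolve_left huv
      have hup' : T.D u c = 1 := by rw [hup, h.pc]
      have huc := (h3 u hu (h.mem_j_of_le hup'.le) hum).resolve_left huv
      rw [val_eq_idOf.1 huc, T.D_self] at hup'
      omega
    · simp at e
  · intro h2
    have hvj := h.mem_j_of_le h2.le
    refine Or.inr (Or.inr (Or.inr (Or.inl ⟨rfl, hvj, ?_⟩)))
    by_cases hf : IsFree G (R.clique i ∩ R.clique j) v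
    · grind
    have hcon : IsConstrained G (R.clique i ∩ R.clique j) v := not_not.1 fun e => hf ⟨⟨hv, hvj⟩, e⟩
    obtain ⟨m, hm, hmj, hvm, h5⟩ := h.constrained hcon
    refine Or.inr ⟨m, hvm, fun u hu huj hum => ?_, ?_⟩
    · have h6 := h.D_le hu
      rcases (by omega : T.D u c = 0 ∨ T.D u c = 1 ∨ T.D u c = 2) with
        h7 | h7 | h7
      · exact Or.inr (val_eq_idOf.2 (T.D_eq_zero.1 h7))
      · exact Or.inl (h.near_unique hm hmj h7 h2 hum hvm)
      · exact absurd (h.eq_p h7 h2 (h.share_cases' hm hmj h7 h2 hum hvm) huj) hvp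
    · rcases h5 with ⟨u, hu, huj, hum, huv⟩ | ⟨w, hw, hwj, hwm, hwv⟩ | ⟨w, hw, hwi, hwm⟩
      · grind
      · grind
      · exact (h.far_of_not_mem hmj h2 hvp hvm hwm hw hwi).elim

omit hno in
theorem answer : R.Answer i T := by
  by_cases hno : ∃ m, m ≠ i ∧ m ≠ j ∧ ∀ v : Fin n, T.D v c = 2 → v ∈ R.clique j → v ∈ R.clique m
  · obtain ⟨m, hm, hmj, hsub⟩ := hno
    exact h.answer_of_subset hm hmj hsub
  have hno' : ∀ m, m ≠ i → m ≠ j →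
      ¬ ∀ v : Fin n, T.D v c = 2 → v ∈ R.clique j → v ∈ R.clique m := fun m hm hmj hsub =>
    hno ⟨m, hm, hmj, hsub⟩
  have hX := (R.isMaxClique i).isCliqueIntersection.inter (R.isMaxClique j).isCliqueIntersection
  have hcp := h.cp
  have hpc := h.pc
  have hzx : T.d z x = 3 := by
    have h1 := h.xc
    have h2 := h.xp
    have h3 := h.zc
    have h4 : T.D z p ≠ 0 := fun e => h.zp (T.D_eq_zero.1 e)
    have f := T.fp z p c x
    have c1 := T.D_comm x p
    have c2 := T.D_comm x c
    have pr := T.par z c p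
    have t := T.D_tri z c p
    grind
  have hle : ∀ u ∈ R.clique i ∩ R.clique j, ∀ u' ∈ R.clique i ∩ R.clique j, T.d u u' ≤ 3 := by
    intro u hu u' hu'
    have h2 := (h.mem_j hu.1).1 hu.2
    have h3 := (h.mem_j hu'.1).1 hu'.2
    have t1 := T.D_tri u c u'
    have t2 := T.D_tri u p u'
    have c1 := T.D_comm u' c
    have c2 := T.D_comm u' p
    have t3 := T.D_tri u p c
    have t4 := T.D_tri u' p c
    grind
  rcases h.ws.side _ hX z ⟨h.zi, h.mem_j_of_le h.zc.le⟩ x ⟨h.xi, h.xj⟩ hzx hle with h1 | h1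
  · refine h.answer_of_children hno' fun v v' hv hv' h2 h3 => h1 v v' hv hv' ?_ ?_
    · have t := T.D_tri v p x
      have h4 := h.child h2 hv.1.2
      have h5 := h.xp
      grind
    · have t := T.D_tri v' p x
      have h4 := h.child h3 hv'.1.2
      have h5 := h.xp
      grind
  · refine h.answer_of_near_side hno' fun v v' hv hv' h2 h3 => h1 v v' hv hv' ?_ ?_
    · have t := T.D_tri v c z
      have h5 := h.zc
      grind
    · have t := T.D_tri v' c z
      have h5 := h.zc
      grind

end Bistar

/-- Every root in metric form has an answer. -/
theorem answer (hG : G.Connected) (hn : 2 ≤ n) (hws : MetricWS T G) : R.Answer i T := by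
  by_cases hfar : ∃ p ∈ R.clique i, ∃ q ∈ R.clique i, T.d p q = 4
  · obtain ⟨p, hp, q, hq, hpq⟩ := hfar
    obtain ⟨c, h⟩ := Central.exists_center hws hp hq hpq
    by_cases hno : ∀ m, m ≠ i → ∀ t, R.clique m = T.ball t → T.D c t = 1 →
        (∀ u ∈ R.clique i, T.D u c = 1 → T.real u = t) ∨
        ∀ u ∈ R.clique i, u ∈ R.clique m → ∀ u' ∈ R.clique i, u' ∈ R.clique m → u = u'
    · exact (h.nonCross hno).answer
    push Not at hno
    obtain ⟨j, hj, p, hjp, hcp, ⟨z, hz, hzc, hzp⟩, -⟩ := hno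
    have hmem : ∀ m t, R.clique m = T.ball t → T.D c t = 1 → ∀ u ∈ R.clique i,
        u ∈ R.clique m ↔ T.D u c ≤ 1 ∨ T.D u t ≤ 1 := by
      intro m t ht hct u hu
      rw [Set.ext_iff.1 ht u]
      change T.D _ _ ≤ 2 ↔ _
      have h1 := h.D_le hu
      have pr := T.par u c t
      have t := T.D_tri u c t
      omega
    by_cases hL : ∃ x : Fin n, T.D x c = 2 ∧ T.D x p = 1
    · obtain ⟨x, hxc, hxp⟩ := hL
      by_cases hone : ∀ l, l ≠ i → ∀ t, R.clique l = T.ball t → T.D c t = 1 → l = j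
      · exact (⟨h, hj, hjp, hcp, hone, hxc, hxp, hzc, hzp⟩ : Bistar T R i c j p x z).answer
      push Not at hone
      obtain ⟨l, hl, t, hlt, hct, hlj⟩ := hone
      refine (⟨h, fun v hv => ?_⟩ : NearInter T R i c j l).answer (Dominated.refl _ _ _)
      rw [hmem j p hjp hcp v hv, hmem l t hlt hct v hv]
      have h1 := h.D_le hv
      refine ⟨fun h2 => ?_, fun h2 => ⟨Or.inl h2, Or.inl h2⟩⟩
      by_contra hlt'
      have h3 : T.D v c = 2 := by omega
      have h4 := Central.D_eq_one_of_le hcp h3 (h2.1.resolve_left hlt')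
      have h5 := Central.D_eq_one_of_le hct h3 (h2.2.resolve_left hlt')
      refine hlj (R.clique_injective ?_)
      rw [hlt, hjp, mid_unique h3 h5 (by grind) h4 (by grind)]
    · refine (⟨h, fun v hv => ?_⟩ : NearInter T R i c j j).answer (Dominated.refl _ _ _)
      rw [and_self, hmem j p hjp hcp v hv]
      refine or_iff_left_of_imp fun h1 => ?_
      by_contra hlt
      have h2 : T.D v c = 2 := by
        have := h.D_le hv
        omega
      exact hL ⟨v, h2, Central.D_eq_one_of_le hcp h2 h1⟩
  · push Not at hfar
    exact answer_of_lt hG hn hws hfar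

end RootedCliqueTree

end

section

open SubTree TreeMetric

namespace RootedCliqueTree

open SteinerTree Guess

variable {n : ℕ} {G : SimpleGraph (Fin n)}

/-- Every well-structured root is represented by a guess. -/
theorem exists_guess (hG : G.Connected) (hn : 2 ≤ n) (R : RootedCliqueTree G) (i : Fin R.q)
    {T : SteinerTree (Fin n)} (hT : T.WellStructured G) :
    ∃ τ : Guess R.q, Admissible R.clique i τ ∧ τ.mode ≤ 4 ∧
      ∃ (T' : SteinerTree (Fin n)) (Y : Set (Fin n)),
        T'.WellStructured G ∧ Y ⊆ R.clique i ∧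
        (Guess.tree R.clique i τ).Represents T'
          (hull T'.graph (T'.real '' Y ∪ T'.center (R.clique i))) (T'.center (R.clique i)) ∧
        R.sep i ⊆ Y ∧
        (∃ φ : T.subtree (R.sep i) ≃g T'.subtree (R.sep i), IsSteinerEquiv φ ∧
          ∀ r : T.span (R.sep i), distTo T.graph r (T.real '' (R.verts i \ R.sep i)) ≤
            distTo T'.graph (φ r) (T'.real '' (R.verts i \ R.sep i))) ∧
        (∀ v ∈ R.clique i \ Y, ∃ S : Set (Fin n),
          (∀ w ∈ S, w ∈ R.clique i \ Y ∨ T.real w ∈ T.center (R.clique i)) ∧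
          v ∈ S ∧ T.IsThinBranch G (R.clique i) S) ∧
        ((T'.subtree (R.clique i)).diam < 4 ∨
            (∃ S : Set (Fin n), IsMinimalSeparator G S ∧ S ⊂ R.clique i ∧ T'.IsBistar S) →
          Y = R.clique i) := by
  obtain ⟨T', Y, τ, c₀, w₂, hws, hmode, hτ, hc, hdom, hsep, hthin, hmore⟩ :=
    R.answer (i := i) hG hn hT.metricWS
  refine ⟨τ, hτ.adm, hmode, T', Y, hws.wellStructured, hτ.sub, ?_, hsep, ?_, hthin, hmore⟩
  · rw [hc]
    exact hτ.represents
  · exact exists_steinerEquiv hT.isRoot hws.root (R.sep_isCliqueIntersection i) hdom.1 hdom.2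

end RootedCliqueTree

end

section

/-! ## A small programming language for the word RAM -/

namespace WordRAM

open Function (update update_self update_of_ne update_idem update_apply)

/-- The program halts within `T` steps in a state that satisfies `Q`. -/
def Runs (W : ℕ) (p : Program) (s : State) (T : ℕ) (Q : State → Prop) : Prop :=
  ∃ t s', Exec W p s t s' ∧ t ≤ T ∧ Q s'

section

variable {W T T' : ℕ} {p q : Program} {s : State} {Q Q' : State → Prop}

theorem Runs.mono (h : Runs W p s T Q) (hT : T ≤ T') (hQ : ∀ s', Q s' → Q' s') :
    Runs W p s T' Q' := by
  obtain ⟨t, s', h1, h2, h3⟩ := h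
  exact ⟨t, s', h1, h2.trans hT, hQ s' h3⟩

theorem Runs.seq (hp : Runs W p s T Q) (hq : ∀ s', Q s' → Runs W q s' T' Q') :
    Runs W (.seq p q) s (T + T') Q' := by
  obtain ⟨t, s', h1, h2, h3⟩ := hp
  obtain ⟨t', s'', h4, h5, h6⟩ := hq s' h3
  exact ⟨_, s'', .seq h1 h4, by omega, h6⟩

theorem Runs.assign {x : ℕ} {e : Expr} (h : e.eval s ≤ W)
    (hQ : Q { s with reg := update s.reg x (e.eval s) }) : Runs W (.assign x e) s 1 Q :=
  ⟨1, _, .assign s x e h, le_rfl, hQ⟩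

theorem Runs.ite {x y : ℕ} (hp : s.reg x < s.reg y → Runs W p s T Q)
    (hq : ¬ s.reg x < s.reg y → Runs W q s T Q) : Runs W (.ite x y p q) s (T + 1) Q := by
  by_cases h : s.reg x < s.reg y
  · obtain ⟨t, s', h1, h2, h3⟩ := hp h
    exact ⟨_, s', .ite_true h h1, by omega, h3⟩
  · obtain ⟨t, s', h1, h2, h3⟩ := hq h
    exact ⟨_, s', .ite_false h h1, by omega, h3⟩

theorem Runs.loop {x y : ℕ} (I : ℕ → State → Prop)
    (hexit : ∀ r s, I r s → ¬ s.reg x < s.reg y → Q s)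
    (hstep : ∀ r s, I r s → s.reg x < s.reg y → ∃ r', r = r' + 1 ∧ Runs W p s T (I r')) (r : ℕ)
    (hI : I r s) : Runs W (.loop x y p) s (r * (T + 1) + 1) Q := by
  induction r using Nat.strong_induction_on generalizing s with
  | _ r ih =>
  by_cases h : s.reg x < s.reg y
  · obtain ⟨r', rfl, t, s', h1, h2, h3⟩ := hstep r s hI h
    obtain ⟨t', s'', h4, h5, h6⟩ := ih r' (by omega) h3
    refine ⟨_, s'', .loop_step h h1 h4, ?_, h6⟩
    grind
  · exact ⟨1, s, Exec.loop_stop h, by omega, hexit r s hI h⟩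

end

inductive Op where
  | add
  | sub
  | mul
  | div

def Op.ev : Op → ℕ → ℕ → ℕ
  | .add => (· + ·)
  | .sub => (· - ·)
  | .mul => (· * ·)
  | .div => (· / ·)

def Op.expr : Op → ℕ → ℕ → Expr
  | .add => .add
  | .sub => .sub
  | .mul => .mul
  | .div => .div

/-- Terms.  The variables `1, …, 4` bound the loops; the variable bound by `letv x` and by `first x`
is `x + 10`. The value of `first x b e` is the first number `x < b` such that `e` is not `0`. -/
inductive Tm where
  | var (x : ℕ)
  | const (k : ℕ)
  | op (o : Op) (a b : Tm)
  | load (a : Tm)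
  | lt (a b : Tm)
  | ite (c a b : Tm)
  | letv (x : ℕ) (a e : Tm)
  | first (x : ℕ) (b : Fin 4) (e : Tm)

/-- The first number below `b` with the property `p`, or `b`. -/
noncomputable def firstBelow (b : ℕ) (p : ℕ → Prop) : ℕ := sInf {y | y < b → p y}

theorem firstBelow_le (b : ℕ) (p : ℕ → Prop) : firstBelow b p ≤ b :=
  Nat.sInf_le (s := {y | y < b → p y}) fun h : b < b => absurd h (lt_irrefl b)

theorem firstBelow_spec {b : ℕ} {p : ℕ → Prop} (h : firstBelow b p < b) : p (firstBelow b p) :=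
  Nat.sInf_mem (s := {y | y < b → p y}) ⟨b, fun h => absurd h (lt_irrefl b)⟩ h

theorem firstBelow_min {b y : ℕ} {p : ℕ → Prop} (h : p y) : firstBelow b p ≤ y :=
  Nat.sInf_le (s := {y | y < b → p y}) fun _ => h

theorem firstBelow_eq {b y : ℕ} {p : ℕ → Prop} (hy : y ≤ b) (h : y < b → p y)
    (hno : ∀ z < y, ¬ p z) : firstBelow b p = y := by
  refine le_antisymm (Nat.sInf_le h) (not_lt.1 fun hlt => hno _ hlt (firstBelow_spec ?_))
  omega

theorem firstBelow_lt_iff {b : ℕ} {p : ℕ → Prop} : firstBelow b p < b ↔ ∃ y < b, p y :=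
  ⟨fun h => ⟨_, h, firstBelow_spec h⟩, fun ⟨_, h1, h2⟩ => (firstBelow_min h2).trans_lt h1⟩

namespace Tm

noncomputable def ev : Tm → (ℕ → ℕ) → (ℕ → ℕ) → ℕ
  | var x, ρ, _ => ρ x
  | const k, _, _ => k
  | op o a b, ρ, μ => o.ev (a.ev ρ μ) (b.ev ρ μ)
  | load a, ρ, μ => μ (a.ev ρ μ)
  | lt a b, ρ, μ => if a.ev ρ μ < b.ev ρ μ then 1 else 0
  | ite c a b, ρ, μ => if 0 < c.ev ρ μ then a.ev ρ μ else b.ev ρ μ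
  | letv x a e, ρ, μ => e.ev (update ρ (x + 10) (μ (a.ev ρ μ))) μ
  | first x b e, ρ, μ => firstBelow (ρ (b + 1)) fun y => 0 < e.ev (update ρ (x + 10) y) μ

/-- The value of the variable `x` is in the register `2 * x`; the result is put into the register
`2 * D + 1`. -/
def compile : Tm → ℕ → Program
  | var x, D => .assign (2 * D + 1) (.reg (2 * x))
  | const k, D => .assign (2 * D + 1) (.const k)
  | op o a b, D => .seq (a.compile D) (.seq (b.compile (D + 1))
      (.assign (2 * D + 1) (o.expr (2 * D + 1) (2 * (D + 1) + 1))))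
  | load a, D => .seq (a.compile D) (.assign (2 * D + 1) (.load (2 * D + 1)))
  | lt a b, D => .seq (a.compile D) (.seq (b.compile (D + 1))
      (.ite (2 * D + 1) (2 * (D + 1) + 1) (.assign (2 * D + 1) (.const 1))
        (.assign (2 * D + 1) (.const 0))))
  | ite c a b, D => .seq (.assign (2 * D + 1) (.const 0)) (.seq (c.compile (D + 1))
      (.ite (2 * D + 1) (2 * (D + 1) + 1) (a.compile D) (b.compile D)))
  | letv x a e, D => .seq (a.compile D) (.seq (.assign (2 * D + 1) (.load (2 * D + 1)))
      (.seq (.assign (2 * (D + 1) + 1) (.reg (2 * (x + 10))))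
      (.seq (.assign (2 * (x + 10)) (.reg (2 * D + 1))) (.seq (e.compile (D + 2))
      (.seq (.assign (2 * D + 1) (.reg (2 * (D + 2) + 1)))
        (.assign (2 * (x + 10)) (.reg (2 * (D + 1) + 1))))))))
  | first x b e, D => .seq (.assign (2 * (D + 1) + 1) (.reg (2 * (x + 10))))
      (.seq (.assign (2 * (D + 2) + 1) (.reg (2 * (b + 1))))
      (.seq (.assign (2 * (D + 3) + 1) (.const 1)) (.seq (.assign (2 * D + 1) (.const 0))
      (.seq (.assign (2 * (x + 10)) (.const 0))
      (.seq (.loop (2 * (x + 10)) (2 * (D + 2) + 1) (.seq (e.compile (D + 4))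
        (.ite (2 * D + 1) (2 * (D + 4) + 1) (.assign (2 * (D + 2) + 1) (.reg (2 * (x + 10))))
          (.assign (2 * (x + 10)) (.add (2 * (x + 10)) (2 * (D + 3) + 1))))))
      (.seq (.assign (2 * D + 1) (.reg (2 * (x + 10))))
        (.assign (2 * (x + 10)) (.reg (2 * (D + 1) + 1)))))))))

def cost (β : ℕ → ℕ) : Tm → ℕ
  | var _ => 1
  | const _ => 1
  | op _ a b => a.cost β + (b.cost β + 1)
  | load a => a.cost β + 1
  | lt a b => a.cost β + (b.cost β + 2)
  | ite c a b => 1 + (c.cost β + (a.cost β + b.cost β + 1))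
  | letv _ a e => a.cost β + (e.cost β + 5)
  | first _ b e => β (b + 1) * (e.cost β + 3) + 8

/-- The exponent of the bound on the numbers that occur in the evaluation. -/
def size : Tm → ℕ
  | var _ => 1
  | const k => k + 1
  | op _ a b => a.size + b.size
  | load a => a.size
  | lt a b => a.size + b.size
  | ite c a b => c.size + (a.size + b.size)
  | letv _ a e => a.size + e.size
  | first _ _ e => e.size + 1

end Tm

/-- The bounds on the variables and on the memory cells. -/
structure Bounded (B : ℕ) (β : ℕ → ℕ) (ρ μ : ℕ → ℕ) : Prop where
  two_le : 2 ≤ B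
  le : ∀ x, β x ≤ B
  eq : ∀ x, β (x + 10) = B
  reg : ∀ x, ρ x ≤ β x
  mem : ∀ a, μ a ≤ B

section

variable {B W : ℕ} {β ρ μ : ℕ → ℕ}

theorem Bounded.update (h : Bounded B β ρ μ) {x v : ℕ} (hv : v ≤ β x) :
    Bounded B β (update ρ x v) μ := by
  refine ⟨h.two_le, h.le, h.eq, fun y => ?_, h.mem⟩
  by_cases hy : y = x
  · grind
  · rw [update_of_ne hy]
    exact h.reg y

namespace Tm

theorem one_le_size (e : Tm) : 1 ≤ e.size := by
  induction e <;> simp only [size] <;> omega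

theorem pow_le {B W a b : ℕ} (hB : 2 ≤ B) (h : B ^ b ≤ W) (hab : a ≤ b) : B ^ a ≤ W :=
  (Nat.pow_le_pow_right (by omega) hab).trans h

theorem ev_le (e : Tm) (h : Bounded B β ρ μ) : e.ev ρ μ ≤ B ^ e.size := by
  have h2 := h.two_le
  have hpos : ∀ k, 0 < B ^ k := fun k => Nat.pow_pos (by omega)
  induction e generalizing ρ with
  | var x => simpa [ev, size] using (h.reg x).trans (h.le x)
  | const k =>
    have h3 : k ≤ 2 ^ k := Nat.lt_two_pow_self.le
    exact (h3.trans (Nat.pow_le_pow_left h2 k)).trans (Nat.pow_le_pow_right (by omega) (Nat.le_succ k))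
  | op o a b iha ihb =>
    have h3 := iha h
    have h4 := ihb h
    have h5 := Nat.mul_le_mul h3 h4
    rw [← pow_add] at h5
    have h6 := Nat.pow_le_pow_right (n := B) (by omega) a.one_le_size
    have h7 := Nat.pow_le_pow_right (n := B) (by omega) b.one_le_size
    have h8 : B ^ a.size + B ^ b.size ≤ B ^ (a.size + b.size) := by
      rw [pow_add]
      nlinarith
    simp only [ev, size]
    have h9 := hpos b.size
    cases o
    · exact (Nat.add_le_add h3 h4).trans h8
    · exact ((Nat.sub_le _ _).trans h3).trans (by omega)
    · exact h5
    · exact ((Nat.div_le_self _ _).trans h3).trans (by omega)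
  | load a => exact (h.mem _).trans (Nat.le_self_pow (by have := a.one_le_size; simp only [size]; omega) _)
  | lt a b =>
    have := hpos (a.size + b.size)
    simp only [ev, size]
    grind
  | ite c a b ihc iha ihb =>
    simp only [ev, size]
    split
    · exact pow_le h2 le_rfl (by omega) |>.trans' (iha h)
    · exact pow_le h2 le_rfl (by omega) |>.trans' (ihb h)
  | letv x a e iha ihe =>
    exact (ihe (h.update (by rw [h.eq]; exact h.mem _))).trans (pow_le h2 le_rfl (by simp only [size]; omega))
  | first x b e =>
    exact ((firstBelow_le _ _).trans ((h.reg _).trans (h.le _))).trans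
      (Nat.le_self_pow (by simp only [size]; omega) _)

/-- The values of the variables. -/
def _root_.WordRAM.State.env (s : State) (x : ℕ) : ℕ := s.reg (2 * x)

/-- The state `s'` differs from `s` only in the variables, which have the values `ρ`, and in the
temporary registers from the number `D` on. -/
structure _root_.WordRAM.Inv (D : ℕ) (s : State) (ρ : ℕ → ℕ) (s' : State) : Prop where
  mem : s'.mem = s.mem
  env : s'.env = ρ
  temp : ∀ d < D, s'.reg (2 * d + 1) = s.reg (2 * d + 1)

theorem update_env {s : State} {x : ℕ} (v : ℕ) :
    State.env { s with reg := update s.reg (2 * x) v } = update s.env x v := by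
  funext y
  by_cases hy : y = x
  · subst hy
    simp [State.env]
  · rw [update_of_ne hy]
    exact update_of_ne (by omega) _ _

theorem update_temp_env {s : State} {d : ℕ} (v : ℕ) :
    State.env { s with reg := update s.reg (2 * d + 1) v } = s.env :=
  funext fun _ => update_of_ne (by omega) _ _

variable {D D' d x v : ℕ} {s s' s'' : State} {ρ ρ' : ℕ → ℕ}

theorem _root_.WordRAM.Inv.refl (D : ℕ) (s : State) : Inv D s s.env s := ⟨rfl, rfl, fun _ _ => rfl⟩

theorem _root_.WordRAM.Inv.trans (h : Inv D s ρ s') (h' : Inv D' s' ρ' s'') (hD : D ≤ D') :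
    Inv D s ρ' s'' :=
  ⟨h'.mem.trans h.mem, h'.env, fun d hd => (h'.temp d (by omega)).trans (h.temp d hd)⟩

theorem _root_.WordRAM.Inv.assign (h : Inv D s ρ s') (hd : D ≤ d) (v : ℕ) :
    Inv D s ρ { s' with reg := update s'.reg (2 * d + 1) v } :=
  ⟨h.mem, (update_temp_env v).trans h.env,
    fun _ _ => (update_of_ne (by omega) _ _).trans (h.temp _ ‹_›)⟩

theorem _root_.WordRAM.Inv.assign_var (h : Inv D s ρ s') (x v : ℕ) :
    Inv D s (update ρ x v) { s' with reg := update s'.reg (2 * x) v } :=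
  ⟨h.mem, (update_env v).trans (by rw [h.env]),
    fun _ _ => (update_of_ne (by omega) _ _).trans (h.temp _ ‹_›)⟩

theorem update_ne (x : ℕ) (d : ℕ) (r : ℕ → ℕ) (v : ℕ) :
    update r (2 * x) v (2 * d + 1) = r (2 * d + 1) := update_of_ne (by omega) _ _

theorem update_ne_temp {d d' : ℕ} (h : d' ≠ d) (r : ℕ → ℕ) (v : ℕ) :
    update r (2 * d + 1) v (2 * d' + 1) = r (2 * d' + 1) := update_of_ne (by omega) _ _

/-- The state after the evaluation of a term with value `v`. -/
def Post (D : ℕ) (s : State) (v : ℕ) (s' : State) : Prop :=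
  Inv D s s.env s' ∧ s'.reg (2 * D + 1) = v

theorem _root_.WordRAM.Inv.post (h : Inv D s s.env s') (v : ℕ) :
    Post D s v { s' with reg := update s'.reg (2 * D + 1) v } :=
  ⟨h.assign le_rfl v, update_self ..⟩

theorem exec (e : Tm) (D : ℕ) (s : State) (h : Bounded B β s.env s.mem) (hW : B ^ e.size ≤ W) :
    Runs W (e.compile D) s (e.cost β) (Post D s (e.ev s.env s.mem)) := by
  have h2 := h.two_le
  have hBW : B ≤ W := (Nat.le_self_pow (by have := e.one_le_size; omega) B).trans hW
  have hreg : ∀ {s : State}, Bounded B β s.env s.mem → ∀ x, s.reg (2 * x) ≤ W :=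
    fun h x => ((h.reg x).trans (h.le x)).trans hBW
  have hstep : ∀ {D s ρ s'} (e : Tm), Inv D s ρ s' → Bounded B β ρ s.mem →
      Bounded B β s'.env s'.mem := fun _ hI hb => by rwa [hI.mem, hI.env]
  induction e generalizing D s with
  | var x => exact .assign (hreg h x) ((Inv.refl D s).post _)
  | const k => exact .assign ((ev_le (.const k) h).trans hW) ((Inv.refl D s).post _)
  | op o a b iha ihb =>
    refine (iha D s h (pow_le h2 hW (by simp only [size]; omega))).seq fun s₁ ⟨h₁, v₁⟩ => ?_
    refine (ihb (D + 1) s₁ (hstep a h₁ h) (pow_le h2 hW (by simp only [size]; omega))).seq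
      fun s₂ ⟨h₂, v₂⟩ => ?_
    rw [← h₂.temp D (by omega)] at v₁
    rw [h₁.mem, h₁.env] at v₂
    have e3 : (o.expr (2 * D + 1) (2 * (D + 1) + 1)).eval s₂ = (op o a b).ev s.env s.mem := by
      cases o <;> simp only [Op.expr, Expr.eval, ev, Op.ev, v₁, v₂]
    refine .assign (by rw [e3]; exact (ev_le _ h).trans hW) ?_
    rw [e3]
    rw [h₁.env] at h₂
    exact (h₁.trans h₂ (by omega)).post _
  | load a iha =>
    refine (iha D s h hW).seq fun s₁ ⟨h₁, v₁⟩ => ?_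
    have e1 : (Expr.load (2 * D + 1)).eval s₁ = (load a).ev s.env s.mem := by
      simp only [Expr.eval, ev, v₁, h₁.mem]
    refine .assign (by rw [e1]; exact (ev_le _ h).trans hW) ?_
    rw [e1]
    exact h₁.post _
  | lt a b iha ihb =>
    refine (iha D s h (pow_le h2 hW (by simp only [size]; omega))).seq fun s₁ ⟨h₁, v₁⟩ => ?_
    refine (ihb (D + 1) s₁ (hstep a h₁ h) (pow_le h2 hW (by simp only [size]; omega))).seq
      fun s₂ ⟨h₂, v₂⟩ => ?_
    rw [← h₂.temp D (by omega)] at v₁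
    rw [h₁.mem, h₁.env] at v₂
    rw [h₁.env] at h₂
    refine .ite (fun hlt => .assign (by simp only [Expr.eval]; omega) ?_)
      fun hlt => .assign (by simp only [Expr.eval]; omega) ?_ <;>
      (rw [v₁, v₂] at hlt
       simp only [ev, hlt, if_true, if_false]
       exact (h₁.trans h₂ (by omega)).post _)
  | ite c a b ihc iha ihb =>
    refine (Runs.assign (Q := Post D s 0) (Nat.zero_le _) ((Inv.refl D s).post _)).seq
      fun s₁ ⟨h₁, v₁⟩ => ?_
    refine (ihc (D + 1) s₁ (hstep c h₁ h) (pow_le h2 hW (by simp only [size]; omega))).seq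
      fun s₂ ⟨h₂, v₂⟩ => ?_
    rw [← h₂.temp D (by omega)] at v₁
    rw [h₁.mem, h₁.env] at v₂
    rw [h₁.env] at h₂
    have h₃ := h₁.trans h₂ (by omega)
    have hpost : ∀ {v s'}, Post D s₂ v s' → Post D s v s' := fun ⟨h₄, v₄⟩ => by
      rw [h₃.env] at h₄
      exact ⟨h₃.trans h₄ le_rfl, v₄⟩
    refine .ite (fun hlt => ?_) fun hlt => ?_ <;>
      (rw [v₁, v₂] at hlt; simp only [ev, hlt, if_true, if_false])
    · refine (iha D s₂ (hstep a h₃ h) (pow_le h2 hW (by simp only [size]; omega))).mono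
        (by omega) fun s' h' => hpost (by rwa [h₃.env, h₃.mem] at h')
    · refine (ihb D s₂ (hstep b h₃ h) (pow_le h2 hW (by simp only [size]; omega))).mono
        (by omega) fun s' h' => hpost (by rwa [h₃.env, h₃.mem] at h')
  | letv x a e iha ihe =>
    set v := s.mem (a.ev s.env s.mem) with hv
    have hvB : v ≤ B := h.mem _
    have hb : Bounded B β (update s.env (x + 10) v) s.mem := h.update (by rw [h.eq]; exact hvB)
    refine ((iha D s h (pow_le h2 hW (by simp only [size]; omega))).seq fun s₁ ⟨h₁, v₁⟩ => ?_).mono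
      (T := a.cost β + (1 + (1 + (1 + (e.cost β + (1 + 1)))))) (by simp only [cost]; omega)
      fun _ => id
    have e1 : (Expr.load (2 * D + 1)).eval s₁ = v := by simp only [Expr.eval, v₁, h₁.mem, hv]
    refine .seq (.assign (Q := Post D s v) (by grind)
      (by rw [e1]; exact h₁.post _)) fun s₂ ⟨h₂, v₂⟩ => ?_
    have x₂ : s₂.reg (2 * (x + 10)) = s.env (x + 10) := congrFun h₂.env _
    refine .seq (.assign (Q := fun s' => Post D s v s' ∧ s'.reg (2 * (D + 1) + 1) = s.env (x + 10))
      (hreg (hstep a h₂ h) _) ⟨⟨h₂.assign (by omega) _, ?_⟩, ?_⟩) fun s₃ ⟨⟨h₃, v₃⟩, x₃⟩ => ?_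
    · grind
    · exact (update_self ..).trans x₂
    refine .seq (.assign (Q := fun s' => Inv D s (update s.env (x + 10) v) s' ∧
      s'.reg (2 * (D + 1) + 1) = s.env (x + 10)) (by simp only [Expr.eval]; omega) ⟨?_, ?_⟩)
      fun s₄ ⟨h₄, x₄⟩ => ?_
    · simp only [Expr.eval, v₃]
      exact h₃.assign_var _ _
    · grind
    refine .seq (ihe (D + 2) s₄ (hstep e h₄ hb) (pow_le h2 hW (by simp only [size]; omega)))
      fun s₅ ⟨h₅, v₅⟩ => ?_
    rw [h₄.env, h₄.mem] at v₅
    rw [← h₅.temp (D + 1) (by omega)] at x₄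
    rw [h₄.env] at h₅
    refine .seq (.assign (Q := fun s' => Inv D s (update s.env (x + 10) v) s' ∧
      s'.reg (2 * (D + 1) + 1) = s.env (x + 10) ∧
      s'.reg (2 * D + 1) = (letv x a e).ev s.env s.mem) ?_ ⟨?_, ?_, ?_⟩) fun s₆ ⟨h₆, x₆, v₆⟩ => ?_
    · simp only [Expr.eval, v₅]
      exact (ev_le (letv x a e) h).trans hW
    · exact (h₄.trans h₅ (by omega)).assign le_rfl _
    · grind
    · exact (update_self ..).trans v₅
    refine .assign (by simp only [Expr.eval, x₆]; exact hreg h _) ⟨?_, (update_ne ..).trans v₆⟩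
    simp only [Expr.eval, x₆]
    have := h₆.assign_var (x + 10) (s.env (x + 10))
    rwa [update_idem, Function.update_eq_self] at this
  | first x b e ihe =>
    set k := s.env (b + 1) with hk
    set p : ℕ → Prop := fun y => 0 < e.ev (update s.env (x + 10) y) s.mem with hp
    have hkW : k ≤ W := hreg h _
    have hkB : k ≤ B := (h.reg _).trans (h.le _)
    have hB : ∀ y ≤ k, Bounded B β (update s.env (x + 10) y) s.mem := fun y hy =>
      h.update (by rw [h.eq]; grind)
    have hWe : B ^ e.size ≤ W := pow_le h2 hW (by simp only [size]; omega)
    refine Runs.mono (T := 1 + (1 + (1 + (1 + (1 + ((k * (e.cost β + (1 + 1) + 1) + 1) + (1 + 1)))))))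
      ?_ ?_ (fun _ => id)
    swap
    · have : k * (e.cost β + (1 + 1) + 1) ≤ β (b + 1) * (e.cost β + 3) :=
        Nat.mul_le_mul_right _ (h.reg _)
      simp only [cost]
      omega
    refine .seq (.assign (Q := fun s' => Inv D s s.env s' ∧ s'.reg (2 * (D + 1) + 1) = s.env (x + 10))
      (hreg h _) ⟨(Inv.refl D s).assign (by omega) _, update_self ..⟩)
      fun s₁ ⟨h₁, a₁⟩ => ?_
    refine .seq (.assign (Q := fun s' => Inv D s s.env s' ∧ s'.reg (2 * (D + 1) + 1) = s.env (x + 10) ∧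
      s'.reg (2 * (D + 2) + 1) = k) (hreg (hstep e h₁ h) _) ⟨h₁.assign (by omega) _,
        (update_ne_temp (by omega) _ _).trans a₁,
        (update_self ..).trans (congrFun h₁.env _)⟩) fun s₂ ⟨h₂, a₂, b₂⟩ => ?_
    refine .seq (.assign (Q := fun s' => Inv D s s.env s' ∧ s'.reg (2 * (D + 1) + 1) = s.env (x + 10) ∧
      s'.reg (2 * (D + 2) + 1) = k ∧ s'.reg (2 * (D + 3) + 1) = 1)
      (by simp only [Expr.eval]; omega) ⟨h₂.assign (by omega) _,
        (update_ne_temp (by omega) _ _).trans a₂, (update_ne_temp (by omega) _ _).trans b₂,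
        update_self ..⟩) fun s₃ ⟨h₃, a₃, b₃, c₃⟩ => ?_
    refine .seq (.assign (Q := fun s' => Inv D s s.env s' ∧ s'.reg (2 * (D + 1) + 1) = s.env (x + 10) ∧
      s'.reg (2 * (D + 2) + 1) = k ∧ s'.reg (2 * (D + 3) + 1) = 1 ∧ s'.reg (2 * D + 1) = 0)
      (Nat.zero_le _) ⟨h₃.assign (by omega) _,
        (update_ne_temp (by omega) _ _).trans a₃, (update_ne_temp (by omega) _ _).trans b₃,
        (update_ne_temp (by omega) _ _).trans c₃, update_self ..⟩)
      fun s₄ ⟨h₄, a₄, b₄, c₄, d₄⟩ => ?_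
    let I : ℕ → State → Prop := fun r s' => ∃ y, Inv D s (update s.env (x + 10) y) s' ∧
      s'.reg (2 * (D + 1) + 1) = s.env (x + 10) ∧ s'.reg (2 * (D + 3) + 1) = 1 ∧
      s'.reg (2 * D + 1) = 0 ∧ y ≤ k ∧ (∀ z < y, ¬ p z) ∧
      (s'.reg (2 * (D + 2) + 1) = k ∧ r = k - y ∨ s'.reg (2 * (D + 2) + 1) = y ∧ p y)
    refine .seq (.assign (Q := I k) (Nat.zero_le _) ⟨0, h₄.assign_var _ _, (update_ne ..).trans a₄,
      (update_ne ..).trans c₄, (update_ne ..).trans d₄, Nat.zero_le _, fun z hz => by omega,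
      .inl ⟨(update_ne ..).trans b₄, rfl⟩⟩) fun s₅ h₅ => ?_
    refine .seq (Q := fun s' => Inv D s (update s.env (x + 10) (firstBelow k p)) s' ∧
      s'.reg (2 * (D + 1) + 1) = s.env (x + 10)) (.loop I ?_ ?_ k h₅) fun s₆ ⟨h₆, a₆⟩ => ?_
    · rintro r s' ⟨y, g, ga, -, -, hy, hno, hb⟩ hlt
      have hx : s'.reg (2 * (x + 10)) = y := (congrFun g.env _).trans (update_self ..)
      rw [hx] at hlt
      have : firstBelow k p = y := firstBelow_eq hy (fun hyk => by
        grind) hno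
      grind
    · rintro r s' ⟨y, g, ga, gc, gd, hy, hno, hb⟩ hlt
      have hx : s'.reg (2 * (x + 10)) = y := (congrFun g.env _).trans (update_self ..)
      rw [hx] at hlt
      rcases hb with ⟨gb, hr⟩ | ⟨gb, -⟩
      swap
      · omega
      rw [gb] at hlt
      refine ⟨r - 1, by omega, ?_⟩
      refine .seq (ihe (D + 4) s' (hstep e g (hB y hy)) hWe) fun s₁ ⟨h₁, v₁⟩ => ?_
      rw [g.env, g.mem] at v₁
      rw [g.env] at h₁
      have h₂ := g.trans h₁ (by omega)
      rw [← h₁.temp (D + 1) (by omega)] at ga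
      rw [← h₁.temp (D + 2) (by omega)] at gb
      rw [← h₁.temp (D + 3) (by omega)] at gc
      rw [← h₁.temp D (by omega)] at gd
      have hx' : s₁.reg (2 * (x + 10)) = y := (congrFun h₂.env _).trans (update_self ..)
      refine .ite (fun hlt' => .assign (by simp only [Expr.eval, hx']; omega) ⟨y,
        h₂.assign (by omega) _, (update_ne_temp (by omega) _ _).trans ga,
        (update_ne_temp (by omega) _ _).trans gc, (update_ne_temp (by omega) _ _).trans gd, hy, hno,
        .inr ⟨(update_self ..).trans hx', ?_⟩⟩)
        fun hlt' => .assign (by simp only [Expr.eval, hx', gc]; omega) ⟨y + 1, ?_,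
        (update_ne ..).trans ga, (update_ne ..).trans gc, (update_ne ..).trans gd, by omega,
        fun z hz => ?_, .inl ⟨(update_ne ..).trans gb, by omega⟩⟩
      · grind
      · simp only [Expr.eval, hx', gc]
        have := h₂.assign_var (x + 10) (y + 1)
        rwa [update_idem] at this
      grind
    have hle : firstBelow k p ≤ W := (firstBelow_le _ _).trans hkW
    have hx : s₆.reg (2 * (x + 10)) = firstBelow k p :=
      (congrFun h₆.env _).trans (update_self ..)
    refine .seq (.assign (Q := fun s' => Inv D s (update s.env (x + 10) (firstBelow k p)) s' ∧
      s'.reg (2 * (D + 1) + 1) = s.env (x + 10) ∧ s'.reg (2 * D + 1) = firstBelow k p)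
      (by simp only [Expr.eval, hx]; exact hle) ⟨h₆.assign le_rfl _,
        (update_ne_temp (by omega) _ _).trans a₆, (update_self ..).trans hx⟩)
      fun s₇ ⟨h₇, a₇, v₇⟩ => ?_
    refine .assign (by simp only [Expr.eval, a₇]; exact hreg h _) ⟨?_, (update_ne ..).trans v₇⟩
    simp only [Expr.eval, a₇]
    have := h₇.assign_var (x + 10) (s.env (x + 10))
    rwa [update_idem, Function.update_eq_self] at this

end Tm

end

end WordRAM

end

section

/-! ## Statements -/

namespace WordRAM

open Function (update update_self update_of_ne update_idem update_apply)

/-- Statements: assignments, writing to memory, and loops over the numbers below the value of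
one of the variables `1, …, 4`. -/
inductive Stm where
  | set (x : ℕ) (e : Tm)
  | put (a e : Tm)
  | seq (c d : Stm)
  | loop (x : ℕ) (b : Fin 4) (c : Stm)

namespace Stm

def compile : Stm → ℕ → Program
  | set x e, D => .seq (e.compile D) (.assign (2 * x) (.reg (2 * D + 1)))
  | put a e, D => .seq (a.compile D) (.seq (e.compile (D + 1))
      (.store (2 * D + 1) (2 * (D + 1) + 1)))
  | seq c d, D => .seq (c.compile D) (d.compile D)
  | loop x b c, D => .seq (.assign (2 * (D + 1) + 1) (.reg (2 * (b + 1))))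
      (.seq (.assign (2 * (D + 2) + 1) (.const 1)) (.seq (.assign (2 * D + 1) (.const 0))
      (.loop (2 * D + 1) (2 * (D + 1) + 1) (.seq (.assign (2 * (x + 10)) (.reg (2 * D + 1)))
        (.seq (c.compile (D + 3))
          (.assign (2 * D + 1) (.add (2 * D + 1) (2 * (D + 2) + 1))))))))

def cost (β : ℕ → ℕ) : Stm → ℕ
  | set _ e => e.cost β + 1
  | put a e => a.cost β + (e.cost β + 1)
  | seq c d => c.cost β + d.cost β
  | loop _ b c => β (b + 1) * (c.cost β + 3) + 4

/-- The exponent of the bound on the numbers that occur. -/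
def size : Stm → ℕ
  | set _ e => e.size
  | put a e => a.size + e.size
  | seq c d => c.size + d.size
  | loop _ _ c => c.size + 1

/-- The weakest precondition. -/
def wp (B : ℕ) (β : ℕ → ℕ) : Stm → ((ℕ → ℕ) → (ℕ → ℕ) → Prop) → (ℕ → ℕ) → (ℕ → ℕ) → Prop
  | set x e, Q, ρ, μ => e.ev ρ μ ≤ β x ∧ Q (update ρ x (e.ev ρ μ)) μ
  | put a e, Q, ρ, μ => e.ev ρ μ ≤ B ∧ Q ρ (update μ (a.ev ρ μ) (e.ev ρ μ))
  | seq c d, Q, ρ, μ => c.wp B β (d.wp B β Q) ρ μ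
  | loop x b c, Q, ρ, μ => ∃ I : ℕ → (ℕ → ℕ) → (ℕ → ℕ) → Prop, I 0 ρ μ ∧
      (∀ j < ρ (b + 1), ∀ ρ' μ', I j ρ' μ' → c.wp B β (I (j + 1)) (update ρ' (x + 10) j) μ') ∧
      ∀ ρ' μ', I (ρ (b + 1)) ρ' μ' → Q ρ' μ'

variable {B W : ℕ} {β : ℕ → ℕ}

theorem exec (c : Stm) (D : ℕ) (s : State) {Q : (ℕ → ℕ) → (ℕ → ℕ) → Prop}
    (h : Bounded B β s.env s.mem) (hQ : c.wp B β Q s.env s.mem) (hW : B ^ c.size ≤ W) :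
    Runs W (c.compile D) s (c.cost β) fun s' => Q s'.env s'.mem ∧ Bounded B β s'.env s'.mem ∧
      ∀ d < D, s'.reg (2 * d + 1) = s.reg (2 * d + 1) := by
  have h2 := h.two_le
  induction c generalizing D s Q with
  | set x e =>
    refine (e.exec D s h hW).seq fun s₁ ⟨h₁, v₁⟩ => .assign ?_ ?_
    · simp only [Expr.eval, v₁]
      exact (e.ev_le h).trans hW
    · have h₃ := h₁.assign_var x (e.ev s.env s.mem)
      simp only [Expr.eval, v₁]
      refine ⟨?_, ?_, h₃.temp⟩
      · rw [h₃.env, h₃.mem]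
        exact hQ.2
      · rw [h₃.env, h₃.mem]
        exact h.update hQ.1
  | put a e =>
    refine (a.exec D s h (Tm.pow_le h2 hW (by simp only [size]; omega))).seq fun s₁ ⟨h₁, v₁⟩ => ?_
    refine (e.exec (D + 1) s₁ (by rwa [h₁.env, h₁.mem])
      (Tm.pow_le h2 hW (by simp only [size]; omega))).seq fun s₂ ⟨h₂, v₂⟩ => ?_
    rw [← h₂.temp D (by omega)] at v₁
    rw [h₁.mem, h₁.env] at v₂
    rw [h₁.env] at h₂
    have h₃ := h₁.trans h₂ (by omega)
    refine ⟨1, _, .store s₂ _ _, le_rfl, ?_⟩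
    simp only [v₁, v₂]
    have e1 : State.env { s₂ with mem := update s₂.mem (a.ev s.env s.mem) (e.ev s.env s.mem) } =
      s.env := h₃.env
    rw [e1, h₃.mem]
    refine ⟨hQ.2, ⟨h2, h.le, h.eq, h.reg, fun y => ?_⟩, h₃.temp⟩
    by_cases hy : y = a.ev s.env s.mem
    · subst hy
      rw [update_self]
      exact hQ.1
    · rw [update_of_ne hy]
      exact h.mem y
  | seq c d ihc ihd =>
    refine (ihc D s h hQ (Tm.pow_le h2 hW (by simp only [size]; omega))).seq
      fun s₁ ⟨q₁, b₁, t₁⟩ => ?_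
    exact (ihd D s₁ b₁ q₁ (Tm.pow_le h2 hW (by simp only [size]; omega))).mono le_rfl
      fun s₂ ⟨q₂, b₂, t₂⟩ => ⟨q₂, b₂, fun d hd => (t₂ d hd).trans (t₁ d hd)⟩
  | loop x b c ih =>
    obtain ⟨I, h0, hI, hQ⟩ := hQ
    set k := s.env (b + 1) with hk
    have hWc : B ^ c.size ≤ W := Tm.pow_le h2 hW (by simp only [size]; omega)
    have hBW : B ≤ W := (Nat.le_self_pow (by simp only [size]; omega) B).trans hW
    have hkB : k ≤ B := (h.reg _).trans (h.le _)
    refine Runs.mono (T := 1 + (1 + (1 + (k * (1 + (c.cost β + 1) + 1) + 1)))) ?_ ?_ fun _ => id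
    swap
    · have : k * (1 + (c.cost β + 1) + 1) ≤ β (b + 1) * (c.cost β + 3) :=
        (Nat.mul_le_mul_right _ (h.reg _)).trans_eq (by ring)
      simp only [cost]
      omega
    have hI0 := Inv.refl D s
    refine .seq (.assign (Q := fun s' => Inv D s s.env s' ∧ s'.reg (2 * (D + 1) + 1) = k)
      (hkB.trans hBW) ⟨hI0.assign (by omega) _, update_self ..⟩) fun s₁ ⟨h₁, a₁⟩ => ?_
    refine .seq (.assign (Q := fun s' => Inv D s s.env s' ∧ s'.reg (2 * (D + 1) + 1) = k ∧
      s'.reg (2 * (D + 2) + 1) = 1) (by simp only [Expr.eval]; omega) ⟨h₁.assign (by omega) _,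
      (Tm.update_ne_temp (by omega) _ _).trans a₁, update_self ..⟩)
      fun s₂ ⟨h₂, a₂, b₂⟩ => ?_
    let J : ℕ → State → Prop := fun r s' => ∃ j, r = k - j ∧ j ≤ k ∧ I j s'.env s'.mem ∧
      Bounded B β s'.env s'.mem ∧ (∀ d < D, s'.reg (2 * d + 1) = s.reg (2 * d + 1)) ∧
      s'.reg (2 * D + 1) = j ∧ s'.reg (2 * (D + 1) + 1) = k ∧ s'.reg (2 * (D + 2) + 1) = 1
    refine .seq (.assign (Q := J k) (Nat.zero_le _) ?_) fun s₃ h₃ => ?_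
    · have h₃ := h₂.assign le_rfl 0
      refine ⟨0, rfl, Nat.zero_le _, ?_, ?_, h₃.temp, update_self ..,
        (Tm.update_ne_temp (by omega) _ _).trans a₂, (Tm.update_ne_temp (by omega) _ _).trans b₂⟩
      · simp only [Expr.eval]
        rwa [h₃.env, h₃.mem]
      · simp only [Expr.eval]
        rwa [h₃.env, h₃.mem]
    refine .loop J ?_ ?_ k h₃
    · grind
    · rintro r s' ⟨j, rfl, hj, i1, b1, t1, v1, v2, v3⟩ hlt
      rw [v1, v2] at hlt
      refine ⟨k - (j + 1), by omega, ?_⟩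
      have b2 : Bounded B β (update s'.env (x + 10) j) s'.mem := b1.update (by rw [h.eq]; omega)
      refine .seq (.assign (Q := Inv (D + 3) s' (update s'.env (x + 10) j))
        (by simp only [Expr.eval, v1]; omega) ?_) fun s₄ h₄ => ?_
      · simp only [Expr.eval, v1]
        exact (Inv.refl (D + 3) s').assign_var _ _
      have c2 := hI j hlt _ _ i1
      rw [← h₄.env, ← h₄.mem] at b2 c2
      refine .seq (ih (D + 3) s₄ b2 c2 hWc) fun s₅ ⟨q₅, b₅, t₅⟩ => ?_
      have w1 := (t₅ D (by omega)).trans ((h₄.temp D (by omega)).trans v1)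
      have w2 := (t₅ (D + 1) (by omega)).trans ((h₄.temp (D + 1) (by omega)).trans v2)
      have w3 := (t₅ (D + 2) (by omega)).trans ((h₄.temp (D + 2) (by omega)).trans v3)
      have h₅ := (Inv.refl D s₅).assign (d := D) le_rfl (j + 1)
      refine .assign (by simp only [Expr.eval, w1, w3]; omega) ?_
      simp only [Expr.eval, w1, w3]
      refine ⟨j + 1, rfl, hlt, ?_, ?_, fun d hd => (h₅.temp d hd).trans ((t₅ d (by omega)).trans
        ((h₄.temp d (by omega)).trans (t1 d hd))), update_self ..,
        (Tm.update_ne_temp (by omega) _ _).trans w2, (Tm.update_ne_temp (by omega) _ _).trans w3⟩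
      · rwa [h₅.env, h₅.mem]
      · rwa [h₅.env, h₅.mem]

end Stm

/-! ## Monomial bounds on the running time -/

/-- A bound `w * k ^ a * n ^ b` on a cost. -/
structure Mono where
  w : ℕ
  a : ℕ
  b : ℕ

namespace Mono

def val (m : Mono) (k n : ℕ) : ℕ := m.w * (k ^ m.a * n ^ m.b)

def add (m m' : Mono) : Mono := ⟨m.w + m'.w, max m.a m'.a, max m.b m'.b⟩

def mul (m m' : Mono) : Mono := ⟨m.w * m'.w, m.a + m'.a, m.b + m'.b⟩

def num (w : ℕ) : Mono := ⟨w, 0, 0⟩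

/-- The bounds on the variables `1, …, 4`. -/
def param : ℕ → Mono
  | 1 => ⟨1, 0, 1⟩
  | 2 => ⟨1, 0, 1⟩
  | 3 => ⟨1, 1, 0⟩
  | _ => ⟨160, 4, 2⟩

variable {k n : ℕ}

theorem le_add (hk : 1 ≤ k) (hn : 1 ≤ n) {x y : ℕ} {m m' : Mono} (h : x ≤ m.val k n)
    (h' : y ≤ m'.val k n) : x + y ≤ (m.add m').val k n := by
  have key : ∀ {a a' b b'}, a ≤ a' → b ≤ b' → k ^ a * n ^ b ≤ k ^ a' * n ^ b' := fun h1 h2 =>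
    Nat.mul_le_mul (Nat.pow_le_pow_right hk h1) (Nat.pow_le_pow_right hn h2)
  simp only [val, add] at *
  rw [Nat.add_mul]
  exact Nat.add_le_add (h.trans (Nat.mul_le_mul_left _ (key (le_max_left ..) (le_max_left ..))))
    (h'.trans (Nat.mul_le_mul_left _ (key (le_max_right ..) (le_max_right ..))))

theorem le_mul {x y : ℕ} {m m' : Mono} (h : x ≤ m.val k n) (h' : y ≤ m'.val k n) :
    x * y ≤ (m.mul m').val k n := by
  refine (Nat.mul_le_mul h h').trans_eq ?_
  simp only [val, mul, pow_add]
  ring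

theorem le_num (w : ℕ) : w ≤ (num w).val k n := by simp [num, val]

end Mono

open Mono

def Tm.bound : Tm → Mono
  | var _ => num 1
  | const _ => num 1
  | op _ a b => a.bound.add (b.bound.add (num 1))
  | load a => a.bound.add (num 1)
  | lt a b => a.bound.add (b.bound.add (num 2))
  | ite c a b => (num 1).add (c.bound.add ((a.bound.add b.bound).add (num 1)))
  | letv _ a e => a.bound.add (e.bound.add (num 5))
  | first _ b e => ((param (b + 1)).mul (e.bound.add (num 3))).add (num 8)

def Stm.bound : Stm → Mono
  | set _ e => e.bound.add (num 1)
  | put a e => a.bound.add (e.bound.add (num 1))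
  | seq c d => c.bound.add d.bound
  | loop _ b c => ((param (b + 1)).mul (c.bound.add (num 3))).add (num 4)

variable {k n : ℕ} {β : ℕ → ℕ}

theorem Tm.cost_le (hk : 1 ≤ k) (hn : 1 ≤ n) (hβ : ∀ b : Fin 4, β (b + 1) ≤ (param (b + 1)).val k n)
    (e : Tm) : e.cost β ≤ e.bound.val k n := by
  induction e with
  | var | const => exact le_num 1
  | op o a b iha ihb => exact le_add hk hn iha (le_add hk hn ihb (le_num 1))
  | load a iha => exact le_add hk hn iha (le_num 1)
  | lt a b iha ihb => exact le_add hk hn iha (le_add hk hn ihb (le_num 2))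
  | ite c a b ihc iha ihb =>
    exact le_add hk hn (le_num 1) (le_add hk hn ihc (le_add hk hn (le_add hk hn iha ihb) (le_num 1)))
  | letv x a e iha ihe => exact le_add hk hn iha (le_add hk hn ihe (le_num 5))
  | first x b e ih => exact le_add hk hn (le_mul (hβ b) (le_add hk hn ih (le_num 3))) (le_num 8)

theorem Stm.cost_le (hk : 1 ≤ k) (hn : 1 ≤ n)
    (hβ : ∀ b : Fin 4, β (b + 1) ≤ (param (b + 1)).val k n) (c : Stm) :
    c.cost β ≤ c.bound.val k n := by
  have ht := fun e : Tm => e.cost_le hk hn hβ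
  induction c with
  | set x e => exact le_add hk hn (ht e) (le_num 1)
  | put a e => exact le_add hk hn (ht a) (le_add hk hn (ht e) (le_num 1))
  | seq c d ihc ihd => exact le_add hk hn ihc ihd
  | loop x b c ih => exact le_add hk hn (le_mul (hβ b) (le_add hk hn ih (le_num 3))) (le_num 4)

end WordRAM

end

section

/-! ## Terms for the conditions on the members of the family -/

namespace WordRAM

open Function (update update_self update_of_ne update_idem update_apply)
open Guess (Share MeetOut Dropped NearByMode Near OnBranch Kept Evidence Candidate Sibling Used)

/-- The list `L` stands in the memory from the address `a` on. -/
def IsCode (a : ℕ) (L : List ℕ) (μ : ℕ → ℕ) : Prop := ∀ (j : ℕ) (h : j < L.length), μ (a + j) = L[j]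

namespace Tm

abbrev V : ℕ → Tm := var

def and (a b : Tm) : Tm := op .mul a b
def or (a b : Tm) : Tm := op .add a b
def plus (a b : Tm) : Tm := op .add a b
def not (a : Tm) : Tm := lt a (const 1)
def imp (a b : Tm) : Tm := a.not.or b
def eq (a b : Tm) : Tm := ((lt a b).plus (lt b a)).not
def ne (a b : Tm) : Tm := (a.eq b).not

/-- Existence of a number below `n`. -/
def exN (x : ℕ) (e : Tm) : Tm := lt (first x 0 e) (V 1)
/-- Existence of a maximal clique. -/
def exQ (x : ℕ) (e : Tm) : Tm := lt (first x 1 e) (V 2)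
def allQ (x : ℕ) (e : Tm) : Tm := (exQ x e.not).not
/-- The index of the first element of the list of the vertices of `Kᵢ` such that `e` holds. -/
def indexK (x : ℕ) (e : Tm) : Tm := first x 2 (letv x ((V 7).plus (V (x + 10))) e)
def exK (x : ℕ) (e : Tm) : Tm := lt (indexK x e) (V 3)
def allK (x : ℕ) (e : Tm) : Tm := (exK x e.not).not
def firstK (x : ℕ) (e : Tm) : Tm := load ((V 7).plus (indexK x e))

section

variable {ρ μ : ℕ → ℕ} {a b e : Tm}

theorem lt_iff : 0 < (lt a b).ev ρ μ ↔ a.ev ρ μ < b.ev ρ μ := by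
  simp only [ev]
  grind

theorem and_iff : 0 < (a.and b).ev ρ μ ↔ 0 < a.ev ρ μ ∧ 0 < b.ev ρ μ :=
  ⟨fun h => ⟨Nat.pos_of_mul_pos_right h, Nat.pos_of_mul_pos_left h⟩, fun h => Nat.mul_pos h.1 h.2⟩

theorem or_iff : 0 < (a.or b).ev ρ μ ↔ 0 < a.ev ρ μ ∨ 0 < b.ev ρ μ := Nat.add_pos_iff_pos_or_pos

theorem not_iff : 0 < a.not.ev ρ μ ↔ ¬ 0 < a.ev ρ μ := by
  rw [not, lt_iff]
  exact Nat.not_lt.symm.trans (by rfl) |>.trans (by simp [ev])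

theorem imp_iff : 0 < (a.imp b).ev ρ μ ↔ (0 < a.ev ρ μ → 0 < b.ev ρ μ) := by
  rw [imp, or_iff, not_iff, imp_iff_not_or]

theorem eq_iff : 0 < (a.eq b).ev ρ μ ↔ a.ev ρ μ = b.ev ρ μ := by
  rw [eq, not_iff, plus, ← or, or_iff, lt_iff, lt_iff]
  omega

theorem ne_iff : 0 < (a.ne b).ev ρ μ ↔ a.ev ρ μ ≠ b.ev ρ μ := by rw [ne, not_iff, eq_iff]

theorem ev_ite {P : Prop} [Decidable P] (h : 0 < e.ev ρ μ ↔ P) :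
    (ite e a b).ev ρ μ = if P then a.ev ρ μ else b.ev ρ μ := by
  simp only [ev, h]

theorem exN_iff {n x : ℕ} (h : ρ 1 = n) :
    0 < (exN x e).ev ρ μ ↔ ∃ v : Fin n, 0 < e.ev (update ρ (x + 10) v) μ := by
  subst h
  rw [exN, lt_iff]
  exact firstBelow_lt_iff.trans ⟨fun ⟨y, h1, h2⟩ => ⟨⟨y, h1⟩, h2⟩, fun ⟨y, h⟩ => ⟨y, y.2, h⟩⟩

theorem exQ_iff {q x : ℕ} (h : ρ 2 = q) :
    0 < (exQ x e).ev ρ μ ↔ ∃ v : Fin q, 0 < e.ev (update ρ (x + 10) v) μ := by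
  subst h
  rw [exQ, lt_iff]
  exact firstBelow_lt_iff.trans ⟨fun ⟨y, h1, h2⟩ => ⟨⟨y, h1⟩, h2⟩, fun ⟨y, h⟩ => ⟨y, y.2, h⟩⟩

theorem allQ_iff {q x : ℕ} (h : ρ 2 = q) :
    0 < (allQ x e).ev ρ μ ↔ ∀ v : Fin q, 0 < e.ev (update ρ (x + 10) v) μ := by
  rw [allQ, not_iff, exQ_iff h]
  simp only [not_iff, not_exists, not_not]

/-- The `k` memory cells from `b` on contain the elements of `A`, in increasing order. -/
structure IsListOf {n : ℕ} (A : Set (Fin n)) (k b : ℕ) (μ : ℕ → ℕ) : Prop where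
  mem : ∀ y < k, ∃ v ∈ A, μ (b + y) = v
  exists_eq : ∀ v ∈ A, ∃ y < k, μ (b + y) = v
  mono : ∀ y z, y < z → z < k → μ (b + y) < μ (b + z)

variable {n k c x : ℕ} {A : Set (Fin n)}

theorem ev_indexK (h3 : ρ 3 = k) (h7 : ρ 7 = c) (hx : x + 10 ≠ 7) : (indexK x e).ev ρ μ =
    firstBelow k fun y => 0 < e.ev (update ρ (x + 10) (μ (c + y))) μ := by
  subst h3 h7
  change firstBelow (ρ 3) _ = _
  congr
  funext y
  simp only [ev, plus, Op.ev, update_idem, update_self,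
    update_of_ne hx.symm]

theorem exK_iff (h : IsListOf A k c μ) (h3 : ρ 3 = k) (h7 : ρ 7 = c) :
    0 < (exK x e).ev ρ μ ↔ ∃ v ∈ A, 0 < e.ev (update ρ (x + 10) v) μ := by
  rw [exK, lt_iff, ev_indexK h3 h7 (by omega), ev, h3, firstBelow_lt_iff]
  constructor
  · rintro ⟨y, hy, h1⟩
    obtain ⟨v, hv, e1⟩ := h.mem y hy
    grind
  · rintro ⟨v, hv, h1⟩
    obtain ⟨y, hy, e1⟩ := h.exists_eq v hv
    grind

theorem allK_iff (h : IsListOf A k c μ) (h3 : ρ 3 = k) (h7 : ρ 7 = c) :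
    0 < (allK x e).ev ρ μ ↔ ∀ v ∈ A, 0 < e.ev (update ρ (x + 10) v) μ := by
  rw [allK, not_iff, exK_iff h h3 h7]
  simp only [not_iff, not_exists, not_and, not_not]

theorem ev_firstK (h : IsListOf A k c μ) (h3 : ρ 3 = k) (h7 : ρ 7 = c)
    (he : ∃ v ∈ A, 0 < e.ev (update ρ (x + 10) v) μ) : (firstK x e).ev ρ μ =
      sInf (Fin.val '' {v | v ∈ A ∧ 0 < e.ev (update ρ (x + 10) v) μ}) := by
  rw [← exK_iff h h3 h7, exK, lt_iff, ev_indexK h3 h7 (by omega), ev, h3] at he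
  change μ (ρ 7 + (indexK x e).ev ρ μ) = _
  rw [ev_indexK h3 h7 (by omega), h7]
  have h1 := firstBelow_spec he
  obtain ⟨v, hv, e1⟩ := h.mem _ he
  rw [e1] at h1 ⊢
  refine le_antisymm (le_csInf ⟨_, v, ⟨hv, h1⟩, rfl⟩ ?_) (Nat.sInf_le ⟨v, ⟨hv, h1⟩, rfl⟩)
  rintro _ ⟨u, ⟨hu, h2⟩, rfl⟩
  obtain ⟨y, hy, e2⟩ := h.exists_eq u hu
  rw [← e1, ← e2]
  rw [← e2] at h2
  rcases (firstBelow_min (b := k) (p := fun y => 0 < e.ev (update ρ (x + 10) (μ (c + y))) μ)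
    h2).lt_or_eq with h4 | h4
  · exact (h.mono _ _ h4 hy).le
  · rw [h4]

end

/-! The variables: `1, 2, 3, 5` are `n`, the number of maximal cliques, the size of `Kᵢ`, and `i`;
`6, 7, 8, 9, 32, 33` are the addresses of the incidence matrix, the list of the vertices of `Kᵢ`, and
the tables for `MeetOut`, `Near`, `Kept` and `parent`; `20, …, 27` are the parts of the guess. -/

def inc (l v : ℕ) : Tm := load ((V 6).plus ((op .mul (V l) (V 1)).plus (V v)))

def meets (l m : ℕ) : Tm := load ((V 8).plus ((op .mul (V l) (V 2)).plus (V m)))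

def table (b v : ℕ) : Tm := load ((V b).plus (V v))

def share (u v : ℕ) : Tm := exQ 9 (((V 19).ne (V 5)).and ((inc 19 u).and (inc 19 v)))

def rel (u v : ℕ) : Tm := ((V u).eq (V v)).or ((V 27).or (share u v))

def meetOut : Tm := exN 9 ((inc 10 19).and ((inc 11 19).and (inc 5 19).not))

def dropped : Tm :=
  exQ 8 (((V 18).ne (V 5)).and ((inc 18 10).and ((exK 7 ((inc 18 17).and ((V 17).ne (V 10)))).and
    (allQ 6 (((V 16).ne (V 5)).imp
      ((exK 7 ((inc 16 17).and ((inc 18 17).and ((V 17).ne (V 20))))).imp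
        (allK 7 ((inc 16 17).imp (((V 17).ne (V 20)).imp (inc 18 17))))))))))

def isMode (m : ℕ) : Tm := (V 26).eq (const m)

def nearByMode : Tm :=
  ((isMode 0).and ((inc 24 10).and (inc 25 10))).or
  (((isMode 1).and ((inc 24 10).and (inc 25 10).not)).or
  (((isMode 2).and ((inc 24 10).and (((V 10).ne (V 23)).and (exQ 8 ((inc 18 10).and
    ((allK 7 ((inc 24 17).imp ((inc 18 17).imp (((V 17).eq (V 10)).or ((V 17).eq (V 21)))))).and
    ((exN 9 ((inc 18 19).and ((inc 24 19).and (inc 5 19).not))).or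
      (exK 7 ((inc 24 17).and ((inc 18 17).and ((V 17).ne (V 10))))))))).not))).or
  (((isMode 3).and ((inc 24 10).and (((V 10).eq (V 23)).or (exQ 8 ((inc 18 10).and
    ((allK 7 ((inc 24 17).imp ((inc 18 17).imp (((V 17).eq (V 10)).or ((V 17).eq (V 20)))))).and
    (exK 7 ((inc 18 17).and ((V 17).ne (V 10)))))))))).or
  ((isMode 4).and (dropped.not.and (exQ 8 (((V 18).ne (V 5)).and ((inc 18 10).and
    ((exK 7 ((inc 18 17).and ((V 17).ne (V 10)))).and
    (exQ 6 (((V 16).ne (V 5)).and ((inc 16 10).and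
      (exK 7 ((inc 16 17).and (inc 18 17).not))))))))))))))

def near : Tm := ((V 10).eq (V 21)).or nearByMode

def onBranch : Tm := (lt (V 22) (V 1)).and (rel 10 22)

def kept : Tm := ((V 26).ne (const 4)).or (((V 10).eq (V 21)).or (dropped.not.or onBranch))

def evidence : Tm :=
  (((V 26).ne (const 0)).and (share 10 15)).or
  ((isMode 0).and (exQ 8 (((V 18).ne (V 5)).and ((inc 18 10).and ((inc 18 15).and
    ((exK 7 ((((V 17).eq (V 20)).or (table 9 17)).and (inc 18 17).not)).or
    (exQ 6 (((V 16).ne (V 5)).and (((V 16).ne (V 18)).and ((inc 16 15).and ((meets 16 18).or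
      (exK 7 (((V 17).ne (V 20)).and ((table 9 17).not.and
        ((inc 16 17).and (inc 18 17))))))))))))))))

def candidate : Tm := ((V 15).ne (V 20)).and ((table 9 15).and ((table 32 15).and evidence))

def sibling : Tm := ((V 15).ne (V 20)).and ((table 9 15).not.and (rel 10 15))

def newParent : Tm := ((V 1).plus (const 1)).plus (firstK 5 sibling)

def parent : Tm :=
  ite (((V 10).eq (V 20)).or (table 9 10)) (V 20)
    (ite (((V 26).ne (const 4)).and onBranch) (ite (lt (V 21) (V 1)) (V 21) newParent)
      (ite (exK 5 candidate) (firstK 5 candidate) newParent))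

def second : Tm :=
  ite (V 27) (ite (lt (V 21) (V 1)) (V 21) (ite (lt (V 22) (V 1)) (table 33 22) (V 20))) (V 20)

def used : Tm :=
  exK 5 (((V 15).ne (V 20)).and ((table 32 15).and
    ((table 33 15).eq (((V 1).plus (const 1)).plus (V 10)))))

/-- The variables and the memory describe the part of the input that matters. -/
structure Base {n q : ℕ} (Cl : Fin q → Set (Fin n)) (i : Fin q) (ρ μ : ℕ → ℕ) : Prop where
  n_eq : ρ 1 = n
  q_eq : ρ 2 = q
  i_eq : ρ 5 = i
  inc : ∀ (l : Fin q) (v : Fin n), 0 < μ (ρ 6 + (l * n + v)) ↔ v ∈ Cl l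
  list : IsListOf (Cl i) (ρ 3) (ρ 7) μ
  meet : ∀ l m : Fin q, 0 < μ (ρ 8 + (l * q + m)) ↔ MeetOut Cl i l m
  k_eq : ρ 3 = (Guess.listOf (Cl i)).length
  code : IsCode (ρ 7) ((Guess.listOf (Cl i)).map Fin.val ++ [n]) μ

/-- The variables and the memory describe the part of the input that matters, and a guess. -/
structure Static {n q : ℕ} (Cl : Fin q → Set (Fin n)) (i : Fin q) (τ : Guess q) (ρ μ : ℕ → ℕ) : Prop
    extends Base Cl i ρ μ where
  c : ρ 20 = τ.c
  a₀ : ρ 21 = τ.a₀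
  x₀ : ρ 22 = τ.x₀
  e : ρ 23 = τ.e
  j : ρ 24 = τ.j
  l : ρ 25 = τ.l
  mode : ρ 26 = τ.mode
  g : 0 < ρ 27 ↔ τ.g

/-- The table for a property of the vertices of `A`. -/
def IsTable {n : ℕ} (A : Set (Fin n)) (b : ℕ) (P : Fin n → Prop) (μ : ℕ → ℕ) : Prop :=
  ∀ v ∈ A, 0 < μ (b + v) ↔ P v

attribute [local simp] and_iff or_iff eq_iff ne_iff not_iff imp_iff inc plus ev Op.ev table isMode
  update_apply Fin.val_inj

section

variable {n q : ℕ} {Cl : Fin q → Set (Fin n)} {i : Fin q} {τ : Guess q} {ρ μ : ℕ → ℕ}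

theorem meetOut_iff (hn : ρ 1 = n) (hi : ρ 5 = i)
    (hinc : ∀ (l : Fin q) (v : Fin n), 0 < μ (ρ 6 + (l * n + v)) ↔ v ∈ Cl l) {l m : Fin q}
    (hl : ρ 10 = l) (hm : ρ 11 = m) : 0 < meetOut.ev ρ μ ↔ MeetOut Cl i l m := by
  simp [meetOut, exN_iff (n := n), hl, hm, hinc, hi, hn, MeetOut]

theorem share_iff (S : Static Cl i τ ρ μ) {x y : ℕ} {u v : Fin n} (hx : x ≠ 19) (hy : y ≠ 19)
    (hu : ρ x = u) (hv : ρ y = v) : 0 < (share x y).ev ρ μ ↔ Share Cl i u v := by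
  simp [share, exQ_iff (q := q), hu, hv, S.inc, S.n_eq, S.q_eq, S.i_eq, Share, hx, hy]

theorem rel_iff (S : Static Cl i τ ρ μ) {x y : ℕ} {u v : Fin n} (hx : x ≠ 19) (hy : y ≠ 19)
    (hu : ρ x = u) (hv : ρ y = v) : 0 < (rel x y).ev ρ μ ↔ Guess.Rel Cl i τ u v := by
  simp [rel, share_iff S hx hy hu hv, hu, hv, S.g, Guess.Rel]

theorem dropped_iff (S : Static Cl i τ ρ μ) {v : Fin n} (hv : ρ 10 = v) :
    0 < dropped.ev ρ μ ↔ Dropped Cl i τ v := by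
  simp [dropped, exQ_iff (q := q), allQ_iff (q := q), exK_iff S.list, allK_iff S.list,
    hv, S.inc, S.n_eq, S.q_eq, S.i_eq, S.c, Dropped]

theorem near_iff (S : Static Cl i τ ρ μ) {v : Fin n} (hv : ρ 10 = v) :
    0 < near.ev ρ μ ↔ Near Cl i τ v := by
  simp [near, nearByMode, dropped_iff S hv, exN_iff (n := n), exQ_iff (q := q),
    exK_iff S.list, allK_iff S.list, hv, S.inc, S.n_eq, S.q_eq, S.i_eq, S.c, S.j, S.l, S.a₀, S.e, S.mode, Near, NearByMode, MeetOut]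

theorem onBranch_iff (S : Static Cl i τ ρ μ) {v : Fin n} (hv : ρ 10 = v) :
    0 < onBranch.ev ρ μ ↔ OnBranch Cl i τ v := by
  rw [onBranch, and_iff, lt_iff, ev, ev, S.x₀, S.n_eq]
  constructor
  · rintro ⟨h1, h2⟩
    exact ⟨⟨_, h1⟩, rfl, (rel_iff S (u := v) (v := ⟨_, h1⟩) (by omega) (by omega) hv S.x₀).1 h2⟩
  · rintro ⟨x, h1, h2⟩
    exact ⟨h1 ▸ x.2, (rel_iff S (by omega) (by omega) hv (S.x₀.trans h1.symm)).2 h2⟩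

theorem kept_iff (S : Static Cl i τ ρ μ) {v : Fin n} (hv : ρ 10 = v) :
    0 < kept.ev ρ μ ↔ Kept Cl i τ v := by
  simp [kept, dropped_iff S hv, onBranch_iff S hv, S.mode, S.a₀, hv, Kept]

/-- The variables that are not changed after the guess is fixed. -/
def IsFixed (x : ℕ) : Prop := x < 10 ∨ 20 ≤ x ∧ x ≤ 27 ∨ x = 32 ∨ x = 33

theorem Base.congr_var (S : Base Cl i ρ μ) {ρ' : ℕ → ℕ} (h : ∀ x < 10, x ≠ 4 → ρ' x = ρ x) :
    Base Cl i ρ' μ := by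
  constructor <;> simp [h]
  exacts [S.n_eq, S.q_eq, S.i_eq, S.inc, S.list, S.meet, S.k_eq, S.code]

theorem Static.congr_var (S : Static Cl i τ ρ μ) {ρ' : ℕ → ℕ} (h : ∀ x, IsFixed x → ρ' x = ρ x) :
    Static Cl i τ ρ' μ := by
  have h' : ∀ x, 20 ≤ x → x ≤ 27 → ρ' x = ρ x := fun x h1 h2 => h x (Or.inr (Or.inl ⟨h1, h2⟩))
  refine ⟨S.toBase.congr_var fun x hx _ => h x (Or.inl hx), ?_, ?_, ?_, ?_, ?_, ?_, ?_, ?_⟩ <;>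
    rw [h' _ (by norm_num) (by norm_num)]
  exacts [S.c, S.a₀, S.x₀, S.e, S.j, S.l, S.mode, S.g]

theorem Static.update (S : Static Cl i τ ρ μ) {x y : ℕ} (hx : x < 10) :
    Static Cl i τ (Function.update ρ (x + 10) y) μ :=
  S.congr_var fun z hz => update_of_ne (by unfold IsFixed at hz; omega) _ _

theorem evidence_iff (S : Static Cl i τ ρ μ) (hN : IsTable (Cl i) (ρ 9) (Near Cl i τ) μ)
    {v a : Fin n} (hv : ρ 10 = v) (ha : ρ 15 = a) :
    0 < evidence.ev ρ μ ↔ Evidence Cl i τ v a := by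
  have hN' : ∀ P : Fin n → Prop, (∃ u ∈ Cl i, (↑u = τ.c ∨ 0 < μ (ρ 9 + u)) ∧ P u) ↔
      ∃ u ∈ Cl i, (↑u = τ.c ∨ Near Cl i τ u) ∧ P u := fun P =>
    exists_congr fun u => and_congr_right fun hu => by rw [hN u hu]
  have hN'' : ∀ P : Fin n → Prop, (∃ u ∈ Cl i, ¬ (u : ℕ) = τ.c ∧ μ (ρ 9 + u) = 0 ∧ P u) ↔
      ∃ u ∈ Cl i, ¬ (u : ℕ) = τ.c ∧ ¬ Near Cl i τ u ∧ P u := fun P =>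
    exists_congr fun u => and_congr_right fun hu => by simp [← hN u hu]
  simp [evidence, share_iff S (by grind) (by grind) hv ha, exQ_iff (q := q),
    exK_iff S.list, meets, hv, ha, S.inc, S.n_eq, S.q_eq, S.i_eq, S.c, S.mode, S.meet, Evidence, hN', hN'']

variable (S : Static Cl i τ ρ μ) (hN : IsTable (Cl i) (ρ 9) (Near Cl i τ) μ) {v : Fin n}
include S hN

theorem sibling_iff (hv : ρ 10 = v) {u : Fin n} (hu : u ∈ Cl i) :
    0 < sibling.ev (update ρ 15 u) μ ↔ Sibling Cl i τ v u := by
  have S' : Static Cl i τ (update ρ 15 u) μ := S.update (x := 5) (by omega)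
  simp [sibling,
    rel_iff S' (by omega : 10 ≠ 19) (by omega : 15 ≠ 19) (u := v) hv (update_self ..), S.c, hN u hu, Sibling, hu]

theorem ev_newParent (hv : ρ 10 = v) (hvK : v ∈ Cl i) (h : ¬ ((v : ℕ) = τ.c ∨ Near Cl i τ v)) :
    newParent.ev ρ μ = n + 1 + sInf (Fin.val '' {u | Sibling Cl i τ v u}) := by
  have h1 : {u | u ∈ Cl i ∧ 0 < sibling.ev (update ρ (5 + 10) u) μ} =
      {u | Sibling Cl i τ v u} := by
    ext u
    exact ⟨fun ⟨h1, h2⟩ => (sibling_iff S hN hv h1).1 h2, fun h => ⟨h.1, (sibling_iff S hN hv h.1).2 h⟩⟩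
  rw [newParent, plus, ev, plus, ev, ev, ev, ev_firstK S.list rfl rfl ⟨v, hvK, ?_⟩, h1, S.n_eq]
  · rfl
  · push Not at h
    exact (sibling_iff S hN hv hvK).2 ⟨hvK, h.1, h.2, Guess.rel_self v⟩

variable (hK : IsTable (Cl i) (ρ 32) (Kept Cl i τ) μ)
include hK

theorem candidate_iff (hv : ρ 10 = v) {a : Fin n} (ha : a ∈ Cl i) :
    0 < candidate.ev (update ρ 15 a) μ ↔ Candidate Cl i τ v a := by
  have S' : Static Cl i τ (update ρ 15 a) μ := S.update (x := 5) (by omega)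
  simp [candidate, evidence_iff S' hN (v := v) hv (update_self ..), S.c,
    hN a ha, hK a ha, Candidate, ha]

theorem ev_parent (hv : ρ 10 = v) (hvK : v ∈ Cl i) : parent.ev ρ μ = Guess.parent Cl i τ v := by
  have h1 : 0 < (((V 10).eq (V 20)).or (table 9 10)).ev ρ μ ↔ (v : ℕ) = τ.c ∨ Near Cl i τ v := by
    simp [hv, S.c, hN v hvK]
  have h2 : 0 < (((V 26).ne (const 4)).and onBranch).ev ρ μ ↔ τ.mode ≠ 4 ∧ OnBranch Cl i τ v := by
    rw [and_iff, ne_iff, onBranch_iff S hv, ev, ev, S.mode]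
  have h3 : 0 < (lt (V 21) (V 1)).ev ρ μ ↔ τ.a₀ < n := by rw [lt_iff, ev, ev, S.a₀, S.n_eq]
  have h4 : 0 < (exK 5 candidate).ev ρ μ ↔ ∃ a, Candidate Cl i τ v a := by
    rw [exK_iff S.list rfl rfl]
    exact ⟨fun ⟨a, h1, h2⟩ => ⟨a, (candidate_iff S hN hK hv h1).1 h2⟩,
      fun ⟨a, h⟩ => ⟨a, h.1, (candidate_iff S hN hK hv h.1).2 h⟩⟩
  have h5 : (∃ a, Candidate Cl i τ v a) → (firstK 5 candidate).ev ρ μ =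
      sInf (Fin.val '' {a | Candidate Cl i τ v a}) := by
    rintro ⟨a, ha⟩
    have h5 : {u | u ∈ Cl i ∧ 0 < candidate.ev (update ρ (5 + 10) u) μ} =
        {u | Candidate Cl i τ v u} := by
      ext u
      exact ⟨fun ⟨h1, h2⟩ => (candidate_iff S hN hK hv h1).1 h2,
        fun h => ⟨h.1, (candidate_iff S hN hK hv h.1).2 h⟩⟩
    rw [ev_firstK S.list rfl rfl ⟨a, ha.1, (candidate_iff S hN hK hv ha.1).2 ha⟩, h5]
  classical
  rw [parent, Guess.parent, ev_ite h1, ev_ite h2, ev_ite h3, ev_ite h4, ev, ev, S.c, S.a₀]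
  by_cases c1 : (v : ℕ) = τ.c ∨ Near Cl i τ v
  · grind
  · rw [if_neg c1, if_neg c1, ev_newParent S hN hv hvK c1]
    grind

omit hN
variable (hP : ∀ v ∈ Cl i, μ (ρ 33 + v) = Guess.parent Cl i τ v)
include hP

theorem used_iff (hv : ρ 10 = v) : 0 < used.ev ρ μ ↔ Used Cl i τ v := by
  rw [used, exK_iff S.list rfl rfl]
  refine exists_congr fun u => and_congr_right fun hu => ?_
  simp [S.c, hK u hu, hP u hu, S.n_eq, hv]

omit hK

theorem ev_second (h : Guess.Admissible Cl i τ) : second.ev ρ μ = Guess.second Cl i τ := by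
  have h3 : 0 < (lt (V 21) (V 1)).ev ρ μ ↔ τ.a₀ < n := by rw [lt_iff, ev, ev, S.a₀, S.n_eq]
  have h2 : 0 < (V 27).ev ρ μ ↔ τ.g := S.g
  have h4 : 0 < (lt (V 22) (V 1)).ev ρ μ ↔ τ.x₀ < n := by rw [lt_iff, ev, ev, S.x₀, S.n_eq]
  classical
  rw [second, Guess.second, ev_ite h2, ev_ite h3, ev_ite h4, ev, ev, S.c, S.a₀]
  by_cases c : τ.x₀ < n
  · have h5 : (table 33 22).ev ρ μ = Guess.parent Cl i τ ⟨τ.x₀, c⟩ := by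
      rcases h.x₀ with e | ⟨v, hv, e⟩
      · omega
      · simp [← e, Fin.eta, S.x₀, hP v hv]
    grind
  grind

end

end Tm

end WordRAM

end

section

/-! ## Writing lists to the memory -/

namespace WordRAM

open Function (update update_self update_of_ne update_idem update_apply)
open Tm (V)

theorem isCode_append {a : ℕ} {L M : List ℕ} {μ : ℕ → ℕ} :
    IsCode a (L ++ M) μ ↔ IsCode a L μ ∧ IsCode (a + L.length) M μ := by
  constructor
  · refine fun h => ⟨fun j hj => ?_, fun j hj => ?_⟩
    · rw [h j (by grind), List.getElem_append_left]
    · rw [add_assoc, h (L.length + j) (by grind),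
        List.getElem_append_right (by omega)]
      grind
  · rintro ⟨h1, h2⟩ j hj
    rw [List.length_append] at hj
    by_cases h : j < L.length
    · rw [h1 j h, List.getElem_append_left]
    · rw [List.getElem_append_right (by omega), ← h2 (j - L.length) (by omega)]
      grind

theorem isCode_singleton {a x : ℕ} {μ : ℕ → ℕ} : IsCode a [x] μ ↔ μ a = x :=
  ⟨fun h => h 0 (by simp), fun h j hj => by grind⟩

theorem IsCode.congr {a : ℕ} {L : List ℕ} {μ μ' : ℕ → ℕ} (h : IsCode a L μ)
    (h' : ∀ j < L.length, μ' (a + j) = μ (a + j)) : IsCode a L μ' := fun j hj =>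
  (h' j hj).trans (h j hj)

theorem length_matrixCode {a b : ℕ} (r : Fin a → Fin b → Prop) :
    (matrixCode r).length = a * b := by
  simp [matrixCode, List.length_flatMap]

theorem isCode_flatMap {m b a : ℕ} {f : Fin m → List ℕ} (hf : ∀ x, (f x).length = b) {μ : ℕ → ℕ}
    (h : IsCode a ((List.finRange m).flatMap f) μ) (x : Fin m) : IsCode (a + x * b) (f x) μ := by
  induction m generalizing a with
  | zero => grind
  | succ m ih =>
    rw [List.finRange_succ, List.flatMap_cons, isCode_append, List.flatMap_map, hf] at h
    refine Fin.cases ?_ (fun y => ?_) x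
    · grind
    · have := ih (fun y => hf y.succ) h.2 y
      grind

open Classical in
theorem IsCode.matrix {a b c : ℕ} {r : Fin a → Fin b → Prop} {μ : ℕ → ℕ}
    (h : IsCode c (matrixCode r) μ) (x : Fin a) (y : Fin b) : 0 < μ (c + (x * b + y)) ↔ r x y := by
  have h1 := isCode_flatMap (b := b) (fun x => by simp) h x y (by simp)
  rw [← add_assoc, h1]
  simp only [List.getElem_map, List.getElem_finRange, Fin.cast_mk, Fin.eta]
  grind

namespace Stm

/-- Append the value of `e` to the output, if `c` holds. -/
def emitIf (c e : Tm) : Stm :=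
  .seq (.set 35 (.lt (.const 0) c)) (.seq (.put (V 28) ((V 35).and e))
    (.set 28 ((V 28).plus (V 35))))

def emit (e : Tm) : Stm := emitIf (.const 1) e

/-- The output, from the address given by the variable `0` on, is `L`, and there is room for `r`
further numbers. -/
def Emitted (B r : ℕ) (L : List ℕ) (ρ μ : ℕ → ℕ) : Prop :=
  ρ 28 = ρ 0 + L.length ∧ ρ 28 + r ≤ B ∧ IsCode (ρ 0) L μ

/-- The output and the change of the variables in `A` do not affect `R`. -/
def Stable (A : Set ℕ) (R : (ℕ → ℕ) → (ℕ → ℕ) → Prop) : Prop :=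
  ∀ ρ μ ρ' μ', R ρ μ → (∀ z, z ∉ A → z ≠ 28 → z ≠ 35 → ρ' z = ρ z) → (∀ a < ρ 0, μ' a = μ a) →
    R ρ' μ'

theorem Stable.and {A : Set ℕ} {R : (ℕ → ℕ) → (ℕ → ℕ) → Prop} {x : ℕ} (h : Stable (insert x A) R)
    (hx : x ∉ A) (h28 : x ≠ 28) (h35 : x ≠ 35) (v : ℕ) :
    Stable A fun ρ μ => R ρ μ ∧ ρ x = v := fun ρ μ ρ' μ' ⟨h1, h2⟩ h3 h4 =>
  ⟨h ρ μ ρ' μ' h1 (fun z hz => h3 z fun hA => hz (Set.mem_insert_of_mem x hA)) h4,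
    (h3 x hx h28 h35).trans h2⟩

section

variable {B r : ℕ} {β ρ μ : ℕ → ℕ} {L : List ℕ} {A : Set ℕ} {c e : Tm}
  {R Q : (ℕ → ℕ) → (ℕ → ℕ) → Prop}

theorem wp_emitIf {P : Prop} [Decidable P] {x : ℕ} (hβ : β 28 = B ∧ β 35 = B) (hR : Stable A R)
    (h : R ρ μ) (hL : Emitted B (r + 1) L ρ μ) (hc : 0 < c.ev ρ μ ↔ P)
    (hx : P → e.ev (update ρ 35 1) μ = x) (hxB : P → x ≤ B)
    (hQ : ∀ ρ' μ', R ρ' μ' → Emitted B r (L ++ if P then [x] else []) ρ' μ' → Q ρ' μ') :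
    (emitIf c e).wp B β Q ρ μ := by
  obtain ⟨h1, h2, h3⟩ := hL
  have hv : (Tm.lt (.const 0) c).ev ρ μ = if P then 1 else 0 := by simp only [Tm.ev, hc]
  simp only [emitIf, wp, Tm.plus, Tm.and, Tm.ev, Op.ev] at hv ⊢
  rw [hv, hβ.1, hβ.2]
  simp only [update_self, update_of_ne (by norm_num : 28 ≠ 35)]
  have e1 : (if P then 1 else 0) * e.ev (update ρ 35 (if P then 1 else 0)) μ = if P then x else 0 := by
    split_ifs with hP
    all_goals grind
  rw [e1]
  refine ⟨by grind, by split_ifs with hP; exacts [hxB hP, Nat.zero_le _],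
    by grind, hQ _ _ (hR ρ μ _ _ h (fun z _ h28 h35 => ?_) fun a ha =>
      update_of_ne (by omega) _ _) ⟨?_, ?_, ?_⟩⟩
  · rw [update_of_ne h28, update_of_ne h35]
  · simp only [update_self, update_apply, List.length_append]
    grind
  · simp only [update_self]
    grind
  · rw [update_of_ne (by norm_num : 0 ≠ 28), update_of_ne (by norm_num : 0 ≠ 35), h1]
    refine isCode_append.2 ⟨h3.congr fun j hj => update_of_ne (by omega) _ _, ?_⟩
    split_ifs with hP
    · exact isCode_singleton.2 (update_self ..)
    · exact fun j hj => absurd hj (by simp)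

theorem wp_emit {x : ℕ} (hβ : β 28 = B ∧ β 35 = B) (hR : Stable A R)
    (h : R ρ μ) (hL : Emitted B (r + 1) L ρ μ)
    (hx : e.ev (update ρ 35 1) μ = x) (hxB : x ≤ B)
    (hQ : ∀ ρ' μ', R ρ' μ' → Emitted B r (L ++ [x]) ρ' μ' → Q ρ' μ') :
    (emit e).wp B β Q ρ μ :=
  wp_emitIf (P := True) hβ hR h hL (by simp [Tm.ev]) (fun _ => hx) (fun _ => hxB) (by grind)

theorem wp_loop_emit {x m w : ℕ} {b : Fin 4} {s : Stm} {f : Fin m → List ℕ} (hR : Stable A R)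
    (hx : x + 10 ∈ A) (hx28 : x + 10 ≠ 28) (hb : ρ (b + 1) = m)
    (hs : ∀ (v : Fin m) ρ' μ' L' r' Q', R ρ' μ' → ρ' (x + 10) = v → Emitted B (r' + w) L' ρ' μ' →
      (∀ ρ'' μ'', R ρ'' μ'' → Emitted B r' (L' ++ f v) ρ'' μ'' → Q' ρ'' μ'') → s.wp B β Q' ρ' μ')
    (h : R ρ μ) (hL : Emitted B (r + m * w) L ρ μ)
    (hQ : ∀ ρ' μ', R ρ' μ' → Emitted B r (L ++ (List.finRange m).flatMap f) ρ' μ' → Q ρ' μ') :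
    (loop x b s).wp B β Q ρ μ := by
  refine ⟨fun j ρ' μ' => R ρ' μ' ∧ Emitted B (r + (m - j) * w)
    (L ++ ((List.finRange m).take j).flatMap f) ρ' μ', ⟨h, by grind⟩, ?_, ?_⟩
  · rintro j hj ρ' μ' ⟨h1, h2⟩
    rw [hb] at hj
    obtain ⟨t, ht⟩ : ∃ t, m - j = t + 1 := ⟨m - j - 1, by omega⟩
    have ht' : m - (j + 1) = t := by omega
    refine hs ⟨j, hj⟩ _ μ' (L ++ ((List.finRange m).take j).flatMap f) (r + t * w) _
      (hR _ _ _ _ h1 (fun z hz _ _ => update_of_ne (fun e => hz (by rwa [e])) _ _) fun _ _ => rfl)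
      (update_self ..) ?_ fun ρ'' μ'' h3 h4 => ⟨h3, ?_⟩
    · rw [ht, add_mul, one_mul, ← add_assoc] at h2
      have e0 : update ρ' (x + 10) j 0 = ρ' 0 := update_of_ne (by omega) _ _
      have e28 : update ρ' (x + 10) j 28 = ρ' 28 := update_of_ne hx28.symm _ _
      unfold Emitted
      rw [e0, e28]
      exact h2
    · rw [ht', List.take_succ_eq_append_getElem (by grind), List.flatMap_append,
        ← List.append_assoc]
      simpa using h4
  · rintro ρ' μ' ⟨h1, h2⟩
    rw [hb, Nat.sub_self, zero_mul, List.take_of_length_le (by simp)] at h2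
    grind

end

/-! ### Tables -/

open Tm

/-- Put the values of `e` for the vertices of `Kᵢ` into a table. -/
def fill (b : ℕ) (e : Tm) : Stm :=
  .loop 1 2 (.put ((V b).plus (table 7 11)) (.letv 0 ((V 7).plus (V 11)) e))

theorem wp_fill {n b B : ℕ} {A : Set (Fin n)} {β ρ μ : ℕ → ℕ} {e : Tm} {r : Fin n → ℕ → Prop}
    {Q : (ℕ → ℕ) → (ℕ → ℕ) → Prop} (hl : IsListOf A (ρ 3) (ρ 7) μ) (hb : b ≠ 11)
    (hk : ρ 7 + ρ 3 ≤ ρ b)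
    (he : ∀ y μ', (∀ a, a < ρ b ∨ ρ b + n ≤ a → μ' a = μ a) → ∀ v ∈ A,
      e.ev (update (update ρ 11 y) 10 v) μ' ≤ B ∧ r v (e.ev (update (update ρ 11 y) 10 v) μ'))
    (hQ : ∀ y μ', (∀ a, a < ρ b ∨ ρ b + n ≤ a → μ' a = μ a) → (∀ v ∈ A, r v (μ' (ρ b + v))) →
      Q (update ρ 11 y) μ') : (fill b e).wp B β Q ρ μ := by
  refine ⟨fun j ρ' μ' => (∃ y, ρ' = update ρ 11 y) ∧ (∀ a, a < ρ b ∨ ρ b + n ≤ a → μ' a = μ a) ∧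
    ∀ y < j, ∀ v : Fin n, μ (ρ 7 + y) = v → r v (μ' (ρ b + v)), ⟨⟨ρ 11, ?_⟩, fun _ _ => rfl, ?_⟩, ?_, ?_⟩
  · rw [Function.update_eq_self]
  · intro y hy
    omega
  · rintro j hj _ μ' ⟨⟨y, rfl⟩, h1, h2⟩
    change j < ρ 3 at hj
    simp only [Nat.reduceAdd, update_idem]
    obtain ⟨v, hv, e1⟩ := hl.mem j hj
    have e2 : μ' (ρ 7 + j) = v := (h1 _ (by omega)).trans e1
    simp only [wp, table, plus, ev, Op.ev, update_self, Nat.zero_add,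
      update_of_ne (by norm_num : 7 ≠ 11), update_of_ne hb, e2]
    refine ⟨(he j μ' h1 v hv).1, ⟨j, rfl⟩, fun a ha => ?_, fun y hy u hu => ?_⟩
    · rw [update_of_ne (by grind), h1 a ha]
    · by_cases huv : u = v
      · subst huv
        rw [update_self]
        exact (he j μ' h1 u hv).2
      · grind
  · rintro _ μ' ⟨⟨y, rfl⟩, h1, h2⟩
    refine hQ y μ' h1 fun v hv => ?_
    obtain ⟨y, hy, e1⟩ := hl.exists_eq v hv
    exact h2 y hy v e1

end Stm

end WordRAM

end

section

/-! ## The program for one member of the family -/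

namespace WordRAM

open Function (update update_self update_of_ne update_idem update_apply)
open Tm Stm
open Guess (Near Kept Used listOf Admissible)

/-- The parts of the memory do not overlap. -/
structure Layout (n q : ℕ) (ρ : ℕ → ℕ) : Prop where
  q_le : q ≤ n
  six : ρ 6 + n * n ≤ ρ 7
  seven : ρ 7 + ρ 3 < ρ 8
  eight : ρ 8 + n * n ≤ ρ 9
  nine : ρ 9 + n ≤ ρ 32
  kept : ρ 32 + n ≤ ρ 33
  parent : ρ 33 + n ≤ ρ 0

theorem Layout.congr {n q : ℕ} {ρ ρ' : ℕ → ℕ} (h : Layout n q ρ)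
    (h' : ∀ x, x < 10 ∧ x ≠ 4 ∨ x = 32 ∨ x = 33 → ρ' x = ρ x) : Layout n q ρ' := by
  refine ⟨h.q_le, ?_, ?_, ?_, ?_, ?_, ?_⟩ <;> simp [h']
  exacts [h.six, h.seven, h.eight, h.nine, h.kept, h.parent]

section

variable {n q : ℕ} {Cl : Fin q → Set (Fin n)} {i : Fin q} {τ : Guess q} {ρ μ μ' : ℕ → ℕ}

theorem mul_add_lt {a b l m : ℕ} (hl : l < a) (hm : m < b) : l * b + m < a * b := by
  have := Nat.mul_le_mul_right b (Nat.succ_le_of_lt hl)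
  grind

theorem Tm.Base.congr_mem (S : Base Cl i ρ μ) (hY : Layout n q ρ)
    (h : ∀ a < ρ 9, μ' a = μ a) : Base Cl i ρ μ' := by
  have h6 := hY.six
  have h7 := hY.seven
  have h8 := hY.eight
  have hl : ∀ y < ρ 3, μ' (ρ 7 + y) = μ (ρ 7 + y) := fun y hy => h _ (by omega)
  refine ⟨S.n_eq, S.q_eq, S.i_eq, fun l v => ?_, ⟨fun y hy => ?_, fun v hv => ?_, fun y z hy hz => ?_⟩,
    fun l m => ?_, S.k_eq, S.code.congr fun j hj => h _ ?_⟩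
  rotate_right
  · have := S.k_eq
    grind
  · have h1 := mul_add_lt l.2 v.2
    have h2 := Nat.mul_le_mul_right n hY.q_le
    rw [h _ (by omega), S.inc]
  · rw [hl y hy]
    exact S.list.mem y hy
  · obtain ⟨y, hy, e⟩ := S.list.exists_eq v hv
    grind
  · rw [hl y (by omega), hl z hz]
    exact S.list.mono y z hy hz
  · have h1 := mul_add_lt l.2 m.2
    have h2 := Nat.mul_le_mul hY.q_le hY.q_le
    rw [h _ (by omega), S.meet]

theorem Tm.Static.congr_mem (S : Static Cl i τ ρ μ) (hY : Layout n q ρ)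
    (h : ∀ a < ρ 9, μ' a = μ a) : Static Cl i τ ρ μ' :=
  ⟨S.toBase.congr_mem hY h, S.c, S.a₀, S.x₀, S.e, S.j, S.l, S.mode, S.g⟩

/-- The guess and the tables. -/
structure Ctx (Cl : Fin q → Set (Fin n)) (i : Fin q) (τ : Guess q) (ρ μ : ℕ → ℕ) : Prop
    extends Static Cl i τ ρ μ where
  layout : Layout n q ρ
  near : IsTable (Cl i) (ρ 9) (Near Cl i τ) μ
  kept : IsTable (Cl i) (ρ 32) (Kept Cl i τ) μ
  parent : ∀ v ∈ Cl i, μ (ρ 33 + v) = Guess.parent Cl i τ v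

theorem Ctx.stable {A : Set ℕ} (hA : ∀ x ∈ A, ¬ IsFixed x) : Stable A (Ctx Cl i τ) := by
  intro ρ μ ρ' μ' h h1 h2
  have h1' : ∀ x, IsFixed x → ρ' x = ρ x := fun x hx => h1 x (fun hxA => hA x hxA hx)
    (by unfold IsFixed at hx; omega) (by unfold IsFixed at hx; omega)
  have hY := h.layout
  have h9 := hY.nine
  have h32 := hY.kept
  have h33 := hY.parent
  refine ⟨(h.toStatic.congr_mem hY fun a ha => h2 a (by omega)).congr_var h1',
    hY.congr fun x hx => h1' x (by unfold IsFixed; omega), ?_, ?_, ?_⟩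
  · intro v hv
    rw [h1' 9 (by unfold IsFixed; omega), h2 _ (by omega), h.near v hv]
  · intro v hv
    rw [h1' 32 (by unfold IsFixed; omega), h2 _ (by omega), h.kept v hv]
  · intro v hv
    rw [h1' 33 (by unfold IsFixed; omega), h2 _ (by omega), h.parent v hv]

/-! ### The tables -/

theorem parent_le (h : Admissible Cl i τ) {v : Fin n} (hv : v ∈ Cl i) :
    Guess.parent Cl i τ v ≤ 2 * n := by
  have := h.c_le
  rcases Guess.parent_cases (τ := τ) hv with ⟨-, e⟩ | ⟨-, ⟨e, h1, -⟩ | ⟨a, -, e, -⟩ | ⟨u, -, -, e, -⟩⟩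
  all_goals omega

def tables : Stm :=
  .seq (fill 9 (.lt (.const 0) Tm.near)) (.seq (fill 32 (.lt (.const 0) Tm.kept)) (fill 33 Tm.parent))

theorem wp_tables {B : ℕ} {β : ℕ → ℕ} {Q : (ℕ → ℕ) → (ℕ → ℕ) → Prop} (S : Static Cl i τ ρ μ)
    (hY : Layout n q ρ) (h : Admissible Cl i τ) (hB : 2 * n + 1 ≤ B)
    (hQ : ∀ y μ', Ctx Cl i τ (update ρ 11 y) μ' → (∀ a, ρ 0 ≤ a → μ' a = μ a) →
      Q (update ρ 11 y) μ') : tables.wp B β Q ρ μ := by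
  have h8 := hY.eight
  have h7 := hY.seven
  have h9 := hY.nine
  have h32 := hY.kept
  have h33 := hY.parent
  have hu : ∀ {ρ μ} {v : Fin n}, Static Cl i τ ρ μ → ∀ y,
      Static Cl i τ (update (update ρ 11 y) 10 v) μ := fun S y =>
    (S.update (x := 1) (y := y) (by omega)).update (x := 0) (by omega)
  have hbool : ∀ {e : Tm} {ρ μ} {P : Prop}, (0 < e.ev ρ μ ↔ P) →
      (Tm.lt (.const 0) e).ev ρ μ ≤ B ∧ (0 < (Tm.lt (.const 0) e).ev ρ μ ↔ P) := by
    intro e ρ μ P hP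
    refine ⟨?_, (lt_iff (a := .const 0)).trans hP⟩
    by_cases hP : 0 < e.ev ρ μ <;> simp only [ev, hP, if_true, if_false] <;> omega
  refine wp_fill (n := n) (r := fun v x => 0 < x ↔ Near Cl i τ v) S.list (by omega) (by omega)
    (fun y μ₁ hμ v hv => hbool (near_iff (hu (S.congr_mem hY fun a ha => hμ a (by omega)) y)
      (update_self ..))) fun y₁ μ₁ hμ₁ hN => ?_
  have e1 : ∀ x, x ≠ 11 → update ρ 11 y₁ x = ρ x := fun x hx => update_of_ne hx _ _
  have S₁ : Static Cl i τ (update ρ 11 y₁) μ₁ :=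
    (S.congr_mem hY fun a ha => hμ₁ a (by omega)).update (x := 1) (by omega)
  have hY₁ : Layout n q (update ρ 11 y₁) := hY.congr fun x hx => e1 x (by omega)
  refine wp_fill (n := n) (r := fun v x => 0 < x ↔ Kept Cl i τ v) S₁.list (by omega)
    (by grind)
    (fun y μ₂ hμ v hv => hbool (kept_iff (hu (S₁.congr_mem hY₁ fun a ha => hμ a (by
      grind)) y)
      (update_self ..))) fun y₂ μ₂ hμ₂ hK => ?_
  rw [update_idem]
  simp only [e1, ne_eq, Nat.reduceEqDiff, not_false_eq_true] at hμ₂ hK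
  have e2 : ∀ x, x ≠ 11 → update ρ 11 y₂ x = ρ x := fun x hx => update_of_ne hx _ _
  have S₂ : Static Cl i τ (update ρ 11 y₂) μ₂ :=
    (S.congr_mem hY fun a ha => (hμ₂ a (by omega)).trans (hμ₁ a (by omega))).update (x := 1) (by omega)
  have hY₂ : Layout n q (update ρ 11 y₂) := hY.congr fun x hx => e2 x (by omega)
  have hN₂ : ∀ μ₃, (∀ a, a < ρ 33 ∨ ρ 33 + n ≤ a → μ₃ a = μ₂ a) →
      IsTable (Cl i) (ρ 9) (Near Cl i τ) μ₃ ∧ IsTable (Cl i) (ρ 32) (Kept Cl i τ) μ₃ := by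
    refine fun μ₃ hμ => ⟨fun v hv => ?_, fun v hv => ?_⟩
    all_goals grind
  refine wp_fill (n := n) (r := fun v x => x = Guess.parent Cl i τ v) S₂.list (by omega)
    (by grind)
    (fun y μ₃ hμ v hv => ?_) fun y₃ μ₃ hμ₃ hP => ?_
  · simp only [e2, ne_eq, Nat.reduceEqDiff, not_false_eq_true] at hμ
    have S₃ := hu (v := v) (S₂.congr_mem hY₂ fun a ha => hμ a (by
      grind)) y
    have := ev_parent S₃ (hN₂ μ₃ hμ).1 (hN₂ μ₃ hμ).2 (update_self ..) hv
    exact ⟨this.trans_le ((parent_le h hv).trans (by omega)), this⟩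
  · rw [update_idem]
    simp only [e2, ne_eq, Nat.reduceEqDiff, not_false_eq_true] at hμ₃ hP
    have e3 : ∀ x, x ≠ 11 → update ρ 11 y₃ x = ρ x := fun x hx => update_of_ne hx _ _
    refine hQ y₃ μ₃ ⟨?_, hY.congr fun x hx => e3 x (by omega), (hN₂ μ₃ hμ₃).1, (hN₂ μ₃ hμ₃).2, hP⟩
      fun a ha => by grind
    exact (S.congr_mem hY fun a ha => by grind).update
      (x := 1) (by omega)

/-! ### The output -/

theorem listOf_flatMap {α : Type*} (A : Set (Fin n)) [DecidablePred (· ∈ A)] (f : Fin n → List α) :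
    (listOf A).flatMap f = (List.finRange n).flatMap fun v => if v ∈ A then f v else [] := by
  rw [listOf]
  induction List.finRange n with
  | nil => rfl
  | cons a l ih =>
    grind

/-- The list of the kept vertices and the list of the used numbers. -/
def isNode : Tm := (inc 5 10).and (((V 10).ne (V 20)).and (table 32 10))

def isNew : Tm := (inc 5 10).and used

def newNode : Tm := ((V 1).plus (const 1)).plus (V 10)

def nodesOutput : Stm :=
  .seq (emit (V 20)) (.seq (.loop 0 0 (emitIf isNode (V 10))) (.loop 0 0 (emitIf isNew newNode)))

def edgesOutput : Stm :=
  .seq (emit (V 20)) (.seq (emit (V 20))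
    (.seq (.loop 0 0 (.seq (emitIf isNode (V 10)) (emitIf isNode (table 33 10))))
      (.loop 0 0 (.seq (emitIf isNew newNode) (emitIf isNew (V 20))))))

def output : Stm :=
  .seq (.set 29 (V 28)) (.seq (emit (const 0)) (.seq nodesOutput
    (.seq (.set 34 (op .sub (op .sub (V 28) (V 29)) (const 1))) (.seq (.put (V 29) (V 34))
      (.seq (emit (V 34)) (.seq edgesOutput (.seq (emit (const 2)) (.seq (emit (V 20))
        (emit second)))))))))

variable {B r : ℕ} {β : ℕ → ℕ} {L : List ℕ} {Q : (ℕ → ℕ) → (ℕ → ℕ) → Prop}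
  {R : (ℕ → ℕ) → (ℕ → ℕ) → Prop}

theorem Stm.Emitted.mono {r' : ℕ} (h : Emitted B r L ρ μ) (hr : r' ≤ r) : Emitted B r' L ρ μ :=
  ⟨h.1, by have := h.2.1; omega, h.2.2⟩

theorem isNode_iff (h : Ctx Cl i τ ρ μ) {v : Fin n} (hv : ρ 10 = v) : 0 < isNode.ev ρ μ ↔
    v ∈ {v | v ∈ Cl i ∧ (v : ℕ) ≠ τ.c ∧ Kept Cl i τ v} := by
  simp only [isNode, and_iff, ne_iff, inc, table, plus, ev, Op.ev, hv, h.i_eq, h.n_eq, h.inc, h.c]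
  exact and_congr_right fun hvK => by rw [h.kept v hvK]

theorem isNew_iff (h : Ctx Cl i τ ρ μ) {v : Fin n} (hv : ρ 10 = v) : 0 < isNew.ev ρ μ ↔
    v ∈ {v | v ∈ Cl i ∧ Used Cl i τ v} := by
  simp only [isNew, and_iff, used_iff h.toStatic h.kept h.parent hv, inc, plus, ev, Op.ev, hv, h.i_eq,
    h.n_eq, h.inc]
  rfl

variable (hβ : ∀ x, 4 < x → β x = B) (hB : 2 * n + 2 ≤ B) (had : Admissible Cl i τ)
  (hR : Stable {10} R) (hRC : ∀ ρ μ, R ρ μ → Ctx Cl i τ ρ μ)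
include hβ hB had hR hRC

theorem wp_nodesOutput (h : R ρ μ) (hL : Emitted B (r + (2 * n + 1)) L ρ μ)
    (hQ : ∀ ρ' μ', R ρ' μ' → Emitted B r (L ++ Guess.nodes Cl i τ) ρ' μ' → Q ρ' μ') :
    nodesOutput.wp B β Q ρ μ := by
  classical
  have hβ' : β 28 = B ∧ β 35 = B := ⟨hβ _ (by omega), hβ _ (by omega)⟩
  have hc := had.c_le
  have hR' : ∀ v, Stable ∅ fun ρ μ => R ρ μ ∧ ρ 10 = v :=
    Stable.and (by simpa using hR) (by simp) (by omega) (by omega)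
  refine wp_emit (r := r + 2 * n) hβ' hR h (hL.mono (by omega)) (hRC _ _ h).c (by omega)
    fun ρ₁ μ₁ h₁ hL₁ => ?_
  refine wp_loop_emit (w := 1) (r := r + n) (m := n) (f := fun v =>
    if v ∈ {v | v ∈ Cl i ∧ (v : ℕ) ≠ τ.c ∧ Kept Cl i τ v} then [(v : ℕ)] else []) hR (by simp)
    (by omega) (hRC _ _ h₁).n_eq (fun v ρ' μ' L' r' Q' h' hv hL' hQ' =>
      wp_emitIf hβ' (hR' v) ⟨h', hv⟩ hL' (isNode_iff (hRC _ _ h') hv)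
        (fun _ => hv) (fun _ => by omega) fun ρ'' μ'' h'' => hQ' ρ'' μ'' h''.1) h₁
    (hL₁.mono (by omega)) fun ρ₂ μ₂ h₂ hL₂ => ?_
  refine wp_loop_emit (w := 1) (r := r) (m := n) (f := fun v =>
    if v ∈ {v | v ∈ Cl i ∧ Used Cl i τ v} then [n + 1 + (v : ℕ)] else []) hR (by simp)
    (by omega) (hRC _ _ h₂).n_eq (fun v ρ' μ' L' r' Q' h' hv hL' hQ' =>
      wp_emitIf (x := n + 1 + v) hβ' (hR' v) ⟨h', hv⟩ hL' (isNew_iff (hRC _ _ h') hv)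
        (fun _ => by
          have := (hRC _ _ h').n_eq
          simp only [newNode, plus, ev, Op.ev, update_apply, Nat.reduceEqDiff, if_false, this, hv])
        (fun _ => by omega) fun ρ'' μ'' h'' => hQ' ρ'' μ'' h''.1) h₂
    (hL₂.mono (by omega)) fun ρ₃ μ₃ h₃ hL₃ => hQ ρ₃ μ₃ h₃ ?_
  rw [Guess.nodes, List.map_eq_flatMap, List.map_eq_flatMap, listOf_flatMap, listOf_flatMap]
  grind

theorem wp_edgesOutput (h : R ρ μ) (hL : Emitted B (r + (4 * n + 2)) L ρ μ)
    (hQ : ∀ ρ' μ', R ρ' μ' → Emitted B r (L ++ (Guess.tree Cl i τ).edges.flatMap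
      fun e => [e.1, e.2]) ρ' μ' → Q ρ' μ') :
    edgesOutput.wp B β Q ρ μ := by
  classical
  have hβ' : β 28 = B ∧ β 35 = B := ⟨hβ _ (by omega), hβ _ (by omega)⟩
  have hc := had.c_le
  have hR' : ∀ v, Stable ∅ fun ρ μ => R ρ μ ∧ ρ 10 = v :=
    Stable.and (by simpa using hR) (by simp) (by omega) (by omega)
  refine wp_emit (r := r + (4 * n + 1)) hβ' hR h (hL.mono (by omega)) (hRC _ _ h).c (by omega)
    fun ρ₀ μ₀ h₀ hL₀ => ?_
  refine wp_emit (r := r + 4 * n) hβ' hR h₀ (hL₀.mono (by omega)) (hRC _ _ h₀).c (by omega)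
    fun ρ₁ μ₁ h₁ hL₁ => ?_
  refine wp_loop_emit (w := 2) (r := r + 2 * n) (m := n) (f := fun v =>
    if v ∈ {v | v ∈ Cl i ∧ (v : ℕ) ≠ τ.c ∧ Kept Cl i τ v} then
      [(v : ℕ), Guess.parent Cl i τ v] else []) hR (by simp)
    (by omega) (hRC _ _ h₁).n_eq (fun v ρ' μ' L' r' Q' h' hv hL' hQ' =>
      wp_emitIf (r := r' + 1) (x := v) hβ' (hR' v) ⟨h', hv⟩ hL' (isNode_iff (hRC _ _ h') hv)
        (fun _ => hv) (fun _ => by omega) fun ρ'' μ'' h'' hL'' =>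
      wp_emitIf (x := Guess.parent Cl i τ v) hβ' (hR' v) h'' hL'' (isNode_iff (hRC _ _ h''.1) h''.2)
        (fun hv' => (by
          simp only [table, plus, ev, Op.ev, update_apply, Nat.reduceEqDiff, if_false, h''.2]
          exact (hRC _ _ h''.1).parent v hv'.1)) (fun hv' => (parent_le had hv'.1).trans (by omega))
        fun ρ₃ μ₃ h₃ hL₃ => hQ' ρ₃ μ₃ h₃.1 (by
          grind)) h₁
    (hL₁.mono (by omega)) fun ρ₂ μ₂ h₂ hL₂ => ?_
  refine wp_loop_emit (w := 2) (r := r) (m := n) (f := fun v =>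
    if v ∈ {v | v ∈ Cl i ∧ Used Cl i τ v} then [n + 1 + (v : ℕ), τ.c] else []) hR (by simp)
    (by omega) (hRC _ _ h₂).n_eq (fun v ρ' μ' L' r' Q' h' hv hL' hQ' =>
      wp_emitIf (r := r' + 1) (x := n + 1 + v) hβ' (hR' v) ⟨h', hv⟩ hL' (isNew_iff (hRC _ _ h') hv)
        (fun _ => by
          have := (hRC _ _ h').n_eq
          simp only [newNode, plus, ev, Op.ev, update_apply, Nat.reduceEqDiff, if_false, this, hv])
        (fun _ => by omega) fun ρ'' μ'' h'' hL'' =>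
      wp_emitIf hβ' (hR' v) h'' hL'' (isNew_iff (hRC _ _ h''.1) h''.2)
        (fun _ => (hRC _ _ h''.1).c) (fun _ => by omega)
        fun ρ₃ μ₃ h₃ hL₃ => hQ' ρ₃ μ₃ h₃.1 (by
          grind)) h₂
    (hL₂.mono (by omega)) fun ρ₃ μ₃ h₃ hL₃ => hQ ρ₃ μ₃ h₃ ?_
  have hp : ∀ u : ℕ, Guess.parentId Cl i τ (n + 1 + u) = τ.c := fun u =>
    Guess.parentId_of_ge (by omega)
  rw [Guess.tree, Guess.nodes]
  simp only [List.map_cons, List.map_append, List.flatMap_cons, List.flatMap_append, List.map_map,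
    List.flatMap_map, listOf_flatMap, Function.comp_apply, Guess.parentId_c had, Guess.parentId_val, hp]
  grind

omit hR hRC

theorem wp_output (h : Ctx Cl i τ ρ μ) (hL : Emitted B (r + (6 * n + 8)) L ρ μ)
    (hQ : ∀ ρ' μ', Ctx Cl i τ ρ' μ' → Emitted B r (L ++ (Guess.tree Cl i τ).code) ρ' μ' → Q ρ' μ') :
    output.wp B β Q ρ μ := by
  have hβ' : β 28 = B ∧ β 35 = B := ⟨hβ _ (by omega), hβ _ (by omega)⟩
  have hc := had.c_le
  have hR₀ : Stable {10, 29, 34} (Ctx Cl i τ) := Ctx.stable (by simp [IsFixed])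
  have hR₂ : Stable {10} (Ctx Cl i τ) := Ctx.stable (by simp [IsFixed])
  have hR₁ : Stable {10} fun ρ' μ' => Ctx Cl i τ ρ' μ' ∧ ρ' 29 = ρ' 0 + L.length :=
    fun ρ μ ρ' μ' h h3 h4 => ⟨hR₂ _ _ _ _ h.1 h3 h4, by grind⟩
  obtain ⟨l1, l2, l3⟩ := hL
  refine ⟨by rw [hβ _ (by omega)]; change ρ 28 ≤ B; omega, ?_⟩
  refine wp_emit (r := r + (6 * n + 7)) (L := L) hβ' hR₁
    ⟨hR₀ _ _ _ _ h (fun z hz _ _ => update_of_ne (by grind) _ _)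
      fun _ _ => rfl, (update_self ..).trans l1⟩ ⟨l1, l2, l3⟩ rfl (Nat.zero_le _)
    fun ρ₁ μ₁ h₁ hL₁ => ?_
  refine wp_nodesOutput (r := r + (4 * n + 6)) hβ hB had hR₁ (fun _ _ h => h.1) h₁
    (hL₁.mono (by omega)) fun ρ₂ μ₂ ⟨h₂, h29⟩ ⟨k1, k2, k3⟩ => ?_
  set m := (Guess.nodes Cl i τ).length with hm
  have e1 : (op .sub (op .sub (V 28) (V 29)) (const 1)).ev ρ₂ μ₂ = m := by
    simp only [ev, Op.ev, k1, h29, List.length_append, List.length_singleton]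
    omega
  have hmB : m ≤ B := by grind
  change (op .sub (op .sub (V 28) (V 29)) (const 1)).ev ρ₂ μ₂ ≤ β 34 ∧ _
  rw [e1, hβ 34 (by omega)]
  refine ⟨hmB, hmB, ?_⟩
  have e29 : (V 29).ev (update ρ₂ 34 m) μ₂ = ρ₂ 0 + L.length := h29
  rw [e29]
  change Stm.wp B β _ Q _ (update μ₂ (ρ₂ 0 + L.length) m)
  have hL₃ : Emitted B (r + (4 * n + 6)) (L ++ [m] ++ Guess.nodes Cl i τ) (update ρ₂ 34 m)
      (update μ₂ (ρ₂ 0 + L.length) m) := by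
    refine ⟨k1.trans (by simp), k2, ?_⟩
    change IsCode (ρ₂ 0) _ _
    rw [isCode_append, isCode_append] at k3 ⊢
    refine ⟨⟨k3.1.1.congr fun j hj => update_of_ne (by omega) _ _,
      isCode_singleton.2 (update_self ..)⟩, ?_⟩
    have := k3.2.congr (μ' := update μ₂ (ρ₂ 0 + L.length) m) fun j hj =>
      update_of_ne (by simp; omega) _ _
    grind
  refine wp_emit (x := m) (r := r + (4 * n + 5)) hβ' hR₂
    (hR₀ _ _ _ _ h₂ (fun z hz _ _ => update_of_ne (by grind) _ _)
      fun a ha => update_of_ne (by omega) _ _) hL₃ rfl hmB fun ρ₃ μ₃ h₃ hL₄ => ?_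
  refine wp_edgesOutput (r := r + 3) hβ hB had hR₂ (fun _ _ h => h) h₃ (hL₄.mono (by omega))
    fun ρ₅ μ₅ h₅ hL₅ => ?_
  refine wp_emit (x := 2) (r := r + 2) hβ' hR₂ h₅ hL₅ rfl (by omega) fun ρ₆ μ₆ h₆ hL₆ => ?_
  refine wp_emit (x := τ.c) (r := r + 1) hβ' hR₂ h₆ hL₆ h₆.c (by omega) fun ρ₇ μ₇ h₇ hL₇ => ?_
  refine wp_emit (x := Guess.second Cl i τ) (r := r) hβ' hR₂ h₇ hL₇
    (ev_second (h₇.toStatic.congr_var fun x hx => update_of_ne (by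
      unfold IsFixed at hx; omega) _ _) h₇.parent had) ?_ fun ρ₈ μ₈ h₈ hL₈ => hQ _ _ h₈ ?_
  · rw [Guess.second]
    split_ifs with h1 h2 h3
    · omega
    · rcases had.x₀ with e | ⟨v, hv, e⟩
      · omega
      · simp only [← e, Fin.eta]
        exact (parent_le had hv).trans (by omega)
    all_goals omega
  · have : (Guess.tree Cl i τ).edges.length = m := by simp [Guess.tree, hm]
    rw [CenteredTree.code, this]
    simpa [Guess.tree, List.append_assoc, ← hm] using hL₈

end

end WordRAM

end

section

/-! ## The loop over all guesses -/

namespace WordRAM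

open Function (update update_self update_of_ne update_apply)
open Tm Stm
open Guess (listOf Admissible)

def digit (x : ℕ) (b : Tm) : Stm :=
  .seq (.set x (op .sub (V 31) (op .mul (op .div (V 31) b) b))) (.set 31 (op .div (V 31) b))

def keyBase : Tm := (V 3).plus (const 1)

def decode : Stm :=
  .seq (.set 31 (V 30)) (.seq (digit 20 keyBase) (.seq (digit 21 keyBase) (.seq (digit 22 keyBase)
    (.seq (digit 23 keyBase) (.seq (digit 24 (V 2)) (.seq (digit 25 (V 2)) (.seq (digit 26 (const 5))
    (.seq (digit 27 (const 2)) (.seq (.set 20 (table 7 20)) (.seq (.set 21 (table 7 21))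
    (.seq (.set 22 (table 7 22)) (.set 23 (table 7 23)))))))))))))

/-- The guess with a given number; the vertices are given by their positions in the list `K`. -/
def guessOf (K : List ℕ) {q : ℕ} (i : Fin q) (g : ℕ) : Guess q :=
  let b := K.length
  let q₁ : Fin q → 0 < q := fun i => i.pos
  { c := K.getD (g % b) 0
    a₀ := K.getD (g / b % b) 0
    x₀ := K.getD (g / b / b % b) 0
    e := K.getD (g / b / b / b % b) 0
    j := ⟨g / b / b / b / b % q, Nat.mod_lt _ (q₁ i)⟩
    l := ⟨g / b / b / b / b / q % q, Nat.mod_lt _ (q₁ i)⟩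
    mode := g / b / b / b / b / q / q % 5
    g := 0 < g / b / b / b / b / q / q / 5 % 2 }

def keyCount (b q : ℕ) : ℕ := b * (b * (b * (b * (q * (q * (5 * 2))))))

theorem exists_digit {b m d r : ℕ} (hd : d < b) (hr : r < m) :
    ∃ g < b * m, g % b = d ∧ g / b = r := by
  refine ⟨d + b * r, ?_, ?_, ?_⟩
  · have := Nat.mul_le_mul_left b (Nat.succ_le_of_lt hr)
    grind
  · rw [Nat.add_mul_mod_self_left, Nat.mod_eq_of_lt hd]
  · rw [Nat.add_mul_div_left _ _ (by omega), Nat.div_eq_of_lt hd, zero_add]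

section

variable {n q : ℕ} {Cl : Fin q → Set (Fin n)} {i : Fin q} {τ : Guess q} {ρ μ : ℕ → ℕ}

/-- The possible values of the central node and its like. -/
noncomputable def keys (A : Set (Fin n)) : List ℕ := (listOf A).map Fin.val ++ [n]

theorem getD_keys (A : Set (Fin n)) {d : ℕ} (hd : d < (keys A).length) :
    (keys A).getD d 0 = n ∨ ∃ v ∈ A, (v : ℕ) = (keys A).getD d 0 := by
  rw [List.getD_eq_getElem _ _ hd]
  have := List.getElem_mem hd
  simp only [keys, List.mem_append, List.mem_map, List.mem_singleton, Guess.mem_listOf] at this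
  exact this.symm

theorem exists_getD_keys {A : Set (Fin n)} {x : ℕ} (h : x = n ∨ ∃ v ∈ A, (v : ℕ) = x) :
    ∃ d < (keys A).length, (keys A).getD d 0 = x := by
  obtain ⟨d, hd, e⟩ := List.getElem_of_mem (a := x) (l := keys A) (by
    simp only [keys, List.mem_append, List.mem_map, List.mem_singleton, Guess.mem_listOf]
    exact h.symm)
  exact ⟨d, hd, by grind⟩

theorem keys_pos (A : Set (Fin n)) : 0 < (keys A).length := by simp [keys]

theorem guessOf_admissible (g : ℕ) : Admissible Cl i (guessOf (keys (Cl i)) i g) := by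
  constructor <;> exact getD_keys _ (Nat.mod_lt _ (keys_pos _))

theorem exists_guessOf (h : Admissible Cl i τ) (hm : τ.mode ≤ 4) :
    ∃ g < keyCount (keys (Cl i)).length q, guessOf (keys (Cl i)) i g = τ := by
  classical
  obtain ⟨d₁, h₁, e₁⟩ := exists_getD_keys h.c
  obtain ⟨d₂, h₂, e₂⟩ := exists_getD_keys h.a₀
  obtain ⟨d₃, h₃, e₃⟩ := exists_getD_keys h.x₀
  obtain ⟨d₄, h₄, e₄⟩ := exists_getD_keys h.e
  obtain ⟨g₇, l₇, a₇, b₇⟩ := exists_digit (Nat.lt_succ_of_le hm)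
    (show (if τ.g then 1 else 0) < 2 by grind)
  obtain ⟨g₆, l₆, a₆, b₆⟩ := exists_digit τ.l.2 l₇
  obtain ⟨g₅, l₅, a₅, b₅⟩ := exists_digit τ.j.2 l₆
  obtain ⟨g₄, l₄, a₄, b₄⟩ := exists_digit h₄ l₅
  obtain ⟨g₃, l₃, a₃, b₃⟩ := exists_digit h₃ l₄
  obtain ⟨g₂, l₂, a₂, b₂⟩ := exists_digit h₂ l₃
  obtain ⟨g₁, l₁, a₁, b₁⟩ := exists_digit h₁ l₂
  refine ⟨g₁, l₁, ?_⟩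
  simp only [guessOf, b₁, b₂, b₃, b₄, b₅, b₆, b₇, a₁, a₂, a₃, a₄, a₅, a₆, a₇, e₁, e₂, e₃, e₄, Fin.eta]
  cases τ
  simp only [Guess.mk.injEq, true_and]
  grind

variable {B r : ℕ} {β : ℕ → ℕ} {L : List ℕ} {Q : (ℕ → ℕ) → (ℕ → ℕ) → Prop}
  (hβ : ∀ x, 4 < x → β x = B)
include hβ

theorem wp_set {x v : ℕ} {e : Tm} (hx : 4 < x) (he : e.ev ρ μ = v) (hv : v ≤ B)
    (hQ : Q (update ρ x v) μ) : (Stm.set x e).wp B β Q ρ μ := by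
  subst he
  exact ⟨hv.trans_eq (hβ x hx).symm, hQ⟩

theorem wp_digit {x c r : ℕ} {b : Tm} (hx : 4 < x) (hx' : x ≠ 31) (hr : ρ 31 = r) (hrB : r ≤ B)
    (hb : ∀ y, b.ev (update ρ x y) μ = c)
    (hQ : Q (update (update ρ x (r % c)) 31 (r / c)) μ) : (digit x b).wp B β Q ρ μ := by
  have e0 : b.ev ρ μ = c := by
    have := hb (ρ x)
    rwa [Function.update_eq_self] at this
  refine wp_set hβ hx (?_ : _ = r % c) ((Nat.mod_le _ _).trans hrB)
    (wp_set hβ (by norm_num) ?_ ((Nat.div_le_self _ _).trans hrB) hQ)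
  · simp only [ev, Op.ev, e0, hr]
    rw [mul_comm, Nat.mod_eq_sub_mul_div]
  · simp only [ev, Op.ev, hb, update_of_ne hx'.symm, hr]

theorem wp_decode {g : ℕ} (S : Base Cl i ρ μ) (hY : Layout n q ρ) (hg : ρ 30 = g) (hgB : g ≤ B)
    (hB : n ≤ B)
    (hQ : ∀ ρ', Static Cl i (guessOf (keys (Cl i)) i g) ρ' μ → Layout n q ρ' → ρ' 28 = ρ 28 →
      ρ' 0 = ρ 0 → Q ρ' μ) : decode.wp B β Q ρ μ := by
  have hk : ρ 3 + 1 = (keys (Cl i)).length := by simp [keys, S.k_eq]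
  have hdiv : ∀ {a b}, a ≤ B → a / b ≤ B := fun h => (Nat.div_le_self _ _).trans h
  set b := (keys (Cl i)).length with hb
  have hkey : ∀ d, μ (ρ 7 + d % b) = (keys (Cl i)).getD (d % b) 0 := fun d => by
    have hd : d % b < b := Nat.mod_lt _ (keys_pos _)
    rw [List.getD_eq_getElem _ _ hd]
    exact S.code _ hd
  have hkB : ∀ d, (keys (Cl i)).getD (d % b) 0 ≤ B := fun d => by
    rcases getD_keys (Cl i) (Nat.mod_lt d (keys_pos _)) with e | ⟨v, -, e⟩
    all_goals grind
  have h₁ : ∀ d, d ≤ B → d / b ≤ B := fun d => (Nat.div_le_self _ _).trans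
  have h₂ := h₁ _ hgB
  have h₃ := h₁ _ h₂
  have h₄ := h₁ _ h₃
  have h₅ := h₁ _ h₄
  have h₆ := (Nat.div_le_self _ q).trans h₅
  have h₇ := (Nat.div_le_self _ q).trans h₆
  have h₈ := (Nat.div_le_self _ 5).trans h₇
  refine wp_set hβ (by norm_num) hg hgB ?_
  refine wp_digit hβ (by norm_num) (by norm_num) (update_self ..) hgB (fun _ => hk) ?_
  refine wp_digit hβ (by norm_num) (by norm_num) (update_self ..) h₂ (fun _ => hk) ?_
  refine wp_digit hβ (by norm_num) (by norm_num) (update_self ..) h₃ (fun _ => hk) ?_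
  refine wp_digit hβ (by norm_num) (by norm_num) (update_self ..) h₄ (fun _ => hk) ?_
  refine wp_digit hβ (by norm_num) (by norm_num) (update_self ..) h₅ (fun _ => S.q_eq) ?_
  refine wp_digit hβ (by norm_num) (by norm_num) (update_self ..) h₆ (fun _ => S.q_eq) ?_
  refine wp_digit hβ (by norm_num) (by norm_num) (update_self ..) h₇ (fun _ => rfl) ?_
  refine wp_digit hβ (by norm_num) (by norm_num) (update_self ..) h₈ (fun _ => rfl) ?_
  refine wp_set hβ (by norm_num) (hkey g) (hkB _) ?_
  refine wp_set hβ (by norm_num) (hkey (g / b)) (hkB _) ?_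
  refine wp_set hβ (by norm_num) (hkey (g / b / b)) (hkB _) ?_
  refine wp_set hβ (by norm_num) (hkey (g / b / b / b)) (hkB _) ?_
  refine hQ _ ⟨S.congr_var fun x hx _ => ?_, rfl, rfl, rfl, rfl, rfl, rfl, rfl, Iff.rfl⟩
    (hY.congr fun x hx => ?_) rfl rfl <;>
  · simp only [update_apply]
    grind

def guess : Stm := .seq decode (.seq tables output)

theorem wp_guess {g : ℕ} (S : Base Cl i ρ μ) (hY : Layout n q ρ) (hg : ρ 30 = g) (hgB : g ≤ B)
    (hB : 2 * n + 2 ≤ B) (hL : Emitted B (r + (6 * n + 8)) L ρ μ)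
    (hQ : ∀ ρ' μ', Base Cl i ρ' μ' → Layout n q ρ' → Emitted B r
      (L ++ (Guess.tree Cl i (guessOf (keys (Cl i)) i g)).code) ρ' μ' → Q ρ' μ') :
    guess.wp B β Q ρ μ := by
  obtain ⟨l1, l2, l3⟩ := hL
  have had := guessOf_admissible (Cl := Cl) (i := i) g
  refine wp_decode hβ S hY hg hgB (by omega) fun ρ₁ S₁ hY₁ e28 e0 => ?_
  refine wp_tables S₁ hY₁ had (by omega) fun y μ₁ h₁ hμ₁ => ?_
  refine wp_output hβ hB had h₁ (L := L) (r := r) ⟨?_, ?_, ?_⟩ fun ρ' μ' h' =>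
    hQ ρ' μ' h'.toBase h'.layout
  · grind
  · grind
  · change IsCode (ρ₁ 0) L μ₁
    rw [e0] at hμ₁ ⊢
    exact l3.congr fun j _ => hμ₁ _ (by omega)

def family : Stm :=
  .seq (.set 4 (op .mul keyBase (op .mul keyBase (op .mul keyBase (op .mul keyBase (op .mul (V 2)
    (op .mul (V 2) (op .mul (const 5) (const 2)))))))))
    (.seq (emit (V 4)) (.loop 20 3 guess))

theorem wp_family {N : ℕ} (S : Base Cl i ρ μ) (hY : Layout n q ρ)
    (hN : keyCount (keys (Cl i)).length q = N) (hβ4 : β 4 = N) (hNB : N ≤ B) (hB : 2 * n + 2 ≤ B)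
    (hL : Emitted B (N * (6 * n + 8) + 1) [] ρ μ)
    (hQ : ∀ ρ' μ', Emitted B 0 (CenteredTree.familyCode ((List.range N).map fun g =>
      Guess.tree Cl i (guessOf (keys (Cl i)) i g))) ρ' μ' → Q ρ' μ') : family.wp B β Q ρ μ := by
  have hk : ρ 3 + 1 = (keys (Cl i)).length := by simp [keys, S.k_eq]
  have e1 : (op .mul keyBase (op .mul keyBase (op .mul keyBase (op .mul keyBase (op .mul (V 2)
    (op .mul (V 2) (op .mul (const 5) (const 2)))))))).ev ρ μ = N := by
    rw [← hN, ← hk, keyCount, ← S.q_eq]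
    rfl
  let R : (ℕ → ℕ) → (ℕ → ℕ) → Prop := fun ρ μ => (Base Cl i ρ μ ∧ Layout n q ρ) ∧ ρ 4 = N
  have hR : Stable ∅ R := by
    refine fun ρ μ ρ' μ' ⟨⟨S, hY⟩, h4⟩ hρ hμ => ⟨⟨?_, ?_⟩, (hρ 4 (by simp) (by omega) (by omega)).trans h4⟩
    · refine (S.congr_mem hY fun a ha => hμ a ?_).congr_var fun x hx _ => hρ x (by simp) (by omega) (by omega)
      have := hY.nine
      have := hY.kept
      have := hY.parent
      omega
    · exact hY.congr fun x hx => hρ x (by simp) (by omega) (by omega)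
  have hu : ∀ {ρ μ x v}, (Base Cl i ρ μ ∧ Layout n q ρ) → (x = 4 ∨ x = 30) →
      Base Cl i (update ρ x v) μ ∧ Layout n q (update ρ x v) := fun h hx =>
    ⟨h.1.congr_var fun y _ _ => update_of_ne (by omega) _ _,
      h.2.congr fun y _ => update_of_ne (by omega) _ _⟩
  refine ⟨e1.trans_le hβ4.ge, ?_⟩
  rw [e1]
  refine wp_emit (x := N) (r := N * (6 * n + 8)) ⟨hβ _ (by norm_num), hβ _ (by norm_num)⟩ hR
    ⟨hu ⟨S, hY⟩ (Or.inl rfl), update_self ..⟩ hL rfl hNB fun ρ₁ μ₁ ⟨h₁, h4⟩ hL₁ => ?_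
  refine ⟨fun g ρ' μ' => (Base Cl i ρ' μ' ∧ Layout n q ρ') ∧ Emitted B ((N - g) * (6 * n + 8))
    ([N] ++ (List.range g).flatMap fun g => (Guess.tree Cl i (guessOf (keys (Cl i)) i g)).code) ρ' μ',
    ⟨h₁, by grind⟩, fun g hg ρ' μ' ⟨h, hL'⟩ => ?_, fun ρ' μ' ⟨_, hL'⟩ => hQ _ _ ?_⟩
  · change g < ρ₁ 4 at hg
    obtain ⟨t, ht⟩ : ∃ t, N - g = t + 1 := ⟨N - g - 1, by omega⟩
    rw [ht, add_mul, one_mul] at hL'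
    have h' := hu (v := g) h (Or.inr rfl)
    refine wp_guess hβ h'.1 h'.2 (update_self ..) (by omega) hB hL' fun ρ'' μ'' h1 h2 h3 =>
      ⟨⟨h1, h2⟩, ?_⟩
    rw [show N - (g + 1) = t by omega, List.range_succ, List.flatMap_append, ← List.append_assoc]
    grind
  · change Emitted B ((N - ρ₁ 4) * _) ([N] ++ (List.range (ρ₁ 4)).flatMap _) _ _ at hL'
    rw [h4, Nat.sub_self, zero_mul] at hL'
    simpa [CenteredTree.familyCode, List.flatMap_map] using hL'

end

end WordRAM

end

section

/-! ## The whole program -/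

namespace WordRAM

open Function (update update_self update_of_ne update_apply)
open Tm Stm
open Guess (listOf MeetOut)

def start : Stm :=
  .seq (.set 1 (load (const 0))) (.seq (.set 2 (load (const 1))) (.seq (.set 5 (load (const 3)))
  (.seq (.set 36 (op .mul (V 1) (V 1))) (.seq (.set 6 ((const 4).plus (V 36)))
  (.seq (.set 7 (op .mul (const 4) (V 36))) (.seq (.set 8 (op .mul (const 5) (V 36)))
  (.seq (.set 9 (op .mul (const 6) (V 36))) (.seq (.set 32 (op .mul (const 7) (V 36)))
    (.set 33 (op .mul (const 8) (V 36)))))))))))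

def vertexList : Stm :=
  .seq (.set 0 (V 7)) (.seq (.set 28 (V 0)) (.seq (.loop 0 0 (emitIf (inc 5 10) (V 10)))
    (.seq (.set 3 (op .sub (V 28) (V 0))) (emit (V 1)))))

def meetTable : Stm :=
  .seq (.set 0 (V 8)) (.seq (.set 28 (V 0)) (.loop 0 1 (.loop 1 1 (emit (lt (const 0) meetOut)))))

def main : Stm :=
  .seq start (.seq vertexList (.seq meetTable (.seq (.set 0 (op .mul (const 10) (V 36)))
    (.seq (.set 28 (V 0)) family))))

variable {n q : ℕ} {Cl : Fin q → Set (Fin n)} {i : Fin q}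

open Classical in
theorem isListOf_of_isCode {A : Set (Fin n)} {a : ℕ} {μ : ℕ → ℕ} (h : IsCode a (keys A) μ) :
    IsListOf A (listOf A).length a μ := by
  have h1 : ∀ (y : ℕ) (hy : y < (listOf A).length), μ (a + y) = (listOf A)[y] := fun y hy => by
    have := (isCode_append.1 h).1 y (by grind)
    grind
  refine ⟨fun y hy => ⟨_, Guess.mem_listOf.1 (List.getElem_mem hy), h1 y hy⟩, fun v hv => ?_,
    fun y z hyz hz => ?_⟩
  · obtain ⟨y, hy, e⟩ := List.getElem_of_mem (Guess.mem_listOf.2 hv)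
    grind
  · rw [h1 y (by omega), h1 z hz]
    have h2 : (listOf A).Pairwise (· < ·) := (List.pairwise_lt_finRange n).filter _
    exact List.pairwise_iff_getElem.1 h2 y z (by omega) hz hyz

/-- The values of the variables after the start of the program, and the incidence matrix. -/
structure Start (Cl : Fin q → Set (Fin n)) (i : Fin q) (ρ μ : ℕ → ℕ) : Prop where
  one : ρ 1 = n
  two : ρ 2 = q
  five : ρ 5 = i
  six : ρ 6 = 4 + n * n
  seven : ρ 7 = 4 * (n * n)
  eight : ρ 8 = 5 * (n * n)
  nine : ρ 9 = 6 * (n * n)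
  kept : ρ 32 = 7 * (n * n)
  parent : ρ 33 = 8 * (n * n)
  square : ρ 36 = n * n
  inc : ∀ (l : Fin q) (v : Fin n), 0 < μ (4 + n * n + (l * n + v)) ↔ v ∈ Cl l

section

variable {B N k : ℕ} {β ρ μ : ℕ → ℕ} {Q : (ℕ → ℕ) → (ℕ → ℕ) → Prop}

theorem Start.congr (h : Start Cl i ρ μ) (hn : 4 ≤ n * n) (hq : q ≤ n) {ρ' μ' : ℕ → ℕ}
    (hρ : ∀ x, x = 1 ∨ x = 2 ∨ 5 ≤ x ∧ x < 10 ∨ x = 32 ∨ x = 33 ∨ x = 36 → ρ' x = ρ x)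
    (hμ : ∀ a < 4 * (n * n), μ' a = μ a) : Start Cl i ρ' μ' := by
  refine ⟨?_, ?_, ?_, ?_, ?_, ?_, ?_, ?_, ?_, ?_, fun l v => ?_⟩
  any_goals rw [hρ _ (by norm_num)]
  exacts [h.one, h.two, h.five, h.six, h.seven, h.eight, h.nine, h.kept, h.parent, h.square, by
    have h1 := mul_add_lt l.2 v.2
    have h2 := Nat.mul_le_mul_right n hq
    rw [hμ _ (by omega), h.inc]]

variable (hβ : ∀ x, x = 0 ∨ 4 < x → β x = B) (hβ1 : β 1 = n) (hβ2 : β 2 = n)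
  (hn : 4 ≤ n * n) (hq : q ≤ n) (hB : 10 * (n * n) ≤ B)
include hβ hβ1 hβ2 hn hq hB

theorem wp_start (h0 : μ 0 = n) (h1 : μ 1 = q) (h3 : μ 3 = i)
    (hinc : ∀ (l : Fin q) (v : Fin n), 0 < μ (4 + n * n + (l * n + v)) ↔ v ∈ Cl l)
    (hQ : ∀ ρ, Start Cl i ρ μ → Q ρ μ) : start.wp B β Q (fun _ => 0) μ := by
  have hβ' : ∀ x, 4 < x → β x = B := fun x hx => hβ x (Or.inr hx)
  have hi := i.2
  have hnB : n ≤ n * n := Nat.le_mul_self n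
  refine ⟨(h0.trans hβ1.symm).le, h1.trans_le (hq.trans_eq hβ2.symm), ?_⟩
  refine wp_set (v := i) hβ' (by norm_num) h3 (by omega) ?_
  refine wp_set (v := n * n) hβ' (by norm_num) (congrArg₂ (· * ·) h0 h0) (by omega) ?_
  refine wp_set (v := 4 + n * n) hβ' (by norm_num) rfl (by omega) ?_
  refine wp_set (v := 4 * (n * n)) hβ' (by norm_num) rfl (by omega) ?_
  refine wp_set (v := 5 * (n * n)) hβ' (by norm_num) rfl (by omega) ?_
  refine wp_set (v := 6 * (n * n)) hβ' (by norm_num) rfl (by omega) ?_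
  refine wp_set (v := 7 * (n * n)) hβ' (by norm_num) rfl (by omega) ?_
  refine wp_set (v := 8 * (n * n)) hβ' (by norm_num) rfl (by omega) ?_
  exact hQ _ ⟨h0, h1, rfl, rfl, rfl, rfl, rfl, rfl, rfl, rfl, hinc⟩

omit hβ1 hβ2

theorem wp_vertexList (h : Start Cl i ρ μ) (hk : (listOf (Cl i)).length ≤ β 3)
    (hQ : ∀ ρ μ, Start Cl i ρ μ → ρ 3 = (listOf (Cl i)).length →
      IsCode (4 * (n * n)) (keys (Cl i)) μ → Q ρ μ) : vertexList.wp B β Q ρ μ := by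
  classical
  have hβ' : β 28 = B ∧ β 35 = B := ⟨hβ _ (by norm_num), hβ _ (by norm_num)⟩
  have hnB : n ≤ n * n := Nat.le_mul_self n
  have hv : ∀ {ρ μ x v}, Start Cl i ρ μ → (x = 0 ∨ x = 28 ∨ x = 3) → Start Cl i (update ρ x v) μ :=
    fun h hx => h.congr hn hq (fun z hz => update_of_ne (by omega) _ _) fun _ _ => rfl
  have hR : Stable {10} fun ρ μ => Start Cl i ρ μ ∧ ρ 0 = 4 * (n * n) := fun ρ μ ρ' μ' h hρ hμ =>
    ⟨h.1.congr hn hq (fun z hz => hρ z (by grind) (by omega) (by omega))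
      (by grind), (hρ 0 (by simp) (by omega) (by omega)).trans h.2⟩
  have hR' : ∀ v, Stable ∅ fun ρ μ => (Start Cl i ρ μ ∧ ρ 0 = 4 * (n * n)) ∧ ρ 10 = v :=
    Stable.and (by simpa using hR) (by simp) (by omega) (by omega)
  refine ⟨(h.seven.trans_le (by omega)).trans_eq (hβ 0 (Or.inl rfl)).symm, ?_⟩
  refine wp_set (v := 4 * (n * n)) (fun x hx => hβ x (Or.inr hx)) (by norm_num) h.seven (by omega) ?_
  refine wp_loop_emit (w := 1) (r := 1) (m := n) (L := []) (f := fun v => if v ∈ Cl i then [(v : ℕ)] else [])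
    hR (by simp) (by norm_num) h.one (fun v ρ' μ' L' r' Q' h' hv' hL' hQ' =>
      wp_emitIf hβ' (hR' v) ⟨h', hv'⟩ hL' (c := Tm.inc 5 10) (P := v ∈ Cl i) ?_ (fun _ => hv')
        (fun _ => by omega) fun ρ'' μ'' h'' => hQ' ρ'' μ'' h''.1) ⟨hv (hv h (by simp)) (by simp), h.seven⟩
    ⟨h.seven.symm, ?_, fun j hj => absurd hj (by simp)⟩ fun ρ₂ μ₂ ⟨h₂, e₂⟩ hL₂ => ?_
  · have := h'.1
    rw [← this.inc, Tm.inc]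
    simp only [plus, ev, Op.ev, this.six, this.five, this.one]
    grind
  · grind
  have e3 : [] ++ (List.finRange n).flatMap (fun v => if v ∈ Cl i then [(v : ℕ)] else []) =
      (listOf (Cl i)).map Fin.val := by
    rw [List.map_eq_flatMap, listOf_flatMap, List.nil_append]
  rw [e3] at hL₂
  have e4 : (op .sub (V 28) (V 0)).ev ρ₂ μ₂ = (listOf (Cl i)).length := by
    simp only [ev, Op.ev, hL₂.1, List.length_map]
    omega
  refine ⟨e4.trans_le hk, ?_⟩
  rw [e4]
  have hR₃ : Stable ∅ fun ρ μ => (Start Cl i ρ μ ∧ ρ 0 = 4 * (n * n)) ∧ ρ 3 = (listOf (Cl i)).length :=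
    fun ρ μ ρ' μ' h hρ hμ => ⟨hR _ _ _ _ h.1 (fun z _ => hρ z (by simp)) hμ,
      (hρ 3 (by simp) (by omega) (by omega)).trans h.2⟩
  refine wp_emit (x := n) (r := 0) hβ' hR₃
    ⟨⟨hv h₂ (by simp), e₂⟩, update_self ..⟩ hL₂ h₂.one (by omega)
    fun ρ₃ μ₃ h₃ hL₃ => hQ _ _ h₃.1.1 h₃.2 ?_
  have := hL₃.2.2
  rwa [h₃.1.2] at this


theorem wp_meetTable (h : Start Cl i ρ μ) (h3 : ρ 3 = (listOf (Cl i)).length)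
    (hkn : (listOf (Cl i)).length < n * n) (hK : IsCode (4 * (n * n)) (keys (Cl i)) μ)
    (hQ : ∀ ρ μ, Start Cl i ρ μ → ρ 3 = (listOf (Cl i)).length →
      IsCode (4 * (n * n)) (keys (Cl i)) μ → IsCode (5 * (n * n)) (matrixCode (MeetOut Cl i)) μ →
      Q ρ μ) : meetTable.wp B β Q ρ μ := by
  classical
  have hβ' : β 28 = B ∧ β 35 = B := ⟨hβ _ (by norm_num), hβ _ (by norm_num)⟩
  have hqq := Nat.mul_le_mul hq hq
  have hv : ∀ {ρ μ x v}, Start Cl i ρ μ → (x = 0 ∨ x = 28) → Start Cl i (update ρ x v) μ :=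
    fun h hx => h.congr hn hq (fun z hz => update_of_ne (by omega) _ _) fun _ _ => rfl
  let R : (ℕ → ℕ) → (ℕ → ℕ) → Prop := fun ρ μ => (Start Cl i ρ μ ∧ ρ 0 = 5 * (n * n)) ∧
    ρ 3 = (listOf (Cl i)).length ∧ IsCode (4 * (n * n)) (keys (Cl i)) μ
  have hR : Stable {10, 11} R := by
    refine fun ρ μ ρ' μ' h hρ hμ => ⟨⟨h.1.1.congr hn hq (fun z hz => hρ z (by simp; omega) (by omega)
      (by omega)) fun a ha => hμ a (by grind), (hρ 0 (by simp) (by omega) (by omega)).trans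
      h.1.2⟩, (hρ 3 (by simp) (by omega) (by omega)).trans h.2.1, h.2.2.congr fun j hj => hμ _ ?_⟩
    rw [h.1.2]
    simp only [keys, List.length_append, List.length_map, List.length_singleton] at hj
    omega
  have hR₁ : ∀ l, Stable {11} fun ρ μ => R ρ μ ∧ ρ 10 = l :=
    Stable.and hR (by simp) (by omega) (by omega)
  have hR₂ : ∀ l m, Stable ∅ fun ρ μ => (R ρ μ ∧ ρ 10 = l) ∧ ρ 11 = m := fun l =>
    Stable.and (by simpa using hR₁ l) (by simp) (by omega) (by omega)
  refine ⟨(h.eight.trans_le (by omega)).trans_eq (hβ 0 (Or.inl rfl)).symm, ?_⟩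
  refine wp_set (v := 5 * (n * n)) (fun x hx => hβ x (Or.inr hx)) (by norm_num) h.eight (by omega) ?_
  have hmat : ∀ l : Fin q, (List.finRange q).flatMap (fun m => [if MeetOut Cl i l m then 1 else 0]) =
      (List.finRange q).map fun m => if MeetOut Cl i l m then 1 else 0 := fun l =>
    (List.map_eq_flatMap ..).symm
  refine wp_loop_emit (w := q * 1) (r := 0) (m := q) (L := []) (f := fun l => (List.finRange q).map
    fun m => if MeetOut Cl i l m then 1 else 0) hR (by simp) (by norm_num) h.two
    (fun l ρ₁ μ₁ L₁ r₁ Q₁ h₁ e₁ hL₁ hQ₁ => wp_loop_emit (w := 1) (r := r₁) (m := q) (L := L₁)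
      (f := fun m => [if MeetOut Cl i l m then 1 else 0]) (hR₁ l) (by simp) (by norm_num) h₁.1.1.two
      (fun m ρ₂ μ₂ L₂ r₂ Q₂ h₂ e₂ hL₂ hQ₂ => wp_emit (r := r₂) hβ' (hR₂ l m) ⟨h₂, e₂⟩ hL₂
        (x := if MeetOut Cl i l m then 1 else 0) ?_ (by grind)
        fun ρ₃ μ₃ h₃ => hQ₂ ρ₃ μ₃ h₃.1) ⟨h₁, e₁⟩ hL₁ fun ρ₃ μ₃ h₃ hL₃ => hQ₁ ρ₃ μ₃ h₃.1 (by
          rwa [hmat] at hL₃))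
    ⟨⟨hv (hv h (by simp)) (by simp), h.eight⟩, h3, hK⟩
    ⟨h.eight.symm, ?_, fun j hj => absurd hj (by simp)⟩ fun ρ₂ μ₂ h₂ hL₂ => hQ _ _ h₂.1.1 h₂.2.1 h₂.2.2 ?_
  · have h' := h₂.1.1.1
    have : 0 < meetOut.ev (update ρ₂ 35 1) μ₂ ↔ MeetOut Cl i l m := by
      refine meetOut_iff h'.one h'.five (fun l v => ?_) h₂.2 e₂
      rw [← h'.inc, ← h'.six]
    simp only [ev, this]
  · grind
  · have := hL₂.2.2
    rwa [h₂.1.2, List.nil_append] at this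

include hβ1 hβ2

theorem wp_main (h0 : μ 0 = n) (h1 : μ 1 = q) (h3 : μ 3 = i)
    (hinc : ∀ (l : Fin q) (v : Fin n), 0 < μ (4 + n * n + (l * n + v)) ↔ v ∈ Cl l)
    (hk : (listOf (Cl i)).length ≤ β 3) (hkn : (listOf (Cl i)).length ≤ n)
    (hN : keyCount (keys (Cl i)).length q = N) (hβ4 : β 4 = N)
    (hNB : 10 * (n * n) + N * (6 * n + 8) + 1 ≤ B) :
    main.wp B β (Emitted B 0 (CenteredTree.familyCode ((List.range N).map fun g =>
      Guess.tree Cl i (guessOf (keys (Cl i)) i g)))) (fun _ => 0) μ := by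
  have hnn : n < n * n := by nlinarith
  refine wp_start hβ hβ1 hβ2 hn hq hB h0 h1 h3 hinc fun ρ₁ h₁ => ?_
  refine wp_vertexList hβ hn hq hB h₁ hk fun ρ₂ μ₂ h₂ k₂ c₂ => ?_
  refine wp_meetTable hβ hn hq hB h₂ k₂ (by omega) c₂ fun ρ₃ μ₃ h₃ k₃ c₃ m₃ => ?_
  have e36 : (op .mul (const 10) (V 36)).ev ρ₃ μ₃ = 10 * (n * n) := congrArg (10 * ·) h₃.square
  refine ⟨(e36.trans_le (by omega)).trans_eq (hβ 0 (Or.inl rfl)).symm, ?_⟩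
  rw [e36]
  refine wp_set (v := 10 * (n * n)) (fun x hx => hβ x (Or.inr hx)) (by norm_num) rfl (by omega) ?_
  refine wp_family (fun x hx => hβ x (Or.inr hx)) (Cl := Cl) (i := i) ⟨h₃.one, h₃.two, h₃.five, ?_, ?_, ?_, k₃, ?_⟩
    ⟨hq, ?_, ?_, ?_, ?_, ?_, ?_⟩ hN hβ4 (by nlinarith) (by nlinarith) ⟨rfl, ?_, fun j hj => absurd hj (by simp)⟩
    fun _ _ => id
  · intro l v
    rw [← h₃.inc, ← h₃.six]
    rfl
  · change IsListOf (Cl i) (ρ₃ 3) (ρ₃ 7) μ₃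
    rw [k₃, h₃.seven]
    exact isListOf_of_isCode c₃
  · intro l m
    rw [← m₃.matrix, ← h₃.eight]
    rfl
  · change IsCode (ρ₃ 7) _ μ₃
    rwa [h₃.seven]
  · change ρ₃ 6 + _ ≤ ρ₃ 7
    rw [h₃.six, h₃.seven]
    omega
  · change ρ₃ 7 + ρ₃ 3 < ρ₃ 8
    rw [h₃.seven, h₃.eight]
    omega
  · change ρ₃ 8 + _ ≤ ρ₃ 9
    rw [h₃.eight, h₃.nine]
    omega
  · change ρ₃ 9 + _ ≤ ρ₃ 32
    rw [h₃.nine, h₃.kept]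
    omega
  · change ρ₃ 32 + _ ≤ ρ₃ 33
    rw [h₃.kept, h₃.parent]
    omega
  · change ρ₃ 33 + _ ≤ 10 * (n * n)
    rw [h₃.parent]
    omega
  grind

end

set_option maxRecDepth 100000 in
theorem main_bound : main.bound.a ≤ 7 ∧ main.bound.b ≤ 4 :=
  ⟨Nat.le_of_ble_eq_true rfl, Nat.le_of_ble_eq_true rfl⟩

end WordRAM

end

theorem pow_four_le {n m : ℕ} (hn : 2 ≤ n) (hm : n ≤ m + 1) :
    (n : ℝ) ^ 4 ≤ 4 * (n ^ 3 * m * Real.log n) := by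
  have h1 : (1 : ℝ) / 2 ≤ Real.log n := by
    have h2 := Real.log_two_gt_d9
    have h3 : Real.log 2 ≤ Real.log n := Real.log_le_log (by norm_num) (by exact_mod_cast hn)
    linarith
  have h2 : (n : ℝ) ≤ 2 * m := by exact_mod_cast (by omega : n ≤ 2 * m)
  have h3 : (0 : ℝ) ≤ n ^ 3 := by positivity
  have h4 : (m : ℝ) * (1 / 2) ≤ m * Real.log n := mul_le_mul_of_nonneg_left h1 (Nat.cast_nonneg m)
  have h5 : (n : ℝ) ≤ 4 * (m * Real.log n) := by linarith
  calc (n : ℝ) ^ 4 = n ^ 3 * n := by ring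
    _ ≤ n ^ 3 * (4 * (m * Real.log n)) := mul_le_mul_of_nonneg_left h5 h3
    _ = _ := by ring

/-- The bounds on the variables. -/
def varBound (n k N B : ℕ) : ℕ → ℕ
  | 1 => n
  | 2 => n
  | 3 => k
  | 4 => N
  | _ => B

theorem length_keys {n : ℕ} (A : Set (Fin n)) : (Guess.listOf A).length = A.ncard := by
  classical
  rw [← List.toFinset_card_of_nodup (Guess.nodup_listOf A), ← Set.ncard_coe_finset]
  congr
  ext v
  simp

theorem keyCount_le {n k q : ℕ} (hk : 1 ≤ k) (hq : q ≤ n) :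
    WordRAM.keyCount (k + 1) q ≤ 160 * (k ^ 4 * n ^ 2) := by
  have h1 : (k + 1) ^ 4 ≤ (2 * k) ^ 4 := Nat.pow_le_pow_left (by omega) 4
  have h2 : q ^ 2 ≤ n ^ 2 := Nat.pow_le_pow_left hq 2
  calc WordRAM.keyCount (k + 1) q = 10 * ((k + 1) ^ 4 * q ^ 2) := by rw [WordRAM.keyCount]; ring
    _ ≤ 10 * ((2 * k) ^ 4 * n ^ 2) := Nat.mul_le_mul_left _ (Nat.mul_le_mul h1 h2)
    _ = _ := by ring

theorem memory_le {n N : ℕ} (hn : 2 ≤ n) (hN : N ≤ 160 * (n ^ 4 * n ^ 2)) :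
    10 * (n * n) + N * (6 * n + 8) + 1 ≤ n ^ 24 := by
  have h1 : ∀ j, 2 ^ j ≤ n ^ j := fun j => Nat.pow_le_pow_left hn j
  have h4 := h1 4
  have h8 := h1 8
  have e1 : N ≤ n ^ 14 := hN.trans (by
    calc 160 * (n ^ 4 * n ^ 2) ≤ n ^ 8 * (n ^ 4 * n ^ 2) := Nat.mul_le_mul_right _ (by omega)
      _ = n ^ 14 := by ring)
  have e2 : 6 * n + 8 ≤ n ^ 5 := by
    calc 6 * n + 8 ≤ 16 * n := by omega
      _ ≤ n ^ 4 * n := Nat.mul_le_mul_right _ (by omega)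
      _ = n ^ 5 := by ring
  have e3 : N * (6 * n + 8) ≤ n ^ 19 := (Nat.mul_le_mul e1 e2).trans_eq (by ring)
  have e4 : 10 * (n * n) ≤ n ^ 19 := by
    calc 10 * (n * n) ≤ n ^ 4 * (n * n) := Nat.mul_le_mul_right _ (by omega)
      _ = n ^ 6 := by ring
      _ ≤ n ^ 19 := Nat.pow_le_pow_right (by omega) (by norm_num)
  have e5 : 1 ≤ n ^ 19 := Nat.one_le_pow _ _ (by omega)
  calc 10 * (n * n) + N * (6 * n + 8) + 1 ≤ 16 * n ^ 19 := by omega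
    _ ≤ n ^ 5 * n ^ 19 := Nat.mul_le_mul_right _ (by have := h1 5; omega)
    _ = n ^ 24 := by ring

namespace RootedCliqueTree

variable {n : ℕ} {G : SimpleGraph (Fin n)} (R : RootedCliqueTree G) (i : Fin R.q)

theorem isCode_inputCode : WordRAM.IsCode 0 (inputCode G R i) (WordRAM.initial (inputCode G R i)).mem :=
  fun j hj => by
    rw [zero_add]
    exact List.getD_eq_getElem _ _ hj

theorem input_le (hn : 2 ≤ n) (hq : R.q ≤ n) (a : ℕ) :
    (WordRAM.initial (inputCode G R i)).mem a ≤ n := by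
  classical
  have h1 : ∀ x ∈ inputCode G R i, x ≤ n := by
    have h2 : ∀ {a b : ℕ} (r : Fin a → Fin b → Prop), ∀ x ∈ matrixCode r, x ≤ n := by
      intro a b r x hx
      simp only [matrixCode, List.mem_flatMap, List.mem_map] at hx
      obtain ⟨_, -, _, -, rfl⟩ := hx
      split <;> omega
    intro x hx
    simp only [inputCode, List.mem_append] at hx
    rcases hx with ((hx | hx) | hx) | hx
    · have := R.root.2
      have := i.2
      simp only [List.mem_cons, List.not_mem_nil, or_false] at hx
      omega
    all_goals exact h2 _ x hx
  change (inputCode G R i).getD a 0 ≤ n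
  by_cases ha : a < (inputCode G R i).length
  · rw [List.getD_eq_getElem _ _ ha]
    exact h1 _ (List.getElem_mem ha)
  · rw [List.getD_eq_default _ _ (by omega)]
    exact Nat.zero_le n

/-- The program enumerates the trees that belong to all guesses. -/
theorem runs_main (hn : 2 ≤ n) {N : ℕ}
    (hN : WordRAM.keyCount (WordRAM.keys (R.clique i)).length R.q = N) {W : ℕ}
    (hW : (n ^ 24) ^ WordRAM.main.size ≤ W) :
    WordRAM.Runs W (WordRAM.main.compile 0) (WordRAM.initial (inputCode G R i))
      (WordRAM.main.bound.w * ((R.clique i).ncard ^ 7 * n ^ 4)) fun s =>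
      s.Outputs (CenteredTree.familyCode ((List.range N).map fun g =>
        Guess.tree R.clique i (WordRAM.guessOf (WordRAM.keys (R.clique i)) i g))) := by
  have : NeZero n := ⟨by omega⟩
  have hq : R.q ≤ n := by simpa using R.q_le
  set k := (R.clique i).ncard with hk
  have hlen : (Guess.listOf (R.clique i)).length = k := length_keys _
  have hkeys : (WordRAM.keys (R.clique i)).length = k + 1 := by simp [WordRAM.keys, hlen]
  have hkn : k ≤ n := by simpa using Set.ncard_le_ncard (Set.subset_univ (R.clique i))
  have hk1 : 1 ≤ k := (Set.ncard_pos (Set.toFinite _)).2 (R.clique_nonempty i)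
  have hN' : N ≤ 160 * (k ^ 4 * n ^ 2) := by
    rw [← hN, hkeys]
    exact keyCount_le hk1 hq
  have hmem := memory_le hn (hN'.trans (Nat.mul_le_mul_left _
    (Nat.mul_le_mul_right _ (Nat.pow_le_pow_left hkn 4))))
  set B := n ^ 24
  have hNB : N ≤ B := by nlinarith
  have hnn : 2 * n ≤ n * n := Nat.mul_le_mul_right n hn
  have hnB : n ≤ B := by omega
  have hcode := R.isCode_inputCode i
  set s := WordRAM.initial (inputCode G R i) with hs
  have hβ : ∀ x, x = 0 ∨ 4 < x → varBound n k N B x = B := by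
    intro x hx
    match x, hx with
    | 0, _ => rfl
    | x + 5, _ => rfl
  have hb : WordRAM.Bounded B (varBound n k N B) s.env s.mem := by
    refine ⟨by omega, fun x => ?_, fun x => hβ _ (by omega), fun x => Nat.zero_le _,
      fun a => (R.input_le i hn hq a).trans hnB⟩
    unfold varBound
    split <;> omega
  have hcost : WordRAM.main.cost (varBound n k N B) ≤ WordRAM.main.bound.w * (k ^ 7 * n ^ 4) := by
    refine (WordRAM.main.cost_le (k := k) (n := n) hk1 (by omega) fun b => ?_).trans
      (Nat.mul_le_mul_left _ (Nat.mul_le_mul (Nat.pow_le_pow_right hk1 WordRAM.main_bound.1)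
        (Nat.pow_le_pow_right (by omega) WordRAM.main_bound.2)))
    fin_cases b <;> simp [varBound, WordRAM.Mono.param, WordRAM.Mono.val, hN']
  have h0 : s.mem 0 = n := rfl
  have hinc : ∀ (l : Fin R.q) (v : Fin n), 0 < s.mem (4 + n * n + (l * n + v)) ↔ v ∈ R.clique l := by
    intro l v
    have h := ((WordRAM.isCode_append.1 (WordRAM.isCode_append.1 hcode).1).2).matrix l v
    rw [List.length_append, WordRAM.length_matrixCode, zero_add] at h
    exact h
  have hwp := WordRAM.wp_main (Cl := R.clique) (i := i) (B := B) (β := varBound n k N B) hβ rfl rfl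
    (by nlinarith) hq (by omega) h0 rfl rfl hinc hlen.le (hlen.trans_le hkn) hN rfl hmem
  refine (WordRAM.main.exec 0 s hb hwp hW).mono hcost fun s' ⟨h, _⟩ j hj => h.2.2 j hj

end RootedCliqueTree

theorem proposition6p9 :
    ∃ (P : WordRAM.Program) (C : ℕ),
      ∀ (n : ℕ), 2 ≤ n → ∀ G : SimpleGraph (Fin n), G.Connected →
      ∀ (R : RootedCliqueTree G) (i : Fin R.q),
      ∃ (ℱ : List CenteredTree) (t : ℕ) (s : WordRAM.State),
        -- the program halts within the time bound, on words of `O(log n)` bits, and outputs `ℱ`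
        WordRAM.Exec (n ^ C) P (WordRAM.initial (inputCode G R i)) t s ∧
        (t : ℝ) ≤ C * ((R.clique i).ncard ^ 7 * (n ^ 3 * G.edgeSet.ncard * Real.log n)) ∧
        s.Outputs (CenteredTree.familyCode ℱ) ∧
        (∀ F ∈ ℱ, F.IsValid (R.clique i)) ∧
        -- the family represents every well-structured root
        ∀ T : SteinerTree (Fin n), T.WellStructured G →
          ∃ (T' : SteinerTree (Fin n)) (Y : Set (Fin n)),
            T'.WellStructured G ∧
            Y ⊆ R.clique i ∧
            (∃ F ∈ ℱ, F.Represents T'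
              (SubTree.hull T'.graph (T'.real '' Y ∪ T'.center (R.clique i)))
              (T'.center (R.clique i))) ∧
            R.sep i ⊆ Y ∧
            (∃ φ : T.subtree (R.sep i) ≃g T'.subtree (R.sep i),
              SteinerTree.IsSteinerEquiv φ ∧
              ∀ r : T.span (R.sep i),
                SubTree.distTo T.graph r (T.real '' (R.verts i \ R.sep i)) ≤
                  SubTree.distTo T'.graph (φ r) (T'.real '' (R.verts i \ R.sep i))) ∧
            (∀ v ∈ R.clique i \ Y, ∃ S : Set (Fin n),
              (∀ w ∈ S, w ∈ R.clique i \ Y ∨ T.real w ∈ T.center (R.clique i)) ∧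
              v ∈ S ∧ T.IsThinBranch G (R.clique i) S) ∧
            ((T'.subtree (R.clique i)).diam < 4 ∨
                (∃ S : Set (Fin n), IsMinimalSeparator G S ∧ S ⊂ R.clique i ∧ T'.IsBistar S) →
              Y = R.clique i) := by
  refine ⟨WordRAM.main.compile 0, 4 * WordRAM.main.bound.w + 24 * WordRAM.main.size,
    fun n hn G hG R i => ?_⟩
  obtain ⟨t, s, hexec, ht, hout⟩ := R.runs_main i hn rfl
    (W := n ^ (4 * WordRAM.main.bound.w + 24 * WordRAM.main.size)) (by
      rw [← pow_mul]
      exact Nat.pow_le_pow_right (by omega) (by omega))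
  refine ⟨_, t, s, hexec, ?_, hout, fun F hF => ?_, fun T hT => ?_⟩
  · have hcard : n ≤ G.edgeSet.ncard + 1 := by
      simpa [Nat.card_coe_set_eq] using hG.card_vert_le_card_edgeSet_add_one
    have h4 := pow_four_le hn hcard
    set L := (n : ℝ) ^ 3 * G.edgeSet.ncard * Real.log n
    have hL : 0 ≤ L := by
      have := Real.log_natCast_nonneg n
      positivity
    have hk : (0 : ℝ) ≤ (R.clique i).ncard ^ 7 := by positivity
    have ht' : (t : ℝ) ≤ WordRAM.main.bound.w * ((R.clique i).ncard ^ 7 * n ^ 4) := by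
      exact_mod_cast ht
    refine ht'.trans ?_
    push_cast
    have h5 : ((R.clique i).ncard : ℝ) ^ 7 * n ^ 4 ≤ (R.clique i).ncard ^ 7 * (4 * L) :=
      mul_le_mul_of_nonneg_left h4 hk
    have h6 := mul_le_mul_of_nonneg_left h5 (Nat.cast_nonneg (α := ℝ) WordRAM.main.bound.w)
    have h7 : 0 ≤ (24 * WordRAM.main.size : ℝ) * ((R.clique i).ncard ^ 7 * L) := by positivity
    linarith
  · obtain ⟨g, -, rfl⟩ := List.mem_map.1 hF
    exact Guess.tree_isValid (WordRAM.guessOf_admissible g)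
  · obtain ⟨τ, hτ, hmode, T', Y, h1, h2, h3, h4⟩ := R.exists_guess hG hn i hT
    obtain ⟨g, hg, rfl⟩ := WordRAM.exists_guessOf hτ hmode
    exact ⟨T', Y, h1, h2, ⟨_, List.mem_map.2 ⟨g, List.mem_range.2 hg, rfl⟩, h3⟩, h4⟩
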